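/- Let $n\ge 2$, $\Lambda=\mathbb Z^n$ with standard basis $\epsilon_1,\dots,\epsilon_n$ and dot product $\langle\cdot,\cdot\rangle$. Let $\Sigma=\Sigma_m\cup\Sigma_l$ with $\Sigma_m=\{\pm\epsilon_i\pm\epsilon_j\mid i<j\}$, $\Sigma_l=\{\pm2\epsilon_i\}$, let $\Sigma^+=\Sigma_m^+\cup\Sigma_l^+=\{\epsilon_i\pm\epsilon_j\ (i<j),\,2\epsilon_i\}$ and $\Sigma^-=-\Sigma^+$. Let $\delta$ be the constant function $1$, $R=\{\alpha+m\delta\mid\alpha\in\Sigma,\ m\in\mathbb Z\}$, $R^+=\Sigma^+\cup\{\alpha+m\delta\in R\mid m>0\}$, $R^-=-R^+$, with simple roots $a_0=\delta-2\epsilon_1$, $a_j=\epsilon_j-\epsilon_{j+1}$ ($1\le j<n$), $a_n=2\epsilon_n$. For $f$ in $\Lambda\oplus\frac12\mathbb Z\delta$ (the form is extended with $\delta$ in the radical) let $s_j f=f-\langle f,a_j^\vee\rangle a_j$ with $\alpha^\vee=2\alpha/\langle\alpha,\alpha\rangle$, and $\tau(v)f=f+\langle v,f\rangle\delta$ for $v\in\Lambda$.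 The $s_0,\dots,s_n$ generate the affine Weyl group $\mathcal W=W\ltimes\tau(\Lambda)$, where $W=S_n\ltimes\{\pm1\}^n=\langle s_1,\dots,s_n\rangle$; length is taken with respect to $s_0,\dots,s_n$. For $\lambda\in\Lambda$ let $\lambda^+$ be the dominant element ($\lambda^+_1\ge\dots\ge\lambda^+_n\ge0$) of $W\lambda$, and $w_\lambda\in W$ the element of minimal length with $w_\lambda\lambda^+=\lambda$. Write $\lambda\le\mu$ if $\mu-\lambda$ is a non-negative integral combination of $a_1^\vee,\dots,a_n^\vee$, and $\mu\prec\lambda$ if $\mu\neq\lambda$ and either $\mu^+<\lambda^+$, or $\mu^+=\lambda^+$ and $\mu\le\lambda$. Parameters. Let $0<q,t<1$, let $q^{1/2}$ be a square root of $q$, and let $t_0,t_n,t_0^\vee,t_n^\vee\in\mathbb C\setminus\{0\}$ be such that $$a=t_0t_0^\vee q^{1/2},\qquad b=-t_0(t_0^\vee)^{-1}q^{1/2},\qquad c=t_nt_n^\vee,\qquad d=-t_n(t_n^\vee)^{-1}$$ have modulus less than $1$, and which are generic in the following sense: for all $m\in\mathbb Z$, * $t^{2k}\ne q^m$ for $1\le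 k\le n-1$; * $(t_0t_n)^2t^{2k}\ne q^m$ for $0\le k\le 2n-2$; * none of $t_n^\vee t_0^\vee q^{1/2}$, $-t_n^\vee(t_0^\vee)^{-1}q^{1/2}$, $-t_nt_0^{-1}$ equals $t_0t_n\,t^{2k}q^m$ for $0\le k\le n-1$. Let $\mathbf t=(t_\beta)$ be the function with value $t_0$ on $(1+2\mathbb Z)\delta+\Sigma_l$, $t_n$ on $2\mathbb Z\delta+\Sigma_l$, $t$ on $\mathbb Z\delta+\Sigma_m$, $t_0^\vee$ on $(\frac12+\mathbb Z)\delta+\frac12\Sigma_l$, $t_n^\vee$ on $\mathbb Z\delta+\frac12\Sigma_l$, and $1$ elsewhere. The dual function $\tilde{\mathbf t}$ is obtained by interchanging the values $t_0$ and $t_n^\vee$; a tilde denotes an object formed with $\tilde{\mathbf t}$ in place of $\mathbf t$. Write $x^{\mu+m\delta}=q^mx^\mu$ for $\mu\in\Lambda$, $m\in\frac12\mathbb Z$. For $\beta\in R$ let $$v_\beta(x)=\frac{(1-t_\beta t_{\beta/2}x^{\beta/2})(1+t_\beta t_{\beta/2}^{-1}x^{\beta/2})}{1-x^\beta},$$ read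 as $(1-t_\beta^2x^\beta)/(1-x^\beta)$ if the gradient of $\beta$ lies in $\Sigma_m$. For $w\in\mathcal W$ with reduced expression $w=s_{i_1}\cdots s_{i_r}$ let $t_w=t_{a_{i_1}}\cdots t_{a_{i_r}}$. Polynomials. On $\mathcal A=\mathbb C[x_1^{\pm1},\dots,x_n^{\pm1}]$ let $w(x^\mu)=x^{w\mu}$ for $w\in\mathcal W$, and $T_j=t_{a_j}+t_{a_j}^{-1}v_{a_j}(x)(s_j-\mathrm{id})$ for $0\le j\le n$. Let $Y_i=T_i\cdots T_{n-1}T_nT_{n-1}\cdots T_1T_0T_1^{-1}\cdots T_{i-1}^{-1}$ for $1\le i\le n$, $Y^\mu=Y_1^{\mu_1}\cdots Y_n^{\mu_n}$, and $f(Y)=\sum_\mu c_\mu Y^\mu$ for $f=\sum_\mu c_\mu x^\mu\in\mathcal A$. For $\lambda\in\Lambda$ let $$\gamma_\lambda=\bigl((t_0t_n)^{\rho_l(\lambda)_i}\,t^{\rho_m(\lambda)_i}\,q^{\lambda_i}\bigr)_{i=1}^n,\qquad \rho_{\bullet}(\lambda)=\sum_{\alpha\in\Sigma_{\bullet}^+}\epsilon(\langle\lambda,\alpha\rangle)\alpha^\vee\quad(\bullet=m,l),$$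 with $\epsilon(k)=1$ for $k\ge0$ and $\epsilon(k)=-1$ for $k<0$, and let $x_0=\tilde\gamma_0=\bigl(t_n^\vee t_n t^{2(n-i)}\bigr)_{i=1}^n$. Inverses of points are taken coordinatewise. Weights. Let $\mathcal C(x)=\prod_{\alpha\in\Sigma^-}v_\alpha(x)$ and $\Delta_+(x)=\prod_{\beta\in R,\ \beta(0)\ge0}v_\beta(x)^{-1}$. For $\lambda\in\Lambda$ let $$\widetilde w(\gamma_\lambda^{-1})=\widetilde{\mathcal C}(\gamma_\lambda^{-1})\,\widetilde w_+(\gamma_{\lambda^+}^{-1}),$$ where, for dominant $\mu$, $$\widetilde w_+(\gamma_\mu^{-1})=\operatorname*{Res}_{x_1=(\gamma_\mu)_1^{-1}}\Bigl(\cdots\operatorname*{Res}_{x_n=(\gamma_\mu)_n^{-1}}\Bigl(\frac{\widetilde\Delta_+(x)}{x_1\cdots x_n}\Bigr)\cdots\Bigr).$$ Theorem. For every $\lambda\in\Lambda$ there is exactly one $P_\lambda\in\mathcal A$ (the monic non-symmetric Koornwinder polynomial of degree $\lambda$) of the form $P_\lambda=x^\lambda+\sum_{\mu\prec\lambda}c_\mu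 x^\mu$ with $f(Y)P_\lambda=f(\gamma_\lambda)P_\lambda$ for all $f\in\mathcal A$. Moreover $\widetilde w(\gamma_0^{-1})\ne0$, and $$P_\lambda(x_0^{-1})=\frac{\widetilde w(\gamma_\lambda^{-1})}{\widetilde w(\gamma_0^{-1})}\;\tilde t_{w_\lambda}^{\,2}\;\tilde t_{\tau(-\lambda^+)}^{\,-1}\prod_{\beta}\widetilde v_\beta(\gamma_{\lambda^+}^{-1}),$$ where the product is taken over $\beta\in(R^+\cap\tau(\lambda^+)R^-)\setminus(\Sigma^+\cap w_\lambda^{-1}\Sigma^-)$. -/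

import Mathlib

noncomputable section

namespace Koornwinder

open scoped Matrix

/-! ### Weights, roots and Weyl groups of type `C^∨C_n` -/

/-- The weight lattice `Λ = ℤ^n`, with standard basis `ε_1, …, ε_n` and the dot product as its
scalar product. -/
abbrev Wt (n : ℕ) := Fin n → ℤ

/-- The lattice `Λ ⊕ (1/2)ℤ δ` of affine linear functions: the pair `(μ, m)` stands for
`μ + (m/2) δ`. It contains the affine root system `S`, it spans the space of affine linear
functions, and it is stable under the affine Weyl group. -/
abbrev Aff (n : ℕ) := Wt n × ℤ

/-- `ε_i`. -/
def eps {n : ℕ} (i : Fin n) : Wt n := Pi.single i 1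

/-- `Σ_m^+ = {ε_i - ε_j, ε_i + ε_j | i < j}`. -/
def posMed (n : ℕ) : Finset (Wt n) :=
  ((Finset.univ : Finset (Fin n × Fin n)).filter (fun ij => ij.1 < ij.2)).image
      (fun ij => eps ij.1 - eps ij.2) ∪
    ((Finset.univ : Finset (Fin n × Fin n)).filter (fun ij => ij.1 < ij.2)).image
      (fun ij => eps ij.1 + eps ij.2)

/-- `Σ_l^+ = {2 ε_i}`. -/
def posLong (n : ℕ) : Finset (Wt n) :=
  (Finset.univ : Finset (Fin n)).image (fun i => 2 • eps i)

/-- `Σ^+`, the positive roots of the root system `Σ` of type `C_n`. -/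
def posRoots (n : ℕ) : Finset (Wt n) := posMed n ∪ posLong n

/-- `α ∈ Σ_m`. -/
def IsMed {n : ℕ} (α : Wt n) : Prop := α ∈ posMed n ∨ -α ∈ posMed n

/-- `α ∈ Σ_l`. -/
def IsLong {n : ℕ} (α : Wt n) : Prop := α ∈ posLong n ∨ -α ∈ posLong n

/-- `α ∈ Σ_s = (1/2) Σ_l`. -/
def IsShort {n : ℕ} (α : Wt n) : Prop := IsLong (2 • α)

/-- The co-root `α^∨ = 2α / ⟨α, α⟩`; the integer division is exact for all `α ∈ Σ`. -/
def coroot {n : ℕ} (α : Wt n) : Wt n := fun k => 2 * α k / (α ⬝ᵥ α)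

/-- The affine root system `R = {α + m δ | α ∈ Σ, m ∈ ℤ}` of type `C̃_n`. -/
def affR (n : ℕ) : Set (Aff n) := {β | (IsMed β.1 ∨ IsLong β.1) ∧ Even β.2}

/-- `R^+ = Σ^+ ∪ {β ∈ R | β(0) > 0}`. -/
def affRPos (n : ℕ) : Set (Aff n) :=
  {β | β ∈ affR n ∧ ((β.1 ∈ posRoots n ∧ β.2 = 0) ∨ 0 < β.2)}

/-- `R^- = -R^+`. -/
def affRNeg (n : ℕ) : Set (Aff n) := {β | -β ∈ affRPos n}

/-- `Σ^+`, as a set of affine roots. -/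
def finPos (n : ℕ) : Set (Aff n) := {β | β.1 ∈ posRoots n ∧ β.2 = 0}

/-- `Σ^-`, as a set of affine roots. -/
def finNeg (n : ℕ) : Set (Aff n) := {β | -β ∈ finPos n}

/-- The simple roots `a_0 = δ - 2 ε_1`, `a_j = ε_j - ε_{j+1}` for `0 < j < n` and
`a_n = 2 ε_n` (note that the index set `Fin n` starts at `0`). -/
def simpleRoot (n : ℕ) (j : ℕ) : Aff n :=
  if j = 0 then (fun k => if k.val = 0 then -2 else 0, 2)
  else if j = n then (fun k => if k.val + 1 = n then 2 else 0, 0)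
  else (fun k => if k.val + 1 = j then 1 else if k.val = j then -1 else 0, 0)

/-- The reflection `s_β(g) = g - ⟨g, β^∨⟩ β`. -/
def refl {n : ℕ} (β : Aff n) : Module.End ℤ (Aff n) where
  toFun g := g - (g.1 ⬝ᵥ coroot β.1) • β
  map_add' g h := by simp only [Prod.fst_add, add_dotProduct, add_smul]; abel
  map_smul' c g := by
    simp only [Prod.smul_fst, smul_dotProduct, smul_assoc, smul_sub, RingHom.id_apply]

/-- The translation `τ(v) f = f + ⟨v, f⟩ δ`. -/
def transl {n : ℕ} (v : Wt n) : Module.End ℤ (Aff n) where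
  toFun g := (g.1, g.2 + 2 * (v ⬝ᵥ g.1))
  map_add' g h := by
    refine Prod.ext rfl ?_
    simp only [Prod.fst_add, Prod.snd_add, dotProduct_add]
    ring
  map_smul' c g := by
    refine Prod.ext rfl ?_
    simp only [Prod.smul_fst, Prod.smul_snd, dotProduct_smul, smul_eq_mul, RingHom.id_apply]
    ring

/-- The product `s_{i_1} ⋯ s_{i_r}` of simple reflections of the affine Weyl group. -/
def wordProd {n : ℕ} (l : List (Fin (n + 1))) : Module.End ℤ (Aff n) :=
  (l.map (fun j => refl (simpleRoot n j.val))).prod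

/-- The length of an element of the affine Weyl group. -/
def len {n : ℕ} (w : Module.End ℤ (Aff n)) : ℕ :=
  sInf {k | ∃ l : List (Fin (n + 1)), l.length = k ∧ wordProd l = w}

/-- `l` is a reduced expression of `w`. -/
def IsReducedExpr {n : ℕ} (l : List (Fin (n + 1))) (w : Module.End ℤ (Aff n)) : Prop :=
  wordProd l = w ∧ l.length = len w

/-- The finite Weyl group `W = S_n ⋉ {±1}^n` of permutations and sign changes. -/
abbrev FinW (n : ℕ) := Equiv.Perm (Fin n) × (Fin n → ℤˣ)

/-- The action of `W` on `Λ ⊕ (1/2)ℤ δ` by permutations and sign changes of the `ε_i`. -/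
def actW {n : ℕ} (w : FinW n) : Module.End ℤ (Aff n) where
  toFun g := (fun i => (w.2 i : ℤ) * g.1 (w.1.symm i), g.2)
  map_add' g h := by ext <;> simp [mul_add]
  map_smul' c g := by ext <;> simp [mul_left_comm]

/-- The action of `W` on `Λ`. -/
def actWt {n : ℕ} (w : FinW n) (μ : Wt n) : Wt n := (actW w (μ, 0)).1

/-- `Λ^+`: the dominant weights. -/
def IsDominant {n : ℕ} (μ : Wt n) : Prop := Antitone μ ∧ ∀ i, 0 ≤ μ i

/-- `λ^+`: the dominant weight in the orbit `W λ`, i.e. the absolute values of the coordinates of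
`λ` in decreasing order. -/
def domWt {n : ℕ} (lam : Wt n) : Wt n :=
  fun i => |lam (Tuple.sort (fun j => -|lam j|) i)|

theorem isDominant_domWt {n : ℕ} (lam : Wt n) : IsDominant (domWt lam) := by
  refine ⟨fun i j hij => ?_, fun i => abs_nonneg _⟩
  have h := Tuple.monotone_sort (fun j => -|lam j|) hij
  simpa [domWt] using h

theorem exists_actWt_domWt {n : ℕ} (lam : Wt n) : ∃ w : FinW n, actWt w (domWt lam) = lam := by
  refine ⟨(Tuple.sort (fun j => -|lam j|), fun i => if lam i < 0 then -1 else 1), ?_⟩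
  funext i
  by_cases h : lam i < 0
  · simp [actWt, actW, domWt, h, abs_of_neg h]
  · simp [actWt, actW, domWt, h, abs_of_nonneg (not_lt.mp h)]

/-- `w_λ`: the element `w` of minimal length in `W` such that `λ^+ = w^{-1} λ`. -/
def minRep {n : ℕ} (lam : Wt n) : FinW n :=
  Function.argminOn (fun w : FinW n => len (actW w)) {w | actWt w (domWt lam) = lam}
    (exists_actWt_domWt lam)

/-- `λ ≤ μ`: the difference `μ - λ` is a non-negative integral combination of the simple
co-roots `a_1^∨, …, a_n^∨`. -/
def domLE {n : ℕ} (lam mu : Wt n) : Prop :=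
  ∃ c : Fin n → ℕ, mu - lam = ∑ i, c i • coroot (simpleRoot n (i.val + 1)).1

/-- `λ ≺ μ`: `λ ≠ μ`, and `λ^+ < μ^+`, or `λ^+ = μ^+` and `λ ≤ μ`. -/
def precLT {n : ℕ} (lam mu : Wt n) : Prop :=
  lam ≠ mu ∧ ((domLE (domWt lam) (domWt mu) ∧ domWt lam ≠ domWt mu) ∨
    (domWt lam = domWt mu ∧ domLE lam mu))

/-! ### Parameters -/

/-- A square root `qh = q^{1/2}` of `q`, and the values of a multiplicity function at `a_0`,
at `a_1, …, a_{n-1}`, at `a_n`, at `a_0^∨` and at `a_n^∨`. -/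
structure Params where
  qh : ℂ
  t0 : ℂ
  t : ℂ
  tn : ℂ
  t0v : ℂ
  tnv : ℂ

/-- `q`. -/
def Params.q (P : Params) : ℂ := P.qh ^ 2

/-- The dual parameters: the values at `a_0` and `a_n^∨` are interchanged. -/
def Params.dual (P : Params) : Params :=
  ⟨P.qh, P.tnv, P.t, P.tn, P.t0v, P.t0⟩

open Classical in
/-- The multiplicity function `t_β`. The orbits of the affine Weyl group in `S` are
`(1/2 + ℤ) δ + Σ_s` (that of `a_0^∨`), `ℤ δ + Σ_s` (that of `a_n^∨`), `ℤ δ + Σ_m`,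
`(1 + 2ℤ) δ + Σ_l` (that of `a_0`) and `2ℤ δ + Σ_l` (that of `a_n`); outside `S` the value
is `1`. -/
def Params.mult (P : Params) {n : ℕ} (β : Aff n) : ℂ :=
  if IsShort β.1 then (if Even β.2 then P.tnv else P.t0v)
  else if IsMed β.1 ∧ Even β.2 then P.t
  else if IsLong β.1 ∧ Even β.2 then (if Even (β.2 / 2) then P.tn else P.t0)
  else 1

/-- `β/2`, for `β` divisible by two. -/
def half {n : ℕ} (β : Aff n) : Aff n := (fun k => β.1 k / 2, β.2 / 2)

/-- The numerator of `v_β`, with the monomials `x^γ` taken from the ring `B`: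
`(1 - t_β t_{β/2} x^{β/2}) (1 + t_β t_{β/2}^{-1} x^{β/2})`, which is `1 - t_β^2 x^β` when
`β/2` does not belong to `S`. -/
def Params.vNumOf (P : Params) {n : ℕ} {B : Type} [CommRing B] [Algebra ℂ B]
    (mon : Aff n → B) (β : Aff n) : B :=
  if 2 • half β = β then
    (1 - (P.mult β * P.mult (half β)) • mon (half β)) *
      (1 + (P.mult β * (P.mult (half β))⁻¹) • mon (half β))
  else 1 - (P.mult β ^ 2) • mon β

/-- `(y)^{μ + m δ} = q^m y^μ`, the value of a monomial at the point `y`. -/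
def Params.monAt (P : Params) {n : ℕ} (y : Fin n → ℂ) (β : Aff n) : ℂ :=
  P.qh ^ β.2 * ∏ i, y i ^ β.1 i

/-- The value of `v_β` at `y`. -/
def Params.v (P : Params) {n : ℕ} (β : Aff n) (y : Fin n → ℂ) : ℂ :=
  P.vNumOf (P.monAt y) β / (1 - P.monAt y β)

/-- `t_w = t_{i_1} ⋯ t_{i_r}` for a reduced expression `s_{i_1} ⋯ s_{i_r}` of `w`. -/
def Params.tw (P : Params) {n : ℕ} (w : Module.End ℤ (Aff n)) : ℂ :=
  ((Classical.epsilon (fun l : List (Fin (n + 1)) => IsReducedExpr l w)).map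
    (fun j => P.mult (simpleRoot n j.val))).prod

/-! ### The Noumi representation -/

/-- The algebra `𝒜` of Laurent polynomials in `x_1, …, x_n`: the group algebra of `Λ`. -/
abbrev Laurent (n : ℕ) := AddMonoidAlgebra ℂ (Wt n)

/-- The value of a Laurent polynomial at the point `y`. -/
def evalAt {n : ℕ} (f : Laurent n) (y : Fin n → ℂ) : ℂ :=
  f.coeff.sum (fun μ c => c * ∏ i, y i ^ μ i)

/-- `x^{μ + m δ} = q^m x^μ`. -/
def Params.mon (P : Params) {n : ℕ} (β : Aff n) : Laurent n :=
  AddMonoidAlgebra.single β.1 (P.qh ^ β.2)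

/-- The linear map on `𝒜` with prescribed values at the monomials `x^μ`. -/
def linExt {n : ℕ} (g : Wt n → Laurent n) : Module.End ℂ (Laurent n) :=
  (Finsupp.linearCombination ℂ g) ∘ₗ
    (AddMonoidAlgebra.coeffLinearEquiv (R := ℂ) (S := ℂ) (M := Wt n)).toLinearMap

/-- The action of the affine Weyl group on `𝒜`: `w(x^μ) = x^{w μ}`. -/
def Params.actA (P : Params) {n : ℕ} (w : Module.End ℤ (Aff n)) : Module.End ℂ (Laurent n) :=
  linExt (fun μ => P.mon (w (μ, 0)))

/-- The divided difference `f ↦ (f - s_β f) / (1 - x^β)`, through its values at the monomials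
(see `one_sub_mul_divDiff`). -/
def Params.divDiff (P : Params) {n : ℕ} (β : Aff n) : Module.End ℂ (Laurent n) :=
  linExt (fun μ =>
    if 0 ≤ μ ⬝ᵥ coroot β.1 then
      -∑ j ∈ Finset.range (μ ⬝ᵥ coroot β.1).toNat, P.mon ((μ, 0) - (j + 1) • β)
    else ∑ j ∈ Finset.range (-(μ ⬝ᵥ coroot β.1)).toNat, P.mon ((μ, 0) + j • β))

/-- The difference-reflection operators `T_j = t_j + t_j^{-1} v_{a_j}(x) (s_j - id)` on `𝒜`. -/
def Params.T (P : Params) (n : ℕ) (j : ℕ) : Module.End ℂ (Laurent n) :=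
  P.mult (simpleRoot n j) • 1 -
    (P.mult (simpleRoot n j))⁻¹ •
      (LinearMap.mulLeft ℂ (P.vNumOf P.mon (simpleRoot n j)) ∘ₗ P.divDiff (simpleRoot n j))

theorem linExt_single {n : ℕ} (g : Wt n → Laurent n) (μ : Wt n) (c : ℂ) :
    linExt g (AddMonoidAlgebra.single μ c) = c • g μ := by
  change Finsupp.linearCombination ℂ g (Finsupp.single μ c) = c • g μ
  simp

theorem Params.mon_add (P : Params) (hP : P.qh ≠ 0) {n : ℕ} (β γ : Aff n) :
    P.mon (β + γ) = P.mon β * P.mon γ := by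
  simp [Params.mon, AddMonoidAlgebra.single_mul_single, zpow_add₀ hP]

/-- The defining property of the divided differences. -/
theorem Params.one_sub_mul_divDiff (P : Params) (hP : P.qh ≠ 0) {n : ℕ} (β : Aff n)
    (f : Laurent n) :
    (1 - P.mon β) * P.divDiff β f = f - P.actA (refl β) f := by
  have key : ∀ (g : Aff n) (k : ℕ), (1 - P.mon β) * ∑ j ∈ Finset.range k, P.mon (g + j • β) =
      P.mon g - P.mon (g + k • β) := by
    intro g k
    induction k with
    | zero => simp
    | succ k ih =>
      rw [Finset.sum_range_succ, mul_add, ih, succ_nsmul, ← add_assoc,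
        P.mon_add hP (g + k • β) β]
      ring
  induction f using AddMonoidAlgebra.induction_linear with
  | zero => simp
  | add f g hf hg => simp only [map_add, mul_add, hf, hg]; ring
  | single μ c =>
    have hs : (AddMonoidAlgebra.single μ c : Laurent n) = c • P.mon (μ, 0) := by
      simp [Params.mon]
    rw [Params.divDiff, Params.actA, linExt_single, linExt_single, hs, mul_smul_comm, ← smul_sub]
    congr 1
    have hr : refl β (μ, 0) = (μ, 0) - (μ ⬝ᵥ coroot β.1) • β := rfl
    rw [hr]
    generalize μ ⬝ᵥ coroot β.1 = k
    split_ifs with h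
    · obtain ⟨m, rfl⟩ := Int.eq_ofNat_of_zero_le h
      have h2 : ∑ j ∈ Finset.range m, P.mon ((μ, 0) - (j + 1) • β) =
          ∑ j ∈ Finset.range m, P.mon (((μ, 0) - (m : ℤ) • β) + j • β) := by
        rw [← Finset.sum_range_reflect]
        refine Finset.sum_congr rfl fun j hj => ?_
        have hj' := Finset.mem_range.mp hj
        have : m - 1 - j + 1 = m - j := by omega
        rw [this]
        congr 1
        have h3 : ((m : ℕ) : ℤ) • β = (m - j) • β + j • β := by
          rw [← add_smul, Nat.sub_add_cancel hj'.le, natCast_zsmul]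
        rw [h3]
        abel
      rw [Int.toNat_natCast, mul_neg, h2, key]
      rw [natCast_zsmul, sub_add_cancel]
      ring
    · obtain ⟨m, hm⟩ := Int.eq_ofNat_of_zero_le (a := -k) (by omega)
      have hk : k = -(m : ℤ) := by omega
      subst hk
      rw [neg_neg, Int.toNat_natCast, key]
      simp

/-- `T_j f = t_j f + t_j^{-1} v_{a_j}(x) (s_j f - f)`, after multiplication by the denominator
`1 - x^{a_j}` of `v_{a_j}`. -/
theorem Params.one_sub_mul_T (P : Params) (hP : P.qh ≠ 0) (n j : ℕ) (f : Laurent n) :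
    (1 - P.mon (simpleRoot n j)) * P.T n j f =
      (1 - P.mon (simpleRoot n j)) * (P.mult (simpleRoot n j) • f) +
        (P.mult (simpleRoot n j))⁻¹ • (P.vNumOf P.mon (simpleRoot n j) *
          (P.actA (refl (simpleRoot n j)) f - f)) := by
  have h := P.one_sub_mul_divDiff hP (simpleRoot n j) f
  have h' : P.actA (refl (simpleRoot n j)) f - f =
      -((1 - P.mon (simpleRoot n j)) * P.divDiff (simpleRoot n j) f) := by
    rw [h]; ring
  rw [h']
  simp only [Params.T, LinearMap.sub_apply, LinearMap.smul_apply, Module.End.one_apply,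
    LinearMap.comp_apply, LinearMap.mulLeft_apply, mul_sub, mul_smul_comm, mul_neg, smul_neg]
  rw [← sub_eq_add_neg, mul_left_comm]

/-- `Y_i = T_i ⋯ T_{n-1} T_n T_{n-1} ⋯ T_1 T_0 T_1^{-1} ⋯ T_{i-1}^{-1}`, for `1 ≤ i ≤ n`. -/
def Params.Y (P : Params) (n : ℕ) (i : ℕ) : Module.End ℂ (Laurent n) :=
  ((List.range' i (n + 1 - i)).map (fun j => P.T n j)).prod *
    ((List.range n).reverse.map (fun j => P.T n j)).prod *
    ((List.range' 1 (i - 1)).map (fun j => Ring.inverse (P.T n j))).prod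

/-- `Y^μ = Y_1^{μ_1} ⋯ Y_n^{μ_n}`. -/
def Params.Ypow (P : Params) {n : ℕ} (μ : Wt n) : Module.End ℂ (Laurent n) :=
  ((List.finRange n).map (fun i => P.Y n (i.val + 1) ^ (μ i).toNat *
    Ring.inverse (P.Y n (i.val + 1)) ^ (-μ i).toNat)).prod

/-- `f(Y) = ∑ c_μ Y^μ` for `f = ∑ c_μ x^μ`. -/
def Params.polyY (P : Params) {n : ℕ} (f : Laurent n) : Module.End ℂ (Laurent n) :=
  f.coeff.sum (fun μ c => c • P.Ypow μ)

/-- The sign function with value `1` at `0`. -/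
def sgn (m : ℤ) : ℤ := if 0 ≤ m then 1 else -1

/-- `ρ_m(λ)`. -/
def rhoMed {n : ℕ} (lam : Wt n) : Wt n := ∑ α ∈ posMed n, sgn (lam ⬝ᵥ α) • coroot α

/-- `ρ_l(λ)`. -/
def rhoLong {n : ℕ} (lam : Wt n) : Wt n := ∑ α ∈ posLong n, sgn (lam ⬝ᵥ α) • coroot α

/-- `γ_λ = t_0^{ρ_l(λ)} t_n^{ρ_l(λ)} t^{ρ_m(λ)} q^λ`. -/
def Params.gam (P : Params) {n : ℕ} (lam : Wt n) : Fin n → ℂ :=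
  fun i => P.t0 ^ rhoLong lam i * P.tn ^ rhoLong lam i * P.t ^ rhoMed lam i * P.q ^ lam i

/-- `γ_λ^{-1}`. -/
def Params.gamInv (P : Params) {n : ℕ} (lam : Wt n) : Fin n → ℂ := fun i => (P.gam lam i)⁻¹

/-- The monic non-symmetric Koornwinder polynomial of degree `λ`: a Laurent polynomial
`x^λ + ∑_{μ ≺ λ} c_μ x^μ` that is an eigenfunction of `f(Y)` with eigenvalue `f(γ_λ)` for all
Laurent polynomials `f`. -/
def Params.IsKoornwinder (P : Params) {n : ℕ} (lam : Wt n) (F : Laurent n) : Prop :=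
  F.coeff lam = 1 ∧ (∀ μ, F.coeff μ ≠ 0 → μ = lam ∨ precLT μ lam) ∧
    ∀ f : Laurent n, P.polyY f F = evalAt f (P.gam lam) • F

/-! ### The discrete weights -/

/-- The weight function `Δ_+`, the product of `1 / v_β` over all `β ∈ R` with `β(0) ≥ 0`. -/
def Params.deltaPlus (P : Params) {n : ℕ} (x : Fin n → ℂ) : ℂ :=
  ∏' β : {β : Aff n // β ∈ affR n ∧ 0 ≤ β.2}, (P.v β.1 x)⁻¹

/-- `𝒞(x)`, the product of `v_α(x)` over all `α ∈ Σ^-`. -/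
def Params.cFun (P : Params) {n : ℕ} (x : Fin n → ℂ) : ℂ :=
  ∏ α ∈ posRoots n, P.v (-α, 0) x

/-- The residue of `f` at the isolated singularity `c`. -/
def residue (f : ℂ → ℂ) (c : ℂ) : ℂ :=
  Filter.limUnder (nhdsWithin (0 : ℝ) (Set.Ioi 0))
    (fun r : ℝ => (2 * (Real.pi : ℂ) * Complex.I)⁻¹ * ∮ z in C(c, r), f z)

/-- The iterated residue `Res_{x_1 = c_1} (Res_{x_2 = c_2} ( ⋯ Res_{x_n = c_n} F ⋯ ))`. -/
def iterResidue : (n : ℕ) → ((Fin n → ℂ) → ℂ) → (Fin n → ℂ) → ℂ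
  | 0, F, c => F c
  | n + 1, F, c =>
    residue (fun z => iterResidue n (fun x => F (Fin.cons z x)) (Fin.tail c)) (c 0)

/-- `w̃_+(γ_μ^{-1})` for dominant `μ`: the iterated residue at `γ_μ^{-1}` of
`Δ_+(x) / (x_1 ⋯ x_n)` with respect to the dual parameters. -/
def Params.wPlusDual (P : Params) {n : ℕ} (mu : Wt n) : ℂ :=
  iterResidue n (fun x => P.dual.deltaPlus x / ∏ i, x i) (P.gamInv mu)

/-- `w̃(γ_λ^{-1}) = 𝒞̃(γ_λ^{-1}) w̃_+(γ_{λ^+}^{-1})`. -/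
def Params.wDual (P : Params) {n : ℕ} (lam : Wt n) : ℂ :=
  P.dual.cFun (P.gamInv lam) * P.wPlusDual (domWt lam)

/-- `(R^+ ∩ τ(λ^+) R^-) \ (Σ^+ ∩ w_λ^{-1} Σ^-)`. -/
def evalRoots {n : ℕ} (lam : Wt n) : Set (Aff n) :=
  (affRPos n ∩ transl (domWt lam) '' affRNeg n) \
    (finPos n ∩ actW (minRep lam) ⁻¹' finNeg n)

end Koornwinder

end

open Koornwinder

/-!
Write `V = x_1^{-1} (T_1 ⋯ T_{n-1} T_n T_{n-1} ⋯ T_1)^{-1}` for the dual affine generator of the double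
affine Hecke algebra, and `s_j λ` for the action of the affine Weyl group on the weights that comes
from its action on affine functions, evaluated at `-λ` (`reflAt`).

*Relations.* At a generic point `y`, `(T_j f)(y)` is a combination of `f(y)` and `f(s_j y)` with
rational coefficients (`ev_T_mid`, `ev_T_last`, `ev_T_zero`), and an operator is determined by these
values (`eq_of_ev_genPt`). So the quadratic and braid relations, and those between the `T_j` and the
`x_i`, are identities of rational functions. They imply that `T_j` and `V` commute with all but one
or two of the `Y_i` (`BraidData.Y_comm`, `BraidData.V_comm_Y`), and that `V` and `V Y_1` satisfy
quadratic relations (`Vu_inv`, `Vu_cross`). Hence `T_j` with `j > 0`, and `V` for `j = 0`, minus a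
scalar that depends on the eigenvalues, map joint eigenvectors of the `Y_i` with eigenvalues `γ` to
joint eigenvectors with eigenvalues `s_j γ` (`intertwine_mid`, `intertwine_last`, `intertwine_zero`).

*Existence and uniqueness.* Every `λ` is reached from `0` by steps `λ ↦ s_j λ` that go up in the
Bruhat order (`weight_induction`), and along such a step `γ_{s_j λ} = s_j γ_λ` (`rho_refl`). Starting
with the eigenvector `1` (`isEigen_one`), the intertwiners produce eigenvectors with eigenvalues
`γ_λ`, and by the lifting property (`BLE.lift`) their monomials `x^μ` have `μ` below `λ` in the Bruhat
order (`isMonicEigen_step`). Strict comparability in that order implies `≺`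
(`BLE.eq_or_precLT`). The eigenvectors show that the `Y_i` are triangular with respect to the
distance of a weight to a point in the fundamental alcove (`Y_single_sub_mem`). As the points `γ_λ`
are pairwise different (`gam_injective`), the joint eigenspaces are one-dimensional
(`eq_of_isEigen`).

*Values at `x_0^{-1}`.* There, one of the two coefficients of `T_j` with `j > 0` vanishes. So `T_j`
and `V` act by scalars under evaluation (`ev_basePt_T`, `ev_basePt_Vu`), and each step multiplies the
value by `ṽ_{a_j}(γ_λ^{-1})` and by multiplicities (`ev_basePt_step`). By induction the value is a
product over the positive affine roots that are not positive at `-λ` (`ev_basePt_eq`). Since the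
roots inverted by `w` are described by any reduced word of `w` (`prod_mult_of_reduced`), the
multiplicities are those of the theorem (`tw_minRep_sq`), and applying `w_λ^{-1}` moves the product
to `γ_{λ^+}^{-1}` (`cFun_mul_finprod`).

*Residues.* For each gradient the factors of `Δ̃_+` combine to shifted factorials
(`hasProd_fibre`). Near `γ_0^{-1}` the poles are simple and lie along `x_i / x_{i+1} = c_i / c_{i+1}` and
`x_n = c_n`, with `c = γ_0^{-1}`, one for each simple root (`legs_pos`, `legs_neg`), so the iterated
residue is a value of the regular part (`iterResidue_eq`). The substitution of `q^{μ_i} x_i` for `x_i`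
moves `γ_μ^{-1}` to `γ_0^{-1}` and changes `Δ̃_+` by finitely many factors (`deltaPlus_eq_shiftFac`),
which are those that are needed (`shiftFac_mul_finprod`).
-/

namespace Koornwinder
open scoped Matrix

/-! ### Roots, co-roots and multiplicities -/

theorem eps_apply {n : ℕ} (i k : Fin n) : eps i k = if k = i then 1 else 0 := by
  simp [eps, Pi.single_apply]

theorem dot_eps {n : ℕ} (μ : Wt n) (i : Fin n) : μ ⬝ᵥ eps i = μ i := by
  simp [eps]

theorem eps_dot_eps {n : ℕ} (i j : Fin n) : eps i ⬝ᵥ eps j = if i = j then 1 else 0 := by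
  rw [dot_eps, eps_apply]; simp [eq_comm]

theorem isMed_iff {n : ℕ} {α : Wt n} : IsMed α ↔ ∃ i j : Fin n, i ≠ j ∧
    (α = eps i - eps j ∨ α = eps i + eps j ∨ α = -(eps i + eps j)) := by
  constructor
  · rintro (h | h)
    · simp only [posMed, Finset.mem_union, Finset.mem_image, Finset.mem_filter, Finset.mem_univ,
        true_and, Prod.exists] at h
      rcases h with ⟨i, j, hij, rfl⟩ | ⟨i, j, hij, rfl⟩
      · exact ⟨i, j, hij.ne, by simp⟩
      · exact ⟨i, j, hij.ne, by simp⟩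
    · simp only [posMed, Finset.mem_union, Finset.mem_image, Finset.mem_filter, Finset.mem_univ,
        true_and, Prod.exists] at h
      rcases h with ⟨i, j, hij, h⟩ | ⟨i, j, hij, h⟩
      · exact ⟨j, i, hij.ne', Or.inl (by rw [← neg_neg α, ← h]; abel)⟩
      · exact ⟨i, j, hij.ne, Or.inr (Or.inr (by rw [← neg_neg α, ← h]))⟩
  · rintro ⟨i, j, hij, h⟩
    simp only [IsMed, posMed, Finset.mem_union, Finset.mem_image, Finset.mem_filter,
      Finset.mem_univ, true_and, Prod.exists]
    rcases lt_or_gt_of_ne hij with hl | hl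
    · rcases h with rfl | rfl | rfl
      · exact Or.inl (Or.inl ⟨i, j, hl, rfl⟩)
      · exact Or.inl (Or.inr ⟨i, j, hl, rfl⟩)
      · exact Or.inr (Or.inr ⟨i, j, hl, by abel⟩)
    · rcases h with rfl | rfl | rfl
      · exact Or.inr (Or.inl ⟨j, i, hl, by abel⟩)
      · exact Or.inl (Or.inr ⟨j, i, hl, by abel⟩)
      · exact Or.inr (Or.inr ⟨j, i, hl, by abel⟩)

theorem isLong_iff {n : ℕ} {α : Wt n} : IsLong α ↔ ∃ i : Fin n,
    (α = 2 • eps i ∨ α = -(2 • eps i)) := by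
  simp only [IsLong, posLong, Finset.mem_image, Finset.mem_univ, true_and]
  constructor
  · rintro (⟨i, h⟩ | ⟨i, h⟩)
    · exact ⟨i, Or.inl h.symm⟩
    · exact ⟨i, Or.inr (by rw [h, neg_neg])⟩
  · rintro ⟨i, rfl | rfl⟩
    · exact Or.inl ⟨i, rfl⟩
    · exact Or.inr ⟨i, by simp⟩

theorem isShort_iff {n : ℕ} {α : Wt n} : IsShort α ↔ ∃ i : Fin n, (α = eps i ∨ α = -eps i) := by
  rw [IsShort, isLong_iff]
  refine exists_congr fun i => or_congr ?_ ?_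
  · constructor
    · intro h; funext k; have := congrFun h k; simp only [two_smul, Pi.add_apply] at this; omega
    · rintro rfl; rfl
  · constructor
    · intro h; funext k; have := congrFun h k
      simp only [two_smul, Pi.add_apply, Pi.neg_apply] at this ⊢; omega
    · rintro rfl; simp

theorem IsMed.dot_self {n : ℕ} {α : Wt n} (h : IsMed α) : α ⬝ᵥ α = 2 := by
  obtain ⟨i, j, hij, rfl | rfl | rfl⟩ := isMed_iff.1 h <;>
  simp [sub_dotProduct, dotProduct_sub, add_dotProduct, dotProduct_add, eps_dot_eps, hij, hij.symm]

theorem IsShort.dot_self {n : ℕ} {α : Wt n} (h : IsShort α) : α ⬝ᵥ α = 1 := by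
  obtain ⟨i, rfl | rfl⟩ := isShort_iff.1 h <;> simp [eps_dot_eps]

theorem IsLong.exists_short {n : ℕ} {α : Wt n} (h : IsLong α) : ∃ η, IsShort η ∧ α = 2 • η := by
  obtain ⟨i, rfl | rfl⟩ := isLong_iff.1 h
  · exact ⟨eps i, isShort_iff.2 ⟨i, Or.inl rfl⟩, rfl⟩
  · exact ⟨-eps i, isShort_iff.2 ⟨i, Or.inr rfl⟩, by simp⟩

theorem IsLong.dot_self {n : ℕ} {α : Wt n} (h : IsLong α) : α ⬝ᵥ α = 4 := by
  obtain ⟨η, hη, rfl⟩ := h.exists_short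
  simp [two_smul, add_dotProduct, dotProduct_add, hη.dot_self]

theorem coroot_med {n : ℕ} {α : Wt n} (h : IsMed α) : coroot α = α := by
  funext k; simp [coroot, h.dot_self]

theorem coroot_long {n : ℕ} {η : Wt n} (h : IsShort η) : coroot (2 • η) = η := by
  funext k
  have : (η + η) ⬝ᵥ (η + η) = 4 := by rw [← two_smul ℕ]; exact IsLong.dot_self h
  simp only [coroot, this, two_smul, Pi.add_apply]
  omega

theorem IsMed.neg {n : ℕ} {α : Wt n} (h : IsMed α) : IsMed (-α) := by
  rcases h with h | h
  · exact Or.inr (by simpa using h)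
  · exact Or.inl h

theorem IsLong.neg {n : ℕ} {α : Wt n} (h : IsLong α) : IsLong (-α) := by
  rcases h with h | h
  · exact Or.inr (by simpa using h)
  · exact Or.inl h

theorem IsShort.neg {n : ℕ} {α : Wt n} (h : IsShort α) : IsShort (-α) := by
  have := IsLong.neg h
  rwa [← smul_neg] at this

theorem mult_med (P : Params) {n : ℕ} {α : Wt n} (h : IsMed α) (m : ℤ) :
    P.mult (α, 2 * m) = P.t := by
  have h1 : ¬ IsShort α := fun hs => by have := hs.dot_self; have := h.dot_self; omega
  simp [Params.mult, h1, h]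

theorem mult_long (P : Params) {n : ℕ} {η : Wt n} (h : IsShort η) (m : ℤ) :
    P.mult (2 • η, 2 * m) = if Even m then P.tn else P.t0 := by
  have hl : IsLong (2 • η) := h
  have h1 : ¬ IsShort (2 • η) := fun hs => by have := hs.dot_self; have := hl.dot_self; omega
  have h2 : ¬ IsMed (2 • η) := fun hs => by have := hs.dot_self; have := hl.dot_self; omega
  simp only [Params.mult, h1, h2, hl, if_false, false_and, true_and, even_two_mul, if_true]
  simp

theorem mult_short (P : Params) {n : ℕ} {η : Wt n} (h : IsShort η) (m : ℤ) :
    P.mult (η, m) = if Even m then P.tnv else P.t0v := by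
  simp [Params.mult, h]

theorem half_two_smul {n : ℕ} (η : Wt n) (m : ℤ) : half (2 • η, 2 * m) = (η, m) := by
  ext k <;> simp [half]

theorem vNumOf_long (P : Params) {n : ℕ} {B : Type} [CommRing B] [Algebra ℂ B]
    (mon : Aff n → B) {η : Wt n} (h : IsShort η) (m : ℤ) :
    P.vNumOf mon (2 • η, 2 * m) =
      (1 - ((if Even m then P.tn else P.t0) * (if Even m then P.tnv else P.t0v)) • mon (η, m)) *
      (1 + ((if Even m then P.tn else P.t0) * (if Even m then P.tnv else P.t0v)⁻¹) •
        mon (η, m)) := by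
  have h2 : 2 • half ((2 • η, 2 * m) : Aff n) = (2 • η, 2 * m) := by
    rw [half_two_smul]; ext <;> simp
  rw [Params.vNumOf, if_pos h2, half_two_smul, mult_long P h, mult_short P h]

theorem vNumOf_med (P : Params) {n : ℕ} {B : Type} [CommRing B] [Algebra ℂ B]
    (mon : Aff n → B) {α : Wt n} (h : IsMed α) (m : ℤ) :
    P.vNumOf mon (α, 2 * m) = 1 - (P.t ^ 2) • mon (α, 2 * m) := by
  have h2 : ¬ 2 • half ((α, 2 * m) : Aff n) = (α, 2 * m) := by
    intro h2
    have h3 : 2 • (half ((α, 2 * m) : Aff n)).1 = α := congrArg Prod.fst h2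
    have h4 := h.dot_self
    rw [← h3] at h4
    simp only [two_smul, add_dotProduct, dotProduct_add] at h4
    omega
  rw [Params.vNumOf, if_neg h2, mult_med P h]

theorem simpleRoot_zero {n : ℕ} (h : 0 < n) :
    simpleRoot n 0 = (2 • (-eps ⟨0, h⟩), 2 * 1) := by
  ext k
  · simp [simpleRoot, eps_apply, Fin.ext_iff]
    split_ifs <;> simp
  · simp [simpleRoot]

theorem simpleRoot_last {m : ℕ} : simpleRoot (m + 1) (m + 1) = (2 • eps (Fin.last m), 2 * 0) := by
  ext k
  · simp [simpleRoot, eps_apply, Fin.ext_iff]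
  · simp [simpleRoot]

theorem simpleRoot_mid {n : ℕ} (j : ℕ) (h : j + 1 < n) :
    simpleRoot n (j + 1) = (eps ⟨j, by omega⟩ - eps ⟨j + 1, h⟩, 2 * 0) := by
  ext k
  · simp only [simpleRoot, Nat.add_eq_zero_iff, one_ne_zero, and_false, if_false, h.ne,
      eps_apply, Fin.ext_iff, Pi.sub_apply, add_left_inj]
    split_ifs <;> first | rfl | omega
  · simp [simpleRoot, h.ne]

theorem isMed_sub {n : ℕ} {i j : Fin n} (h : i ≠ j) : IsMed (eps i - eps j) :=
  isMed_iff.2 ⟨i, j, h, Or.inl rfl⟩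

theorem isMed_add {n : ℕ} {i j : Fin n} (h : i ≠ j) : IsMed (eps i + eps j) :=
  isMed_iff.2 ⟨i, j, h, Or.inr (Or.inl rfl)⟩

theorem isShort_eps {n : ℕ} (i : Fin n) : IsShort (eps i) := isShort_iff.2 ⟨i, Or.inl rfl⟩

theorem zpow_finset_sum {G ι : Type*} [CommGroup G] (a : G) (s : Finset ι) (f : ι → ℤ) :
    a ^ (∑ i ∈ s, f i) = ∏ i ∈ s, a ^ f i := by
  classical
  induction s using Finset.induction_on with
  | empty => simp
  | insert i s hi ih => rw [Finset.sum_insert hi, Finset.prod_insert hi, zpow_add, ih]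

/-! ### Values of Laurent polynomials -/

section Values

variable {n : ℕ} {K : Type} [Field K] [Algebra ℂ K]

/-- The monomial `μ ↦ y^μ`, as a homomorphism. -/
def monHom (y : Fin n → Kˣ) : Multiplicative (Wt n) →* K where
  toFun μ := ((∏ i, y i ^ (Multiplicative.toAdd μ) i : Kˣ) : K)
  map_one' := by simp
  map_mul' a b := by simp [zpow_add, Finset.prod_mul_distrib]

/-- The value of a Laurent polynomial at a point with coordinates in the units of a field. -/
noncomputable def ev (y : Fin n → Kˣ) : Laurent n →ₐ[ℂ] K := AddMonoidAlgebra.lift ℂ K (Wt n) (monHom y)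

theorem ev_single (y : Fin n → Kˣ) (μ : Wt n) (c : ℂ) :
    ev y (AddMonoidAlgebra.single μ c) = c • ((∏ i, y i ^ μ i : Kˣ) : K) := by
  rw [ev, AddMonoidAlgebra.lift_single]; rfl

/-- The coordinates of the point `y ∘ w`, where `w` acts on affine linear functions. -/
noncomputable def actPt (P : Params) (hP : P.qh ≠ 0) (w : Module.End ℤ (Aff n)) (y : Fin n → Kˣ) :
    Fin n → Kˣ := fun i =>
  Units.map (algebraMap ℂ K).toMonoidHom (Units.mk0 P.qh hP) ^ (w (eps i, 0)).2 *
    ∏ k, y k ^ (w (eps i, 0)).1 k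

theorem ev_mon (P : Params) (hP : P.qh ≠ 0) (y : Fin n → Kˣ) (β : Aff n) :
    ev y (P.mon β) = ((Units.map (algebraMap ℂ K).toMonoidHom (Units.mk0 P.qh hP) ^ β.2 *
      ∏ k, y k ^ β.1 k : Kˣ) : K) := by
  rw [Params.mon, ev_single, Algebra.smul_def]
  simp

theorem ev_actA (P : Params) (hP : P.qh ≠ 0) (w : Module.End ℤ (Aff n)) (y : Fin n → Kˣ)
    (f : Laurent n) : ev y (P.actA w f) = ev (actPt P hP w y) f := by
  induction f using AddMonoidAlgebra.induction_linear with
  | zero => simp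
  | add f g hf hg => simp only [map_add, hf, hg]
  | single μ c =>
    rw [Params.actA, linExt_single, map_smul, ev_mon P hP, ev_single]
    congr 2
    have hμ : ((μ, 0) : Aff n) = ∑ i, μ i • ((eps i, 0) : Aff n) := by
      ext k
      · simp [Prod.fst_sum, eps_apply]
      · simp [Prod.snd_sum]
    rw [hμ, map_sum]
    simp only [map_smul, Prod.snd_sum, Prod.fst_sum, Finset.sum_apply, Prod.smul_snd,
      Prod.smul_fst, Pi.smul_apply, smul_eq_mul, actPt]
    simp only [mul_zpow, Finset.prod_mul_distrib]
    congr 1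
    · rw [Finset.prod_congr rfl (fun i _ => by rw [← zpow_mul, mul_comm])]
      exact zpow_finset_sum _ _ _
    · simp only [← Finset.prod_zpow, ← zpow_mul]
      rw [Finset.prod_comm]
      refine Finset.prod_congr rfl fun k _ => ?_
      rw [Finset.prod_congr rfl (fun i _ => by rw [mul_comm])]
      exact zpow_finset_sum _ _ _

end Values

/-- All parameters are non-zero. -/
structure Params.Nondeg (P : Params) : Prop where
  qh : P.qh ≠ 0
  t0 : P.t0 ≠ 0
  t : P.t ≠ 0
  tn : P.tn ≠ 0
  t0v : P.t0v ≠ 0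
  tnv : P.tnv ≠ 0

/-! ### The operators `T_j` at points -/

section Points

variable {n : ℕ} {K : Type} [Field K] [Algebra ℂ K]

/-- The value of `T_j f` at a point `y`, in terms of the values of `f` at `y` and at `s_j y`. -/
theorem ev_T (P : Params) (hP : P.qh ≠ 0) (j : ℕ) (y : Fin n → Kˣ)
    (hy : ev y (P.mon (simpleRoot n j)) ≠ 1) (f : Laurent n) :
    ev y (P.T n j f) = algebraMap ℂ K (P.mult (simpleRoot n j)) * ev y f +
      (algebraMap ℂ K (P.mult (simpleRoot n j)))⁻¹ *
        (ev y (P.vNumOf P.mon (simpleRoot n j)) / (1 - ev y (P.mon (simpleRoot n j)))) *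
        (ev (actPt P hP (refl (simpleRoot n j)) y) f - ev y f) := by
  have h := congrArg (ev y) (P.one_sub_mul_T hP n j f)
  simp only [map_mul, map_sub, map_add, map_one, map_smul, ev_actA P hP] at h
  simp only [Algebra.smul_def, map_inv₀] at h
  have h1 : 1 - ev y (P.mon (simpleRoot n j)) ≠ 0 := sub_ne_zero.2 hy.symm
  apply mul_left_cancel₀ h1
  rw [h]
  have h2 := mul_div_cancel₀ (ev y (P.vNumOf P.mon (simpleRoot n j))) h1
  linear_combination (-(algebraMap ℂ K (P.mult (simpleRoot n j)))⁻¹ *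
    (ev (actPt P hP (refl (simpleRoot n j)) y) f - ev y f)) * h2

/-- The coefficient of `f(y)` in `(T_j f)(y)` for a simple root of medium length, with `x = y_j` and
`w = y_{j+1}`. -/
def cMed (t x w : K) : K := (t - t⁻¹) * w / (w - x)

/-- The coefficient of `f(s_j y)` in `(T_j f)(y)`, with `x = y_j` and `w = y_{j+1}`. -/
def dMed (t x w : K) : K := (t⁻¹ * w - t * x) / (w - x)

/-- The coefficient of `f(y)` in `(T_j f)(y)` for a long simple root, with `u = y^{a_j / 2}`. -/
def cLong (t t' u : K) : K := ((t - t⁻¹) + (t' - t'⁻¹) * u) / (1 - u ^ 2)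

/-- The coefficient of `f(s_j y)` in `(T_j f)(y)` for a long simple root, with `u = y^{a_j / 2}`. -/
def dLong (t t' u : K) : K := t⁻¹ * ((1 - t * t' * u) * (1 + t * t'⁻¹ * u)) / (1 - u ^ 2)

/-- `q^{1/2}` as a unit of a field of coefficients. -/
noncomputable def Params.qhU (P : Params) (hP : P.qh ≠ 0) : Kˣ :=
  Units.map (algebraMap ℂ K).toMonoidHom (Units.mk0 P.qh hP)

omit [Algebra ℂ K] in
theorem prod_zpow_eps (y : Fin n → Kˣ) (i : Fin n) : ∏ k, y k ^ (eps i k) = y i := by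
  rw [Finset.prod_eq_single i] <;> simp +contextual [eps_apply]

theorem ev_mon' (P : Params) (hP : P.qh ≠ 0) (y : Fin n → Kˣ) (μ : Wt n) (m : ℤ) :
    ev y (P.mon (μ, m)) = ((P.qhU hP ^ m * ∏ k, y k ^ μ k : Kˣ) : K) := ev_mon P hP y _

omit [Algebra ℂ K] in
theorem prod_zpow_add (y : Fin n → Kˣ) (μ ν : Wt n) :
    ∏ k, y k ^ (μ + ν) k = (∏ k, y k ^ μ k) * ∏ k, y k ^ ν k := by
  simp [zpow_add, Finset.prod_mul_distrib]

omit [Algebra ℂ K] in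
theorem prod_zpow_neg (y : Fin n → Kˣ) (μ : Wt n) :
    ∏ k, y k ^ (-μ) k = (∏ k, y k ^ μ k)⁻¹ := by
  simp

omit [Algebra ℂ K] in
theorem prod_zpow_sub (y : Fin n → Kˣ) (μ ν : Wt n) :
    ∏ k, y k ^ (μ - ν) k = (∏ k, y k ^ μ k) * (∏ k, y k ^ ν k)⁻¹ := by
  rw [sub_eq_add_neg, prod_zpow_add, prod_zpow_neg]

theorem actPt_med (P : Params) (hP : P.qh ≠ 0) {p r : Fin n} (hpr : p ≠ r) (y : Fin n → Kˣ) :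
    actPt P hP (refl (eps p - eps r, 2 * 0)) y = y ∘ Equiv.swap p r := by
  funext i
  have h : refl (eps p - eps r, 2 * 0) ((eps i, 0) : Aff n) = (eps (Equiv.swap p r i), 0) := by
    change ((eps i, 0) : Aff n) - (eps i ⬝ᵥ coroot (eps p - eps r)) • _ = _
    rw [coroot_med (isMed_sub hpr), dotProduct_sub, eps_dot_eps, eps_dot_eps]
    by_cases h1 : i = p
    · subst h1; simp [hpr]
    · by_cases h2 : i = r
      · subst h2; simp [h1]
      · simp [h1, h2, Equiv.swap_apply_of_ne_of_ne]
  simp only [actPt, h, prod_zpow_eps]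
  simp

theorem actPt_last (P : Params) (hP : P.qh ≠ 0) (p : Fin n) (y : Fin n → Kˣ) :
    actPt P hP (refl (2 • eps p, 2 * 0)) y = Function.update y p (y p)⁻¹ := by
  funext i
  have h : refl (2 • eps p, 2 * 0) ((eps i, 0) : Aff n) =
      (if i = p then -eps p else eps i, 0) := by
    change ((eps i, 0) : Aff n) - (eps i ⬝ᵥ coroot (2 • eps p)) • _ = _
    rw [coroot_long (isShort_eps p), eps_dot_eps]
    split_ifs with h
    · subst h; simp [two_smul]
    · simp
  simp only [actPt, h]
  split_ifs with h
  · subst h; rw [prod_zpow_neg, prod_zpow_eps]; simp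
  · rw [prod_zpow_eps]; simp [h]

theorem actPt_zero (P : Params) (hP : P.qh ≠ 0) (p : Fin n) (y : Fin n → Kˣ) :
    actPt P hP (refl (2 • (-eps p), 2 * 1)) y =
      Function.update y p (P.qhU hP ^ 2 * (y p)⁻¹) := by
  funext i
  have h : refl (2 • (-eps p), 2 * 1) ((eps i, 0) : Aff n) =
      (if i = p then -eps p else eps i, if i = p then 2 else 0) := by
    change ((eps i, 0) : Aff n) - (eps i ⬝ᵥ coroot (2 • (-eps p))) • _ = _
    rw [coroot_long (isShort_eps p).neg, dotProduct_neg, eps_dot_eps]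
    split_ifs with h
    · subst h; simp [two_smul]
    · simp
  simp only [actPt, h]
  split_ifs with h
  · subst h; rw [prod_zpow_neg, prod_zpow_eps, Function.update_self]; rfl
  · rw [prod_zpow_eps]; simp [h]

theorem ev_T_mid (P : Params) (hP : P.Nondeg) {j : ℕ} (hj : j + 1 < n) (y : Fin n → Kˣ)
    (hy : (y ⟨j, by omega⟩ : K) ≠ y ⟨j + 1, hj⟩) (f : Laurent n) :
    ev y (P.T n (j + 1) f) =
      cMed (algebraMap ℂ K P.t) (y ⟨j, by omega⟩) (y ⟨j + 1, hj⟩) * ev y f +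
      dMed (algebraMap ℂ K P.t) (y ⟨j, by omega⟩) (y ⟨j + 1, hj⟩) *
        ev (y ∘ Equiv.swap ⟨j, by omega⟩ ⟨j + 1, hj⟩) f := by
  have hpr : (⟨j, by omega⟩ : Fin n) ≠ ⟨j + 1, hj⟩ := by simp
  have hm : ev y (P.mon (simpleRoot n (j + 1))) = y ⟨j, by omega⟩ / y ⟨j + 1, hj⟩ := by
    rw [simpleRoot_mid j hj, ev_mon' P hP.qh, prod_zpow_sub, prod_zpow_eps, prod_zpow_eps]
    simp [div_eq_mul_inv]
  have ht : algebraMap ℂ K P.t ≠ 0 := by simpa using hP.t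
  have hr := (y ⟨j + 1, hj⟩).ne_zero
  rw [ev_T P hP.qh, hm]
  · have h2 : ev y (P.vNumOf P.mon (simpleRoot n (j + 1))) =
        1 - algebraMap ℂ K P.t ^ 2 * (y ⟨j, by omega⟩ / y ⟨j + 1, hj⟩) := by
      rw [← hm, simpleRoot_mid j hj, vNumOf_med P P.mon (isMed_sub hpr),
        map_sub, map_one, map_smul, Algebra.smul_def, map_pow]
    rw [h2, simpleRoot_mid j hj, mult_med P (isMed_sub hpr), actPt_med P hP.qh hpr]
    generalize ev y f = A
    generalize ev (y ∘ _) f = B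
    rw [cMed, dMed]
    have h3 := sub_ne_zero.2 hy.symm
    field_simp
    ring
  · rw [hm, Ne, div_eq_one_iff_eq hr]; exact hy

omit [Algebra ℂ K] in
theorem long_aux {t t' u A B : K} (ht : t ≠ 0) (ht' : t' ≠ 0) (hu : u ^ 2 ≠ 1) :
    t * A + t⁻¹ * ((1 - t * t' * u) * (1 + t * t'⁻¹ * u) / (1 - u ^ 2)) * (B - A) =
      cLong t t' u * A + dLong t t' u * B := by
  have h3 := sub_ne_zero.2 hu.symm
  rw [cLong, dLong]
  field_simp
  ring

theorem ev_T_last (P : Params) (hP : P.Nondeg) {m : ℕ} (y : Fin (m + 1) → Kˣ)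
    (hy : (y (Fin.last m) : K) ^ 2 ≠ 1) (f : Laurent (m + 1)) :
    ev y (P.T (m + 1) (m + 1) f) =
      cLong (algebraMap ℂ K P.tn) (algebraMap ℂ K P.tnv) (y (Fin.last m)) * ev y f +
      dLong (algebraMap ℂ K P.tn) (algebraMap ℂ K P.tnv) (y (Fin.last m)) *
        ev (Function.update y (Fin.last m) (y (Fin.last m))⁻¹) f := by
  have hh : ev y (P.mon (eps (Fin.last m), 0)) = y (Fin.last m) := by
    rw [ev_mon' P hP.qh, prod_zpow_eps]; simp
  have hm : ev y (P.mon (simpleRoot (m + 1) (m + 1))) = (y (Fin.last m) : K) ^ 2 := by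
    rw [simpleRoot_last, ev_mon' P hP.qh, two_smul, prod_zpow_add, prod_zpow_eps]
    simp [pow_two]
  have ht : algebraMap ℂ K P.tn ≠ 0 := by simpa using hP.tn
  have ht' : algebraMap ℂ K P.tnv ≠ 0 := by simpa using hP.tnv
  rw [ev_T P hP.qh _ _ (by rwa [hm]), hm, simpleRoot_last, vNumOf_long P P.mon (isShort_eps _),
    mult_long P (isShort_eps _), actPt_last]
  simp only [Even.zero, if_true]
  rw [← long_aux ht ht' hy]
  simp only [map_mul, map_sub, map_add, map_one, map_smul, hh]
  simp only [Algebra.smul_def, map_mul, map_inv₀]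

theorem ev_T_zero (P : Params) (hP : P.Nondeg) {m : ℕ} (y : Fin (m + 1) → Kˣ)
    (hy : ((P.qhU hP.qh * (y 0)⁻¹ : Kˣ) : K) ^ 2 ≠ 1) (f : Laurent (m + 1)) :
    ev y (P.T (m + 1) 0 f) =
      cLong (algebraMap ℂ K P.t0) (algebraMap ℂ K P.t0v) (P.qhU hP.qh * (y 0)⁻¹ : Kˣ) * ev y f +
      dLong (algebraMap ℂ K P.t0) (algebraMap ℂ K P.t0v) (P.qhU hP.qh * (y 0)⁻¹ : Kˣ) *
        ev (Function.update y 0 (P.qhU hP.qh ^ 2 * (y 0)⁻¹)) f := by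
  have hs : IsShort (-eps (0 : Fin (m + 1))) := (isShort_eps _).neg
  have h0 : simpleRoot (m + 1) 0 = (2 • (-eps 0), 2 * 1) := simpleRoot_zero (Nat.succ_pos m)
  have hh : ev y (P.mon (-eps 0, 1)) = (P.qhU hP.qh * (y 0)⁻¹ : Kˣ) := by
    rw [ev_mon' P hP.qh, prod_zpow_neg, prod_zpow_eps]; simp
  have hm : ev y (P.mon (simpleRoot (m + 1) 0)) = ((P.qhU hP.qh * (y 0)⁻¹ : Kˣ) : K) ^ 2 := by
    rw [h0, ev_mon' P hP.qh, two_smul, prod_zpow_add, prod_zpow_neg, prod_zpow_eps]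
    simp [pow_two, zpow_ofNat]; ring
  have ht : algebraMap ℂ K P.t0 ≠ 0 := by simpa using hP.t0
  have ht' : algebraMap ℂ K P.t0v ≠ 0 := by simpa using hP.t0v
  rw [ev_T P hP.qh _ _ (by rwa [hm]), hm, h0, vNumOf_long P P.mon hs,
    mult_long P hs, actPt_zero]
  simp only [Int.not_even_one, if_false]
  rw [← long_aux ht ht' hy]
  simp only [map_mul, map_sub, map_add, map_one, map_smul, hh]
  simp only [Algebra.smul_def, map_mul, map_inv₀]

end Points

/-! ### The generic point -/

section Generic

variable {n : ℕ}

/-- The generic point: its coordinates are the variables, in the field of fractions of `𝒜`. -/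
noncomputable def genPt (n : ℕ) : Fin n → (FractionRing (Laurent n))ˣ := fun i =>
  Units.mk0 (algebraMap (Laurent n) _ (AddMonoidAlgebra.single (eps i) 1)) (by simp)

theorem ev_genPt (f : Laurent n) : ev (genPt n) f = algebraMap (Laurent n) _ f := by
  suffices h : ev (genPt n) = Algebra.algHom ℂ (Laurent n) (FractionRing (Laurent n)) by
    rw [h]; rfl
  refine AddMonoidAlgebra.algHom_ext (fun μ => ?_) (by ext)
  rw [ev_single, one_smul]
  have key : ∀ (s : Finset (Fin n)),
      ((∏ i ∈ s, genPt n i ^ μ i : (FractionRing (Laurent n))ˣ) : FractionRing (Laurent n)) =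
      algebraMap (Laurent n) _ (AddMonoidAlgebra.single (∑ i ∈ s, μ i • eps i) 1) := by
    intro s
    induction s using Finset.induction_on with
    | empty => simp [← AddMonoidAlgebra.one_def]
    | insert i s hi ih =>
      rw [Finset.prod_insert hi, Finset.sum_insert hi, Units.val_mul, ih]
      rw [show (AddMonoidAlgebra.single (μ i • eps i + ∑ i ∈ s, μ i • eps i) 1 : Laurent n) =
        AddMonoidAlgebra.single (μ i • eps i) 1 * AddMonoidAlgebra.single (∑ i ∈ s, μ i • eps i) 1
        by rw [AddMonoidAlgebra.single_mul_single, one_mul], map_mul]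
      congr 1
      have hz : ∀ k : ℕ, ((genPt n i ^ k : (FractionRing (Laurent n))ˣ) :
          FractionRing (Laurent n)) =
          algebraMap (Laurent n) _ (AddMonoidAlgebra.single (k • eps i) 1) := by
        intro k
        rw [Units.val_pow_eq_pow_val, genPt, Units.val_mk0, ← map_pow,
          AddMonoidAlgebra.single_pow, one_pow]
      obtain ⟨k, hk | hk⟩ := Int.eq_nat_or_neg (μ i)
      · rw [hk, zpow_natCast, hz, natCast_zsmul]
      · rw [hk, zpow_neg, zpow_natCast, Units.val_inv_eq_inv_val, hz, inv_eq_iff_eq_inv]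
        symm
        apply inv_eq_of_mul_eq_one_left
        rw [← map_mul, AddMonoidAlgebra.single_mul_single]
        simp [AddMonoidAlgebra.one_def]
  have hμ : ∑ i, μ i • eps i = μ := by
    funext k
    simp [eps_apply]
  rw [key, hμ]
  rfl

/-- Operators on `𝒜` are equal if they agree at the generic point. -/
theorem eq_of_ev_genPt {A B : Module.End ℂ (Laurent n)}
    (h : ∀ f, ev (genPt n) (A f) = ev (genPt n) (B f)) : A = B := by
  refine LinearMap.ext fun f => ?_
  have := h f
  rw [ev_genPt, ev_genPt] at this
  exact IsFractionRing.injective (Laurent n) _ this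

theorem genPt_ne_smul {μ ν : Wt n} (h : μ ≠ ν) (c d : ℂ) (hc : c ≠ 0) :
    ev (genPt n) (AddMonoidAlgebra.single μ c) ≠ ev (genPt n) (AddMonoidAlgebra.single ν d) := by
  rw [ev_genPt, ev_genPt]
  intro he
  have := IsFractionRing.injective (Laurent n) _ he
  rw [AddMonoidAlgebra.single_inj] at this
  tauto

theorem ev_eps {K : Type} [Field K] [Algebra ℂ K] (y : Fin n → Kˣ) (i : Fin n) :
    ev y (AddMonoidAlgebra.single (eps i) 1) = y i := by
  rw [ev_single, prod_zpow_eps, one_smul]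

theorem ev_eps_add {K : Type} [Field K] [Algebra ℂ K] (y : Fin n → Kˣ) (i j : Fin n) :
    ev y (AddMonoidAlgebra.single (eps i + eps j) 1) = y i * y j := by
  rw [ev_single, prod_zpow_add, prod_zpow_eps, prod_zpow_eps, one_smul, Units.val_mul]

theorem genPt_ne {i j : Fin n} (h : i ≠ j) :
    (genPt n i : FractionRing (Laurent n)) ≠ genPt n j := by
  have : eps i ≠ eps j := fun he => h (by
    have := congrFun he i; simp [eps_apply] at this; exact this)
  simpa only [ev_eps] using genPt_ne_smul this 1 1 one_ne_zero

theorem genPt_mul_ne (i j : Fin n) (c : ℂ) :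
    (genPt n i : FractionRing (Laurent n)) * genPt n j ≠ algebraMap ℂ _ c := by
  have : eps i + eps j ≠ 0 := fun he => by
    have := congrFun he i; simp only [eps_apply, Pi.add_apply, Pi.zero_apply] at this
    split_ifs at this <;> omega
  have := genPt_ne_smul this 1 c one_ne_zero
  rw [ev_eps_add, ev_single] at this
  simpa [Algebra.smul_def] using this

end Generic

/-! ### Rational function identities behind the Hecke relations -/

section Identities

variable {K : Type} [Field K]

theorem cMed_add {t x w : K} (h : x ≠ w) : cMed t x w + cMed t w x = t - t⁻¹ := by
  have h1 := sub_ne_zero.2 h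
  have h2 := sub_ne_zero.2 h.symm
  rw [cMed, cMed]; field_simp; ring

theorem cMed_sq {t x w : K} (ht : t ≠ 0) (h : x ≠ w) :
    cMed t x w ^ 2 + dMed t x w * dMed t w x = (t - t⁻¹) * cMed t x w + 1 := by
  have h1 := sub_ne_zero.2 h
  have h2 := sub_ne_zero.2 h.symm
  rw [cMed, dMed, dMed]; field_simp; ring

theorem cMed_cross {t x w : K} (ht : t ≠ 0) (h : x ≠ w) :
    cMed t x w ^ 2 * x + dMed t x w * dMed t w x * w = w := by
  have h1 := sub_ne_zero.2 h
  have h2 := sub_ne_zero.2 h.symm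
  rw [cMed, dMed, dMed]; field_simp; ring

theorem cMed_cross' {t x w : K} (h : x ≠ w) : cMed t x w * x + w * cMed t w x = 0 := by
  have h1 := sub_ne_zero.2 h
  have h2 := sub_ne_zero.2 h.symm
  rw [cMed, cMed]; field_simp; ring

theorem sq_inv_ne {u : K} (h : u ^ 2 ≠ 1) : u⁻¹ ^ 2 ≠ 1 := by
  rwa [inv_pow, Ne, inv_eq_one]

theorem cLong_add {t t' u : K} (hu : u ≠ 0) (h : u ^ 2 ≠ 1) :
    cLong t t' u + cLong t t' u⁻¹ = t - t⁻¹ := by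
  have h1 := sub_ne_zero.2 h
  have h2 := sub_ne_zero.2 h.symm
  have e : 1 - u⁻¹ ^ 2 = (u ^ 2 - 1) / u ^ 2 := by field_simp
  rw [cLong, cLong, e]; field_simp; ring

theorem cLong_sq {t t' u : K} (ht : t ≠ 0) (ht' : t' ≠ 0) (hu : u ≠ 0) (h : u ^ 2 ≠ 1) :
    cLong t t' u ^ 2 + dLong t t' u * dLong t t' u⁻¹ = (t - t⁻¹) * cLong t t' u + 1 := by
  have h1 := sub_ne_zero.2 h
  have h2 := sub_ne_zero.2 h.symm
  have e : 1 - u⁻¹ ^ 2 = (u ^ 2 - 1) / u ^ 2 := by field_simp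
  rw [cLong, dLong, dLong, e]; field_simp; ring

theorem cLong_cross {t t' u : K} (ht : t ≠ 0) (ht' : t' ≠ 0) (hu : u ≠ 0) (h : u ^ 2 ≠ 1) :
    u ^ 2 * cLong t t' u ^ 2 + dLong t t' u * dLong t t' u⁻¹ =
      1 + (t'⁻¹ - t') * (u * cLong t t' u) := by
  have h1 := sub_ne_zero.2 h
  have h2 := sub_ne_zero.2 h.symm
  have e : 1 - u⁻¹ ^ 2 = (u ^ 2 - 1) / u ^ 2 := by field_simp
  rw [cLong, dLong, dLong, e]; field_simp; ring

theorem cLong_cross' {t t' u : K} (hu : u ≠ 0) (h : u ^ 2 ≠ 1) :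
    u ^ 2 * cLong t t' u + cLong t t' u⁻¹ = (t'⁻¹ - t') * u := by
  have h1 := sub_ne_zero.2 h
  have h2 := sub_ne_zero.2 h.symm
  have e : 1 - u⁻¹ ^ 2 = (u ^ 2 - 1) / u ^ 2 := by field_simp
  rw [cLong, cLong, e]; field_simp; ring

/-- The rational identity behind the braid relation of length three. -/
theorem cMed_braid_three {t x w z : K} (hxw : x ≠ w) (hxz : x ≠ z) (hwz : w ≠ z) :
    cMed t x w * cMed t w z + cMed t x z * cMed t w x = cMed t w z * cMed t x z := by
  have h1 := sub_ne_zero.2 hxw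
  have h2 := sub_ne_zero.2 hxw.symm
  have h3 := sub_ne_zero.2 hxz.symm
  have h4 := sub_ne_zero.2 hwz.symm
  simp only [cMed]; field_simp; ring

/-- The rational identities behind the braid relation of length four. -/
theorem cMed_braid_four {t s s' x w : K} (hx : x ≠ 0) (hx2 : x ^ 2 ≠ 1)
    (hw2 : w ^ 2 ≠ 1) (hxw : x ≠ w) (hm : x * w ≠ 1) :
    cMed t x w * cLong s s' w + cLong s s' x * cMed t w x =
      cMed t w x⁻¹ * (cLong s s' w - (s - s⁻¹) + cLong s s' x) := by
  have h1 := sub_ne_zero.2 hx2.symm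
  have h2 := sub_ne_zero.2 hw2.symm
  have h3 := sub_ne_zero.2 hxw
  have h3' := sub_ne_zero.2 hxw.symm
  have h4 := sub_ne_zero.2 hm.symm
  have h4' : 1 - w * x ≠ 0 := by rwa [mul_comm]
  have e2 : (t - t⁻¹) * x⁻¹ / (x⁻¹ - w) = (t - t⁻¹) / (1 - x * w) := by
    have : x⁻¹ - w = (1 - x * w) / x := by field_simp
    rw [this]; field_simp
  simp only [cMed, cLong, e2]
  generalize t - t⁻¹ = κ
  generalize s - s⁻¹ = ν
  generalize s' - s'⁻¹ = ν'
  field_simp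
  ring

theorem cMed_inv_inv {t x w : K} (hx : x ≠ 0) (hw : w ≠ 0) (hxw : x ≠ w) :
    cMed t w⁻¹ x⁻¹ = cMed t x w ∧ dMed t w⁻¹ x⁻¹ = dMed t x w := by
  have h3 := sub_ne_zero.2 hxw.symm
  have e2 : x⁻¹ - w⁻¹ = (w - x) / (x * w) := by field_simp
  constructor
  · rw [cMed, cMed, e2]; field_simp
  · rw [dMed, dMed, e2]; field_simp

end Identities

/-! ### The Hecke relations -/

section Relations

variable {n : ℕ} (P : Params)

theorem mult_simpleRoot_mid {j : ℕ} (hj : j + 1 < n) : P.mult (simpleRoot n (j + 1)) = P.t := by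
  rw [simpleRoot_mid j hj, mult_med P (isMed_sub (by simp))]

theorem mult_simpleRoot_last {m : ℕ} : P.mult (simpleRoot (m + 1) (m + 1)) = P.tn := by
  rw [simpleRoot_last, mult_long P (isShort_eps _)]; simp

theorem mult_simpleRoot_zero {m : ℕ} : P.mult (simpleRoot (m + 1) 0) = P.t0 := by
  rw [simpleRoot_zero (Nat.succ_pos m), mult_long P (isShort_eps _).neg]; simp

/-- Multiplication by `x^μ`. -/
noncomputable def mulX (μ : Wt n) : Module.End ℂ (Laurent n) :=
  LinearMap.mulLeft ℂ (AddMonoidAlgebra.single μ 1)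

theorem mulX_mul (μ ν : Wt n) : mulX μ * mulX ν = mulX (μ + ν) := by
  refine LinearMap.ext fun f => ?_
  simp only [mulX, Module.End.mul_apply, LinearMap.mulLeft_apply, ← mul_assoc,
    AddMonoidAlgebra.single_mul_single, one_mul]

theorem mulX_zero : mulX (0 : Wt n) = 1 := by
  refine LinearMap.ext fun f => ?_
  simp only [mulX, LinearMap.mulLeft_apply, ← AddMonoidAlgebra.one_def, one_mul,
    Module.End.one_apply]

theorem ev_mulX {K : Type} [Field K] [Algebra ℂ K] (y : Fin n → Kˣ) (i : Fin n) (f : Laurent n) :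
    ev y (mulX (eps i) f) = y i * ev y f := by
  rw [mulX, LinearMap.mulLeft_apply, map_mul, ev_eps]

theorem genPt_sq_ne (i : Fin n) : (genPt n i : FractionRing (Laurent n)) ^ 2 ≠ 1 := by
  have := genPt_mul_ne i i 1
  rwa [← pow_two, map_one] at this

theorem ev_comp_swap {K : Type} [Field K] [Algebra ℂ K] {p r : Fin n} (y : Fin n → Kˣ) :
    (y ∘ Equiv.swap p r) p = y r ∧ (y ∘ Equiv.swap p r) r = y p ∧
      (y ∘ Equiv.swap p r) ∘ Equiv.swap p r = y := by
  refine ⟨by simp, by simp, ?_⟩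
  funext i; simp

variable {P}

section

variable {K : Type} [Field K] [Algebra ℂ K]

theorem ev_T_sq_mid (hP : P.Nondeg) {j : ℕ} (hj : j + 1 < n) (y : Fin n → Kˣ)
    (hne : (y ⟨j, by omega⟩ : K) ≠ y ⟨j + 1, hj⟩) (f : Laurent n) :
    ev y ((P.T n (j + 1) * P.T n (j + 1)) f) =
      ev y (((P.t - P.t⁻¹) • P.T n (j + 1) + 1 : Module.End ℂ (Laurent n)) f) := by
  have ht : algebraMap ℂ K P.t ≠ 0 := by simpa using hP.t
  obtain ⟨e1, e2, e3⟩ := ev_comp_swap (p := ⟨j, by omega⟩) (r := ⟨j + 1, hj⟩) y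
  simp only [Module.End.mul_apply, LinearMap.add_apply, LinearMap.smul_apply,
    Module.End.one_apply, map_add, map_smul]
  rw [ev_T_mid P hP hj y hne, ev_T_mid P hP hj y hne, ev_T_mid P hP hj _ (by
    rw [e1, e2]; exact hne.symm), e1, e2, e3]
  simp only [Algebra.smul_def, map_sub, map_inv₀]
  linear_combination ev y f * cMed_sq ht hne +
    ev (y ∘ _) f * dMed (algebraMap ℂ K P.t) (y ⟨j, by omega⟩) (y ⟨j + 1, hj⟩) *
      cMed_add (t := algebraMap ℂ K P.t) hne

theorem ev_T_cross_mid (hP : P.Nondeg) {j : ℕ} (hj : j + 1 < n) (y : Fin n → Kˣ)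
    (hne : (y ⟨j, by omega⟩ : K) ≠ y ⟨j + 1, hj⟩) (f : Laurent n) :
    ev y ((P.T n (j + 1) * mulX (eps ⟨j, by omega⟩) * P.T n (j + 1) :
      Module.End ℂ (Laurent n)) f) =
      ev y (mulX (eps ⟨j + 1, hj⟩) f) := by
  have ht : algebraMap ℂ K P.t ≠ 0 := by simpa using hP.t
  obtain ⟨e1, e2, e3⟩ := ev_comp_swap (p := ⟨j, by omega⟩) (r := ⟨j + 1, hj⟩) y
  simp only [Module.End.mul_apply]
  rw [ev_T_mid P hP hj y hne, ev_mulX, ev_mulX, ev_mulX, ev_T_mid P hP hj y hne,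
    ev_T_mid P hP hj _ (by rw [e1, e2]; exact hne.symm), e1, e2, e3]
  linear_combination ev y f * cMed_cross ht hne +
    ev (y ∘ _) f * dMed (algebraMap ℂ K P.t) (y ⟨j, by omega⟩) (y ⟨j + 1, hj⟩) *
      cMed_cross' (t := algebraMap ℂ K P.t) hne

theorem ev_T_sq_last (hP : P.Nondeg) {m : ℕ} (y : Fin (m + 1) → Kˣ)
    (hne : (y (Fin.last m) : K) ^ 2 ≠ 1) (f : Laurent (m + 1)) :
    ev y ((P.T (m + 1) (m + 1) * P.T (m + 1) (m + 1)) f) =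
      ev y (((P.tn - P.tn⁻¹) • P.T (m + 1) (m + 1) + 1 : Module.End ℂ (Laurent (m + 1))) f) := by
  have ht : algebraMap ℂ K P.tn ≠ 0 := by simpa using hP.tn
  have ht' : algebraMap ℂ K P.tnv ≠ 0 := by simpa using hP.tnv
  have hu := (y (Fin.last m)).ne_zero
  simp only [Module.End.mul_apply, LinearMap.add_apply, LinearMap.smul_apply,
    Module.End.one_apply, map_add, map_smul]
  rw [ev_T_last P hP y hne, ev_T_last P hP y hne, ev_T_last P hP _ (by
    rw [Function.update_self, Units.val_inv_eq_inv_val]; exact sq_inv_ne hne)]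
  simp only [Function.update_self, Function.update_idem, inv_inv, Function.update_eq_self,
    Units.val_inv_eq_inv_val, Algebra.smul_def, map_sub, map_inv₀]
  linear_combination ev y f * cLong_sq ht ht' hu hne +
    ev (Function.update y _ _) f *
      dLong (algebraMap ℂ K P.tn) (algebraMap ℂ K P.tnv) (y (Fin.last m)) *
      cLong_add (t := algebraMap ℂ K P.tn) (t' := algebraMap ℂ K P.tnv) hu hne

theorem ev_T_cross_last (hP : P.Nondeg) {m : ℕ} (y : Fin (m + 1) → Kˣ)
    (hne : (y (Fin.last m) : K) ^ 2 ≠ 1) (f : Laurent (m + 1)) :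
    ev y (((mulX (eps (Fin.last m)) * P.T (m + 1) (m + 1)) * (mulX (eps (Fin.last m)) *
      P.T (m + 1) (m + 1))) f) =
      ev y (((P.tnv⁻¹ - P.tnv) • (mulX (eps (Fin.last m)) * P.T (m + 1) (m + 1)) + 1 :
        Module.End ℂ (Laurent (m + 1))) f) := by
  have ht : algebraMap ℂ K P.tn ≠ 0 := by simpa using hP.tn
  have ht' : algebraMap ℂ K P.tnv ≠ 0 := by simpa using hP.tnv
  have hu := (y (Fin.last m)).ne_zero
  simp only [Module.End.mul_apply, LinearMap.add_apply, LinearMap.smul_apply,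
    Module.End.one_apply, map_add, map_smul, ev_mulX]
  rw [ev_T_last P hP y hne, ev_T_last P hP y hne, ev_mulX, ev_mulX, ev_T_last P hP y hne,
    ev_T_last P hP _ (by
    rw [Function.update_self, Units.val_inv_eq_inv_val]; exact sq_inv_ne hne)]
  simp only [Function.update_self, Function.update_idem, inv_inv, Function.update_eq_self,
    Units.val_inv_eq_inv_val, Algebra.smul_def, map_sub, map_inv₀]
  have h1 := cLong_cross ht ht' hu hne
  have h2 := cLong_cross' (t := algebraMap ℂ K P.tn) (t' := algebraMap ℂ K P.tnv) hu hne
  have h3 := mul_inv_cancel₀ hu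
  generalize cLong (algebraMap ℂ K P.tn) (algebraMap ℂ K P.tnv) (y (Fin.last m) : K)⁻¹ = c' at *
  generalize dLong (algebraMap ℂ K P.tn) (algebraMap ℂ K P.tnv) (y (Fin.last m) : K)⁻¹ = d' at *
  generalize cLong (algebraMap ℂ K P.tn) (algebraMap ℂ K P.tnv) (y (Fin.last m) : K) = c at *
  generalize dLong (algebraMap ℂ K P.tn) (algebraMap ℂ K P.tnv) (y (Fin.last m) : K) = d at *
  linear_combination ev y f * h1 + ev (Function.update y (Fin.last m) (y (Fin.last m))⁻¹) f * d * h2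
    + h3 * (ev y f * d * d' + ev (Function.update y (Fin.last m) (y (Fin.last m))⁻¹) f * d * c')

theorem ev_T_sq_zero (hP : P.Nondeg) {m : ℕ} (y : Fin (m + 1) → Kˣ)
    (hne : ((P.qhU hP.qh * (y 0)⁻¹ : Kˣ) : K) ^ 2 ≠ 1) (f : Laurent (m + 1)) :
    ev y ((P.T (m + 1) 0 * P.T (m + 1) 0) f) =
      ev y (((P.t0 - P.t0⁻¹) • P.T (m + 1) 0 + 1 : Module.End ℂ (Laurent (m + 1))) f) := by
  have ht : algebraMap ℂ K P.t0 ≠ 0 := by simpa using hP.t0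
  have ht' : algebraMap ℂ K P.t0v ≠ 0 := by simpa using hP.t0v
  have hu := (P.qhU hP.qh * (y 0)⁻¹ : Kˣ).ne_zero
  have hs : P.qhU hP.qh * (P.qhU hP.qh ^ 2 * (y 0)⁻¹)⁻¹ = (P.qhU hP.qh * (y 0)⁻¹ : Kˣ)⁻¹ := by
    rw [mul_inv, mul_inv, inv_inv, pow_two, mul_inv, ← mul_assoc, mul_inv_cancel_left]
  have hs2 : P.qhU hP.qh ^ 2 * (P.qhU hP.qh ^ 2 * (y 0)⁻¹)⁻¹ = (y 0 : Kˣ) := by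
    rw [mul_inv, inv_inv, mul_inv_cancel_left]
  simp only [Module.End.mul_apply, LinearMap.add_apply, LinearMap.smul_apply,
    Module.End.one_apply, map_add, map_smul]
  rw [ev_T_zero P hP y hne, ev_T_zero P hP y hne, ev_T_zero P hP _ (by
    rw [Function.update_self, hs, Units.val_inv_eq_inv_val]; exact sq_inv_ne hne)]
  rw [Function.update_self, hs, hs2, Function.update_idem, Function.update_eq_self]
  simp only [Units.val_inv_eq_inv_val (P.qhU hP.qh * (y 0)⁻¹), Algebra.smul_def, map_sub, map_inv₀]
  linear_combination ev y f * cLong_sq ht ht' hu hne +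
    ev (Function.update y _ _) f *
      dLong (algebraMap ℂ K P.t0) (algebraMap ℂ K P.t0v) (P.qhU hP.qh * (y 0)⁻¹ : Kˣ) *
      cLong_add (t := algebraMap ℂ K P.t0) (t' := algebraMap ℂ K P.t0v) hu hne

theorem ev_mulX_neg (y : Fin n → Kˣ) (i : Fin n) (f : Laurent n) :
    ev y (mulX (-eps i) f) = (y i : K)⁻¹ * ev y f := by
  rw [mulX, LinearMap.mulLeft_apply, map_mul, ev_single, prod_zpow_neg, prod_zpow_eps, one_smul,
    Units.val_inv_eq_inv_val]

/-- The quadratic relation for `q^{1/2} x_1^{-1} T_0`. -/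
theorem ev_T_cross_zero (hP : P.Nondeg) {m : ℕ} (y : Fin (m + 1) → Kˣ)
    (hne : ((P.qhU hP.qh * (y 0)⁻¹ : Kˣ) : K) ^ 2 ≠ 1) (f : Laurent (m + 1)) :
    ev y (((P.qh • (mulX (-eps 0) * P.T (m + 1) 0)) * (P.qh • (mulX (-eps 0) *
      P.T (m + 1) 0)) : Module.End ℂ (Laurent (m + 1))) f) =
      ev y (((P.t0v⁻¹ - P.t0v) • (P.qh • (mulX (-eps 0) * P.T (m + 1) 0)) + 1 :
        Module.End ℂ (Laurent (m + 1))) f) := by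
  have ht : algebraMap ℂ K P.t0 ≠ 0 := by simpa using hP.t0
  have ht' : algebraMap ℂ K P.t0v ≠ 0 := by simpa using hP.t0v
  have hu := (P.qhU hP.qh * (y 0)⁻¹ : Kˣ).ne_zero
  have hs : P.qhU hP.qh * (P.qhU hP.qh ^ 2 * (y 0)⁻¹)⁻¹ = (P.qhU hP.qh * (y 0)⁻¹ : Kˣ)⁻¹ := by
    rw [mul_inv, mul_inv, inv_inv, pow_two, mul_inv, ← mul_assoc, mul_inv_cancel_left]
  have hs2 : P.qhU hP.qh ^ 2 * (P.qhU hP.qh ^ 2 * (y 0)⁻¹)⁻¹ = (y 0 : Kˣ) := by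
    rw [mul_inv, inv_inv, mul_inv_cancel_left]
  have hq : ∀ (z : Kˣ), algebraMap ℂ K P.qh * (z : K)⁻¹ = (P.qhU hP.qh * z⁻¹ : Kˣ) := by
    intro z; rw [Units.val_mul, Units.val_inv_eq_inv_val]; rfl
  simp only [Module.End.mul_apply, LinearMap.add_apply, LinearMap.smul_apply,
    Module.End.one_apply, map_add, map_smul, ev_mulX_neg]
  rw [ev_T_zero P hP y hne, ev_T_zero P hP y hne, ev_mulX_neg, ev_mulX_neg, ev_T_zero P hP y hne,
    ev_T_zero P hP _ (by
    rw [Function.update_self, hs, Units.val_inv_eq_inv_val]; exact sq_inv_ne hne)]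
  simp only [Algebra.smul_def, map_sub, map_inv₀, ← mul_assoc, hq]
  rw [Function.update_self, hs, hs2, Function.update_idem, Function.update_eq_self]
  have h4 := hq (P.qhU hP.qh ^ 2 * (y 0)⁻¹)
  rw [hs] at h4
  have h5 := hq (y 0)
  rw [Units.val_inv_eq_inv_val (P.qhU hP.qh * (y 0)⁻¹)] at h4 ⊢
  have h1 := cLong_cross ht ht' hu hne
  have h2 := cLong_cross' (t := algebraMap ℂ K P.t0) (t' := algebraMap ℂ K P.t0v) hu hne
  have h3 := mul_inv_cancel₀ hu
  generalize ((P.qhU hP.qh * (y 0)⁻¹ : Kˣ) : K) = u at *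
  generalize cLong (algebraMap ℂ K P.t0) (algebraMap ℂ K P.t0v) u⁻¹ = c' at *
  generalize dLong (algebraMap ℂ K P.t0) (algebraMap ℂ K P.t0v) u⁻¹ = d' at *
  generalize cLong (algebraMap ℂ K P.t0) (algebraMap ℂ K P.t0v) u = c at *
  generalize dLong (algebraMap ℂ K P.t0) (algebraMap ℂ K P.t0v) u = d at *
  generalize ev (Function.update y 0 (P.qhU hP.qh ^ 2 * (y 0)⁻¹)) f = B at *
  generalize ev y f = A at *
  generalize (((P.qhU hP.qh ^ 2 * (y 0)⁻¹ : Kˣ) : K))⁻¹ = z' at *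
  generalize ((y 0 : Kˣ) : K)⁻¹ = z at *
  generalize algebraMap ℂ K P.qh = Q at *
  subst h5
  linear_combination A * h1 + B * d * h2 + h3 * (A * d * d' + B * d * c') +
    (Q * z) * d * (c' * B + d' * A) * h4

end

theorem T_sq_mid (hP : P.Nondeg) {j : ℕ} (hj : j + 1 < n) :
    P.T n (j + 1) * P.T n (j + 1) = (P.t - P.t⁻¹) • P.T n (j + 1) + 1 :=
  eq_of_ev_genPt fun f => ev_T_sq_mid hP hj _ (genPt_ne (by simp)) f

/-- The relation between `T_j` and the variables `x_j`, `x_{j+1}`. -/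
theorem T_cross_mid (hP : P.Nondeg) {j : ℕ} (hj : j + 1 < n) :
    P.T n (j + 1) * mulX (eps ⟨j, by omega⟩) * P.T n (j + 1) = mulX (eps ⟨j + 1, hj⟩) :=
  eq_of_ev_genPt fun f => ev_T_cross_mid hP hj _ (genPt_ne (by simp)) f

theorem T_sq_last (hP : P.Nondeg) {m : ℕ} :
    P.T (m + 1) (m + 1) * P.T (m + 1) (m + 1) = (P.tn - P.tn⁻¹) • P.T (m + 1) (m + 1) + 1 :=
  eq_of_ev_genPt fun f => ev_T_sq_last hP _ (genPt_sq_ne _) f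

theorem T_cross_last (hP : P.Nondeg) {m : ℕ} :
    (mulX (eps (Fin.last m)) * P.T (m + 1) (m + 1)) * (mulX (eps (Fin.last m)) *
      P.T (m + 1) (m + 1)) =
      (P.tnv⁻¹ - P.tnv) • (mulX (eps (Fin.last m)) * P.T (m + 1) (m + 1)) + 1 :=
  eq_of_ev_genPt fun f => ev_T_cross_last hP _ (genPt_sq_ne _) f

theorem genPt_zero_ne (hP : P.Nondeg) {m : ℕ} :
    ((P.qhU hP.qh * (genPt (m + 1) 0)⁻¹ : (FractionRing (Laurent (m + 1)))ˣ) :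
      FractionRing (Laurent (m + 1))) ^ 2 ≠ 1 := by
  intro h
  have h0 := (genPt (m + 1) 0).ne_zero
  apply genPt_mul_ne (0 : Fin (m + 1)) 0 (P.qh ^ 2)
  rw [Units.val_mul, Units.val_inv_eq_inv_val, ← div_eq_mul_inv, div_pow,
    div_eq_one_iff_eq (pow_ne_zero 2 h0)] at h
  rw [map_pow, ← pow_two, ← h]
  rfl

theorem T_sq_zero (hP : P.Nondeg) {m : ℕ} :
    P.T (m + 1) 0 * P.T (m + 1) 0 = (P.t0 - P.t0⁻¹) • P.T (m + 1) 0 + 1 :=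
  eq_of_ev_genPt fun f => ev_T_sq_zero hP _ (genPt_zero_ne hP) f

theorem T_cross_zero (hP : P.Nondeg) {m : ℕ} :
    (P.qh • (mulX (-eps 0) * P.T (m + 1) 0)) * (P.qh • (mulX (-eps 0) * P.T (m + 1) 0)) =
      (P.t0v⁻¹ - P.t0v) • (P.qh • (mulX (-eps 0) * P.T (m + 1) 0)) + 1 :=
  eq_of_ev_genPt fun f => ev_T_cross_zero hP _ (genPt_zero_ne hP) f

end Relations

section Braid

variable {n : ℕ} {P : Params}

section

variable {K : Type} [Field K]

theorem comp_swap_apply_of_ne {p r k : Fin n} (y : Fin n → Kˣ) (h1 : k ≠ p) (h2 : k ≠ r) :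
    (y ∘ Equiv.swap p r) k = y k := by
  simp [Equiv.swap_apply_of_ne_of_ne h1 h2]

theorem update_comp_swap {p r k : Fin n} (y : Fin n → Kˣ) (v : Kˣ) (h1 : k ≠ p) (h2 : k ≠ r) :
    Function.update y k v ∘ Equiv.swap p r = Function.update (y ∘ Equiv.swap p r) k v := by
  funext i
  by_cases h : i = k
  · subst h; simp [Equiv.swap_apply_of_ne_of_ne h1 h2]
  · have : Equiv.swap p r i ≠ k := by
      intro h3; apply h; rw [← h3]
      have := congrArg (Equiv.swap p r) h3
      rw [Equiv.swap_apply_self, Equiv.swap_apply_of_ne_of_ne h1 h2] at this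
      rw [h3]; exact this
    simp [h, this]

/-- The point obtained from `y` by prescribing three coordinates. -/
def pt3 (y : Fin n → Kˣ) (p r s : Fin n) (x w z : Kˣ) : Fin n → Kˣ := fun i =>
  if i = p then x else if i = r then w else if i = s then z else y i

theorem pt3_swap_left (y : Fin n → Kˣ) {p r s : Fin n} (hpr : p ≠ r) (hps : p ≠ s) (hrs : r ≠ s)
    (x w z : Kˣ) : pt3 y p r s x w z ∘ Equiv.swap p r = pt3 y p r s w x z := by
  funext i
  by_cases h1 : i = p
  · subst h1; simp [pt3, hpr.symm]
  · by_cases h2 : i = r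
    · subst h2; simp [pt3, hpr.symm]
    · rw [Function.comp_apply, Equiv.swap_apply_of_ne_of_ne h1 h2]
      simp [pt3, h1, h2]

theorem pt3_swap_right (y : Fin n → Kˣ) {p r s : Fin n} (hpr : p ≠ r) (hps : p ≠ s) (hrs : r ≠ s)
    (x w z : Kˣ) : pt3 y p r s x w z ∘ Equiv.swap r s = pt3 y p r s x z w := by
  funext i
  by_cases h1 : i = r
  · subst h1; simp [pt3, hpr.symm, hps.symm, hrs.symm]
  · by_cases h2 : i = s
    · subst h2; simp [pt3, hpr.symm, hps.symm, hrs.symm]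
    · rw [Function.comp_apply, Equiv.swap_apply_of_ne_of_ne h1 h2]
      simp [pt3, h1, h2]

theorem pt3_self (y : Fin n → Kˣ) (p r s : Fin n) : pt3 y p r s (y p) (y r) (y s) = y := by
  funext i; simp only [pt3]; split_ifs with h1 h2 h3 <;> simp_all

/-- The point obtained from `y` by prescribing two coordinates. -/
def pt2 (y : Fin n → Kˣ) (p r : Fin n) (x w : Kˣ) : Fin n → Kˣ := fun i =>
  if i = p then x else if i = r then w else y i

theorem pt2_swap (y : Fin n → Kˣ) {p r : Fin n} (hpr : p ≠ r) (x w : Kˣ) :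
    pt2 y p r x w ∘ Equiv.swap p r = pt2 y p r w x := by
  funext i
  by_cases h1 : i = p
  · subst h1; simp [pt2, hpr.symm]
  · by_cases h2 : i = r
    · subst h2; simp [pt2, hpr.symm]
    · rw [Function.comp_apply, Equiv.swap_apply_of_ne_of_ne h1 h2]
      simp [pt2, h1, h2]

theorem pt2_update (y : Fin n → Kˣ) {p r : Fin n} (hpr : p ≠ r) (x w v : Kˣ) :
    Function.update (pt2 y p r x w) r v = pt2 y p r x v := by
  funext i
  by_cases h2 : i = r
  · subst h2; simp [pt2, hpr.symm]
  · simp [pt2, h2]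

theorem pt2_self (y : Fin n → Kˣ) (p r : Fin n) : pt2 y p r (y p) (y r) = y := by
  funext i; simp only [pt2]; split_ifs with h1 h2 <;> simp_all

variable [Algebra ℂ K]

/-- Operators that act through reflections fixing each other's coefficients commute. -/
theorem ev_comm {A B : Module.End ℂ (Laurent n)} {y yA yB yAB : Fin n → Kˣ} {cA dA cB dB : K}
    (hA : ∀ f, ev y (A f) = cA * ev y f + dA * ev yA f)
    (hB : ∀ f, ev y (B f) = cB * ev y f + dB * ev yB f)
    (hA' : ∀ f, ev yB (A f) = cA * ev yB f + dA * ev yAB f)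
    (hB' : ∀ f, ev yA (B f) = cB * ev yA f + dB * ev yAB f) (f : Laurent n) :
    ev y ((A * B) f) = ev y ((B * A) f) := by
  simp only [Module.End.mul_apply, hA, hB, hA', hB']
  ring

theorem ev_braid_three (hP : P.Nondeg) {j : ℕ} (hj : j + 2 < n) (y : Fin n → Kˣ) (x w z : Kˣ)
    (hxw : (x : K) ≠ w) (hxz : (x : K) ≠ z) (hwz : (w : K) ≠ z) (f : Laurent n) :
    ev (pt3 y ⟨j, by omega⟩ ⟨j + 1, by omega⟩ ⟨j + 2, hj⟩ x w z)
      ((P.T n (j + 1) * P.T n (j + 2) * P.T n (j + 1)) f) =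
    ev (pt3 y ⟨j, by omega⟩ ⟨j + 1, by omega⟩ ⟨j + 2, hj⟩ x w z)
      ((P.T n (j + 2) * P.T n (j + 1) * P.T n (j + 2)) f) := by
  have hpr : (⟨j, by omega⟩ : Fin n) ≠ ⟨j + 1, by omega⟩ := by simp
  have hps : (⟨j, by omega⟩ : Fin n) ≠ ⟨j + 2, by omega⟩ := by simp
  have hrs : (⟨j + 1, by omega⟩ : Fin n) ≠ ⟨j + 2, by omega⟩ := by simp
  set p : Fin n := ⟨j, by omega⟩
  set r : Fin n := ⟨j + 1, by omega⟩
  set s : Fin n := ⟨j + 2, hj⟩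
  have h1 : ∀ (x w z : Kˣ), (x : K) ≠ w → ∀ f, ev (pt3 y p r s x w z) (P.T n (j + 1) f) =
      cMed (algebraMap ℂ K P.t) x w * ev (pt3 y p r s x w z) f +
      dMed (algebraMap ℂ K P.t) x w * ev (pt3 y p r s w x z) f := by
    intro x w z hxw f
    have e1 : pt3 y p r s x w z p = x := by simp [pt3]
    have e2 : pt3 y p r s x w z r = w := by simp [pt3, hpr.symm]
    have := ev_T_mid P hP (j := j) (by omega) (pt3 y p r s x w z) (by
      change (pt3 y p r s x w z p : K) ≠ pt3 y p r s x w z r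
      rwa [e1, e2]) f
    change _ = cMed _ (pt3 y p r s x w z p : K) (pt3 y p r s x w z r) * _ +
      dMed _ (pt3 y p r s x w z p : K) (pt3 y p r s x w z r) *
      ev (pt3 y p r s x w z ∘ Equiv.swap p r) f at this
    rw [this, e1, e2, pt3_swap_left y hpr hps hrs]
  have h2 : ∀ (x w z : Kˣ), (w : K) ≠ z → ∀ f, ev (pt3 y p r s x w z) (P.T n (j + 2) f) =
      cMed (algebraMap ℂ K P.t) w z * ev (pt3 y p r s x w z) f +
      dMed (algebraMap ℂ K P.t) w z * ev (pt3 y p r s x z w) f := by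
    intro x w z hxw f
    have e1 : pt3 y p r s x w z r = w := by simp [pt3, hpr.symm]
    have e2 : pt3 y p r s x w z s = z := by simp [pt3, hps.symm, hrs.symm]
    have := ev_T_mid P hP (j := j + 1) (by omega) (pt3 y p r s x w z) (by
      change (pt3 y p r s x w z r : K) ≠ pt3 y p r s x w z s
      rwa [e1, e2]) f
    change _ = cMed _ (pt3 y p r s x w z r : K) (pt3 y p r s x w z s) * _ +
      dMed _ (pt3 y p r s x w z r : K) (pt3 y p r s x w z s) *
      ev (pt3 y p r s x w z ∘ Equiv.swap r s) f at this
    rw [this, e1, e2, pt3_swap_right y hpr hps hrs]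
  simp only [Module.End.mul_apply, h1 _ _ _ hxw, h1 _ _ _ hxz, h1 _ _ _ hwz, h1 _ _ _ hxw.symm,
    h2 _ _ _ hxw, h2 _ _ _ hxz, h2 _ _ _ hwz, h2 _ _ _ hwz.symm]
  have ht : algebraMap ℂ K P.t ≠ 0 := by simpa using hP.t
  have b := cMed_braid_three (t := algebraMap ℂ K P.t) hxw hxz hwz
  have s1 := cMed_sq ht hxw
  have s2 := cMed_sq ht hwz
  have a1 := cMed_add (t := algebraMap ℂ K P.t) hxw
  have a2 := cMed_add (t := algebraMap ℂ K P.t) hwz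
  generalize algebraMap ℂ K P.t = t at *
  generalize ev (pt3 y p r s x w z) f = φ1
  generalize ev (pt3 y p r s w x z) f = φ2
  generalize ev (pt3 y p r s x z w) f = φ3
  generalize cMed t (x : K) w = A12 at *
  generalize cMed t (w : K) x = A21 at *
  generalize cMed t (w : K) z = A23 at *
  generalize cMed t (z : K) w = A32 at *
  generalize cMed t (x : K) z = A13 at *
  generalize dMed t (x : K) w = D12 at *
  generalize dMed t (w : K) x = D21 at *
  generalize dMed t (w : K) z = D23 at *
  generalize dMed t (z : K) w = D32 at *
  obtain rfl : A21 = t - t⁻¹ - A12 := by linear_combination a1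
  obtain rfl : A32 = t - t⁻¹ - A23 := by linear_combination a2
  linear_combination φ1 * (A13 * s1 - A13 * s2 + (A12 - A23) * b) + φ2 * D12 * b - φ3 * D23 * b

theorem ev_braid_four (hP : P.Nondeg) {m : ℕ} (y : Fin (m + 2) → Kˣ) (x w : Kˣ)
    (hxw : (x : K) ≠ w) (hm : (x : K) * w ≠ 1) (hx2 : (x : K) ^ 2 ≠ 1) (hw2 : (w : K) ^ 2 ≠ 1)
    (f : Laurent (m + 2)) :
    ev (pt2 y ⟨m, by omega⟩ (Fin.last (m + 1)) x w)
      ((P.T (m + 2) (m + 1) * P.T (m + 2) (m + 2) * P.T (m + 2) (m + 1) * P.T (m + 2) (m + 2)) f) =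
    ev (pt2 y ⟨m, by omega⟩ (Fin.last (m + 1)) x w)
      ((P.T (m + 2) (m + 2) * P.T (m + 2) (m + 1) * P.T (m + 2) (m + 2) *
        P.T (m + 2) (m + 1)) f) := by
  have hpr : (⟨m, by omega⟩ : Fin (m + 2)) ≠ Fin.last (m + 1) := by simp [Fin.ext_iff]
  set p : Fin (m + 2) := ⟨m, by omega⟩
  set r : Fin (m + 2) := Fin.last (m + 1)
  have h1 : ∀ (x w : Kˣ), (x : K) ≠ w → ∀ f, ev (pt2 y p r x w) (P.T (m + 2) (m + 1) f) =
      cMed (algebraMap ℂ K P.t) x w * ev (pt2 y p r x w) f +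
      dMed (algebraMap ℂ K P.t) x w * ev (pt2 y p r w x) f := by
    intro x w hxw f
    have e1 : pt2 y p r x w p = x := by simp [pt2]
    have e2 : pt2 y p r x w r = w := by simp [pt2, hpr.symm]
    have := ev_T_mid P hP (j := m) (by omega) (pt2 y p r x w) (by
      change (pt2 y p r x w p : K) ≠ pt2 y p r x w r
      rwa [e1, e2]) f
    change _ = cMed _ (pt2 y p r x w p : K) (pt2 y p r x w r) * _ +
      dMed _ (pt2 y p r x w p : K) (pt2 y p r x w r) *
      ev (pt2 y p r x w ∘ Equiv.swap p r) f at this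
    rw [this, e1, e2, pt2_swap y hpr]
  have h2 : ∀ (x w : Kˣ), (w : K) ^ 2 ≠ 1 → ∀ f, ev (pt2 y p r x w) (P.T (m + 2) (m + 2) f) =
      cLong (algebraMap ℂ K P.tn) (algebraMap ℂ K P.tnv) w * ev (pt2 y p r x w) f +
      dLong (algebraMap ℂ K P.tn) (algebraMap ℂ K P.tnv) w * ev (pt2 y p r x w⁻¹) f := by
    intro x w hw f
    have e2 : pt2 y p r x w r = w := by simp [pt2, hpr.symm]
    have := ev_T_last P hP (pt2 y p r x w) (by
      change (pt2 y p r x w r : K) ^ 2 ≠ 1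
      rwa [e2]) f
    change _ = cLong _ _ (pt2 y p r x w r : K) * _ + dLong _ _ (pt2 y p r x w r : K) *
      ev (Function.update (pt2 y p r x w) r (pt2 y p r x w r)⁻¹) f at this
    rw [this, e2, pt2_update y hpr]
  have hx0 := x.ne_zero
  have hw0 := w.ne_zero
  have hx2' : ((x⁻¹ : Kˣ) : K) ^ 2 ≠ 1 := by
    rw [Units.val_inv_eq_inv_val]; exact sq_inv_ne hx2
  have hw2' : ((w⁻¹ : Kˣ) : K) ^ 2 ≠ 1 := by
    rw [Units.val_inv_eq_inv_val]; exact sq_inv_ne hw2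
  have n1 : (x : K) ≠ (w⁻¹ : Kˣ) := by
    rw [Units.val_inv_eq_inv_val]; intro h; rw [h] at hm; exact hm (inv_mul_cancel₀ hw0)
  have n2 : (w : K) ≠ (x⁻¹ : Kˣ) := by
    rw [Units.val_inv_eq_inv_val]; intro h; rw [h] at hm; exact hm (mul_inv_cancel₀ hx0)
  have n3 : ((w⁻¹ : Kˣ) : K) ≠ (x⁻¹ : Kˣ) := by
    rw [Units.val_inv_eq_inv_val, Units.val_inv_eq_inv_val]
    exact fun h => hxw (inv_injective h).symm
  simp only [Module.End.mul_apply, h1 _ _ hxw, h1 _ _ hxw.symm, h1 _ _ n1, h1 _ _ n1.symm,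
    h1 _ _ n2, h1 _ _ n3, h2 _ _ hx2, h2 _ _ hw2, h2 _ _ hx2',
    h2 _ _ hw2', inv_inv]
  have ht : algebraMap ℂ K P.t ≠ 0 := by simpa using hP.t
  have hs : algebraMap ℂ K P.tn ≠ 0 := by simpa using hP.tn
  have hs' : algebraMap ℂ K P.tnv ≠ 0 := by simpa using hP.tnv
  have b := cMed_braid_four (t := algebraMap ℂ K P.t) (s := algebraMap ℂ K P.tn)
    (s' := algebraMap ℂ K P.tnv) hx0 hx2 hw2 hxw hm
  have s1 := cMed_sq ht hxw
  have s2 := cMed_sq ht n1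
  have a1 := cMed_add (t := algebraMap ℂ K P.t) hxw
  have a2 := cMed_add (t := algebraMap ℂ K P.t) n1
  have q1 := cLong_sq hs hs' hx0 hx2
  have q2 := cLong_sq hs hs' hw0 hw2
  have r1 := cLong_add (t := algebraMap ℂ K P.tn) (t' := algebraMap ℂ K P.tnv) hx0 hx2
  have r2 := cLong_add (t := algebraMap ℂ K P.tn) (t' := algebraMap ℂ K P.tnv) hw0 hw2
  obtain ⟨i1, i2⟩ := cMed_inv_inv (t := algebraMap ℂ K P.t) hx0 hw0 hxw
  have n1' : (x : K) ≠ (w : K)⁻¹ := by rwa [← Units.val_inv_eq_inv_val]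
  obtain ⟨i3, i4⟩ := cMed_inv_inv (t := algebraMap ℂ K P.t) hx0 (inv_ne_zero hw0) n1'
  rw [inv_inv] at i3 i4
  simp only [Units.val_inv_eq_inv_val, i1, i2, i3, i4] at *
  generalize algebraMap ℂ K P.t = t at *
  generalize algebraMap ℂ K P.tn = s at *
  generalize algebraMap ℂ K P.tnv = s' at *
  generalize ev (pt2 y p r x w) f = φ1
  generalize ev (pt2 y p r x w⁻¹) f = φ2
  generalize ev (pt2 y p r w x) f = φ3
  generalize ev (pt2 y p r w x⁻¹) f = φ4
  generalize ev (pt2 y p r w⁻¹ x) f = φ5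
  generalize cMed t (x : K) w = a at *
  generalize cMed t (w : K) x = am at *
  generalize cMed t (x : K) (w : K)⁻¹ = a' at *
  generalize cMed t (w : K)⁻¹ x = am' at *
  generalize dMed t (x : K) w = d at *
  generalize dMed t (w : K) x = dm at *
  generalize dMed t (x : K) (w : K)⁻¹ = d' at *
  generalize dMed t (w : K)⁻¹ x = dm' at *
  generalize cLong s s' (x : K) = cx at *
  generalize cLong s s' (x : K)⁻¹ = cx' at *
  generalize cLong s s' (w : K) = cw at *
  generalize cLong s s' (w : K)⁻¹ = cw' at *
  generalize dLong s s' (x : K) = dx at *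
  generalize dLong s s' (x : K)⁻¹ = dx' at *
  generalize dLong s s' (w : K) = dw at *
  generalize dLong s s' (w : K)⁻¹ = dw' at *
  obtain rfl : am = t - t⁻¹ - a := by linear_combination a1
  obtain rfl : am' = t - t⁻¹ - a' := by linear_combination a2
  obtain rfl : cx' = s - s⁻¹ - cx := by linear_combination r1
  obtain rfl : cw' = s - s⁻¹ - cw := by linear_combination r2
  linear_combination φ2 * dw * ((a - a') * b + cx * s1 - cx * s2) +
    φ3 * d * ((cx - cw) * b + a' * q1 - a' * q2) + φ4 * d * dx * b - φ5 * dw * d' * b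

end

theorem T_braid_three (hP : P.Nondeg) {j : ℕ} (hj : j + 2 < n) :
    P.T n (j + 1) * P.T n (j + 2) * P.T n (j + 1) =
      P.T n (j + 2) * P.T n (j + 1) * P.T n (j + 2) := by
  refine eq_of_ev_genPt fun f => ?_
  have := ev_braid_three hP hj (genPt n) _ _ _ (genPt_ne (i := ⟨j, by omega⟩)
    (j := ⟨j + 1, by omega⟩) (by simp)) (genPt_ne (j := ⟨j + 2, by omega⟩) (by simp))
    (genPt_ne (by simp)) f
  rwa [pt3_self] at this

theorem T_braid_four (hP : P.Nondeg) {m : ℕ} :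
    P.T (m + 2) (m + 1) * P.T (m + 2) (m + 2) * P.T (m + 2) (m + 1) * P.T (m + 2) (m + 2) =
    P.T (m + 2) (m + 2) * P.T (m + 2) (m + 1) * P.T (m + 2) (m + 2) * P.T (m + 2) (m + 1) := by
  refine eq_of_ev_genPt fun f => ?_
  have h1 := genPt_mul_ne (⟨m, by omega⟩ : Fin (m + 2)) (Fin.last (m + 1)) 1
  rw [map_one] at h1
  have := ev_braid_four hP (genPt (m + 2)) (genPt _ ⟨m, by omega⟩) (genPt _ (Fin.last (m + 1)))
    (genPt_ne (by simp [Fin.ext_iff])) h1 (genPt_sq_ne _) (genPt_sq_ne _) f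
  rwa [pt2_self] at this

theorem T_comm_mid_mid (hP : P.Nondeg) {i j : ℕ} (hij : i + 2 ≤ j) (hj : j + 1 < n) :
    Commute (P.T n (i + 1)) (P.T n (j + 1)) := by
  refine eq_of_ev_genPt fun f => ?_
  set p : Fin n := ⟨i, by omega⟩ with hp
  set r : Fin n := ⟨i + 1, by omega⟩ with hr
  set p' : Fin n := ⟨j, by omega⟩ with hp'
  set r' : Fin n := ⟨j + 1, hj⟩ with hr'
  have h1 : p ≠ p' := by simp [hp, hp', Fin.ext_iff]; omega
  have h2 : p ≠ r' := by simp [hp, hr', Fin.ext_iff]; omega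
  have h3 : r ≠ p' := by simp [hr, hp', Fin.ext_iff]; omega
  have h4 : r ≠ r' := by simp [hr, hr', Fin.ext_iff]; omega
  have hi' : i + 1 < n := by omega
  have hA := ev_T_mid (K := FractionRing (Laurent n)) P hP hi'
  have hB := ev_T_mid (K := FractionRing (Laurent n)) P hP hj
  have e1 := comp_swap_apply_of_ne (p := p') (r := r') (genPt n) h1 h2
  have e2 := comp_swap_apply_of_ne (p := p') (r := r') (genPt n) h3 h4
  have e3 := comp_swap_apply_of_ne (p := p) (r := r) (genPt n) h1.symm h3.symm
  have e4 := comp_swap_apply_of_ne (p := p) (r := r) (genPt n) h2.symm h4.symm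
  have n1 : (genPt n p : FractionRing (Laurent n)) ≠ genPt n r := genPt_ne (by simp [hp, hr])
  have n2 : (genPt n p' : FractionRing (Laurent n)) ≠ genPt n r' := genPt_ne (by simp [hp', hr'])
  have hA' := hA (genPt n ∘ Equiv.swap p' r') (by rwa [e1, e2])
  have hB' := hB (genPt n ∘ Equiv.swap p r) (by rwa [e3, e4])
  simp only [← hp, ← hr, e1, e2] at hA'
  simp only [← hp', ← hr', e3, e4] at hB'
  refine ev_comm (hA _ n1) (hB _ n2) hA' (fun f => ?_) f
  rw [hB' f]
  congr 4
  funext k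
  simp only [Function.comp_apply]
  congr 1
  by_cases k1 : k = p
  · subst k1; simp [Equiv.swap_apply_of_ne_of_ne, h1, h2, h3, h4]
  by_cases k2 : k = r
  · subst k2; simp [Equiv.swap_apply_of_ne_of_ne, h1, h2, h3, h4]
  by_cases k3 : k = p'
  · subst k3; simp [Equiv.swap_apply_of_ne_of_ne, h1.symm, h2.symm, h3.symm, h4.symm]
  by_cases k4 : k = r'
  · subst k4; simp [Equiv.swap_apply_of_ne_of_ne, h1.symm, h2.symm, h3.symm, h4.symm]
  simp [Equiv.swap_apply_of_ne_of_ne, k1, k2, k3, k4]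

theorem T_comm_mid_last (hP : P.Nondeg) {m i : ℕ} (hi : i + 2 ≤ m) :
    Commute (P.T (m + 1) (i + 1)) (P.T (m + 1) (m + 1)) := by
  refine eq_of_ev_genPt fun f => ?_
  set p : Fin (m + 1) := ⟨i, by omega⟩ with hp
  set r : Fin (m + 1) := ⟨i + 1, by omega⟩ with hr
  have h1 : Fin.last m ≠ p := by simp [hp, Fin.ext_iff]; omega
  have h2 : Fin.last m ≠ r := by simp [hr, Fin.ext_iff]; omega
  have hi' : i + 1 < m + 1 := by omega
  have hA := ev_T_mid (K := FractionRing (Laurent (m + 1))) P hP hi'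
  have hB := fun y hy => ev_T_last (K := FractionRing (Laurent (m + 1))) P hP (m := m) y hy
  have n1 : (genPt (m + 1) p : FractionRing (Laurent (m + 1))) ≠ genPt (m + 1) r :=
    genPt_ne (by simp [hp, hr])
  have n2 := genPt_sq_ne (Fin.last m)
  have hA' := hA (Function.update (genPt (m + 1)) (Fin.last m) (genPt (m + 1) (Fin.last m))⁻¹) (by
    rwa [← hp, ← hr, Function.update_of_ne h1.symm, Function.update_of_ne h2.symm])
  have e := comp_swap_apply_of_ne (genPt (m + 1)) h1 h2
  have hB' := hB (genPt (m + 1) ∘ Equiv.swap p r) (by rwa [e])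
  simp only [← hp, ← hr, Function.update_of_ne h1.symm, Function.update_of_ne h2.symm,
    update_comp_swap _ _ h1 h2] at hA'
  rw [e] at hB'
  exact ev_comm (hA _ n1) (hB _ n2) hA' hB' f

theorem T_comm_zero_mid (hP : P.Nondeg) {m i : ℕ} (h0 : 0 < i) (hi : i + 1 ≤ m) :
    Commute (P.T (m + 1) 0) (P.T (m + 1) (i + 1)) := by
  refine eq_of_ev_genPt fun f => ?_
  set p : Fin (m + 1) := ⟨i, by omega⟩ with hp
  set r : Fin (m + 1) := ⟨i + 1, by omega⟩ with hr
  have h1 : 0 ≠ p := by simp [hp, Fin.ext_iff]; omega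
  have h2 : 0 ≠ r := by simp [hr, Fin.ext_iff]
  have hi' : i + 1 < m + 1 := by omega
  have hA := ev_T_mid (K := FractionRing (Laurent (m + 1))) P hP hi'
  have hB := fun y hy => ev_T_zero (K := FractionRing (Laurent (m + 1))) P hP (m := m) y hy
  have n1 : (genPt (m + 1) p : FractionRing (Laurent (m + 1))) ≠ genPt (m + 1) r :=
    genPt_ne (by simp [hp, hr])
  have n2 := genPt_zero_ne (P := P) hP (m := m)
  have hA' := hA (Function.update (genPt (m + 1)) 0 (P.qhU hP.qh ^ 2 * (genPt (m + 1) 0)⁻¹)) (by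
    rwa [← hp, ← hr, Function.update_of_ne h1.symm, Function.update_of_ne h2.symm])
  have e := comp_swap_apply_of_ne (genPt (m + 1)) h1 h2
  have hB' := hB (genPt (m + 1) ∘ Equiv.swap p r) (by rwa [e])
  simp only [← hp, ← hr, Function.update_of_ne h1.symm, Function.update_of_ne h2.symm,
    update_comp_swap _ _ h1 h2] at hA'
  rw [e] at hB'
  exact (ev_comm (hA _ n1) (hB _ n2) hA' hB' f).symm

theorem T_comm_zero_last (hP : P.Nondeg) {m : ℕ} (hm : 0 < m) :
    Commute (P.T (m + 1) 0) (P.T (m + 1) (m + 1)) := by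
  refine eq_of_ev_genPt fun f => ?_
  have h1 : (0 : Fin (m + 1)) ≠ Fin.last m := by simp [Fin.ext_iff]; omega
  have hA := fun y hy => ev_T_last (K := FractionRing (Laurent (m + 1))) P hP (m := m) y hy
  have hB := fun y hy => ev_T_zero (K := FractionRing (Laurent (m + 1))) P hP (m := m) y hy
  have n1 := genPt_sq_ne (Fin.last m)
  have n2 := genPt_zero_ne (P := P) hP (m := m)
  have hA' := hA (Function.update (genPt (m + 1)) 0 (P.qhU hP.qh ^ 2 * (genPt (m + 1) 0)⁻¹)) (by
    rwa [Function.update_of_ne h1.symm])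
  have hB' := hB (Function.update (genPt (m + 1)) (Fin.last m) (genPt (m + 1) (Fin.last m))⁻¹) (by
    rwa [Function.update_of_ne h1])
  rw [Function.update_of_ne h1.symm] at hA'
  rw [Function.update_of_ne h1, Function.update_comm h1.symm] at hB'
  exact (ev_comm (hA _ n1) (hB _ n2) hA' hB' f).symm

theorem X_comm_mid (hP : P.Nondeg) {j : ℕ} (hj : j + 1 < n) {i : Fin n} (h1 : i.val ≠ j)
    (h2 : i.val ≠ j + 1) : Commute (mulX (eps i)) (P.T n (j + 1)) := by
  refine eq_of_ev_genPt fun f => ?_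
  have n1 : (genPt n ⟨j, by omega⟩ : FractionRing (Laurent n)) ≠ genPt n ⟨j + 1, hj⟩ :=
    genPt_ne (by simp)
  rw [Module.End.mul_apply, Module.End.mul_apply, ev_mulX, ev_T_mid P hP hj _ n1,
    ev_T_mid P hP hj _ n1, ev_mulX, ev_mulX, comp_swap_apply_of_ne _ (by simpa [Fin.ext_iff])
    (by simpa [Fin.ext_iff])]
  ring

theorem X_comm_last (hP : P.Nondeg) {m : ℕ} {i : Fin (m + 1)} (h : i ≠ Fin.last m) :
    Commute (mulX (eps i)) (P.T (m + 1) (m + 1)) := by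
  refine eq_of_ev_genPt fun f => ?_
  rw [Module.End.mul_apply, Module.End.mul_apply, ev_mulX, ev_T_last P hP _ (genPt_sq_ne _),
    ev_T_last P hP _ (genPt_sq_ne _), ev_mulX, ev_mulX, Function.update_of_ne h]
  ring

theorem X_comm_zero (hP : P.Nondeg) {m : ℕ} {i : Fin (m + 1)} (h : i ≠ 0) :
    Commute (mulX (eps i)) (P.T (m + 1) 0) := by
  refine eq_of_ev_genPt fun f => ?_
  rw [Module.End.mul_apply, Module.End.mul_apply, ev_mulX, ev_T_zero P hP _ (genPt_zero_ne hP),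
    ev_T_zero P hP _ (genPt_zero_ne hP), ev_mulX, ev_mulX, Function.update_of_ne h]
  ring

end Braid

/-! ### Consequences of the braid relations -/

section Group

variable {G : Type*} [Group G]

/-- The relations between the `T_j` and the `x_i` from which the commutation relations of the
`Y_i` are derived. -/
structure BraidData (n : ℕ) (T X : ℕ → G) : Prop where
  comm : ∀ i j, i + 2 ≤ j → j ≤ n → Commute (T i) (T j)
  braid : ∀ i, 1 ≤ i → i + 1 < n → T i * T (i + 1) * T i = T (i + 1) * T i * T (i + 1)
  braid' : ∀ i, 1 ≤ i → i + 1 = n →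
    T i * T (i + 1) * T i * T (i + 1) = T (i + 1) * T i * T (i + 1) * T i
  cross : ∀ i, 1 ≤ i → i < n → T i * X i * T i = X (i + 1)
  commX : ∀ j, 2 ≤ j → j ≤ n → Commute (X 1) (T j)
  commX' : Commute (X 2) (T 0)

/-- The element `T_i ⋯ T_{n-1} T_n T_{n-1} ⋯ T_i` with `i = n - k`. -/
def hookM (n : ℕ) (T : ℕ → G) : ℕ → G
  | 0 => T n
  | k + 1 => T (n - (k + 1)) * hookM n T k * T (n - (k + 1))

/-- The element `T_k ⋯ T_1 T_0 T_1⁻¹ ⋯ T_k⁻¹`. -/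
def conjZ (T : ℕ → G) : ℕ → G
  | 0 => T 0
  | k + 1 => T (k + 1) * conjZ T k * (T (k + 1))⁻¹

/-- `Y_i`, as a product in a group. -/
def grpY (n : ℕ) (T : ℕ → G) (i : ℕ) : G :=
  ((List.range' i (n + 1 - i)).map T).prod * ((List.range n).reverse.map T).prod *
    ((List.range' 1 (i - 1)).map fun j => (T j)⁻¹).prod

theorem grpY_eq {n : ℕ} (T : ℕ → G) {i : ℕ} (h1 : 1 ≤ i) (h2 : i < n) :
    grpY n T i = T i * grpY n T (i + 1) * T i := by
  obtain ⟨k, rfl⟩ : ∃ k, i = k + 1 := ⟨i - 1, by omega⟩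
  have e1 : n + 1 - (k + 1) = (n + 1 - (k + 1 + 1)) + 1 := by omega
  rw [grpY, e1, List.range'_succ, grpY, Nat.add_sub_cancel, Nat.add_sub_cancel,
    List.range'_1_concat]
  simp [mul_assoc, add_comm]

theorem conjZ_eq (T : ℕ → G) (k : ℕ) : conjZ T k = ((List.range (k + 1)).reverse.map T).prod *
    ((List.range' 1 k).map fun j => (T j)⁻¹).prod := by
  induction k with
  | zero => simp [conjZ]
  | succ k ih =>
    rw [conjZ, ih, List.range_succ (n := k + 1), List.range'_1_concat]
    simp [mul_assoc, add_comm]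

theorem grpY_last {n : ℕ} (T : ℕ → G) (h : 1 ≤ n) : grpY n T n = T n * conjZ T (n - 1) := by
  obtain ⟨k, rfl⟩ : ∃ k, n = k + 1 := ⟨n - 1, by omega⟩
  rw [Nat.add_sub_cancel, conjZ_eq, grpY]
  simp [mul_assoc]

theorem grpY_eq_hook {n : ℕ} (T : ℕ → G) {k : ℕ} (h : k < n) :
    grpY n T (n - k) = hookM n T k * conjZ T (n - k - 1) := by
  induction k with
  | zero => exact grpY_last T h
  | succ k ih =>
    have e : n - (k + 1) + 1 = n - k := by omega
    rw [grpY_eq T (by omega) (by omega), e, ih (by omega), hookM]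
    obtain ⟨l, hl⟩ : ∃ l, n - (k + 1) = l + 1 := ⟨n - (k + 1) - 1, by omega⟩
    have e2 : n - k - 1 = l + 1 := by omega
    rw [hl, e2, conjZ]
    simp [mul_assoc]

theorem commute_conj_of_braid {a b z : G} (h : a * b * a = b * a * b) (hz : Commute b z) :
    Commute a (b * (a * z * a⁻¹) * b⁻¹) := by
  have e : a = (b * a) * b * (b * a)⁻¹ := by
    rw [eq_mul_inv_iff_mul_eq, ← mul_assoc, h]
  have e2 : b * (a * z * a⁻¹) * b⁻¹ = (b * a) * z * (b * a)⁻¹ := by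
    simp [mul_assoc]
  rw [e2]
  nth_rewrite 1 [e]
  exact (Commute.conj_iff _).2 hz

theorem commute_hook_of_braid {a b z : G} (h : a * b * a = b * a * b) (hz : Commute a z) :
    Commute b (a * (b * z * b) * a) := by
  calc b * (a * (b * z * b) * a) = (b * a * b) * z * (b * a) := by simp only [mul_assoc]
    _ = a * b * (a * z) * (b * a) := by rw [← h]; simp only [mul_assoc]
    _ = a * b * z * (a * b * a) := by rw [hz.eq]; simp only [mul_assoc]
    _ = a * (b * z * b) * a * b := by rw [h]; simp only [mul_assoc]

variable {n : ℕ} {T X : ℕ → G}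

theorem commute_hookM {g : G} {k : ℕ} (hg : ∀ j, n - k ≤ j → j ≤ n → Commute g (T j)) :
    Commute g (hookM n T k) := by
  induction k with
  | zero => exact hg n (by omega) le_rfl
  | succ k ih =>
    have := hg (n - (k + 1)) le_rfl (by omega)
    exact (this.mul_right (ih fun j h1 h2 => hg j (by omega) h2)).mul_right this

theorem BraidData.hookM_comm (H : BraidData n T X) {k : ℕ} (hk : k < n) {j : ℕ}
    (h1 : n - k < j) (h2 : j ≤ n) : Commute (T j) (hookM n T k) := by
  induction k with
  | zero => omega
  | succ k ih =>
    by_cases h : n - k < j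
    · have : Commute (T j) (T (n - (k + 1))) := (H.comm _ _ (by omega) h2).symm
      exact (this.mul_right (ih (by omega) h)).mul_right this
    · obtain ⟨i, hi⟩ : ∃ i, n - (k + 1) = i := ⟨_, rfl⟩
      obtain rfl : j = i + 1 := by omega
      rw [hookM, hi]
      cases k with
      | zero =>
        have hn : i + 1 = n := by omega
        have := H.braid' i (by omega) hn
        rw [hookM, ← hn]
        change T (i + 1) * (T i * T (i + 1) * T i) = T i * T (i + 1) * T i * T (i + 1)
        rw [this]; simp only [mul_assoc]
      | succ k =>
        rw [hookM, show n - (k + 1) = i + 1 by omega]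
        refine commute_hook_of_braid (H.braid i (by omega) (by omega)) ?_
        exact commute_hookM fun j h1 h2 => H.comm _ _ (by omega) h2

theorem BraidData.hookM_comm' (H : BraidData n T X) {k : ℕ} {j : ℕ}
    (h1 : j + 1 < n - k) : Commute (T j) (hookM n T k) :=
  commute_hookM fun i h2 h3 => H.comm _ _ (by omega) h3

theorem BraidData.conjZ_comm (H : BraidData n T X) {k : ℕ} {j : ℕ} (h1 : k + 2 ≤ j)
    (h2 : j ≤ n) : Commute (T j) (conjZ T k) := by
  induction k with
  | zero => exact (H.comm _ _ h1 h2).symm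
  | succ k ih =>
    have : Commute (T j) (T (k + 1)) := (H.comm _ _ (by omega) h2).symm
    exact (this.mul_right (ih (by omega))).mul_right this.inv_right

theorem BraidData.conjZ_comm' (H : BraidData n T X) {k : ℕ} (hk : k < n) {j : ℕ} (h0 : 1 ≤ j)
    (h1 : j < k) : Commute (T j) (conjZ T k) := by
  induction k with
  | zero => omega
  | succ k ih =>
    by_cases h : j < k
    · have : Commute (T j) (T (k + 1)) := (H.comm _ _ (by omega) (by omega))
      exact (this.mul_right (ih (by omega) h)).mul_right this.inv_right
    · obtain ⟨i, rfl⟩ : ∃ i, k = i + 1 := ⟨k - 1, by omega⟩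
      obtain rfl : j = i + 1 := by omega
      rw [conjZ, conjZ]
      exact commute_conj_of_braid (H.braid _ (by omega) (by omega))
        (H.conjZ_comm (by omega) (by omega))

/-- `T_j` commutes with `Y_i` unless `j` is `i - 1` or `i`. -/
theorem BraidData.Y_comm (H : BraidData n T X) {i j : ℕ} (hi : 1 ≤ i) (hi' : i ≤ n)
    (hj : 1 ≤ j) (hj' : j ≤ n) (h1 : j ≠ i) (h2 : j + 1 ≠ i) :
    Commute (T j) (grpY n T i) := by
  obtain ⟨k, hk, rfl⟩ : ∃ k, k < n ∧ i = n - k := ⟨n - i, by omega, by omega⟩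
  rw [grpY_eq_hook T hk]
  by_cases h : n - k < j
  · exact (H.hookM_comm hk h hj').mul_right (H.conjZ_comm (by omega) hj')
  · exact (H.hookM_comm' (by omega)).mul_right (H.conjZ_comm' (by omega) hj (by omega))

/-- The dual affine generator `x_1⁻¹ (T_1 ⋯ T_n ⋯ T_1)⁻¹`. -/
def grpV (n : ℕ) (T X : ℕ → G) : G := (X 1)⁻¹ * (hookM n T (n - 1))⁻¹

/-- The elements `x_i⁻¹ (T_i ⋯ T_n ⋯ T_i)⁻¹` are conjugate to each other. -/
theorem BraidData.conj_step (H : BraidData n T X) {k : ℕ} (hk : k + 1 < n) :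
    (X (n - (k + 1)))⁻¹ * (hookM n T (k + 1))⁻¹ =
      T (n - (k + 1)) * ((X (n - k))⁻¹ * (hookM n T k)⁻¹) * (T (n - (k + 1)))⁻¹ := by
  have h := H.cross (n - (k + 1)) (by omega) (by omega)
  rw [show n - (k + 1) + 1 = n - k by omega] at h
  rw [← h, hookM]
  simp [mul_assoc]

theorem BraidData.V_comm_T (H : BraidData n T X) {j : ℕ} (h1 : 2 ≤ j) (h2 : j ≤ n) :
    Commute (grpV n T X) (T j) :=
  (H.commX j h1 h2).inv_left.mul_left
    (H.hookM_comm (by omega) (by omega) h2).symm.inv_left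

/-- The dual affine generator commutes with `Y_2, …, Y_n`. -/
theorem BraidData.V_comm_Y (H : BraidData n T X) {i : ℕ} (h1 : 2 ≤ i) (h2 : i ≤ n) :
    Commute (grpV n T X) (grpY n T i) := by
  obtain ⟨l, rfl⟩ : ∃ l, i = 2 + l := ⟨i - 2, by omega⟩
  induction l with
  | zero =>
    obtain ⟨k, rfl⟩ : ∃ k, n = k + 2 := ⟨n - 2, by omega⟩
    have e := grpY_eq_hook (n := k + 2) T (k := k) (by omega)
    rw [show k + 2 - k = 2 by omega] at e
    rw [add_zero, e]
    refine Commute.mul_right (commute_hookM fun j h1 h2 => H.V_comm_T (by omega) h2) ?_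
    have hs := H.conj_step (k := k) (by omega)
    rw [show k + 2 - (k + 1) = 1 by omega, show k + 2 - k = 2 by omega] at hs
    rw [grpV, show k + 2 - 1 = k + 1 by omega, hs, show 2 - 1 = 0 + 1 by omega, conjZ, conjZ,
      zero_add]
    exact (Commute.conj_iff _).2 (H.commX'.inv_left.mul_left
      (H.hookM_comm' (k := k) (j := 0) (by omega)).symm.inv_left)
  | succ l ih =>
    have h3 : grpY n T (2 + (l + 1)) = (T (2 + l))⁻¹ * grpY n T (2 + l) * (T (2 + l))⁻¹ := by
      rw [grpY_eq T (i := 2 + l) (by omega) (by omega)]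
      simp [mul_assoc, add_assoc]
    rw [h3]
    have h4 := (H.V_comm_T (j := 2 + l) (by omega) (by omega)).inv_right
    exact (h4.mul_right (ih (by omega) (by omega))).mul_right h4

/-- `V` inherits a quadratic relation, because it is conjugate to `x_n⁻¹ T_n⁻¹`. -/
theorem BraidData.V_conj (H : BraidData n T X) (hn : 1 ≤ n) :
    ∃ g : G, grpV n T X = g * ((X n)⁻¹ * (T n)⁻¹) * g⁻¹ := by
  have key : ∀ k, k < n → ∃ g : G, (X (n - k))⁻¹ * (hookM n T k)⁻¹ =
      g * ((X n)⁻¹ * (T n)⁻¹) * g⁻¹ := by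
    intro k
    induction k with
    | zero => intro _; exact ⟨1, by simp [hookM]⟩
    | succ k ih =>
      intro hk
      obtain ⟨g, hg⟩ := ih (by omega)
      refine ⟨T (n - (k + 1)) * g, ?_⟩
      rw [H.conj_step hk, hg]
      simp [mul_assoc]
  have := key (n - 1) (by omega)
  rwa [show n - (n - 1) = 1 by omega] at this

/-- The product `V Y_1` inherits a quadratic relation from `x_1⁻¹ T_0`. -/
theorem V_mul_Y (hn : 1 ≤ n) : grpV n T X * grpY n T 1 = (X 1)⁻¹ * T 0 := by
  have e := grpY_eq_hook (n := n) T (k := n - 1) (by omega)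
  rw [show n - (n - 1) = 1 by omega] at e
  rw [e, grpV]
  simp [mul_assoc, conjZ]

theorem conjZ_conj (T : ℕ → G) (k : ℕ) : ∃ g : G, conjZ T k = g * T 0 * g⁻¹ := by
  induction k with
  | zero => exact ⟨1, by simp [conjZ]⟩
  | succ k ih =>
    obtain ⟨g, hg⟩ := ih
    exact ⟨T (k + 1) * g, by rw [conjZ, hg]; simp [mul_assoc]⟩

end Group

/-! ### The operators `T_j` and `Y_i` as units -/

section Units

/-- The unit given by an element `T` with `T^2 = κ T + 1`. -/
def unitOfQuad {A : Type*} [Ring A] [Algebra ℂ A] (T : A) (κ : ℂ) (h : T * T = κ • T + 1) : Aˣ where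
  val := T
  inv := T - κ • 1
  val_inv := by rw [mul_sub, h]; simp
  inv_val := by rw [sub_mul, h]; simp

variable {m : ℕ} {P : Params}

theorem T_sq (hP : P.Nondeg) {j : ℕ} (hj : j ≤ m + 1) :
    P.T (m + 1) j * P.T (m + 1) j = (P.mult (simpleRoot (m + 1) j) -
      (P.mult (simpleRoot (m + 1) j))⁻¹) • P.T (m + 1) j + 1 := by
  rcases Nat.eq_zero_or_pos j with rfl | h0
  · rw [mult_simpleRoot_zero]; exact T_sq_zero hP
  · obtain ⟨i, rfl⟩ : ∃ i, j = i + 1 := ⟨j - 1, by omega⟩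
    by_cases hi : i = m
    · subst hi; rw [mult_simpleRoot_last]; exact T_sq_last hP
    · rw [mult_simpleRoot_mid P (by omega)]; exact T_sq_mid hP (by omega)

open Classical in
/-- `T_j` as a unit. -/
noncomputable def Tu (P : Params) (m : ℕ) (j : ℕ) : (Module.End ℂ (Laurent (m + 1)))ˣ :=
  if h : P.Nondeg ∧ j ≤ m + 1 then unitOfQuad (P.T (m + 1) j) _ (T_sq h.1 h.2) else 1

theorem Tu_val (hP : P.Nondeg) {j : ℕ} (hj : j ≤ m + 1) :
    (Tu P m j : Module.End ℂ (Laurent (m + 1))) = P.T (m + 1) j := by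
  rw [Tu, dif_pos ⟨hP, hj⟩]; rfl

theorem Tu_inv (hP : P.Nondeg) {j : ℕ} (hj : j ≤ m + 1) :
    ((Tu P m j)⁻¹ : (Module.End ℂ (Laurent (m + 1)))ˣ) = P.T (m + 1) j -
      (P.mult (simpleRoot (m + 1) j) - (P.mult (simpleRoot (m + 1) j))⁻¹) •
        (1 : Module.End ℂ (Laurent (m + 1))) := by
  rw [Tu, dif_pos ⟨hP, hj⟩]; rfl

/-- Multiplication by `x_i` as a unit. -/
noncomputable def Xu (m : ℕ) (i : ℕ) : (Module.End ℂ (Laurent (m + 1)))ˣ where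
  val := mulX (eps (Fin.ofNat (m + 1) (i - 1)))
  inv := mulX (-eps (Fin.ofNat (m + 1) (i - 1)))
  val_inv := by rw [mulX_mul, add_neg_cancel, mulX_zero]
  inv_val := by rw [mulX_mul, neg_add_cancel, mulX_zero]

theorem Xu_val {i : ℕ} (hi : i < m + 1) :
    (Xu m (i + 1) : Module.End ℂ (Laurent (m + 1))) = mulX (eps ⟨i, hi⟩) := by
  simp only [Xu, Nat.add_sub_cancel]
  congr 2
  simp [Fin.ext_iff, Nat.mod_eq_of_lt hi]

/-- The operators `T_j` and the multiplications by `x_i` satisfy all relations of `BraidData`. -/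
theorem braidData (hP : P.Nondeg) : BraidData (m + 2) (Tu P (m + 1)) (Xu (m + 1)) where
  comm i j hij hj := by
    apply Units.ext
    rw [Units.val_mul, Units.val_mul, Tu_val hP (by omega), Tu_val hP (by omega)]
    rcases Nat.eq_zero_or_pos i with rfl | h0
    · obtain ⟨l, rfl⟩ : ∃ l, j = l + 1 := ⟨j - 1, by omega⟩
      by_cases hl : l = m + 1
      · subst hl; exact T_comm_zero_last hP (by omega)
      · exact T_comm_zero_mid hP (by omega) (by omega)
    · obtain ⟨l, rfl⟩ : ∃ l, j = l + 1 := ⟨j - 1, by omega⟩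
      obtain ⟨k, rfl⟩ : ∃ k, i = k + 1 := ⟨i - 1, by omega⟩
      by_cases hl : l = m + 1
      · subst hl; exact T_comm_mid_last hP (by omega)
      · exact T_comm_mid_mid hP (by omega) (by omega)
  braid i h1 h2 := by
    obtain ⟨k, rfl⟩ : ∃ k, i = k + 1 := ⟨i - 1, by omega⟩
    apply Units.ext
    simp only [Units.val_mul]
    rw [Tu_val hP (by omega), Tu_val hP (by omega)]
    exact T_braid_three hP (by omega)
  braid' i h1 h2 := by
    obtain rfl : i = m + 1 := by omega
    apply Units.ext
    simp only [Units.val_mul]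
    rw [Tu_val hP (by omega), Tu_val hP (by omega)]
    exact T_braid_four hP
  cross i h1 h2 := by
    obtain ⟨k, rfl⟩ : ∃ k, i = k + 1 := ⟨i - 1, by omega⟩
    apply Units.ext
    simp only [Units.val_mul]
    rw [Tu_val hP (by omega), Xu_val (by omega), Xu_val (by omega)]
    exact T_cross_mid hP (by omega)
  commX j h1 h2 := by
    obtain ⟨l, rfl⟩ : ∃ l, j = l + 1 := ⟨j - 1, by omega⟩
    apply Units.ext
    rw [Units.val_mul, Units.val_mul, Tu_val hP (by omega), Xu_val (i := 0) (by omega)]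
    by_cases hl : l = m + 1
    · subst hl; exact X_comm_last hP (by simp [Fin.ext_iff])
    · exact X_comm_mid hP (by omega) (by simp; omega) (by simp)
  commX' := by
    apply Units.ext
    rw [Units.val_mul, Units.val_mul, Tu_val hP (by omega), Xu_val (i := 1) (by omega)]
    exact X_comm_zero hP (by simp)

theorem units_val_list_prod {A ι : Type*} [Monoid A] (l : List ι) (f : ι → Aˣ) :
    (((l.map f).prod : Aˣ) : A) = (l.map fun i => (f i : A)).prod := by
  induction l with
  | nil => rfl
  | cons i l ih => rw [List.map_cons, List.map_cons, List.prod_cons, List.prod_cons,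
      Units.val_mul, ih]

/-- `Y_i` as a unit. -/
noncomputable def Yu (P : Params) (m : ℕ) (i : ℕ) : (Module.End ℂ (Laurent (m + 1)))ˣ :=
  grpY (m + 1) (Tu P m) i

theorem Yu_val (hP : P.Nondeg) {i : ℕ} (h1 : 1 ≤ i) (h2 : i ≤ m + 1) :
    (Yu P m i : Module.End ℂ (Laurent (m + 1))) = P.Y (m + 1) i := by
  simp only [Yu, grpY, Params.Y, Units.val_mul, units_val_list_prod]
  congr 1
  · congr 1
    · congr 1
      refine List.map_congr_left fun j hj => ?_
      rw [List.mem_range'_1] at hj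
      exact Tu_val hP (by omega)
    · congr 1
      refine List.map_congr_left fun j hj => ?_
      rw [List.mem_reverse, List.mem_range] at hj
      exact Tu_val hP (by omega)
  · congr 1
    refine List.map_congr_left fun j hj => ?_
    rw [List.mem_range'_1] at hj
    rw [← Tu_val hP (j := j) (m := m) (by omega), Ring.inverse_unit]

/-- The dual affine generator as a unit. -/
noncomputable def Vu (P : Params) (m : ℕ) : (Module.End ℂ (Laurent (m + 1)))ˣ :=
  grpV (m + 1) (Tu P m) (Xu m)

/-- The quadratic relation for the dual affine generator, with the parameter `t_n^∨`. -/
theorem Vu_inv (hP : P.Nondeg) :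
    ((Vu P (m + 1))⁻¹ : (Module.End ℂ (Laurent (m + 2)))ˣ) =
      (Vu P (m + 1) : Module.End ℂ (Laurent (m + 2))) - (P.tnv - P.tnv⁻¹) •
        (1 : Module.End ℂ (Laurent (m + 2))) := by
  obtain ⟨g, hg⟩ := (braidData (m := m) hP).V_conj (by omega)
  rw [Vu, hg]
  set u := Xu (m + 1) (m + 2) with hu
  set T := Tu P (m + 1) (m + 2) with hT
  have h := T_cross_last (m := m + 1) hP
  rw [show Fin.last (m + 1) = ⟨m + 1, by omega⟩ from rfl, ← Xu_val, ← Tu_val hP (by omega), ← hu,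
    ← hT] at h
  set D : (Module.End ℂ (Laurent (m + 2)))ˣ := u * T with hD
  have h2 : (u : Module.End ℂ (Laurent (m + 2))) * (T : Module.End ℂ (Laurent (m + 2))) =
    (D : Module.End ℂ (Laurent (m + 2))) := rfl
  rw [h2] at h
  have h3 : (D : Module.End ℂ (Laurent (m + 2))) = (P.tnv⁻¹ - P.tnv) •
      (1 : Module.End ℂ (Laurent (m + 2))) + ((D⁻¹ : (Module.End ℂ (Laurent (m + 2)))ˣ) :
        Module.End ℂ (Laurent (m + 2))) := by
    have := congrArg (fun z => z * ((D⁻¹ : (Module.End ℂ (Laurent (m + 2)))ˣ) :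
      Module.End ℂ (Laurent (m + 2)))) h
    simpa only [mul_assoc, Units.mul_inv, mul_one, add_mul, smul_mul_assoc, one_mul] using this
  have e : u⁻¹ * T⁻¹ = T * D⁻¹ * T⁻¹ := by rw [hD]; simp
  rw [e]
  have e1 : (g * (T * D⁻¹ * T⁻¹) * g⁻¹)⁻¹ = (g * T) * D * (g * T)⁻¹ := by simp [mul_assoc]
  have e2 : g * (T * D⁻¹ * T⁻¹) * g⁻¹ = (g * T) * D⁻¹ * (g * T)⁻¹ := by simp [mul_assoc]
  rw [e1, e2]
  generalize g * T = k
  rw [Units.val_mul, Units.val_mul, h3, mul_add, add_mul, mul_smul_comm, smul_mul_assoc, mul_one,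
    Units.mul_inv, Units.val_mul, Units.val_mul]
  module

/-- The quadratic relation for `q^{1/2} V Y_1 = q^{1/2} x_1^{-1} T_0`, with the parameter
`t_0^∨`. -/
theorem Vu_cross (hP : P.Nondeg) :
    P.qh • ((Vu P (m + 1) : Module.End ℂ (Laurent (m + 2))) * P.Y (m + 2) 1) -
      P.qh⁻¹ • (((Yu P (m + 1) 1)⁻¹ : (Module.End ℂ (Laurent (m + 2)))ˣ) *
        ((Vu P (m + 1))⁻¹ : (Module.End ℂ (Laurent (m + 2)))ˣ)) =
      (P.t0v⁻¹ - P.t0v) • (1 : Module.End ℂ (Laurent (m + 2))) := by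
  have h0 := V_mul_Y (n := m + 2) (T := Tu P (m + 1)) (X := Xu (m + 1)) (by omega)
  have h1 : ((Vu P (m + 1) * Yu P (m + 1) 1 : (Module.End ℂ (Laurent (m + 2)))ˣ) :
      Module.End ℂ (Laurent (m + 2))) = mulX (-eps 0) * P.T (m + 2) 0 := by
    rw [Vu, Yu, h0, Units.val_mul, Tu_val hP (by omega)]
    rfl
  rw [← Yu_val hP le_rfl (by omega), ← Units.val_mul, ← Units.val_mul, ← mul_inv_rev]
  set D := Vu P (m + 1) * Yu P (m + 1) 1
  have h := T_cross_zero (m := m + 1) hP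
  rw [← h1] at h
  have hq := hP.qh
  have h2 := congrArg (fun z => P.qh⁻¹ • (z * ((D⁻¹ : (Module.End ℂ (Laurent (m + 2)))ˣ) :
      Module.End ℂ (Laurent (m + 2))))) h
  simp only [smul_mul_assoc, mul_smul_comm, mul_assoc, Units.mul_inv, mul_one, add_mul, one_mul,
    smul_add, smul_smul, inv_mul_cancel_left₀ hq, mul_comm _ P.qh] at h2
  rw [h2]
  simp

end Units

/-! ### Intertwiners -/

section Intertwiners

variable {m : ℕ} {P : Params}

/-- `F` is a joint eigenvector of the operators `Y_i`, with eigenvalues `g_i`. -/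
def IsEigen (P : Params) {n : ℕ} (F : Laurent n) (g : Fin n → ℂ) : Prop :=
  ∀ i : Fin n, P.Y n (i.val + 1) F = g i • F

theorem units_inv_apply_of_apply {V : Type*} [AddCommGroup V] [Module ℂ V]
    (u : (Module.End ℂ V)ˣ) {F : V} {c : ℂ} (hc : c ≠ 0)
    (h : (u : Module.End ℂ V) F = c • F) :
    ((u⁻¹ : (Module.End ℂ V)ˣ) : Module.End ℂ V) F = c⁻¹ • F := by
  have h1 : ((u⁻¹ : (Module.End ℂ V)ˣ) : Module.End ℂ V) ((u : Module.End ℂ V) F) = F := by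
    rw [← Module.End.mul_apply, Units.inv_mul, Module.End.one_apply]
  rw [h, map_smul] at h1
  rw [← h1, smul_smul, h1, inv_mul_cancel₀ hc, one_smul]

theorem units_apply_of_inv_apply {V : Type*} [AddCommGroup V] [Module ℂ V]
    (u : (Module.End ℂ V)ˣ) {F : V} {c : ℂ} (hc : c ≠ 0)
    (h : ((u⁻¹ : (Module.End ℂ V)ˣ) : Module.End ℂ V) F = c • F) :
    (u : Module.End ℂ V) F = c⁻¹ • F := by
  have := units_inv_apply_of_apply u⁻¹ hc h
  rwa [inv_inv] at this

theorem T_comm_Y (hP : P.Nondeg) {i j : ℕ} (hi : 1 ≤ i) (hi' : i ≤ m + 2)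
    (hj : 1 ≤ j) (hj' : j ≤ m + 2) (h1 : j ≠ i) (h2 : j + 1 ≠ i) :
    P.T (m + 2) j * P.Y (m + 2) i = P.Y (m + 2) i * P.T (m + 2) j := by
  have := congrArg Units.val ((braidData (m := m) hP).Y_comm hi hi' hj hj' h1 h2).eq
  rw [Units.val_mul, Units.val_mul, Tu_val hP hj'] at this
  change _ * (Yu P (m + 1) i : Module.End ℂ (Laurent (m + 2))) = (Yu P (m + 1) i : Module.End ℂ _)
    * _ at this
  rwa [Yu_val hP hi hi'] at this

/-- If `A` commutes with `B`, then `A - a` preserves the eigenspaces of `B`. -/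
theorem eigen_comm_apply {n : ℕ} {A B : Module.End ℂ (Laurent n)} (h : A * B = B * A)
    {F : Laurent n} {c a : ℂ} (hF : B F = c • F) : B (A F - a • F) = c • (A F - a • F) := by
  rw [map_sub, map_smul, hF, ← Module.End.mul_apply, ← h, Module.End.mul_apply, hF, map_smul,
    smul_sub, smul_comm]

/-- For `0 < j < n` the intertwiner `T_j - c` interchanges the eigenvalues of `Y_j` and `Y_{j+1}`.
-/
theorem intertwine_mid (hP : P.Nondeg) {j : ℕ} (hj : j + 1 < m + 2) {F : Laurent (m + 2)}
    {g : Fin (m + 2) → ℂ} (hF : IsEigen P F g) (hg : g ⟨j, by omega⟩ ≠ g ⟨j + 1, hj⟩) :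
    IsEigen P (P.T (m + 2) (j + 1) F - cMed P.t (g ⟨j + 1, hj⟩) (g ⟨j, by omega⟩) • F)
      (g ∘ Equiv.swap ⟨j, by omega⟩ ⟨j + 1, hj⟩) := by
  set p : Fin (m + 2) := ⟨j, by omega⟩ with hp
  set r : Fin (m + 2) := ⟨j + 1, hj⟩ with hr
  have hY : P.Y (m + 2) (j + 1) = P.T (m + 2) (j + 1) * P.Y (m + 2) (j + 2) *
      P.T (m + 2) (j + 1) := by
    have := congrArg Units.val (grpY_eq (n := m + 2) (Tu P (m + 1)) (i := j + 1) (by omega)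
      (by omega))
    rw [Units.val_mul, Units.val_mul, Tu_val hP (by omega)] at this
    change (Yu P (m + 1) (j + 1) : Module.End ℂ (Laurent (m + 2))) =
      _ * (Yu P (m + 1) (j + 2) : Module.End ℂ _) * _ at this
    rwa [Yu_val hP (by omega) (by omega), Yu_val hP (by omega) (by omega)] at this
  have hq := T_sq_mid (n := m + 2) hP hj
  have h1 : P.Y (m + 2) (j + 1) F = g p • F := hF p
  have h2 : P.Y (m + 2) (j + 2) F = g r • F := hF r
  set T := P.T (m + 2) (j + 1)
  have hpr : p ≠ r := by simp [hp, hr]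
  have hqF : ∀ x, T (T x) = (P.t - P.t⁻¹) • T x + x := fun x => by
    rw [← Module.End.mul_apply, hq]; rfl
  have h3 : T (P.Y (m + 2) (j + 2) (T F)) = g p • F := by rw [← h1, hY]; rfl
  -- the relation between `T` and the second of the two operators `Y`
  have h4 : P.Y (m + 2) (j + 2) (T F) = g p • T F - ((P.t - P.t⁻¹) * g p) • F := by
    have := congrArg T h3
    rw [hqF, h3, map_smul] at this
    rw [← sub_eq_of_eq_add' this.symm, smul_smul]
  have h5 : P.Y (m + 2) (j + 1) (T F) = ((P.t - P.t⁻¹) * g p) • F + g r • T F := by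
    rw [hY, Module.End.mul_apply, Module.End.mul_apply, hqF, map_add, map_smul, h4, h2]
    rw [map_add, map_smul, map_sub, map_smul, map_smul, map_smul, hqF]
    module
  have hs : g p - g r ≠ 0 := sub_ne_zero.2 hg
  have hc : cMed P.t (g r) (g p) * (g p - g r) = (P.t - P.t⁻¹) * g p := by
    rw [cMed, div_mul_cancel₀ _ hs]
  intro i
  by_cases hi : i = p
  · subst hi
    change P.Y (m + 2) (j + 1) _ = _
    rw [Function.comp_apply, Equiv.swap_apply_left, map_sub, map_smul, h1, h5, ← hc]
    module
  by_cases hi2 : i = r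
  · subst hi2
    change P.Y (m + 2) (j + 2) _ = _
    rw [Function.comp_apply, Equiv.swap_apply_right, map_sub, map_smul, h2, h4, ← hc]
    module
  · rw [Function.comp_apply, Equiv.swap_apply_of_ne_of_ne hi hi2]
    refine eigen_comm_apply (T_comm_Y hP (by omega) (by omega) (by omega) (by omega) ?_ ?_) (hF i)
    · intro h; apply hi; simp [hp, Fin.ext_iff]; omega
    · intro h; apply hi2; simp [hr, Fin.ext_iff]; omega

/-- The intertwiner `T_n - c` inverts the eigenvalue of `Y_n`. -/
theorem intertwine_last (hP : P.Nondeg) {F : Laurent (m + 2)}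
    {g : Fin (m + 2) → ℂ} (hF : IsEigen P F g) (h0 : g (Fin.last (m + 1)) ≠ 0)
    (hg : g (Fin.last (m + 1)) ^ 2 ≠ 1) :
    IsEigen P (P.T (m + 2) (m + 2) F - cLong P.tn P.t0 (g (Fin.last (m + 1)))⁻¹ • F)
      (Function.update g (Fin.last (m + 1)) (g (Fin.last (m + 1)))⁻¹) := by
  set r : Fin (m + 2) := Fin.last (m + 1) with hr
  have h1 : P.Y (m + 2) (m + 2) F = g r • F := hF r
  have hq := T_sq_last (m := m + 1) hP
  have hZ : ((Tu P (m + 1) (m + 2))⁻¹ * Yu P (m + 1) (m + 2)) =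
      conjZ (Tu P (m + 1)) (m + 1) := by
    rw [Yu, grpY_last _ (by omega)]; simp
  -- `T_n⁻¹ Y_n` is conjugate to `T_0`, so it satisfies the quadratic relation of `T_0`
  have hZ2 : ((conjZ (Tu P (m + 1)) (m + 1) : (Module.End ℂ (Laurent (m + 2)))ˣ) :
      Module.End ℂ (Laurent (m + 2))) =
      ((conjZ (Tu P (m + 1)) (m + 1))⁻¹ : (Module.End ℂ (Laurent (m + 2)))ˣ) +
      (P.t0 - P.t0⁻¹) • (1 : Module.End ℂ (Laurent (m + 2))) := by
    obtain ⟨k, hk⟩ := conjZ_conj (Tu P (m + 1)) (m + 1)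
    have e := Tu_inv (m := m + 1) hP (j := 0) (by omega)
    rw [mult_simpleRoot_zero, ← Tu_val hP (by omega)] at e
    rw [hk, mul_inv_rev, mul_inv_rev, inv_inv, Units.val_mul, Units.val_mul, Units.val_mul,
      Units.val_mul, e, sub_mul, mul_sub, smul_mul_assoc, mul_smul_comm, one_mul, Units.mul_inv]
    rw [mul_assoc]
    abel
  rw [← hZ, mul_inv_rev, inv_inv, Units.val_mul, Units.val_mul, Tu_val hP (by omega),
    Yu_val hP (by omega) (by omega), Tu_inv hP (by omega), mult_simpleRoot_last] at hZ2
  have hYi := units_inv_apply_of_apply (Yu P (m + 1) (m + 2)) h0 (by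
    rw [Yu_val hP (by omega) (by omega)]; exact h1)
  set Yi : Module.End ℂ (Laurent (m + 2)) :=
    (((Yu P (m + 1) (m + 2))⁻¹ : (Module.End ℂ (Laurent (m + 2)))ˣ) : Module.End ℂ (Laurent (m + 2))) with hYidef
  set T := P.T (m + 2) (m + 2)
  have h2 := LinearMap.congr_fun hZ2 F
  simp only [Module.End.mul_apply, LinearMap.add_apply, LinearMap.sub_apply, LinearMap.smul_apply,
    Module.End.one_apply, h1, map_smul] at h2
  have h3 : Yi (T F) = g r • T F - ((P.tn - P.tn⁻¹) * g r + (P.t0 - P.t0⁻¹)) • F := by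
    rw [eq_sub_of_add_eq h2.symm]; module
  have hc : cLong P.tn P.t0 (g r)⁻¹ * (g r - (g r)⁻¹) =
      (P.tn - P.tn⁻¹) * g r + (P.t0 - P.t0⁻¹) := by
    have h5 : g r ^ 2 - 1 ≠ 0 := sub_ne_zero.2 hg
    have h6 : 1 - (g r)⁻¹ ^ 2 = (g r ^ 2 - 1) / g r ^ 2 := by field_simp
    rw [cLong, h6]; field_simp
  intro i
  by_cases hi : i = r
  · subst hi
    change P.Y (m + 2) (m + 2) _ = _
    rw [Function.update_self, ← Yu_val hP (by omega) (by omega)]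
    refine units_apply_of_inv_apply _ h0 ?_
    rw [← hYidef, map_sub, map_smul, hYi, h3, ← hc]
    module
  · rw [Function.update_of_ne hi]
    have hi' : i.val ≠ m + 1 := fun h => hi (by simp [hr, Fin.ext_iff, h])
    exact eigen_comm_apply (T_comm_Y hP (by omega) (by omega) (by omega) (by omega) (by omega)
      (by omega)) (hF i)

/-- The intertwiner `V - c` maps the eigenvalue `g` of `Y_1` to `q^{-1} g^{-1}`. -/
theorem intertwine_zero (hP : P.Nondeg) {F : Laurent (m + 2)}
    {g : Fin (m + 2) → ℂ} (hF : IsEigen P F g) (h0 : g 0 ≠ 0)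
    (hg : (P.qh * g 0) ^ 2 ≠ 1) :
    IsEigen P ((Vu P (m + 1) : Module.End ℂ (Laurent (m + 2))) F -
      cLong P.tnv P.t0v (P.qh * g 0) • F)
      (Function.update g 0 (P.qh ^ 2 * g 0)⁻¹) := by
  have h1 : P.Y (m + 2) 1 F = g 0 • F := hF 0
  have hYi := units_inv_apply_of_apply (Yu P (m + 1) 1) h0 (by
    rw [Yu_val hP (by omega) (by omega)]; exact h1)
  have h2 := LinearMap.congr_fun (Vu_cross (m := m) hP) F
  rw [Vu_inv hP] at h2
  set Yi : Module.End ℂ (Laurent (m + 2)) :=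
    (((Yu P (m + 1) 1)⁻¹ : (Module.End ℂ (Laurent (m + 2)))ˣ) : Module.End ℂ (Laurent (m + 2))) with hYidef
  set V : Module.End ℂ (Laurent (m + 2)) := (Vu P (m + 1) : Module.End ℂ (Laurent (m + 2)))
    with hV
  simp only [Module.End.mul_apply, LinearMap.sub_apply, LinearMap.smul_apply,
    Module.End.one_apply, h1, map_smul, map_sub, hYi] at h2
  have hq := hP.qh
  have h3 : Yi (V F) = (P.qh ^ 2 * g 0) • V F +
      ((P.tnv - P.tnv⁻¹) * (g 0)⁻¹ + P.qh * (P.t0v - P.t0v⁻¹)) • F := by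
    have h4 := congrArg (fun x => P.qh • x) h2
    simp only [smul_sub, smul_smul, mul_inv_cancel₀ hq, one_smul, mul_inv_cancel_left₀ hq] at h4
    have h5 : Yi (V F) = (P.qh * (P.qh * g 0)) • V F +
      ((P.tnv - P.tnv⁻¹) * (g 0)⁻¹) • F - (P.qh * (P.t0v⁻¹ - P.t0v)) • F := by
      rw [← h4]; module
    rw [h5]; module
  have hc : cLong P.tnv P.t0v (P.qh * g 0) * ((g 0)⁻¹ - P.qh ^ 2 * g 0) =
      (P.tnv - P.tnv⁻¹) * (g 0)⁻¹ + P.qh * (P.t0v - P.t0v⁻¹) := by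
    have h5 : 1 - (P.qh * g 0) ^ 2 ≠ 0 := sub_ne_zero.2 hg.symm
    have h6 : (g 0)⁻¹ - P.qh ^ 2 * g 0 = (1 - (P.qh * g 0) ^ 2) / g 0 := by field_simp
    rw [cLong, h6, div_mul_div_cancel₀ h5]; field_simp
  intro i
  by_cases hi : i = 0
  · subst hi
    change P.Y (m + 2) 1 _ = _
    rw [Function.update_self, ← Yu_val hP (by omega) (by omega)]
    refine units_apply_of_inv_apply _ (mul_ne_zero (pow_ne_zero 2 hq) h0) ?_
    rw [← hYidef, map_sub, map_smul, hYi, h3, ← hc]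
    module
  · rw [Function.update_of_ne hi]
    have hi' : i.val ≠ 0 := fun h => hi (by simp [Fin.ext_iff, h])
    have hc := congrArg Units.val ((braidData (m := m) hP).V_comm_Y (i := i.val + 1) (by omega)
      (by omega)).eq
    rw [Units.val_mul, Units.val_mul] at hc
    change V * (Yu P (m + 1) (i.val + 1) : Module.End ℂ (Laurent (m + 2))) =
      (Yu P (m + 1) (i.val + 1) : Module.End ℂ (Laurent (m + 2))) * V at hc
    rw [Yu_val hP (by omega) (by omega)] at hc
    exact eigen_comm_apply hc (hF i)

end Intertwiners

/-! ### Roots, reflections and heights -/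

section Roots

variable {n : ℕ}

/-- `α ∈ Σ`. -/
def IsRoot (α : Wt n) : Prop := IsMed α ∨ IsLong α

/-- The vector `(n, n - 1, …, 1)`; it is regular dominant, and `⟨α, ·⟩ < 2 n + 2` on `Σ`. -/
def htVec (n : ℕ) : Wt n := fun i => (n : ℤ) - i.val

/-- A height function on affine functions that is positive on `R^+` and negative on `R^-`. -/
def ht (β : Aff n) : ℤ := β.1 ⬝ᵥ htVec n + ((n : ℤ) + 1) * β.2

theorem mem_posMed {α : Wt n} : α ∈ posMed n ↔
    ∃ i j : Fin n, i < j ∧ (α = eps i - eps j ∨ α = eps i + eps j) := by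
  simp only [posMed, Finset.mem_union, Finset.mem_image, Finset.mem_filter,
    Finset.mem_univ, true_and, Prod.exists]
  constructor
  · rintro (⟨i, j, h, rfl⟩ | ⟨i, j, h, rfl⟩)
    exacts [⟨i, j, h, Or.inl rfl⟩, ⟨i, j, h, Or.inr rfl⟩]
  · rintro ⟨i, j, h, rfl | rfl⟩
    exacts [Or.inl ⟨i, j, h, rfl⟩, Or.inr ⟨i, j, h, rfl⟩]

theorem mem_posLong {α : Wt n} : α ∈ posLong n ↔ ∃ i : Fin n, α = 2 • eps i := by
  simp [posLong, eq_comm]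

theorem mem_posRoots {α : Wt n} : α ∈ posRoots n ↔ α ∈ posMed n ∨ α ∈ posLong n := by
  simp [posRoots]

theorem isRoot_iff {α : Wt n} : IsRoot α ↔ α ∈ posRoots n ∨ -α ∈ posRoots n := by
  simp only [IsRoot, IsMed, IsLong, mem_posRoots]; tauto

theorem isRoot_of_mem {α : Wt n} (h : α ∈ posRoots n) : IsRoot α := isRoot_iff.2 (Or.inl h)

theorem IsRoot.neg {α : Wt n} (h : IsRoot α) : IsRoot (-α) := h.imp IsMed.neg IsLong.neg

theorem eps_dot (i : Fin n) (μ : Wt n) : eps i ⬝ᵥ μ = μ i := by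
  rw [dotProduct_comm, dot_eps]

theorem dot_htVec_pos {α : Wt n} (h : α ∈ posRoots n) : 0 < α ⬝ᵥ htVec n := by
  rcases mem_posRoots.1 h with h | h
  · obtain ⟨i, j, hij, rfl | rfl⟩ := mem_posMed.1 h <;>
    · simp only [sub_dotProduct, add_dotProduct, eps_dot, htVec]
      have : i.val < j.val := hij
      omega
  · obtain ⟨i, rfl⟩ := mem_posLong.1 h
    simp only [two_smul, add_dotProduct, eps_dot, htVec]
    omega

theorem dot_htVec_le {α : Wt n} (h : α ∈ posRoots n) : α ⬝ᵥ htVec n ≤ 2 * n := by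
  rcases mem_posRoots.1 h with h | h
  · obtain ⟨i, j, hij, rfl | rfl⟩ := mem_posMed.1 h <;>
    · simp only [sub_dotProduct, add_dotProduct, eps_dot, htVec]
      omega
  · obtain ⟨i, rfl⟩ := mem_posLong.1 h
    simp only [two_smul, add_dotProduct, eps_dot, htVec]
    omega

theorem mem_posRoots_iff {α : Wt n} : α ∈ posRoots n ↔ IsRoot α ∧ 0 < α ⬝ᵥ htVec n := by
  refine ⟨fun h => ⟨isRoot_of_mem h, dot_htVec_pos h⟩, fun ⟨h, h2⟩ => ?_⟩
  rcases isRoot_iff.1 h with h | h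
  · exact h
  · have := dot_htVec_pos h
    rw [neg_dotProduct] at this
    omega

theorem mem_affR_iff {β : Aff n} : β ∈ affR n ↔ ∃ α c, IsRoot α ∧ β = (α, 2 * c) := by
  constructor
  · rintro ⟨h, c, hc⟩
    exact ⟨β.1, c, h, Prod.ext rfl (by rw [hc]; ring)⟩
  · rintro ⟨α, c, h, rfl⟩
    exact ⟨h, even_two_mul c⟩

theorem mem_affRPos_iff {β : Aff n} : β ∈ affRPos n ↔ β ∈ affR n ∧ 0 < ht β := by
  refine and_congr_right fun h => ?_
  obtain ⟨α, c, hα, rfl⟩ := mem_affR_iff.1 h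
  have hb : -(2 * (n : ℤ)) ≤ α ⬝ᵥ htVec n ∧ α ⬝ᵥ htVec n ≤ 2 * n := by
    rcases isRoot_iff.1 hα with h | h
    · have := dot_htVec_pos h; have := dot_htVec_le h; omega
    · have := dot_htVec_pos h; have := dot_htVec_le h
      rw [neg_dotProduct] at *; omega
  simp only [ht]
  rcases lt_trichotomy c 0 with hc | rfl | hc
  · have : ((n : ℤ) + 1) * (2 * c) ≤ ((n : ℤ) + 1) * (-2) :=
      mul_le_mul_of_nonneg_left (by omega) (by omega)
    exact iff_of_false (by rintro (⟨_, h⟩ | h) <;> omega) (by omega)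
  · simp [mem_posRoots_iff, hα]
  · have : ((n : ℤ) + 1) * 2 ≤ ((n : ℤ) + 1) * (2 * c) :=
      mul_le_mul_of_nonneg_left (by omega) (by omega)
    exact iff_of_true (Or.inr (by omega)) (by omega)

theorem affR_neg {β : Aff n} (h : β ∈ affR n) : -β ∈ affR n := by
  obtain ⟨α, c, hα, rfl⟩ := mem_affR_iff.1 h
  exact mem_affR_iff.2 ⟨-α, -c, hα.neg, Prod.ext rfl (by simp)⟩

theorem ht_neg (β : Aff n) : ht (-β) = -ht β := by
  simp [ht]; ring

theorem mem_affRPos_or_neg {β : Aff n} (h : β ∈ affR n) : β ∈ affRPos n ∨ -β ∈ affRPos n := by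
  obtain ⟨⟨h1, h2⟩⟩ : Nonempty (β ∈ affR n ∧ ht β ≠ 0) := by
    refine ⟨h, fun h0 => ?_⟩
    obtain ⟨α, c, hα, rfl⟩ := mem_affR_iff.1 h
    simp only [ht] at h0
    have hb : (α ⬝ᵥ htVec n ≠ 0) ∧ -(2 * (n : ℤ)) ≤ α ⬝ᵥ htVec n ∧ α ⬝ᵥ htVec n ≤ 2 * n := by
      rcases isRoot_iff.1 hα with h | h
      · have := dot_htVec_pos h; have := dot_htVec_le h; omega
      · have := dot_htVec_pos h; have := dot_htVec_le h
        rw [neg_dotProduct] at *; omega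
    rcases lt_trichotomy c 0 with hc | rfl | hc
    · have : ((n : ℤ) + 1) * (2 * c) ≤ ((n : ℤ) + 1) * (-2) :=
        mul_le_mul_of_nonneg_left (by omega) (by omega)
      omega
    · simp at h0; omega
    · have : ((n : ℤ) + 1) * 2 ≤ ((n : ℤ) + 1) * (2 * c) :=
        mul_le_mul_of_nonneg_left (by omega) (by omega)
      omega
  rw [mem_affRPos_iff, mem_affRPos_iff, ht_neg]
  rcases lt_or_gt_of_ne h2 with h3 | h3
  · exact Or.inr ⟨affR_neg h, by omega⟩
  · exact Or.inl ⟨h, h3⟩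

theorem not_mem_affRPos_neg {β : Aff n} (h : β ∈ affRPos n) : -β ∉ affRPos n := by
  rw [mem_affRPos_iff] at *
  rw [ht_neg]
  omega

/-! ### The action of the finite Weyl group -/

theorem actWt_apply (w : FinW n) (μ : Wt n) (i : Fin n) :
    actWt w μ i = (w.2 i : ℤ) * μ (w.1.symm i) := rfl

theorem actWt_add (w : FinW n) (μ ν : Wt n) : actWt w (μ + ν) = actWt w μ + actWt w ν := by
  funext i; simp [actWt_apply, mul_add]

theorem actWt_neg (w : FinW n) (μ : Wt n) : actWt w (-μ) = -actWt w μ := by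
  funext i; simp [actWt_apply]

theorem actWt_sub (w : FinW n) (μ ν : Wt n) : actWt w (μ - ν) = actWt w μ - actWt w ν := by
  funext i; simp [actWt_apply, mul_sub]

theorem actWt_two_smul (w : FinW n) (μ : Wt n) : actWt w (2 • μ) = 2 • actWt w μ := by
  rw [two_smul, two_smul, actWt_add]

theorem actWt_eps (w : FinW n) (i : Fin n) : actWt w (eps i) = (w.2 (w.1 i) : ℤ) • eps (w.1 i) := by
  funext k
  simp only [actWt_apply, eps_apply, Pi.smul_apply, smul_eq_mul, Equiv.symm_apply_eq]
  split_ifs with h <;> simp [h]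

theorem actWt_dot (w : FinW n) (μ ν : Wt n) : actWt w μ ⬝ᵥ actWt w ν = μ ⬝ᵥ ν := by
  simp only [dotProduct, actWt_apply]
  rw [← Equiv.sum_comp w.1]
  refine Finset.sum_congr rfl fun i _ => ?_
  rw [Equiv.symm_apply_apply]
  rcases Int.units_eq_one_or (w.2 (w.1 i)) with h | h <;> simp [h]

theorem one_symm_apply {n : ℕ} (i : Fin n) : (Equiv.symm (1 : Equiv.Perm (Fin n))) i = i := rfl

theorem IsMed.actWt {α : Wt n} (h : IsMed α) (w : FinW n) : IsMed (actWt w α) := by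
  obtain ⟨i, j, hij, h⟩ := isMed_iff.1 h
  have hne : w.1 i ≠ w.1 j := fun h => hij (w.1.injective h)
  have e1 : Koornwinder.actWt w (-(eps i + eps j)) = -Koornwinder.actWt w (eps i + eps j) :=
    actWt_neg _ _
  rcases h with rfl | rfl | rfl <;> simp only [e1, actWt_add, actWt_sub, actWt_eps] <;>
  rcases Int.units_eq_one_or (w.2 (w.1 i)) with h1 | h1 <;>
  rcases Int.units_eq_one_or (w.2 (w.1 j)) with h2 | h2 <;>
  simp only [h1, h2, Units.val_one, Units.val_neg, neg_smul, one_smul, sub_neg_eq_add] <;>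
  refine isMed_iff.2 ?_ <;>
  first
  | (refine ⟨w.1 i, w.1 j, hne, Or.inl ?_⟩; abel; done)
  | (refine ⟨w.1 i, w.1 j, hne, Or.inr (Or.inl ?_)⟩; abel; done)
  | (refine ⟨w.1 i, w.1 j, hne, Or.inr (Or.inr ?_)⟩; abel; done)
  | (refine ⟨w.1 j, w.1 i, hne.symm, Or.inl ?_⟩; abel)

theorem IsShort.actWt {α : Wt n} (h : IsShort α) (w : FinW n) : IsShort (actWt w α) := by
  obtain ⟨i, rfl | rfl⟩ := isShort_iff.1 h <;> simp only [actWt_neg, actWt_eps] <;>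
  rcases Int.units_eq_one_or (w.2 (w.1 i)) with h1 | h1 <;>
  simp only [h1, Units.val_one, Units.val_neg, neg_smul, one_smul, neg_neg] <;>
  first
  | exact isShort_iff.2 ⟨_, Or.inl rfl⟩
  | exact isShort_iff.2 ⟨_, Or.inr rfl⟩

theorem IsLong.actWt {α : Wt n} (h : IsLong α) (w : FinW n) : IsLong (actWt w α) := by
  obtain ⟨η, hη, rfl⟩ := h.exists_short
  rw [actWt_two_smul]
  exact hη.actWt w

theorem IsRoot.actWt {α : Wt n} (h : IsRoot α) (w : FinW n) : IsRoot (actWt w α) :=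
  h.imp (fun h => h.actWt w) (fun h => h.actWt w)

theorem coroot_actWt {α : Wt n} (h : IsRoot α) (w : FinW n) :
    coroot (actWt w α) = actWt w (coroot α) := by
  rcases h with h | h
  · rw [coroot_med (h.actWt w), coroot_med h]
  · obtain ⟨η, hη, rfl⟩ := h.exists_short
    rw [actWt_two_smul, coroot_long (hη.actWt w), coroot_long hη]

theorem coroot_neg {α : Wt n} (h : IsRoot α) : coroot (-α) = -coroot α := by
  rcases h with h | h
  · rw [coroot_med h.neg, coroot_med h]
  · obtain ⟨η, hη, rfl⟩ := h.exists_short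
    rw [← smul_neg, coroot_long hη.neg, coroot_long hη]

/-- The reflection in a root is a signed permutation; it can be written with the root and the
co-root in either order. -/
theorem exists_actWt_eq_refl {α : Wt n} (h : IsRoot α) : ∃ w : FinW n,
    (∀ μ, μ - (μ ⬝ᵥ coroot α) • α = actWt w μ) ∧ (∀ μ, μ - (μ ⬝ᵥ α) • coroot α = actWt w μ) := by
  rcases h with h | h
  · rw [coroot_med h]
    suffices hs : ∃ w : FinW n, ∀ μ, μ - (μ ⬝ᵥ α) • α = actWt w μ from
      hs.imp fun w hw => ⟨hw, hw⟩
    have hadd : ∀ i j : Fin n, i ≠ j → ∃ w : FinW n, ∀ μ,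
        μ - (μ ⬝ᵥ (eps i + eps j)) • (eps i + eps j) = actWt w μ := by
      intro i j hij
      refine ⟨(Equiv.swap i j, fun k => if k = i ∨ k = j then -1 else 1), fun μ => ?_⟩
      funext k
      simp only [dotProduct_add, dot_eps, actWt_apply, Pi.sub_apply, Pi.smul_apply, Pi.add_apply,
        eps_apply, Equiv.symm_swap, smul_eq_mul]
      by_cases h1 : k = i
      · subst h1; simp [hij]
      by_cases h2 : k = j
      · subst h2; simp [h1]
      simp [h1, h2, Equiv.swap_apply_of_ne_of_ne h1 h2]
    obtain ⟨i, j, hij, rfl | rfl | rfl⟩ := isMed_iff.1 h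
    · refine ⟨(Equiv.swap i j, fun _ => 1), fun μ => ?_⟩
      funext k
      simp only [dotProduct_sub, dot_eps, actWt_apply, Pi.sub_apply, Pi.smul_apply,
        eps_apply, Equiv.symm_swap, smul_eq_mul]
      by_cases h1 : k = i
      · subst h1; simp [hij]
      by_cases h2 : k = j
      · subst h2; simp [h1]
      simp [h1, h2, Equiv.swap_apply_of_ne_of_ne h1 h2]
    · exact hadd i j hij
    · simpa only [dotProduct_neg, smul_neg, neg_smul, neg_neg] using hadd i j hij
  · have hl : ∀ i : Fin n, ∀ μ : Wt n, μ - (2 * μ i) • eps i =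
        actWt (1, fun k => if k = i then -1 else 1) μ := by
      intro i μ
      funext k
      simp only [actWt_apply, Pi.sub_apply, Pi.smul_apply, eps_apply, smul_eq_mul]
      by_cases h1 : k = i
      · subst h1; simp [one_symm_apply]; ring
      · simp [h1, one_symm_apply]
    obtain ⟨i, rfl | rfl⟩ := isLong_iff.1 h
    · refine ⟨(1, fun k => if k = i then -1 else 1), fun μ => ?_, fun μ => ?_⟩
      · rw [coroot_long (isShort_eps i), ← hl i μ, dot_eps, two_smul ℕ, smul_add]; module
      · rw [coroot_long (isShort_eps i), ← hl i μ, dotProduct_smul, dot_eps, two_smul, two_mul]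
    · refine ⟨(1, fun k => if k = i then -1 else 1), fun μ => ?_, fun μ => ?_⟩
      · rw [← smul_neg, coroot_long (isShort_eps i).neg, ← hl i μ, dotProduct_neg, dot_eps,
          two_smul ℕ, smul_add]; module
      · rw [← smul_neg, coroot_long (isShort_eps i).neg, ← hl i μ, dotProduct_smul,
          dotProduct_neg, dot_eps, two_smul]; module

theorem dot_coroot_self {α : Wt n} (h : IsRoot α) : α ⬝ᵥ coroot α = 2 := by
  rcases h with h | h
  · rw [coroot_med h, h.dot_self]
  · obtain ⟨η, hη, rfl⟩ := h.exists_short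
    rw [coroot_long hη, smul_dotProduct, hη.dot_self]; rfl

theorem dot_self_mul_coroot {α : Wt n} (h : IsRoot α) (μ : Wt n) :
    (α ⬝ᵥ α) * (μ ⬝ᵥ coroot α) = 2 * (μ ⬝ᵥ α) := by
  rcases h with h | h
  · rw [coroot_med h, h.dot_self]
  · rw [h.dot_self]
    obtain ⟨η, hη, rfl⟩ := h.exists_short
    rw [coroot_long hη, dotProduct_smul]; simp; ring

theorem dot_self_pos {α : Wt n} (h : IsRoot α) : 0 < α ⬝ᵥ α := by
  rcases h with h | h <;> rw [h.dot_self] <;> norm_num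

/-! ### Reflections of affine roots -/

theorem refl_apply (β g : Aff n) : refl β g =
    (g.1 - (g.1 ⬝ᵥ coroot β.1) • β.1, g.2 - (g.1 ⬝ᵥ coroot β.1) * β.2) := rfl

theorem ht_refl (β g : Aff n) : ht (refl β g) = ht g - (g.1 ⬝ᵥ coroot β.1) * ht β := by
  simp only [refl_apply, ht, sub_dotProduct, smul_dotProduct, smul_eq_mul]; ring

theorem refl_mem_affR {β g : Aff n} (hβ : β ∈ affR n) (hg : g ∈ affR n) : refl β g ∈ affR n := by
  obtain ⟨α, c, hα, rfl⟩ := mem_affR_iff.1 hβ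
  obtain ⟨γ, d, hγ, rfl⟩ := mem_affR_iff.1 hg
  obtain ⟨w, hw, -⟩ := exists_actWt_eq_refl hα
  exact mem_affR_iff.2 ⟨actWt w γ, d - (γ ⬝ᵥ coroot α) * c, hγ.actWt w,
    Prod.ext (hw γ) (by simp only [refl_apply]; ring)⟩

theorem refl_refl {β : Aff n} (hβ : IsRoot β.1) (g : Aff n) : refl β (refl β g) = g := by
  have h := dot_coroot_self hβ
  ext k
  · simp only [refl_apply, sub_dotProduct, smul_dotProduct, h, Pi.sub_apply, Pi.smul_apply,
      smul_eq_mul]; ring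
  · simp only [refl_apply, sub_dotProduct, smul_dotProduct, h, smul_eq_mul]; ring

theorem refl_self {β : Aff n} (hβ : IsRoot β.1) : refl β β = -β := by
  have h := dot_coroot_self hβ
  ext k
  · simp only [refl_apply, h, Pi.sub_apply, Pi.smul_apply, smul_eq_mul, Prod.fst_neg,
      Pi.neg_apply]; ring
  · simp only [refl_apply, h, Prod.snd_neg]; ring

end Roots

section Simple

variable {m : ℕ}

/-- Case distinction on the simple affine roots. -/
theorem simpleRoot_cases {p : ℕ → Prop} (h0 : p 0)
    (hmid : ∀ j, j + 1 < m + 1 → p (j + 1)) (hlast : p (m + 1)) {j : ℕ} (hj : j ≤ m + 1) :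
    p j := by
  rcases Nat.eq_zero_or_pos j with rfl | hj0
  · exact h0
  rcases hj.lt_or_eq with h | rfl
  · obtain ⟨i, rfl⟩ : ∃ i, j = i + 1 := ⟨j - 1, by omega⟩
    exact hmid i h
  · exact hlast

theorem ht_simpleRoot_pos {j : ℕ} (hj : j ≤ m + 1) : 0 < ht (simpleRoot (m + 1) j) := by
  refine simpleRoot_cases (p := fun j => 0 < ht (simpleRoot (m + 1) j)) ?_ ?_ ?_ hj
  · rw [simpleRoot_zero (by omega)]
    simp [ht, htVec, eps_dot, two_smul]; omega
  · intro j hj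
    rw [simpleRoot_mid j hj]
    simp [ht, htVec, eps_dot, sub_dotProduct]
  · rw [simpleRoot_last]
    simp [ht, htVec, eps_dot, two_smul]

theorem isRoot_simpleRoot {j : ℕ} (hj : j ≤ m + 1) : IsRoot (simpleRoot (m + 1) j).1 := by
  refine simpleRoot_cases (p := fun j => IsRoot (simpleRoot (m + 1) j).1) ?_ ?_ ?_ hj
  · rw [simpleRoot_zero (by omega)]; exact Or.inr (isShort_eps _).neg
  · intro j hj
    rw [simpleRoot_mid j hj]; exact Or.inl (isMed_sub (by simp))
  · rw [simpleRoot_last]; exact Or.inr (isShort_eps _)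

theorem even_simpleRoot {j : ℕ} (hj : j ≤ m + 1) : Even (simpleRoot (m + 1) j).2 := by
  refine simpleRoot_cases (p := fun j => Even (simpleRoot (m + 1) j).2) ?_ ?_ ?_ hj
  · rw [simpleRoot_zero (by omega)]; exact even_two_mul _
  · intro j hj
    rw [simpleRoot_mid j hj]; exact even_two_mul _
  · rw [simpleRoot_last]; exact even_two_mul _

theorem simpleRoot_mem {j : ℕ} (hj : j ≤ m + 1) : simpleRoot (m + 1) j ∈ affRPos (m + 1) :=
  mem_affRPos_iff.2 ⟨⟨isRoot_simpleRoot hj, even_simpleRoot hj⟩, ht_simpleRoot_pos hj⟩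

/-- A simple reflection permutes the positive affine roots other than the simple root. -/
theorem refl_simpleRoot_mem {j : ℕ} (hj : j ≤ m + 1) {β : Aff (m + 1)} (hβ : β ∈ affRPos (m + 1))
    (hne : β ≠ simpleRoot (m + 1) j) : refl (simpleRoot (m + 1) j) β ∈ affRPos (m + 1) := by
  have hmem := refl_mem_affR (simpleRoot_mem hj).1 hβ.1
  rcases Nat.eq_zero_or_pos j with rfl | hj0
  · refine mem_affRPos_iff.2 ⟨hmem, ?_⟩
    have hpos := (mem_affRPos_iff.1 hβ).2
    obtain ⟨α, c, hα, rfl⟩ := mem_affR_iff.1 hβ.1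
    rw [ht_refl]
    rw [simpleRoot_zero (by omega)] at hne ⊢
    have e1 : ht ((2 • -eps ⟨0, by omega⟩, 2 * 1) : Aff (m + 1)) = 2 := by
      simp [ht, htVec, eps_dot, two_smul]; ring
    have h0 : (⟨0, by omega⟩ : Fin (m + 1)) = 0 := rfl
    rw [e1, coroot_long (isShort_eps _).neg, dotProduct_neg, dot_eps, h0]
    rw [h0] at hne
    rcases hβ.2 with ⟨hβ1, hβ2⟩ | hc
    · have : 0 ≤ α 0 := by
        rcases mem_posRoots.1 hβ1 with h | h
        · obtain ⟨i, j, hij, rfl | rfl⟩ := mem_posMed.1 h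
          · have : (0 : Fin (m + 1)) ≠ j := (lt_of_le_of_lt (Fin.zero_le i) hij).ne
            simp only [Pi.sub_apply, eps_apply, this, if_false]; split_ifs <;> simp
          · simp only [Pi.add_apply, eps_apply]; split_ifs <;> simp
        · obtain ⟨i, rfl⟩ := mem_posLong.1 h
          simp only [two_smul, Pi.add_apply, eps_apply]; split_ifs <;> simp
      change 0 < _ - -(α 0) * 2
      omega
    · replace hc : 1 ≤ c := by
        change 0 < 2 * c at hc; omega
      have hc' : ((m : ℤ) + 1 + 1) * 2 ≤ ((m : ℤ) + 1 + 1) * (2 * c) :=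
        mul_le_mul_of_nonneg_left (by omega) (by omega)
      simp only [ht] at hpos ⊢
      push_cast at hpos ⊢
      rcases hα with hα | hα
      · obtain ⟨i, j, hij, rfl | rfl | rfl⟩ := isMed_iff.1 hα <;>
        · simp only [sub_dotProduct, neg_dotProduct, add_dotProduct, eps_dot, htVec, Pi.sub_apply,
            Pi.add_apply, Pi.neg_apply, eps_apply]
          have hij' : i.val ≠ j.val := fun h => hij (Fin.ext h)
          have hi := i.isLt
          have hj := j.isLt
          push_cast
          split_ifs with h1 h2 h2 <;> simp only [Fin.ext_iff, Fin.val_zero] at * <;> omega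
      · obtain ⟨i, rfl | rfl⟩ := isLong_iff.1 hα
        · simp only [two_smul, add_dotProduct, eps_dot, htVec, Pi.add_apply, eps_apply]
          push_cast
          have hi := i.isLt
          split_ifs with h1 <;> omega
        · have hi := i.isLt
          have h5 : i = 0 → 2 ≤ c := by
            rintro rfl
            by_contra h
            obtain rfl : c = 1 := by omega
            exact hne (by rw [smul_neg])
          have h6 : 2 ≤ c → ((m : ℤ) + 1 + 1) * 4 ≤ ((m : ℤ) + 1 + 1) * (2 * c) := fun h =>
            mul_le_mul_of_nonneg_left (by omega) (by omega)
          simp only [two_smul, neg_dotProduct, add_dotProduct, eps_dot, htVec, Pi.add_apply,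
            Pi.neg_apply, eps_apply]
          push_cast
          split_ifs with h1
          · have := h6 (h5 h1.symm); omega
          · omega
  · have hlev : (simpleRoot (m + 1) j).2 = 0 := by
      rcases hj.lt_or_eq with h | rfl
      · obtain ⟨i, rfl⟩ : ∃ i, j = i + 1 := ⟨j - 1, by omega⟩
        rw [simpleRoot_mid i h]; rfl
      · rw [simpleRoot_last]; rfl
    refine ⟨hmem, ?_⟩
    rcases hβ.2 with ⟨hβ1, hβ2⟩ | hc
    · refine Or.inl ⟨mem_posRoots_iff.2 ⟨hmem.1, ?_⟩, by rw [refl_apply, hlev, hβ2]; simp⟩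
      obtain ⟨α, c, hα, rfl⟩ := mem_affR_iff.1 hβ.1
      change 2 * c = 0 at hβ2
      obtain rfl : c = 0 := by omega
      change α ∈ posRoots _ at hβ1
      simp only [refl_apply, sub_dotProduct, smul_dotProduct, smul_eq_mul]
      rcases hj.lt_or_eq with h | rfl
      · obtain ⟨k, rfl⟩ : ∃ i, j = i + 1 := ⟨j - 1, by omega⟩
        rw [simpleRoot_mid k h] at hne ⊢
        rw [coroot_med (isMed_sub (by simp))]
        rcases mem_posRoots.1 hβ1 with h | h
        · obtain ⟨i, j, hij, rfl | rfl⟩ := mem_posMed.1 h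
          · have hne' : ¬ (i.val = k ∧ j.val = k + 1) := by
              rintro ⟨rfl, hj⟩
              exact hne (by congr; exact Fin.ext hj)
            have hij' : i.val < j.val := hij
            simp only [sub_dotProduct, dotProduct_sub, eps_dot, htVec, eps_apply, Fin.ext_iff]
            split_ifs <;> omega
          · have hij' : i.val < j.val := hij
            simp only [add_dotProduct, sub_dotProduct, dotProduct_sub, eps_dot, htVec, eps_apply,
              Fin.ext_iff]
            split_ifs <;> omega
        · obtain ⟨i, rfl⟩ := mem_posLong.1 h
          simp only [two_smul, add_dotProduct, sub_dotProduct, dotProduct_sub, eps_dot, htVec,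
            eps_apply, Fin.ext_iff]
          split_ifs <;> omega
      · rw [simpleRoot_last] at hne ⊢
        rw [coroot_long (isShort_eps _)]
        rcases mem_posRoots.1 hβ1 with h | h
        · obtain ⟨i, j, hij, rfl | rfl⟩ := mem_posMed.1 h <;>
          · have hij' : i.val < j.val := hij
            simp only [two_smul, add_dotProduct, sub_dotProduct, eps_dot, htVec,
              eps_apply, Fin.ext_iff, Fin.val_last]
            push_cast
            split_ifs <;> omega
        · obtain ⟨i, rfl⟩ := mem_posLong.1 h
          have hne' : i.val ≠ m := by
            intro h
            exact hne (by rw [show i = Fin.last m from Fin.ext h])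
          simp only [two_smul, add_dotProduct, eps_dot, htVec, eps_apply, Fin.ext_iff, Fin.val_last]
          push_cast
          split_ifs <;> omega
    · exact Or.inr (by rw [refl_apply, hlev]; simpa using hc)

end Simple

/-! ### The Bruhat order on the weight lattice -/

section Bruhat

variable {n : ℕ}

/-- The value of the affine function `β` at `-λ`. -/
def valAt (lam : Wt n) (β : Aff n) : ℤ := β.2 / 2 - lam ⬝ᵥ β.1

/-- The reflection of `λ` in the hyperplane of the points `λ` with `β(-λ) = 0`. For `a_1, …, a_n`
this is the usual action; `a_0` maps `λ` to `(-1 - λ_1, λ_2, …, λ_n)`. -/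
def reflAt (β : Aff n) (lam : Wt n) : Wt n := lam + valAt lam β • coroot β.1

theorem valAt_mk (lam α : Wt n) (c : ℤ) : valAt lam (α, 2 * c) = c - lam ⬝ᵥ α := by
  simp [valAt]

/-- The covering-type relation generating the Bruhat order: `λ'` is the reflection of `λ` in a
positive affine root that is positive at `-λ`. -/
def Up (lam lam' : Wt n) : Prop :=
  ∃ β ∈ affRPos n, 0 < valAt lam β ∧ lam' = reflAt β lam

/-- The Bruhat order on `Λ`, identified with the minimal coset representatives modulo `W`. -/
def BLE : Wt n → Wt n → Prop := Relation.ReflTransGen Up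

/-- The squared distance of `λ` to a point in the interior of the fundamental alcove, after
rescaling. Steps of the Bruhat order increase it. -/
def meas (lam : Wt n) : ℤ :=
  ((2 * (n : ℤ) + 2) • lam + htVec n) ⬝ᵥ ((2 * (n : ℤ) + 2) • lam + htVec n)

theorem meas_nonneg (lam : Wt n) : 0 ≤ meas lam := by
  rw [meas, dotProduct]
  exact Finset.sum_nonneg fun i _ => mul_self_nonneg _

theorem valAt_reflAt {β : Aff n} (hβ : β ∈ affR n) (lam : Wt n) :
    valAt (reflAt β lam) β = -valAt lam β := by
  obtain ⟨α, c, hα, rfl⟩ := mem_affR_iff.1 hβ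
  simp only [reflAt, valAt_mk, add_dotProduct, smul_dotProduct, dotProduct_comm (coroot α) α,
    dot_coroot_self hα, smul_eq_mul]
  ring

theorem reflAt_reflAt {β : Aff n} (hβ : β ∈ affR n) (lam : Wt n) :
    reflAt β (reflAt β lam) = lam := by
  rw [reflAt, valAt_reflAt hβ, reflAt]; module

theorem coroot_refl {α γ : Wt n} (hα : IsRoot α) (hγ : IsRoot γ) :
    coroot (γ - (γ ⬝ᵥ coroot α) • α) = coroot γ - (coroot γ ⬝ᵥ α) • coroot α := by
  obtain ⟨w, h1, h2⟩ := exists_actWt_eq_refl hα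
  rw [h1, h2, coroot_actWt hγ]

theorem valAt_refl {β γ : Aff n} (hβ : β ∈ affR n) (hγ : γ ∈ affR n) (lam : Wt n) :
    valAt (reflAt β lam) (refl β γ) = valAt lam γ := by
  obtain ⟨α, c, hα, rfl⟩ := mem_affR_iff.1 hβ
  obtain ⟨δ, d, hδ, rfl⟩ := mem_affR_iff.1 hγ
  have e : refl (α, 2 * c) ((δ, 2 * d) : Aff n) =
      (δ - (δ ⬝ᵥ coroot α) • α, 2 * (d - (δ ⬝ᵥ coroot α) * c)) :=
    Prod.ext rfl (by simp only [refl_apply]; ring)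
  rw [e, valAt_mk, valAt_mk, reflAt, valAt_mk]
  simp only [add_dotProduct, smul_dotProduct, dotProduct_sub, dotProduct_smul,
    dotProduct_comm (coroot α), dot_coroot_self hα, smul_eq_mul]
  ring

theorem reflAt_refl {β γ : Aff n} (hβ : β ∈ affR n) (hγ : γ ∈ affR n) (lam : Wt n) :
    reflAt (refl β γ) (reflAt β lam) = reflAt β (reflAt γ lam) := by
  rw [reflAt, valAt_refl hβ hγ]
  obtain ⟨α, c, hα, rfl⟩ := mem_affR_iff.1 hβ
  obtain ⟨δ, d, hδ, rfl⟩ := mem_affR_iff.1 hγ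
  have e : coroot (refl (α, 2 * c) ((δ, 2 * d) : Aff n)).1 =
      coroot δ - (coroot δ ⬝ᵥ α) • coroot α := coroot_refl hα hδ
  rw [e]
  simp only [reflAt, valAt_mk, add_dotProduct, smul_dotProduct, smul_eq_mul]
  module

/-- Reflections in positive affine roots move weights away from the fundamental alcove. -/
theorem Up.meas_lt {lam lam' : Wt n} (h : Up lam lam') : meas lam < meas lam' := by
  obtain ⟨β, hβ, hv, rfl⟩ := h
  have hht := (mem_affRPos_iff.1 hβ).2
  obtain ⟨α, c, hα, rfl⟩ := mem_affR_iff.1 hβ.1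
  set N := α ⬝ᵥ α with hN
  have hN0 : 0 < N := dot_self_pos hα
  set u := (2 * (n : ℤ) + 2) • lam + htVec n with hu
  have e : (2 * (n : ℤ) + 2) • reflAt (α, 2 * c) lam + htVec n =
      u + ((2 * (n : ℤ) + 2) * valAt lam (α, 2 * c)) • coroot α := by
    rw [hu, reflAt]; module
  have h1 := dot_self_mul_coroot hα u
  have h2 := dot_self_mul_coroot hα (coroot α)
  rw [dotProduct_comm (coroot α) α, dot_coroot_self hα] at h2
  have h3 : u ⬝ᵥ α = (2 * (n : ℤ) + 2) * (lam ⬝ᵥ α) + α ⬝ᵥ htVec n := by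
    rw [hu, add_dotProduct, smul_dotProduct, dotProduct_comm (htVec n), smul_eq_mul]
  rw [meas, meas, e, ← hu]
  set v := valAt lam (α, 2 * c) with hvdef
  have hv' : v = c - lam ⬝ᵥ α := valAt_mk _ _ _
  simp only [ht] at hht
  simp only [add_dotProduct, dotProduct_add, smul_dotProduct, dotProduct_smul, smul_eq_mul,
    dotProduct_comm (coroot α) u]
  rw [← hN] at h1 h2
  have key : N * ((u ⬝ᵥ u + (2 * (n : ℤ) + 2) * v * (u ⬝ᵥ coroot α) +
      ((2 * (n : ℤ) + 2) * v * (u ⬝ᵥ coroot α + (2 * (n : ℤ) + 2) * v *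
        (coroot α ⬝ᵥ coroot α)))) - u ⬝ᵥ u) =
      4 * (2 * (n : ℤ) + 2) * v * (α ⬝ᵥ htVec n + ((n : ℤ) + 1) * (2 * c)) := by
    rw [hv'] at *
    linear_combination (2 * (2 * (n : ℤ) + 2) * (c - lam ⬝ᵥ α)) * h1 +
      (2 * (n : ℤ) + 2) ^ 2 * (c - lam ⬝ᵥ α) ^ 2 * h2 +
      (4 * (2 * (n : ℤ) + 2) * (c - lam ⬝ᵥ α)) * h3
  have hpos : 0 < 4 * (2 * (n : ℤ) + 2) * v * (α ⬝ᵥ htVec n + ((n : ℤ) + 1) * (2 * c)) := by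
    positivity
  rw [← key] at hpos
  have := pos_of_mul_pos_right hpos hN0.le
  linarith

theorem BLE.refl (lam : Wt n) : BLE lam lam := Relation.ReflTransGen.refl

theorem Up.ble {lam mu : Wt n} (h : Up lam mu) : BLE lam mu := Relation.ReflTransGen.single h

theorem BLE.trans {lam mu nu : Wt n} (h : BLE lam mu) (h' : BLE mu nu) : BLE lam nu :=
  Relation.ReflTransGen.trans h h'

theorem BLE.eq_or_meas_lt {lam mu : Wt n} (h : BLE lam mu) : lam = mu ∨ meas lam < meas mu := by
  induction h with
  | refl => exact Or.inl rfl
  | tail _ h ih =>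
    rcases ih with rfl | ih
    · exact Or.inr h.meas_lt
    · exact Or.inr (ih.trans h.meas_lt)

theorem up_reflAt {lam : Wt n} {β : Aff n} (hβ : β ∈ affRPos n) (h : 0 < valAt lam β) :
    Up lam (reflAt β lam) := ⟨β, hβ, h, rfl⟩

/-- A simple reflection preserves the relation `Up`, except where it is itself the reflection used.
-/
theorem Up.lift {m : ℕ} {j : ℕ} (hj : j ≤ m + 1) {mu mu' : Wt (m + 1)} (h : Up mu mu') :
    reflAt (simpleRoot (m + 1) j) mu = mu' ∨
      Up (reflAt (simpleRoot (m + 1) j) mu) (reflAt (simpleRoot (m + 1) j) mu') := by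
  obtain ⟨β, hβ, hv, rfl⟩ := h
  by_cases hb : β = simpleRoot (m + 1) j
  · left; rw [hb]
  · right
    have ha := (simpleRoot_mem hj).1
    exact ⟨_, refl_simpleRoot_mem hj hβ hb, by rwa [valAt_refl ha hβ.1],
      (reflAt_refl ha hβ.1 _).symm⟩

/-- The lifting property of the Bruhat order. -/
theorem BLE.lift {m : ℕ} {j : ℕ} (hj : j ≤ m + 1) {mu lam : Wt (m + 1)} (h : BLE mu lam)
    (hl : 0 < valAt lam (simpleRoot (m + 1) j)) :
    BLE mu (reflAt (simpleRoot (m + 1) j) lam) ∧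
      BLE (reflAt (simpleRoot (m + 1) j) mu) (reflAt (simpleRoot (m + 1) j) lam) := by
  induction h using Relation.ReflTransGen.head_induction_on with
  | refl => exact ⟨(up_reflAt (simpleRoot_mem hj) hl).ble, BLE.refl _⟩
  | head h _ ih =>
    refine ⟨h.ble.trans ih.1, ?_⟩
    rcases h.lift hj with h | h
    · rw [h]; exact ih.1
    · exact h.ble.trans ih.2

/-- The weights on the segment from `μ` to its reflection in the positive affine root `α + cδ` are
below that reflection, if the root is not negative at `-μ`: the two are interchanged by a reflection
in a parallel root. -/
theorem ble_reflAt_of_mem_string {α : Wt n} {c : ℤ} (ha : (α, 2 * c) ∈ affRPos n) (mu : Wt n)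
    {i : ℤ} (hi : 0 ≤ i) (hi' : i ≤ valAt mu (α, 2 * c)) :
    BLE (mu + i • coroot α) (reflAt (α, 2 * c) mu) := by
  rcases hi'.eq_or_lt with rfl | hlt
  · exact BLE.refl _
  have hα : IsRoot α := ha.1.1
  have hpos : (α, 2 * (c + i)) ∈ affRPos n := by
    rw [mem_affRPos_iff] at ha ⊢
    refine ⟨mem_affR_iff.2 ⟨_, _, hα, rfl⟩, ?_⟩
    have := mul_nonneg (by omega : (0 : ℤ) ≤ n + 1) hi
    simp only [ht] at ha ⊢
    linarith [ha.2]
  rw [valAt_mk] at hlt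
  have hv : valAt (mu + i • coroot α) (α, 2 * (c + i)) = c - mu ⬝ᵥ α - i := by
    rw [valAt_mk, add_dotProduct, smul_dotProduct, dotProduct_comm (coroot α), dot_coroot_self hα,
      smul_eq_mul]
    ring
  have h := up_reflAt hpos (lam := mu + i • coroot α) (by rw [hv]; omega)
  rw [reflAt, hv] at h
  rw [reflAt, valAt_mk]
  convert h.ble using 1
  module

/-- The counterpart of `ble_reflAt_of_mem_string` for roots that are non-positive at `-μ`. -/
theorem ble_of_mem_string {α : Wt n} {c : ℤ} (ha : (α, 2 * c) ∈ affRPos n) (mu : Wt n)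
    {i : ℤ} (hi : i ≤ 0) (hi' : valAt mu (α, 2 * c) ≤ i) :
    BLE (mu + i • coroot α) mu := by
  have h := ble_reflAt_of_mem_string ha (reflAt (α, 2 * c) mu) (i := i - valAt mu (α, 2 * c))
    (by omega) (by rw [valAt_reflAt ha.1]; omega)
  rw [reflAt_reflAt ha.1] at h
  rwa [show reflAt (α, 2 * c) mu + (i - valAt mu (α, 2 * c)) • coroot α = mu + i • coroot α by
    rw [reflAt]; module] at h

end Bruhat

/-! ### Comparison with the dominance order -/

section Dominance

variable {n : ℕ}

theorem domWt_actWt (w : FinW n) (lam : Wt n) : domWt (actWt w lam) = domWt lam := by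
  have habs : ∀ i, |actWt w lam i| = |lam (w.1.symm i)| := fun i => by
    rw [actWt_apply, abs_mul]
    rcases Int.units_eq_one_or (w.2 i) with h | h <;> simp [h]
  have h := Tuple.comp_perm_comp_sort_eq_comp_sort (f := fun j => -|lam j|) (σ := w.1.symm)
  funext i
  have h2 := congrFun h i
  simp only [Function.comp_apply, neg_inj] at h2
  simp only [domWt, habs]
  exact h2

theorem sum_domWt_sq (lam : Wt n) : domWt lam ⬝ᵥ domWt lam = lam ⬝ᵥ lam := by
  obtain ⟨w, hw⟩ := exists_actWt_domWt lam
  conv_rhs => rw [← hw, actWt_dot]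

/-- The sum of the first `k` coordinates of `λ^+`. -/
def psum (k : ℕ) (lam : Wt n) : ℤ := ∑ i with i.val < k, domWt lam i

/-- The vectors that define the functionals whose maximum is `psum k`. -/
def IsTest (k : ℕ) (v : Wt n) : Prop := (∀ i, |v i| ≤ 1) ∧ ∑ i, |v i| ≤ k

theorem IsTest.actWt {k : ℕ} {v : Wt n} (h : IsTest k v) (w : FinW n) : IsTest k (actWt w v) := by
  have habs : ∀ i, |Koornwinder.actWt w v i| = |v (w.1.symm i)| := fun i => by
    rw [actWt_apply, abs_mul]
    rcases Int.units_eq_one_or (w.2 i) with h | h <;> simp [h]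
  refine ⟨fun i => by rw [habs]; exact h.1 _, ?_⟩
  simp only [habs]
  rw [Equiv.sum_comp w.1.symm (fun i => |v i|)]
  exact h.2

/-- The inverse of an element of `W`. -/
def invW (w : FinW n) : FinW n := (w.1.symm, fun i => w.2 (w.1 i))

theorem actWt_invW (w : FinW n) (μ : Wt n) : actWt w (actWt (invW w) μ) = μ := by
  funext i
  simp only [actWt_apply, invW, Equiv.symm_symm, Equiv.apply_symm_apply]
  rcases Int.units_eq_one_or (w.2 i) with h | h <;> simp [h]

theorem invW_actWt (w : FinW n) (μ : Wt n) : actWt (invW w) (actWt w μ) = μ := by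
  funext i
  simp only [actWt_apply, invW, Equiv.symm_symm, Equiv.symm_apply_apply]
  rcases Int.units_eq_one_or (w.2 (w.1 i)) with h | h <;> simp [h]

/-- Together with `exists_dot_eq_psum`: `psum k` is a maximum of linear functionals that is
invariant under `W`. -/
theorem dot_le_psum {k : ℕ} (hk : k ≤ n) {v : Wt n} (hv : IsTest k v) (lam : Wt n) :
    v ⬝ᵥ lam ≤ psum k lam := by
  obtain ⟨w, hw⟩ := exists_actWt_domWt lam
  have e : v ⬝ᵥ lam = actWt (invW w) v ⬝ᵥ domWt lam := by
    conv_lhs => rw [← hw, ← actWt_invW w v, actWt_dot]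
  rw [e]
  replace hv := hv.actWt (invW w)
  generalize actWt (invW w) v = v at hv
  obtain ⟨hd1, hd2⟩ := isDominant_domWt lam
  set d := domWt lam
  rcases Nat.eq_zero_or_pos k with rfl | hk0
  · have : ∀ i, v i = 0 := fun i => by
      have h1 := Finset.single_le_sum (f := fun i => |v i|) (fun i _ => abs_nonneg _)
        (Finset.mem_univ i)
      have h2 : |v i| ≤ 0 := h1.trans (by simpa using hv.2)
      exact abs_nonpos_iff.1 h2
    simp [psum, dotProduct, this]
  · set τ := d ⟨k - 1, by omega⟩ with hτ
    have h1 : ∀ i, v i * d i ≤ (if i.val < k then d i - τ else 0) + |v i| * τ := by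
      intro i
      have hτ0 : 0 ≤ τ := hd2 _
      have hvi := abs_le.1 (hv.1 i)
      split_ifs with hi
      · have hdi : τ ≤ d i := hd1 (by rw [Fin.le_def]; simp; omega)
        have hle := le_abs_self (v i)
        nlinarith [mul_nonneg (sub_nonneg.2 hvi.2) (sub_nonneg.2 hdi),
          mul_nonneg (sub_nonneg.2 hle) hτ0]
      · have hdi : d i ≤ τ := hd1 (by rw [Fin.le_def]; simp; omega)
        have hle := le_abs_self (v i)
        nlinarith [mul_le_mul_of_nonneg_right hle (hd2 i),
          mul_le_mul_of_nonneg_left hdi (abs_nonneg (v i))]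
    have hcard : ((Finset.univ.filter fun i : Fin n => i.val < k).card : ℤ) = k := by
      rw [Fin.card_filter_val_lt, min_eq_right hk]
    calc v ⬝ᵥ d ≤ ∑ i, ((if i.val < k then d i - τ else 0) + |v i| * τ) :=
          Finset.sum_le_sum fun i _ => h1 i
      _ = psum k lam - k * τ + (∑ i, |v i|) * τ := by
        rw [Finset.sum_add_distrib, ← Finset.sum_filter, Finset.sum_sub_distrib,
          Finset.sum_const, nsmul_eq_mul, hcard, Finset.sum_mul]
        rfl
      _ ≤ psum k lam := by nlinarith [hv.2, hd2 ⟨k - 1, by omega⟩]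

theorem exists_dot_eq_psum (k : ℕ) (lam : Wt n) : ∃ v : Wt n, IsTest k v ∧
    v ⬝ᵥ lam = psum k lam := by
  obtain ⟨w, hw⟩ := exists_actWt_domWt lam
  have h0 : IsTest k (fun i : Fin n => if i.val < k then 1 else 0) := by
    refine ⟨fun i => by dsimp only; split_ifs <;> simp, ?_⟩
    have : ∀ i : Fin n, |(if i.val < k then (1 : ℤ) else 0)| = if i.val < k then 1 else 0 :=
      fun i => by split_ifs <;> simp
    simp only [this]
    rw [Finset.sum_boole, Fin.card_filter_val_lt]
    exact_mod_cast min_le_right _ _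
  refine ⟨_, h0.actWt w, ?_⟩
  conv_lhs => rw [← hw, actWt_dot]
  simp [psum, dotProduct, Finset.sum_filter]

/-- `psum k` is convex along root strings. -/
theorem psum_le_of_string {k : ℕ} (hk : k ≤ n) {α : Wt n} (hα : IsRoot α) (mu : Wt n) {i : ℤ}
    (hi : (0 ≤ i ∧ i ≤ mu ⬝ᵥ α) ∨ (i ≤ 0 ∧ mu ⬝ᵥ α ≤ i)) :
    psum k (mu - i • coroot α) ≤ psum k mu := by
  obtain ⟨v, hv, he⟩ := exists_dot_eq_psum k (mu - i • coroot α)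
  obtain ⟨w, -, hw⟩ := exists_actWt_eq_refl hα
  have h1 := dot_le_psum hk hv mu
  have h2 := dot_le_psum hk hv (actWt w mu)
  have h3 : psum k (actWt w mu) = psum k mu := by simp only [psum, domWt_actWt]
  rw [h3, ← hw, dotProduct_sub, dotProduct_smul, smul_eq_mul] at h2
  rw [← he, dotProduct_sub, dotProduct_smul, smul_eq_mul]
  rcases le_total 0 (v ⬝ᵥ coroot α) with h | h
  · rcases hi with ⟨h4, h5⟩ | ⟨h4, h5⟩
    · nlinarith
    · nlinarith
  · rcases hi with ⟨h4, h5⟩ | ⟨h4, h5⟩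
    · nlinarith
    · nlinarith

theorem coroot_simpleRoot_apply {n : ℕ} (i p : Fin n) :
    coroot (simpleRoot n (i.val + 1)).1 p =
      (if p = i then 1 else 0) - (if p.val = i.val + 1 then 1 else 0) := by
  obtain ⟨m, rfl⟩ : ∃ m, n = m + 1 := ⟨n - 1, by have := i.isLt; omega⟩
  rcases (Nat.succ_le_of_lt i.isLt).lt_or_eq with h | h
  · rw [simpleRoot_mid i.val h, coroot_med (isMed_sub (by simp [Fin.ext_iff]))]
    simp [eps_apply, Fin.ext_iff]
  · have hi : i = Fin.last m := Fin.ext (by simpa using h)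
    have hp : p.val ≠ i.val + 1 := by have := p.isLt; simp only [Nat.succ_eq_add_one] at h; omega
    subst hi
    rw [if_neg hp, Fin.val_last, simpleRoot_last, coroot_long (isShort_eps _), eps_apply, sub_zero]

/-- The dominance order is described by partial sums. -/
theorem domLE_of_psum {lam mu : Wt n}
    (h : ∀ k ≤ n, ∑ i with i.val < k, lam i ≤ ∑ i with i.val < k, mu i) : domLE lam mu := by
  refine ⟨fun i => (∑ p with p.val < i.val + 1, (mu - lam) p).toNat, ?_⟩
  have hc : ∀ k ≤ n, 0 ≤ ∑ p with p.val < k, (mu - lam) p := fun k hk => by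
    simp only [Pi.sub_apply, Finset.sum_sub_distrib]
    linarith [h k hk]
  funext p
  rw [Finset.sum_apply]
  simp only [Pi.smul_apply, coroot_simpleRoot_apply, smul_sub, Finset.sum_sub_distrib]
  have e1 : ∑ i : Fin n, (∑ p with p.val < i.val + 1, (mu - lam) p).toNat •
      (if p = i then (1 : ℤ) else 0) = ∑ r with r.val < p.val + 1, (mu - lam) r := by
    rw [Finset.sum_eq_single p (fun i _ hi => by simp [hi.symm]) (by simp), if_pos rfl, nsmul_one]
    exact Int.toNat_of_nonneg (hc _ p.isLt)
  have e2 : ∑ i : Fin n, (∑ p with p.val < i.val + 1, (mu - lam) p).toNat •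
      (if p.val = i.val + 1 then (1 : ℤ) else 0) = ∑ r with r.val < p.val, (mu - lam) r := by
    rcases Nat.eq_zero_or_pos p.val with h0 | h0
    · rw [h0]; simp
    · rw [Finset.sum_eq_single ⟨p.val - 1, by omega⟩]
      · have : p.val - 1 + 1 = p.val := by omega
        simp only [this, if_true, nsmul_one]
        exact Int.toNat_of_nonneg (hc _ p.isLt.le)
      · intro i _ hi
        rw [if_neg, smul_zero]
        intro h; apply hi; ext; simp; omega
      · simp
  rw [e1, e2]
  have e3 : (Finset.univ.filter fun r : Fin n => r.val < p.val + 1) =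
      insert p (Finset.univ.filter fun r : Fin n => r.val < p.val) := by
    ext r; simp [Fin.ext_iff]; omega
  rw [e3, Finset.sum_insert (by simp)]
  ring

theorem domLE_of_psum_domWt {lam mu : Wt n} (h : ∀ k ≤ n, psum k lam ≤ psum k mu) :
    domLE (domWt lam) (domWt mu) := domLE_of_psum h

theorem domLE.trans {lam mu nu : Wt n} (h : domLE lam mu) (h' : domLE mu nu) : domLE lam nu := by
  obtain ⟨c, hc⟩ := h
  obtain ⟨d, hd⟩ := h'
  refine ⟨c + d, ?_⟩
  rw [← sub_add_sub_cancel nu mu lam, hc, hd, ← Finset.sum_add_distrib]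
  exact Finset.sum_congr rfl fun i _ => by rw [Pi.add_apply, add_smul, add_comm]

theorem domLE_add_coroot {α : Wt n} (hα : α ∈ posRoots n) (lam : Wt n) {i : ℤ} (hi : 0 ≤ i) :
    domLE lam (lam + i • coroot α) := by
  refine domLE_of_psum fun k _ => ?_
  simp only [Pi.add_apply, Pi.smul_apply, smul_eq_mul, Finset.sum_add_distrib, ← Finset.mul_sum]
  suffices h : 0 ≤ ∑ p with p.val < k, coroot α p by
    have := mul_nonneg hi h; linarith
  have he : ∀ i : Fin n, ∑ p with p.val < k, eps i p = if i.val < k then 1 else 0 := fun i => by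
    simp [eps_apply, Finset.sum_ite_eq']
  rcases mem_posRoots.1 hα with h | h
  · rw [coroot_med (Or.inl h)]
    obtain ⟨i, j, hij, rfl | rfl⟩ := mem_posMed.1 h
    · have : i.val < j.val := hij
      simp only [Pi.sub_apply, Finset.sum_sub_distrib, he]
      split_ifs <;> omega
    · simp only [Pi.add_apply, Finset.sum_add_distrib, he]
      split_ifs <;> omega
  · obtain ⟨i, rfl⟩ := mem_posLong.1 h
    rw [coroot_long (isShort_eps i), he]
    split_ifs <;> omega

/-- The relation `≺` is transitive. That the outer weights differ is part of `≺`, and is assumed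
here. -/
theorem precLT.trans {lam mu nu : Wt n} (h : precLT lam mu) (h' : precLT mu nu)
    (hne : lam ≠ nu) : precLT lam nu := by
  refine ⟨hne, ?_⟩
  rcases h.2 with ⟨h1, h2⟩ | ⟨h1, h2⟩ <;> rcases h'.2 with ⟨h3, h4⟩ | ⟨h3, h4⟩
  · by_cases he : domWt lam = domWt nu
    · exfalso
      rw [← he] at h3
      obtain ⟨c, hc⟩ := h1
      obtain ⟨d, hd⟩ := h3
      have h5 : ∑ i, (c i + d i) • coroot (simpleRoot n (i.val + 1)).1 = 0 := by
        simp only [add_smul, Finset.sum_add_distrib, ← hc, ← hd]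
        abel
      -- a vanishing non-negative combination of simple co-roots has vanishing coefficients
      have h6 : ∀ i : Fin n, (c i + d i) = 0 := by
        intro i
        obtain ⟨k, hk⟩ := i
        induction k with
        | zero =>
          have := congrFun h5 ⟨0, hk⟩
          rw [Finset.sum_apply] at this
          simp only [Pi.smul_apply, coroot_simpleRoot_apply] at this
          rw [Finset.sum_eq_single ⟨0, hk⟩ (fun i _ hi => by simp [hi.symm]) (by simp)] at this
          have h7 : ((c ⟨0, hk⟩ + d ⟨0, hk⟩ : ℕ) : ℤ) = 0 := by simpa using this
          exact_mod_cast h7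
        | succ k ih =>
          have := congrFun h5 ⟨k + 1, hk⟩
          rw [Finset.sum_apply] at this
          simp only [Pi.smul_apply, coroot_simpleRoot_apply] at this
          rw [Finset.sum_eq_single ⟨k + 1, hk⟩ (fun i _ hi => ?_) (by simp)] at this
          · have h7 : ((c ⟨k + 1, hk⟩ + d ⟨k + 1, hk⟩ : ℕ) : ℤ) = 0 := by simpa using this
            exact_mod_cast h7
          · rw [if_neg (Ne.symm hi)]
            by_cases hk' : i.val = k
            · have : i = ⟨k, by omega⟩ := Fin.ext hk'
              rw [this, ih (by omega), zero_smul]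
            · simp; omega
      apply h2
      have h7 : domWt mu - domWt lam = 0 := by
        rw [hc]
        refine Finset.sum_eq_zero fun i _ => ?_
        have := h6 i
        rw [show c i = 0 by omega, zero_smul]
      exact (sub_eq_zero.1 h7).symm
    · exact Or.inl ⟨h1.trans h3, he⟩
  · exact Or.inl ⟨h3 ▸ h1, h3 ▸ h2⟩
  · exact Or.inl ⟨h1 ▸ h3, h1 ▸ h4⟩
  · exact Or.inr ⟨h1.trans h3, h2.trans h4⟩

/-- A reflection in `α` stays in the orbit of `λ`, and one in `α + cδ` with `c > 0` leads to a
larger dominant weight. -/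
theorem Up.precLT {lam lam' : Wt n} (h : Up lam lam') : precLT lam lam' := by
  have hm := h.meas_lt
  obtain ⟨β, hβ, hv, rfl⟩ := h
  refine ⟨fun h => by rw [← h] at hm; exact hm.false, ?_⟩
  obtain ⟨α, c, hα, rfl⟩ := mem_affR_iff.1 hβ.1
  rcases hβ.2 with ⟨h1, h2⟩ | h1
  · right
    -- the reflection is in `W`, and `μ - λ` is a positive multiple of the co-root of `α ∈ Σ⁺`
    change 2 * c = 0 at h2
    obtain rfl : c = 0 := by omega
    refine ⟨?_, domLE_add_coroot h1 _ hv.le⟩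
    obtain ⟨w, -, hw⟩ := exists_actWt_eq_refl hα
    rw [reflAt, valAt_mk, zero_sub, neg_smul, ← sub_eq_add_neg, hw, domWt_actWt]
  · left
    change 0 < 2 * c at h1
    rw [valAt_mk] at hv
    set mu := reflAt (α, 2 * c) lam with hmu
    rw [reflAt, valAt_mk] at hmu
    have hl : lam = mu - (c - lam ⬝ᵥ α) • coroot α := by rw [hmu]; module
    have hd : mu ⬝ᵥ α = 2 * c - lam ⬝ᵥ α := by
      rw [hmu, add_dotProduct, smul_dotProduct, dotProduct_comm (coroot α), dot_coroot_self hα,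
        smul_eq_mul]; ring
    -- `λ` lies on the segment from `μ` to its image under the linear reflection in `α`
    refine ⟨domLE_of_psum_domWt fun k hk => ?_, fun he => ?_⟩
    · conv_lhs => rw [hl]
      exact psum_le_of_string hk hα mu (Or.inl ⟨by omega, by omega⟩)
    -- weights with the same dominant representative have the same norm
    · have h3 : lam ⬝ᵥ lam = mu ⬝ᵥ mu := by rw [← sum_domWt_sq, he, sum_domWt_sq]
      have h4 := dot_self_mul_coroot hα lam
      have h5 := dot_self_mul_coroot hα (coroot α)
      have h6 := dot_self_pos hα
      rw [dotProduct_comm (coroot α) α, dot_coroot_self hα] at h5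
      rw [hmu] at h3
      simp only [add_dotProduct, dotProduct_add, smul_dotProduct, dotProduct_smul, smul_eq_mul,
        dotProduct_comm (coroot α) lam] at h3
      set v := c - lam ⬝ᵥ α with hvd
      have h7 : 4 * v * c = 0 := by
        have h8 : lam ⬝ᵥ α = c - v := by omega
        rw [h8] at h4
        linear_combination (-(α ⬝ᵥ α)) * h3 - 2 * v * h4 - v ^ 2 * h5
      have : 0 < 4 * v * c := by
        have : 0 < c := by omega
        positivity
      omega

/-- The Bruhat order is contained in the order `≺`. -/
theorem BLE.eq_or_precLT {lam mu : Wt n} (h : BLE lam mu) : lam = mu ∨ precLT lam mu := by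
  have : lam = mu ∨ (precLT lam mu ∧ meas lam < meas mu) := by
    induction h with
    | refl => exact Or.inl rfl
    | tail _ h ih =>
      rcases ih with rfl | ih
      · exact Or.inr ⟨h.precLT, h.meas_lt⟩
      · have hm := ih.2.trans h.meas_lt
        exact Or.inr ⟨ih.1.trans h.precLT (fun he => by rw [he] at hm; exact hm.false), hm⟩
  exact this.imp_right And.left

end Dominance

/-! ### The operators on monomials -/

section Support

variable {n : ℕ}

/-- The Laurent polynomials all of whose exponents lie in `S`. -/
def suppIn (S : Set (Wt n)) : Submodule ℂ (Laurent n) where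
  carrier := {f | ∀ ν, f.coeff ν ≠ 0 → ν ∈ S}
  add_mem' := by
    intro f g hf hg ν h
    by_cases hfν : f.coeff ν = 0
    · exact hg ν fun h2 => h (by rw [AddMonoidAlgebra.coeff_add, Finsupp.add_apply, hfν, h2, add_zero])
    · exact hf ν hfν
  zero_mem' := by intro ν h; exact absurd rfl h
  smul_mem' := by
    intro c f hf ν h
    exact hf ν fun h2 => h (by rw [AddMonoidAlgebra.coeff_smul, Finsupp.smul_apply, h2, smul_zero])

theorem suppIn_mono {S T : Set (Wt n)} (h : S ⊆ T) {f : Laurent n} (hf : f ∈ suppIn S) :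
    f ∈ suppIn T := fun ν hν => h (hf ν hν)

theorem single_mem_suppIn {S : Set (Wt n)} {μ : Wt n} (h : μ ∈ S) (c : ℂ) :
    (AddMonoidAlgebra.single μ c : Laurent n) ∈ suppIn S := by
  intro ν hν
  rw [AddMonoidAlgebra.coeff_single, Finsupp.single_apply] at hν
  split_ifs at hν with h2
  · exact h2 ▸ h
  · exact absurd rfl hν

theorem mon_mem_suppIn (P : Params) {S : Set (Wt n)} {β : Aff n} (h : β.1 ∈ S) :
    P.mon β ∈ suppIn S := single_mem_suppIn h _

theorem eq_sum_single (f : Laurent n) :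
    f = ∑ μ ∈ f.coeff.support, f.coeff μ • (AddMonoidAlgebra.single μ 1 : Laurent n) := by
  conv_lhs => rw [← AddMonoidAlgebra.sum_coeff_single f]
  rw [Finsupp.sum]
  exact Finset.sum_congr rfl fun μ _ => by rw [AddMonoidAlgebra.smul_single, smul_eq_mul, mul_one]

theorem coeff_apply_eq_sum (A : Module.End ℂ (Laurent n)) (f : Laurent n) (κ : Wt n) :
    (A f).coeff κ =
      ∑ μ ∈ f.coeff.support, f.coeff μ * (A (AddMonoidAlgebra.single μ 1)).coeff κ := by
  conv_lhs => rw [eq_sum_single f]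
  rw [map_sum, AddMonoidAlgebra.coeff_sum, Finsupp.finsetSum_apply]
  exact Finset.sum_congr rfl fun μ _ => by
    rw [map_smul, AddMonoidAlgebra.coeff_smul, Finsupp.smul_apply, smul_eq_mul]

theorem map_mem_suppIn (A : Module.End ℂ (Laurent n)) {S T : Set (Wt n)}
    (h : ∀ μ ∈ S, A (AddMonoidAlgebra.single μ 1) ∈ suppIn T) {f : Laurent n}
    (hf : f ∈ suppIn S) : A f ∈ suppIn T := by
  rw [eq_sum_single f, map_sum]
  refine Submodule.sum_mem _ fun μ hμ => ?_
  rw [map_smul]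
  exact Submodule.smul_mem _ _ (h μ (hf μ (Finsupp.mem_support_iff.1 hμ)))

/-- The value of `T_j` on a monomial, with the quotient by `1 - x^{a_j}` written as a geometric sum.
-/
theorem T_single (P : Params) (j : ℕ) (μ : Wt n) {c d : ℂ} {h : Aff n}
    (hv : P.vNumOf P.mon (simpleRoot n j) = 1 + c • P.mon h - d • P.mon (simpleRoot n j)) :
    P.T n j (AddMonoidAlgebra.single μ 1) =
      P.mult (simpleRoot n j) • P.mon (μ, 0) - (P.mult (simpleRoot n j))⁻¹ •
        ((1 + c • P.mon h - d • P.mon (simpleRoot n j)) *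
          if 0 ≤ μ ⬝ᵥ coroot (simpleRoot n j).1 then
            -∑ i ∈ Finset.range (μ ⬝ᵥ coroot (simpleRoot n j).1).toNat,
              P.mon ((μ, 0) - (i + 1) • simpleRoot n j)
          else ∑ i ∈ Finset.range (-(μ ⬝ᵥ coroot (simpleRoot n j).1)).toNat,
            P.mon ((μ, 0) + i • simpleRoot n j)) := by
  rw [Params.T, hv]
  simp only [LinearMap.sub_apply, LinearMap.smul_apply, Module.End.one_apply, LinearMap.comp_apply,
    LinearMap.mulLeft_apply]
  rw [Params.divDiff, linExt_single, one_smul]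
  rfl

variable {P : Params} {j : ℕ} {c : ℂ} {h : Aff n} {r : ℤ} {η : Wt n}

theorem T_single_of_pos (hq : P.qh ≠ 0) (ht : P.mult (simpleRoot n j) ≠ 0)
    (hv : P.vNumOf P.mon (simpleRoot n j) =
      1 + c • P.mon h - (P.mult (simpleRoot n j)) ^ 2 • P.mon (simpleRoot n j))
    (hr : 1 ≤ r) (ha : (simpleRoot n j).1 = r • η) (hη : coroot (simpleRoot n j).1 = η)
    (hh : h.1 = η) (hc : c = 0 ∨ r = 2) (μ : Wt n) (hk : 0 < μ ⬝ᵥ η) :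
    P.T n j (AddMonoidAlgebra.single μ 1) ∈
      suppIn {ν | ∃ i : ℤ, ν = μ - i • η ∧ 0 < i ∧ i ≤ r * (μ ⬝ᵥ η)} := by
  rw [T_single P j μ hv, hη, if_pos hk.le]
  obtain ⟨K, hK⟩ : ∃ K : ℕ, μ ⬝ᵥ η = K + 1 := ⟨(μ ⬝ᵥ η - 1).toNat, by omega⟩
  rw [hK, show ((K : ℤ) + 1).toNat = K + 1 by omega]
  set a := simpleRoot n j
  set t := P.mult a
  have e1 : t • P.mon (μ, 0) - t⁻¹ • ((1 + c • P.mon h - t ^ 2 • P.mon a) *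
      -∑ i ∈ Finset.range (K + 1), P.mon ((μ, 0) - (i + 1) • a)) =
      t⁻¹ • ∑ i ∈ Finset.range (K + 1), P.mon ((μ, 0) - (i + 1) • a) +
      t⁻¹ • ∑ i ∈ Finset.range (K + 1), c • P.mon (h + ((μ, 0) - (i + 1) • a)) -
      t • ∑ i ∈ Finset.range K, P.mon ((μ, 0) - (i + 1) • a) := by
    have e2 : P.mon a * ∑ i ∈ Finset.range (K + 1), P.mon ((μ, 0) - (i + 1) • a) =
        ∑ i ∈ Finset.range K, P.mon ((μ, 0) - (i + 1) • a) + P.mon (μ, 0) := by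
      rw [Finset.mul_sum, Finset.sum_range_succ']
      congr 1
      · refine Finset.sum_congr rfl fun i _ => ?_
        rw [← P.mon_add hq]
        congr 1
        module
      · rw [← P.mon_add hq]
        congr 1
        module
    have e3 : (c • P.mon h) * ∑ i ∈ Finset.range (K + 1), P.mon ((μ, 0) - (i + 1) • a) =
        ∑ i ∈ Finset.range (K + 1), c • P.mon (h + ((μ, 0) - (i + 1) • a)) := by
      rw [Finset.mul_sum]
      exact Finset.sum_congr rfl fun i _ => by rw [P.mon_add hq h, smul_mul_assoc]
    rw [mul_neg, sub_mul, add_mul, one_mul, smul_mul_assoc (t ^ 2), e2, e3]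
    have e4 : t⁻¹ * t ^ 2 = t := by field_simp
    simp only [smul_neg, smul_sub, smul_add, smul_smul, e4]
    abel
  rw [e1]
  have hpos : ∀ i : ℕ, ((μ, 0) - (i + 1) • a : Aff n).1 = μ - (r * ((i : ℤ) + 1)) • η := fun i => by
    rw [Prod.fst_sub, Prod.smul_fst, ha]; module
  refine Submodule.sub_mem _ (Submodule.add_mem _ (Submodule.smul_mem _ _
    (Submodule.sum_mem _ fun i hi => ?_)) (Submodule.smul_mem _ _ (Submodule.sum_mem _
    fun i hi => ?_))) (Submodule.smul_mem _ _ (Submodule.sum_mem _ fun i hi => ?_))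
  · rw [Finset.mem_range] at hi
    exact mon_mem_suppIn P ⟨_, hpos i, by positivity, by gcongr; omega⟩
  · rw [Finset.mem_range] at hi
    rcases hc with rfl | rfl
    · rw [zero_smul]; exact Submodule.zero_mem _
    · refine Submodule.smul_mem _ _ (mon_mem_suppIn P ⟨2 * i + 1, ?_, by omega, by omega⟩)
      rw [Prod.fst_add, hpos, hh]; module
  · rw [Finset.mem_range] at hi
    exact mon_mem_suppIn P ⟨_, hpos i, by positivity, by gcongr⟩

theorem T_single_of_nonpos (hq : P.qh ≠ 0) (ht : P.mult (simpleRoot n j) ≠ 0)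
    (hv : P.vNumOf P.mon (simpleRoot n j) =
      1 + c • P.mon h - (P.mult (simpleRoot n j)) ^ 2 • P.mon (simpleRoot n j))
    (hr : 1 ≤ r) (ha : (simpleRoot n j).1 = r • η) (hη : coroot (simpleRoot n j).1 = η)
    (hh : h.1 = η) (hc : c = 0 ∨ r = 2) (μ : Wt n) (hk : μ ⬝ᵥ η ≤ 0) :
    P.T n j (AddMonoidAlgebra.single μ 1) - P.mult (simpleRoot n j) •
        P.mon ((μ, 0) - (μ ⬝ᵥ η) • simpleRoot n j) ∈
      suppIn {ν | ∃ i : ℤ, ν = μ - i • η ∧ r * (μ ⬝ᵥ η) < i ∧ i ≤ 0} := by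
  rw [T_single P j μ hv, hη]
  rcases hk.eq_or_lt with hk | hk
  · rw [hk]; simp
  rw [if_neg (by omega)]
  obtain ⟨K, hK⟩ : ∃ K : ℕ, μ ⬝ᵥ η = -(K + 1 : ℕ) := ⟨(-μ ⬝ᵥ η - 1).toNat, by
    rw [neg_dotProduct]; omega⟩
  rw [hK, show (-(-((K + 1 : ℕ) : ℤ))).toNat = K + 1 by omega]
  set a := simpleRoot n j
  set t := P.mult a
  have e1 : t • P.mon (μ, 0) - t⁻¹ • ((1 + c • P.mon h - t ^ 2 • P.mon a) *
      ∑ i ∈ Finset.range (K + 1), P.mon ((μ, 0) + i • a)) -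
      t • P.mon ((μ, 0) - (-((K + 1 : ℕ) : ℤ)) • a) =
      t • P.mon (μ, 0) -
      t⁻¹ • ∑ i ∈ Finset.range (K + 1), P.mon ((μ, 0) + i • a) -
      t⁻¹ • ∑ i ∈ Finset.range (K + 1), c • P.mon (h + ((μ, 0) + i • a)) +
      t • ∑ i ∈ Finset.range K, P.mon ((μ, 0) + (i + 1) • a) := by
    have e2 : P.mon a * ∑ i ∈ Finset.range (K + 1), P.mon ((μ, 0) + i • a) =
        ∑ i ∈ Finset.range K, P.mon ((μ, 0) + (i + 1) • a) +
          P.mon ((μ, 0) - (-((K + 1 : ℕ) : ℤ)) • a) := by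
      rw [Finset.mul_sum, Finset.sum_range_succ]
      congr 1
      · refine Finset.sum_congr rfl fun i _ => ?_
        rw [← P.mon_add hq]
        congr 1
        module
      · rw [← P.mon_add hq]
        congr 1
        push_cast
        module
    have e3 : (c • P.mon h) * ∑ i ∈ Finset.range (K + 1), P.mon ((μ, 0) + i • a) =
        ∑ i ∈ Finset.range (K + 1), c • P.mon (h + ((μ, 0) + i • a)) := by
      rw [Finset.mul_sum]
      exact Finset.sum_congr rfl fun i _ => by rw [P.mon_add hq h, smul_mul_assoc]
    rw [sub_mul, add_mul, one_mul, smul_mul_assoc (t ^ 2), e2, e3]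
    have e4 : t⁻¹ * t ^ 2 = t := by field_simp
    simp only [smul_sub, smul_add, smul_smul, e4]
    abel
  rw [e1]
  have hpos : ∀ i : ℕ, ((μ, 0) + i • a : Aff n).1 = μ - (-(r * (i : ℤ))) • η := fun i => by
    rw [Prod.fst_add, Prod.smul_fst, ha]; module
  have hlt : ∀ i : ℕ, i < K + 1 → r * (-((K + 1 : ℕ) : ℤ)) < -(r * (i : ℤ)) := fun i hi => by
    have : r * (i : ℤ) < r * ((K + 1 : ℕ) : ℤ) := by gcongr
    linarith
  refine Submodule.add_mem _ (Submodule.sub_mem _ (Submodule.sub_mem _ (Submodule.smul_mem _ _ ?_)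
    (Submodule.smul_mem _ _ (Submodule.sum_mem _ fun i hi => ?_))) (Submodule.smul_mem _ _
    (Submodule.sum_mem _ fun i hi => ?_))) (Submodule.smul_mem _ _
    (Submodule.sum_mem _ fun i hi => ?_))
  · have := hlt 0 (by omega)
    exact mon_mem_suppIn P ⟨0, by simp, by simpa using this, le_rfl⟩
  · rw [Finset.mem_range] at hi
    exact mon_mem_suppIn P ⟨_, hpos i, hlt i hi, by
      rw [neg_nonpos]; positivity⟩
  · rw [Finset.mem_range] at hi
    rcases hc with rfl | rfl
    · rw [zero_smul]; exact Submodule.zero_mem _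
    · refine Submodule.smul_mem _ _ (mon_mem_suppIn P ⟨-(2 * i + 1), ?_, by push_cast; omega,
        by omega⟩)
      rw [Prod.fst_add, hpos, hh]; module
  · rw [Finset.mem_range] at hi
    exact mon_mem_suppIn P ⟨_, hpos (i + 1), hlt _ (by omega), by
      rw [neg_nonpos]; positivity⟩

end Support

section Raising

variable {m : ℕ} {P : Params}

/-- The operators that raise the degree: `T_j` for `j > 0`, and `x_1^{-1} T_0` for `j = 0`. -/
noncomputable def raiseOp (P : Params) (m j : ℕ) : Module.End ℂ (Laurent (m + 1)) :=
  if j = 0 then mulX (-eps 0) * P.T (m + 1) 0 else P.T (m + 1) j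

/-- The coefficient of the leading monomial in `raiseOp P m j x^λ`. -/
noncomputable def raiseCoeff (P : Params) (m j : ℕ) (lam : Wt (m + 1)) : ℂ :=
  if j = 0 then P.t0 * P.q ^ lam 0 else P.mult (simpleRoot (m + 1) j)

theorem mult_simpleRoot_ne (hP : P.Nondeg) {j : ℕ} (hj : j ≤ m + 1) :
    P.mult (simpleRoot (m + 1) j) ≠ 0 := by
  refine simpleRoot_cases (p := fun j => P.mult (simpleRoot (m + 1) j) ≠ 0) ?_ ?_ ?_ hj
  · rw [mult_simpleRoot_zero]; exact hP.t0
  · intro j hj; rw [mult_simpleRoot_mid P hj]; exact hP.t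
  · rw [mult_simpleRoot_last]; exact hP.tn

/-- The data of a simple root `a_j` entering in the formula for `T_j` on monomials. -/
theorem exists_simpleRoot_data (hP : P.Nondeg) {j : ℕ} (hj : j ≤ m + 1) :
    ∃ (c : ℂ) (h : Aff (m + 1)) (r : ℤ), P.vNumOf P.mon (simpleRoot (m + 1) j) =
      1 + c • P.mon h - (P.mult (simpleRoot (m + 1) j)) ^ 2 • P.mon (simpleRoot (m + 1) j) ∧
      1 ≤ r ∧ (simpleRoot (m + 1) j).1 = r • coroot (simpleRoot (m + 1) j).1 ∧
      h.1 = coroot (simpleRoot (m + 1) j).1 ∧ (c = 0 ∨ r = 2) ∧ (j = 0 → r = 2) := by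
  have hlong : ∀ (t t' : ℂ) (h h2 : Aff (m + 1)), t' ≠ 0 → 2 • h = h2 →
      (1 - (t * t') • P.mon h) * (1 + (t * t'⁻¹) • P.mon h) =
      1 + (t * t'⁻¹ - t * t') • P.mon h - t ^ 2 • P.mon h2 := by
    rintro t t' h _ ht' rfl
    rw [two_smul, P.mon_add hP.qh]
    have : t ^ 2 = (t * t') * (t * t'⁻¹) := by field_simp
    rw [this]
    simp only [sub_mul, mul_add, one_mul, mul_one, smul_mul_smul_comm, sub_smul]
    abel
  refine simpleRoot_cases (p := fun j => ∃ (c : ℂ) (h : Aff (m + 1)) (r : ℤ),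
    P.vNumOf P.mon (simpleRoot (m + 1) j) =
      1 + c • P.mon h - (P.mult (simpleRoot (m + 1) j)) ^ 2 • P.mon (simpleRoot (m + 1) j) ∧
      1 ≤ r ∧ (simpleRoot (m + 1) j).1 = r • coroot (simpleRoot (m + 1) j).1 ∧
      h.1 = coroot (simpleRoot (m + 1) j).1 ∧ (c = 0 ∨ r = 2) ∧ (j = 0 → r = 2)) ?_ ?_ ?_ hj
  · rw [mult_simpleRoot_zero, simpleRoot_zero (by omega), vNumOf_long P _ (isShort_eps _).neg]
    refine ⟨_, _, 2, hlong _ _ _ _ ?_ ?_, by norm_num, ?_, ?_, Or.inr rfl, fun _ => rfl⟩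
    · simpa using hP.t0v
    · exact Prod.ext rfl (by simp)
    · rw [coroot_long (isShort_eps _).neg]; exact (natCast_zsmul _ 2).symm
    · rw [coroot_long (isShort_eps _).neg]
  · intro j hj
    rw [mult_simpleRoot_mid P hj, simpleRoot_mid j hj, vNumOf_med P _ (isMed_sub (by simp)),
      coroot_med (isMed_sub (by simp))]
    exact ⟨0, (_, 0), 1, by rw [zero_smul, add_zero], le_rfl, (one_smul _ _).symm, rfl,
      Or.inl rfl, by omega⟩
  · rw [mult_simpleRoot_last, simpleRoot_last, vNumOf_long P _ (isShort_eps _)]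
    refine ⟨_, _, 2, hlong _ _ _ _ ?_ ?_, by norm_num, ?_, ?_, Or.inr rfl, fun _ => rfl⟩
    · simpa using hP.tnv
    · exact Prod.ext rfl (by simp)
    · rw [coroot_long (isShort_eps _)]; exact (natCast_zsmul _ 2).symm
    · rw [coroot_long (isShort_eps _)]

theorem simpleRoot_snd {j : ℕ} (hj : j ≤ m + 1) :
    (simpleRoot (m + 1) j).2 = if j = 0 then 2 else 0 := by
  refine simpleRoot_cases (p := fun j => (simpleRoot (m + 1) j).2 = if j = 0 then 2 else 0)
    ?_ ?_ ?_ hj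
  · rw [simpleRoot_zero (by omega)]; rfl
  · intro j hj; rw [simpleRoot_mid j hj]; rfl
  · rw [simpleRoot_last]; rfl

theorem coroot_simpleRoot_zero : coroot (simpleRoot (m + 1) 0).1 = -eps 0 := by
  rw [simpleRoot_zero (by omega), coroot_long (isShort_eps _).neg]; rfl

theorem mulX_single (μ ν : Wt (m + 1)) (c : ℂ) :
    mulX μ (AddMonoidAlgebra.single ν c) = AddMonoidAlgebra.single (μ + ν) c := by
  rw [mulX, LinearMap.mulLeft_apply, AddMonoidAlgebra.single_mul_single, one_mul]

/-- If `a_j` is not positive at `-μ`, the exponents of `raiseOp P m j x^μ` lie on the segment from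
`μ` to `s_j μ`, and these are below `μ`. -/
theorem raiseOp_single_of_nonpos (hP : P.Nondeg) {j : ℕ} (hj : j ≤ m + 1) (μ : Wt (m + 1))
    (hv : valAt μ (simpleRoot (m + 1) j) ≤ 0) :
    raiseOp P m j (AddMonoidAlgebra.single μ 1) ∈
      suppIn {ν | ∃ i : ℤ, ν = μ + i • coroot (simpleRoot (m + 1) j).1 ∧
        valAt μ (simpleRoot (m + 1) j) ≤ i ∧ i ≤ 0} := by
  obtain ⟨c, h, r, h1, h2, h3, h4, h5, h6⟩ := exists_simpleRoot_data hP hj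
  have hval : valAt μ (simpleRoot (m + 1) j) = (if j = 0 then 1 else 0) -
      r * (μ ⬝ᵥ coroot (simpleRoot (m + 1) j).1) := by
    rw [valAt, simpleRoot_snd hj]
    conv_lhs => rw [h3]
    rw [dotProduct_smul, smul_eq_mul]
    split_ifs <;> rfl
  rw [hval] at hv ⊢
  have hT := T_single_of_pos hP.qh (mult_simpleRoot_ne hP hj) h1 h2 h3 rfl h4 h5 μ
  have hT' := T_single_of_nonpos hP.qh (mult_simpleRoot_ne hP hj) h1 h2 h3 rfl h4 h5 μ
  set η := coroot (simpleRoot (m + 1) j).1 with hη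
  by_cases hj0 : j = 0
  · subst hj0
    obtain rfl := h6 rfl
    simp only [if_true] at hv ⊢
    rw [raiseOp, if_pos rfl, Module.End.mul_apply]
    refine map_mem_suppIn (mulX (-eps 0)) ?_ (hT (by omega))
    rintro _ ⟨i, rfl, hi1, hi2⟩
    rw [mulX_single]
    refine single_mem_suppIn ?_ _
    refine ⟨1 - i, ?_, by omega, by omega⟩
    rw [hη, coroot_simpleRoot_zero]
    module
  · simp only [if_neg hj0, zero_sub] at hv ⊢
    rw [raiseOp, if_neg hj0]
    have hk : 0 ≤ μ ⬝ᵥ η := by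
      by_contra h
      have : r * (μ ⬝ᵥ η) < 0 := mul_neg_of_pos_of_neg (by omega) (by omega)
      omega
    rcases hk.eq_or_lt with hk | hk
    · have hT'' := hT' hk.symm.le
      rw [← hk] at hT'' ⊢
      rw [← sub_add_cancel (P.T (m + 1) j (AddMonoidAlgebra.single μ 1))
        (P.mult (simpleRoot (m + 1) j) • P.mon ((μ, 0) - (0 : ℤ) • simpleRoot (m + 1) j))]
      refine Submodule.add_mem _ (suppIn_mono ?_ hT'') (Submodule.smul_mem _ _
        (mon_mem_suppIn P ?_))
      · rintro _ ⟨i, rfl, hi1, hi2⟩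
        omega
      · exact ⟨0, by simp, by simp, le_rfl⟩
    · refine suppIn_mono ?_ (hT hk)
      rintro _ ⟨i, rfl, hi1, hi2⟩
      exact ⟨-i, by module, by omega, by omega⟩

/-- If `a_j` is positive at `-μ`, then `raiseOp P m j x^μ` is a multiple of `x^{s_j μ}` plus a
combination of monomials on the segment from `μ` to `s_j μ`. -/
theorem raiseOp_single_of_pos (hP : P.Nondeg) {j : ℕ} (hj : j ≤ m + 1) (μ : Wt (m + 1))
    (hv : 0 < valAt μ (simpleRoot (m + 1) j)) :
    raiseOp P m j (AddMonoidAlgebra.single μ 1) - raiseCoeff P m j μ •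
      (AddMonoidAlgebra.single (reflAt (simpleRoot (m + 1) j) μ) 1 : Laurent (m + 1)) ∈
      suppIn {ν | ∃ i : ℤ, ν = μ + i • coroot (simpleRoot (m + 1) j).1 ∧
        0 ≤ i ∧ i < valAt μ (simpleRoot (m + 1) j)} := by
  obtain ⟨c, h, r, h1, h2, h3, h4, h5, h6⟩ := exists_simpleRoot_data hP hj
  have hval : valAt μ (simpleRoot (m + 1) j) = (if j = 0 then 1 else 0) -
      r * (μ ⬝ᵥ coroot (simpleRoot (m + 1) j).1) := by
    rw [valAt, simpleRoot_snd hj]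
    conv_lhs => rw [h3]
    rw [dotProduct_smul, smul_eq_mul]
    split_ifs <;> rfl
  rw [reflAt]
  rw [hval] at hv ⊢
  have hT' := T_single_of_nonpos hP.qh (mult_simpleRoot_ne hP hj) h1 h2 h3 rfl h4 h5 μ
  by_cases hj0 : j = 0
  · subst hj0
    obtain rfl := h6 rfl
    simp only [if_true] at hv ⊢
    have hT := map_mem_suppIn (mulX (-eps 0)) (T := {ν | ∃ i : ℤ, ν = μ + i • -eps 0 ∧
        0 ≤ i ∧ i < 1 - 2 * (μ ⬝ᵥ -eps 0)}) ?_ (hT' (by omega))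
    · rw [map_sub, map_smul, Params.mon, mulX_single] at hT
      rw [raiseOp, if_pos rfl, Module.End.mul_apply, raiseCoeff, if_pos rfl]
      rw [coroot_simpleRoot_zero] at hT ⊢
      convert hT using 2
      rw [mult_simpleRoot_zero, mul_smul, AddMonoidAlgebra.smul_single, smul_eq_mul, mul_one,
        Params.q, ← zpow_natCast, ← zpow_mul]
      congr 2
      · rw [Prod.fst_sub, Prod.smul_fst, h3, coroot_simpleRoot_zero]; module
      · rw [Prod.snd_sub, Prod.smul_snd, simpleRoot_snd hj, dotProduct_neg, dot_eps]
        simp [mul_comm]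
    · rintro _ ⟨i, rfl, hi1, hi2⟩
      rw [mulX_single]
      rw [coroot_simpleRoot_zero] at *
      refine single_mem_suppIn ?_ _
      exact ⟨1 - i, by module, by omega, by omega⟩
  · simp only [if_neg hj0, zero_sub] at hv ⊢
    have hk : μ ⬝ᵥ coroot (simpleRoot (m + 1) j).1 ≤ 0 := by
      by_contra h
      have : 0 < r * (μ ⬝ᵥ coroot (simpleRoot (m + 1) j).1) := mul_pos (by omega) (by omega)
      omega
    rw [raiseOp, if_neg hj0, raiseCoeff, if_neg hj0]
    have hT := hT' hk
    have hT2 := suppIn_mono (T := {ν | ∃ i : ℤ, ν = μ + i • coroot (simpleRoot (m + 1) j).1 ∧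
        0 ≤ i ∧ i < -(r * (μ ⬝ᵥ coroot (simpleRoot (m + 1) j).1))}) ?_ hT
    · convert hT2 using 2
      rw [Params.mon]
      congr 2
      · have e : (μ ⬝ᵥ coroot (simpleRoot (m + 1) j).1) • (simpleRoot (m + 1) j).1 =
            ((μ ⬝ᵥ coroot (simpleRoot (m + 1) j).1) * r) • coroot (simpleRoot (m + 1) j).1 := by
          rw [mul_smul, ← h3]
        rw [Prod.fst_sub, Prod.smul_fst, e]
        module
      · rw [Prod.snd_sub, Prod.smul_snd, simpleRoot_snd hj, if_neg hj0]; simp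
    · rintro _ ⟨i, rfl, hi1, hi2⟩
      exact ⟨-i, by module, by omega, by omega⟩

theorem simpleRoot_mk {j : ℕ} (hj : j ≤ m + 1) : ∃ c,
    simpleRoot (m + 1) j = ((simpleRoot (m + 1) j).1, 2 * c) := by
  obtain ⟨c, hc⟩ := even_simpleRoot (m := m) hj
  exact ⟨c, Prod.ext rfl (by rw [hc]; ring)⟩

/-- If `μ ≤ λ < s_j λ`, the exponents of `raiseOp P m j x^μ` are at most `s_j λ`. -/
theorem ble_of_coeff_raiseOp (hP : P.Nondeg) {j : ℕ} (hj : j ≤ m + 1) {μ lam : Wt (m + 1)}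
    (hμ : BLE μ lam) (hl : 0 < valAt lam (simpleRoot (m + 1) j)) :
    raiseOp P m j (AddMonoidAlgebra.single μ 1) ∈
      suppIn {ν | BLE ν (reflAt (simpleRoot (m + 1) j) lam)} := by
  obtain ⟨h1, h2⟩ := hμ.lift hj hl
  have ha := simpleRoot_mem (m := m) hj
  obtain ⟨c, hc⟩ := simpleRoot_mk (m := m) hj
  rcases le_or_gt (valAt μ (simpleRoot (m + 1) j)) 0 with hv | hv
  · refine suppIn_mono ?_ (raiseOp_single_of_nonpos hP hj μ hv)
    rintro _ ⟨i, rfl, hi1, hi2⟩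
    rw [hc] at ha hi1
    exact (ble_of_mem_string ha μ hi2 hi1).trans h1
  · rw [← sub_add_cancel (raiseOp P m j (AddMonoidAlgebra.single μ 1)) (raiseCoeff P m j μ •
      (AddMonoidAlgebra.single (reflAt (simpleRoot (m + 1) j) μ) 1 : Laurent (m + 1)))]
    refine Submodule.add_mem _ (suppIn_mono ?_ (raiseOp_single_of_pos hP hj μ hv))
      (Submodule.smul_mem _ _ (single_mem_suppIn (S := {ν | BLE ν _}) h2 _))
    rintro _ ⟨i, rfl, hi1, hi2⟩
    refine BLE.trans ?_ h2
    rw [hc] at ha hi2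
    have := ble_reflAt_of_mem_string ha μ hi1 hi2.le
    rwa [← hc] at this

theorem raiseOp_mem (hP : P.Nondeg) {j : ℕ} (hj : j ≤ m + 1) {lam : Wt (m + 1)}
    (hl : 0 < valAt lam (simpleRoot (m + 1) j)) {F : Laurent (m + 1)}
    (hF : F ∈ suppIn {μ | BLE μ lam}) :
    raiseOp P m j F ∈ suppIn {μ | BLE μ (reflAt (simpleRoot (m + 1) j) lam)} :=
  map_mem_suppIn _ (fun _ hμ => ble_of_coeff_raiseOp hP hj hμ hl) hF

/-- If `μ ≤ λ`, no weight below `μ`, or strictly below `s_j μ`, equals `s_j λ`. -/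
theorem reflAt_ne_of_string {j : ℕ} (hj : j ≤ m + 1) {μ lam : Wt (m + 1)} (hμ : BLE μ lam)
    (hl : 0 < valAt lam (simpleRoot (m + 1) j)) {ν : Wt (m + 1)}
    (h : BLE ν μ ∨ (BLE ν (reflAt (simpleRoot (m + 1) j) μ) ∧
      ν ≠ reflAt (simpleRoot (m + 1) j) μ)) : ν ≠ reflAt (simpleRoot (m + 1) j) lam := by
  have ha := simpleRoot_mem (m := m) hj
  rintro rfl
  rcases h with h | ⟨h, hne⟩
  · have h1 := (up_reflAt ha hl).meas_lt
    have h2 := (h.trans hμ).eq_or_meas_lt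
    rcases h2 with h2 | h2
    · rw [h2] at h1; exact h1.false
    · omega
  · rcases h.eq_or_meas_lt with h2 | h2
    · exact hne h2
    · rcases (hμ.lift hj hl).2.eq_or_meas_lt with h3 | h3
      · rw [h3] at h2; exact h2.false
      · omega

/-- Only the monomial `x^λ` contributes to the leading coefficient. -/
theorem coeff_raiseOp (hP : P.Nondeg) {j : ℕ} (hj : j ≤ m + 1) {lam : Wt (m + 1)}
    (hl : 0 < valAt lam (simpleRoot (m + 1) j)) {F : Laurent (m + 1)}
    (hF : F ∈ suppIn {μ | BLE μ lam}) :
    (raiseOp P m j F).coeff (reflAt (simpleRoot (m + 1) j) lam) =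
      raiseCoeff P m j lam * F.coeff lam := by
  have ha := simpleRoot_mem (m := m) hj
  obtain ⟨c, hc⟩ := simpleRoot_mk (m := m) hj
  have hcor : coroot (simpleRoot (m + 1) j).1 ≠ 0 := fun h => by
    have := dot_coroot_self (isRoot_simpleRoot (m := m) hj)
    rw [h, dotProduct_zero] at this
    omega
  have hone : ∀ μ, BLE μ lam → (raiseOp P m j (AddMonoidAlgebra.single μ 1)).coeff
      (reflAt (simpleRoot (m + 1) j) lam) = if μ = lam then raiseCoeff P m j lam else 0 := by
    intro μ hμ
    rcases le_or_gt (valAt μ (simpleRoot (m + 1) j)) 0 with hv | hv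
    · rw [if_neg (by rintro rfl; omega)]
      by_contra h0
      obtain ⟨i, hi, hi1, hi2⟩ := raiseOp_single_of_nonpos hP hj μ hv _ h0
      rw [hc] at ha hi1
      exact reflAt_ne_of_string hj hμ hl (Or.inl (ble_of_mem_string ha μ hi2 hi1)) hi.symm
    · have h0 : (raiseOp P m j (AddMonoidAlgebra.single μ 1) - raiseCoeff P m j μ •
          (AddMonoidAlgebra.single (reflAt (simpleRoot (m + 1) j) μ) 1 : Laurent (m + 1))).coeff
          (reflAt (simpleRoot (m + 1) j) lam) = 0 := by
        by_contra h0
        obtain ⟨i, hi, hi1, hi2⟩ := raiseOp_single_of_pos hP hj μ hv _ h0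
        have h3 := ble_reflAt_of_mem_string (hc ▸ ha) μ hi1 (hc ▸ hi2.le)
        rw [← hc] at h3
        refine reflAt_ne_of_string hj hμ hl (Or.inr ⟨h3, fun he => ?_⟩) hi.symm
        rw [reflAt, add_right_inj, ← sub_eq_zero, ← sub_smul, smul_eq_zero] at he
        rcases he with he | he
        · omega
        · exact hcor he
      rw [AddMonoidAlgebra.coeff_sub, Finsupp.sub_apply, sub_eq_zero] at h0
      rw [h0, AddMonoidAlgebra.coeff_smul, Finsupp.smul_apply, AddMonoidAlgebra.coeff_single,
        Finsupp.single_apply, smul_eq_mul]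
      by_cases he : μ = lam
      · subst he; simp
      · rw [if_neg, if_neg he, mul_zero]
        intro h
        apply he
        rw [← reflAt_reflAt ha.1 μ, h, reflAt_reflAt ha.1]
  rw [coeff_apply_eq_sum, Finset.sum_congr rfl fun μ hμ => by
    rw [hone μ (hF μ (Finsupp.mem_support_iff.1 hμ))]]
  simp only [mul_ite, mul_zero, Finset.sum_ite_eq', Finsupp.mem_support_iff]
  split_ifs with h
  · ring
  · rw [not_ne_iff.1 h]; ring

end Raising

/-! ### The spectral points -/

section Spectral

variable {n : ℕ}

/-- `β` is positive at a point close to `λ` in a generic dominant direction. -/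
def PosAt (lam β : Wt n) : Prop := 0 < lam ⬝ᵥ β ∨ (lam ⬝ᵥ β = 0 ∧ β ∈ posRoots n)

/-- The medium roots that are positive at `λ` in the sense of `PosAt`. -/
def posAtMed (lam : Wt n) : Finset (Wt n) := (posMed n).image fun α => sgn (lam ⬝ᵥ α) • α

/-- The long roots that are positive at `λ` in the sense of `PosAt`. -/
def posAtLong (lam : Wt n) : Finset (Wt n) := (posLong n).image fun α => sgn (lam ⬝ᵥ α) • α

theorem sgn_eq (k : ℤ) : sgn k = 1 ∨ sgn k = -1 := by
  unfold sgn; split_ifs <;> simp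

theorem sgn_smul_injOn (lam : Wt n) :
    Set.InjOn (fun α => sgn (lam ⬝ᵥ α) • α) (posRoots n : Set (Wt n)) := by
  intro α hα γ hγ h
  have h1 := dot_htVec_pos (Finset.mem_coe.1 hα)
  have h2 := dot_htVec_pos (Finset.mem_coe.1 hγ)
  have h3 := congrArg (· ⬝ᵥ htVec n) h
  simp only at h h3
  rcases sgn_eq (lam ⬝ᵥ α) with e1 | e1 <;> rcases sgn_eq (lam ⬝ᵥ γ) with e2 | e2 <;>
    simp only [e1, e2, neg_smul, one_smul, neg_dotProduct, neg_inj] at h h3 <;>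
    first | exact h | omega

theorem sgn_smul_injOn_med (lam : Wt n) :
    Set.InjOn (fun α => sgn (lam ⬝ᵥ α) • α) (posMed n : Set (Wt n)) :=
  (sgn_smul_injOn lam).mono fun _ h => mem_posRoots.2 (Or.inl h)

theorem sgn_smul_injOn_long (lam : Wt n) :
    Set.InjOn (fun α => sgn (lam ⬝ᵥ α) • α) (posLong n : Set (Wt n)) :=
  (sgn_smul_injOn lam).mono fun _ h => mem_posRoots.2 (Or.inr h)

theorem card_posAtMed (lam : Wt n) : (posAtMed lam).card = (posMed n).card :=
  Finset.card_image_of_injOn (sgn_smul_injOn_med lam)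

theorem card_posAtLong (lam : Wt n) : (posAtLong lam).card = (posLong n).card :=
  Finset.card_image_of_injOn (sgn_smul_injOn_long lam)

theorem posAt_sgn_smul {lam α : Wt n} (h : α ∈ posRoots n) : PosAt lam (sgn (lam ⬝ᵥ α) • α) := by
  unfold PosAt sgn
  split_ifs with h0
  · rw [one_smul]
    rcases h0.eq_or_lt with h1 | h1
    · exact Or.inr ⟨h1.symm, h⟩
    · exact Or.inl h1
  · left; rw [dotProduct_smul]; simp; omega

theorem sgn_smul_of_posAt {lam β : Wt n} (hβ : IsRoot β) (h : PosAt lam β) :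
    (β ∈ posRoots n ∧ sgn (lam ⬝ᵥ β) • β = β) ∨
      (-β ∈ posRoots n ∧ sgn (lam ⬝ᵥ (-β)) • (-β) = β) := by
  rcases isRoot_iff.1 hβ with h1 | h1
  · refine Or.inl ⟨h1, ?_⟩
    have : 0 ≤ lam ⬝ᵥ β := by rcases h with h | h <;> omega
    rw [sgn, if_pos this, one_smul]
  · refine Or.inr ⟨h1, ?_⟩
    have : ¬ 0 ≤ lam ⬝ᵥ (-β) := by
      rw [dotProduct_neg]
      rcases h with h | ⟨h, h2⟩
      · omega
      · have := dot_htVec_pos h1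
        have := dot_htVec_pos h2
        rw [neg_dotProduct] at *
        omega
    rw [sgn, if_neg this, neg_smul, one_smul, neg_neg]

theorem isMed_of_mem {α : Wt n} (h : α ∈ posMed n) : IsMed α := Or.inl h

theorem isLong_of_mem {α : Wt n} (h : α ∈ posLong n) : IsLong α := Or.inl h

theorem not_isMed_and_isLong {α : Wt n} (h : IsMed α) (h' : IsLong α) : False := by
  have := h.dot_self; have := h'.dot_self; omega

theorem mem_posAtMed {lam β : Wt n} : β ∈ posAtMed lam ↔ IsMed β ∧ PosAt lam β := by
  rw [posAtMed, Finset.mem_image]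
  constructor
  · rintro ⟨α, hα, rfl⟩
    refine ⟨?_, posAt_sgn_smul (mem_posRoots.2 (Or.inl hα))⟩
    rcases sgn_eq (lam ⬝ᵥ α) with h | h <;> rw [h]
    · simpa using isMed_of_mem hα
    · simpa using (isMed_of_mem hα).neg
  · rintro ⟨h1, h2⟩
    rcases sgn_smul_of_posAt (Or.inl h1) h2 with ⟨h, h'⟩ | ⟨h, h'⟩
    · refine ⟨β, (mem_posRoots.1 h).resolve_right fun h3 => ?_, h'⟩
      exact not_isMed_and_isLong h1 (isLong_of_mem h3)
    · refine ⟨-β, (mem_posRoots.1 h).resolve_right fun h3 => ?_, h'⟩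
      exact not_isMed_and_isLong h1.neg (isLong_of_mem h3)

theorem mem_posAtLong {lam β : Wt n} : β ∈ posAtLong lam ↔ IsLong β ∧ PosAt lam β := by
  rw [posAtLong, Finset.mem_image]
  constructor
  · rintro ⟨α, hα, rfl⟩
    refine ⟨?_, posAt_sgn_smul (mem_posRoots.2 (Or.inr hα))⟩
    rcases sgn_eq (lam ⬝ᵥ α) with h | h <;> rw [h]
    · simpa using isLong_of_mem hα
    · simpa using (isLong_of_mem hα).neg
  · rintro ⟨h1, h2⟩
    rcases sgn_smul_of_posAt (Or.inr h1) h2 with ⟨h, h'⟩ | ⟨h, h'⟩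
    · refine ⟨β, (mem_posRoots.1 h).resolve_left fun h3 => ?_, h'⟩
      exact not_isMed_and_isLong (isMed_of_mem h3) h1
    · refine ⟨-β, (mem_posRoots.1 h).resolve_left fun h3 => ?_, h'⟩
      exact not_isMed_and_isLong (isMed_of_mem h3) h1.neg

theorem rhoMed_eq (lam : Wt n) : rhoMed lam = ∑ β ∈ posAtMed lam, coroot β := by
  rw [posAtMed, Finset.sum_image (sgn_smul_injOn_med lam), rhoMed]
  refine Finset.sum_congr rfl fun α hα => ?_
  rcases sgn_eq (lam ⬝ᵥ α) with h | h <;> rw [h]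
  · rw [one_smul, one_smul]
  · rw [neg_smul, neg_smul, one_smul, one_smul, coroot_neg (Or.inl (isMed_of_mem hα))]

theorem rhoLong_eq (lam : Wt n) : rhoLong lam = ∑ β ∈ posAtLong lam, coroot β := by
  rw [posAtLong, Finset.sum_image (sgn_smul_injOn_long lam), rhoLong]
  refine Finset.sum_congr rfl fun α hα => ?_
  rcases sgn_eq (lam ⬝ᵥ α) with h | h <;> rw [h]
  · rw [one_smul, one_smul]
  · rw [neg_smul, neg_smul, one_smul, one_smul, coroot_neg (Or.inr (isLong_of_mem hα))]

theorem sum_posMed {M : Type*} [AddCommMonoid M] (f : Wt n → M) :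
    ∑ α ∈ posMed n, f α = ∑ i, ∑ j, if i < j then f (eps i - eps j) + f (eps i + eps j) else 0 := by
  have hdisj : Disjoint
      (((Finset.univ : Finset (Fin n × Fin n)).filter (fun ij => ij.1 < ij.2)).image
        (fun ij => eps ij.1 - eps ij.2))
      (((Finset.univ : Finset (Fin n × Fin n)).filter (fun ij => ij.1 < ij.2)).image
        (fun ij => eps ij.1 + eps ij.2)) := by
    rw [Finset.disjoint_left]
    intro α h1 h2
    simp only [Finset.mem_image, Finset.mem_filter, Finset.mem_univ, true_and, Prod.exists] at h1 h2
    obtain ⟨i, j, hij, rfl⟩ := h1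
    obtain ⟨k, l, hkl, h⟩ := h2
    have := congrArg (fun α : Wt n => α ⬝ᵥ fun _ => 1) h
    simp only [sub_dotProduct, add_dotProduct, eps_dot] at this
    omega
  have hinj1 : Set.InjOn (fun ij : Fin n × Fin n => (eps ij.1 - eps ij.2 : Wt n))
      ((Finset.univ : Finset (Fin n × Fin n)).filter (fun ij => ij.1 < ij.2)) := by
    rintro ⟨i, j⟩ hij ⟨k, l⟩ hkl h
    simp only [Finset.coe_filter, Finset.mem_univ, true_and, Set.mem_ofPred_eq] at hij hkl h
    have h1 := congrFun h i
    have h2 := congrFun h j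
    simp only [Pi.sub_apply, eps_apply, if_true, hij.ne, hij.ne', if_false] at h1 h2
    have e1 : i = k := by by_contra h; rw [if_neg h] at h1; split_ifs at h1 <;> omega
    have e2 : j = l := by by_contra h; rw [if_neg h] at h2; split_ifs at h2 <;> omega
    rw [e1, e2]
  have hinj2 : Set.InjOn (fun ij : Fin n × Fin n => (eps ij.1 + eps ij.2 : Wt n))
      ((Finset.univ : Finset (Fin n × Fin n)).filter (fun ij => ij.1 < ij.2)) := by
    rintro ⟨i, j⟩ hij ⟨k, l⟩ hkl h
    simp only [Finset.coe_filter, Finset.mem_univ, true_and, Set.mem_ofPred_eq] at hij hkl h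
    have h1 := congrFun h i
    have h2 := congrFun h j
    have h3 := congrFun h k
    simp only [Pi.add_apply, eps_apply, if_true, hij.ne, hij.ne', hkl.ne, if_false] at h1 h2 h3
    have e1 : i = k ∨ i = l := by by_contra! h; rw [if_neg h.1, if_neg h.2] at h1; omega
    have e2 : j = k ∨ j = l := by by_contra! h; rw [if_neg h.1, if_neg h.2] at h2; omega
    rcases e1 with e1 | e1 <;> rcases e2 with e2 | e2
    · exact absurd (e1.trans e2.symm) hij.ne
    · rw [e1, e2]
    · rw [e1, e2] at hij; exact absurd hkl hij.not_gt
    · exact absurd (e1.trans e2.symm) hij.ne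
  rw [posMed, Finset.sum_union hdisj, Finset.sum_image hinj1, Finset.sum_image hinj2,
    ← Finset.sum_add_distrib, Finset.sum_filter, ← Finset.univ_product_univ, Finset.sum_product]

theorem sum_posLong {M : Type*} [AddCommMonoid M] (f : Wt n → M) :
    ∑ α ∈ posLong n, f α = ∑ i, f (2 • eps i) := by
  rw [posLong, Finset.sum_image]
  intro i _ j _ h
  have := congrFun h i
  simp only [two_smul, Pi.add_apply, eps_apply, if_true] at this
  by_contra hij
  rw [if_neg hij] at this
  omega

theorem rhoLong_apply (lam : Wt n) (i : Fin n) : rhoLong lam i = sgn (lam i) := by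
  rw [rhoLong, sum_posLong, Finset.sum_apply, Finset.sum_eq_single i]
  · rw [coroot_long (isShort_eps i), dotProduct_smul, dot_eps, Pi.smul_apply, eps_apply, if_pos rfl]
    unfold sgn
    simp
  · intro j _ hj
    rw [coroot_long (isShort_eps j), Pi.smul_apply, eps_apply, if_neg hj.symm, smul_zero]
  · simp

theorem rhoMed_apply (lam : Wt n) (i : Fin n) : rhoMed lam i = ∑ p : Fin n, ∑ r : Fin n,
    if p < r then (if i = p then sgn (lam p - lam r) + sgn (lam p + lam r) else 0) +
      (if i = r then sgn (lam p + lam r) - sgn (lam p - lam r) else 0) else 0 := by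
  rw [rhoMed, sum_posMed, Finset.sum_apply]
  refine Finset.sum_congr rfl fun p _ => ?_
  rw [Finset.sum_apply]
  refine Finset.sum_congr rfl fun r _ => ?_
  by_cases h : p < r
  · simp only [h, if_true]
    rw [coroot_med (isMed_sub h.ne), coroot_med (isMed_add h.ne)]
    simp only [Pi.add_apply, Pi.smul_apply, Pi.sub_apply, eps_apply, dotProduct_sub,
      dotProduct_add, dot_eps, smul_eq_mul]
    by_cases h1 : i = p
    · subst h1
      simp [h.ne]
    · by_cases h2 : i = r
      · subst h2
        simp [h.ne']
        ring
      · simp [h1, h2]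
  · simp [h]

theorem sum_pairs (i : Fin n) : (∑ p : Fin n, ∑ r : Fin n,
    if p < r then (if i = p then (1 : ℤ) else 0) else 0) = n - 1 - i.val ∧
    (∑ p : Fin n, ∑ r : Fin n,
    if p < r then (if i = r then (1 : ℤ) else 0) else 0) = i.val := by
  constructor
  · rw [Finset.sum_eq_single i (fun p _ hp => Finset.sum_eq_zero fun r _ => by
      simp [hp.symm]) (by simp)]
    simp only [if_true]
    rw [Finset.sum_boole]
    have : (Finset.univ.filter fun r : Fin n => i < r) = Finset.Ioi i := by ext; simp
    rw [this, Fin.card_Ioi]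
    have := i.isLt
    omega
  · rw [Finset.sum_comm, Finset.sum_eq_single i (fun p _ hp => Finset.sum_eq_zero fun r _ => by
      simp [hp.symm]) (by simp)]
    simp only [if_true]
    rw [Finset.sum_boole]
    have : (Finset.univ.filter fun r : Fin n => r < i) = Finset.Iio i := by ext; simp
    rw [this, Fin.card_Iio]

theorem rhoMed_zero (i : Fin n) : rhoMed (0 : Wt n) i = 2 * (n - 1 - i.val) := by
  rw [rhoMed_apply, ← (sum_pairs i).1, Finset.mul_sum]
  refine Finset.sum_congr rfl fun p _ => ?_
  rw [Finset.mul_sum]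
  refine Finset.sum_congr rfl fun r _ => ?_
  simp only [Pi.zero_apply, add_zero, sgn, le_refl, if_true, sub_self]
  split_ifs <;> norm_num

/-- The absolute value of a coordinate of `ρ_m(λ)` is even and at most `2 (n - 1)`, because in the
sum defining it each pair of roots `ε_i ± ε_p` or `ε_p ± ε_i` contributes `0` or `2 sgn λ_i`. -/
theorem rhoMed_eq_mul (lam : Wt n) (i : Fin n) :
    ∃ k : ℕ, k ≤ n - 1 ∧ rhoMed lam i = sgn (lam i) * (2 * k) := by
  have hn : 1 ≤ n := by have := i.isLt; omega
  suffices h : ∃ k : ℤ, 0 ≤ k ∧ k ≤ n - 1 ∧ rhoMed lam i = sgn (lam i) * (2 * k) by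
    obtain ⟨k, h0, h1, h2⟩ := h
    exact ⟨k.toNat, by omega, by rw [h2, Int.toNat_of_nonneg h0]⟩
  have hterm : ∀ p r : Fin n, ∃ k : ℤ, 0 ≤ k ∧
      k ≤ (if p < r then (if i = p then (1 : ℤ) else 0) else 0) +
        (if p < r then (if i = r then (1 : ℤ) else 0) else 0) ∧
      (if p < r then (if i = p then sgn (lam p - lam r) + sgn (lam p + lam r) else 0) +
      (if i = r then sgn (lam p + lam r) - sgn (lam p - lam r) else 0) else 0) =
        sgn (lam i) * (2 * k) := by
    intro p r
    by_cases h : p < r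
    · simp only [h, if_true]
      by_cases h1 : i = p
      · subst h1
        simp only [if_true, h.ne, if_false, add_zero]
        by_cases h2 : lam i - lam r < 0 ↔ lam i + lam r < 0
        · refine ⟨1, by norm_num, by norm_num, ?_⟩
          unfold sgn; split_ifs <;> omega
        · refine ⟨0, by norm_num, by norm_num, ?_⟩
          unfold sgn; split_ifs <;> omega
      · by_cases h2 : i = r
        · subst h2
          simp only [if_true, h1, if_false, zero_add]
          by_cases h2 : lam p - lam i < 0 ↔ lam p + lam i < 0
          · refine ⟨0, by norm_num, by norm_num, ?_⟩
            unfold sgn; split_ifs <;> omega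
          · refine ⟨1, by norm_num, by norm_num, ?_⟩
            unfold sgn; split_ifs <;> omega
        · exact ⟨0, le_rfl, by simp [h1, h2], by simp [h1, h2]⟩
    · exact ⟨0, le_rfl, by simp [h], by simp [h]⟩
  choose k hk0 hk1 hk2 using hterm
  refine ⟨∑ p, ∑ r, k p r, Finset.sum_nonneg fun p _ => Finset.sum_nonneg fun r _ => hk0 p r,
    ?_, ?_⟩
  · calc ∑ p, ∑ r, k p r ≤ _ := Finset.sum_le_sum fun p _ => Finset.sum_le_sum fun r _ => hk1 p r
      _ = (n : ℤ) - 1 := by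
        simp only [Finset.sum_add_distrib]
        rw [(sum_pairs i).1, (sum_pairs i).2]
        ring
  · rw [rhoMed_apply, Finset.mul_sum, Finset.mul_sum]
    refine Finset.sum_congr rfl fun p _ => ?_
    rw [Finset.mul_sum, Finset.mul_sum]
    exact Finset.sum_congr rfl fun r _ => hk2 p r

/-- The genericity of the parameters that is needed for the spectral points `γ_λ` to be
different. -/
structure Params.Generic (P : Params) (n : ℕ) : Prop extends P.Nondeg where
  q_pow : ∀ k : ℤ, P.q ^ k = 1 → k = 0
  gen1 : ∀ k : ℕ, 1 ≤ k → k < n → ∀ m : ℤ, P.t ^ (2 * k) ≠ P.q ^ m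
  gen2 : ∀ k : ℕ, k ≤ 2 * n - 2 → ∀ m : ℤ, (P.t0 * P.tn) ^ 2 * P.t ^ (2 * k) ≠ P.q ^ m

theorem Params.Nondeg.q_ne {P : Params} (hP : P.Nondeg) : P.q ≠ 0 := pow_ne_zero 2 hP.qh

theorem gam_ne_zero {P : Params} (hP : P.Nondeg) (lam : Wt n) (i : Fin n) : P.gam lam i ≠ 0 := by
  have := hP.t0; have := hP.tn; have := hP.t; have := hP.q_ne
  simp only [Params.gam]
  positivity

theorem gam_eq {P : Params} (lam : Wt n) (i : Fin n) : ∃ k : ℕ, k ≤ n - 1 ∧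
    P.gam lam i = ((P.t0 * P.tn) * P.t ^ (2 * k)) ^ sgn (lam i) * P.q ^ lam i := by
  obtain ⟨k, hk, h⟩ := rhoMed_eq_mul lam i
  refine ⟨k, hk, ?_⟩
  rw [Params.gam, rhoLong_apply, h, mul_zpow, mul_zpow]
  congr 2
  rw [mul_comm (sgn _), zpow_mul]
  norm_cast

/-- Two coordinates are compared by `gen2` if the signs of the weights differ, by `gen1` if not. -/
theorem gam_injective {P : Params} (hP : P.Generic n) : Function.Injective (P.gam (n := n)) := by
  have ht0 := hP.t0; have htn := hP.tn; have ht := hP.t; have hq := hP.toNondeg.q_ne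
  have hX : P.t0 * P.tn ≠ 0 := mul_ne_zero ht0 htn
  intro lam mu h
  funext i
  have hi := congrFun h i
  have hn : 1 ≤ n := by have := i.isLt; omega
  obtain ⟨k, hk, e1⟩ := gam_eq (P := P) lam i
  obtain ⟨l, hl, e2⟩ := gam_eq (P := P) mu i
  rw [e1, e2] at hi
  -- coordinates of different signs
  have hcross : ∀ (k l : ℕ) (a b : ℤ), k ≤ n - 1 → l ≤ n - 1 →
      (P.t0 * P.tn * P.t ^ (2 * k)) ^ (1 : ℤ) * P.q ^ a =
      (P.t0 * P.tn * P.t ^ (2 * l)) ^ (-1 : ℤ) * P.q ^ b → False := by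
    intro k l a b hk hl h
    refine hP.gen2 (k + l) (by omega) (b - a) ?_
    rw [zpow_sub₀ hq, eq_div_iff (zpow_ne_zero _ hq)]
    rw [zpow_one, zpow_neg_one] at h
    have h2 : P.t0 * P.tn * P.t ^ (2 * l) ≠ 0 := mul_ne_zero hX (pow_ne_zero _ ht)
    rw [← mul_right_inj' (inv_ne_zero h2), ← h]
    field_simp
    ring
  -- coordinates of equal signs
  have hsame : ∀ (k l : ℕ) (a b : ℤ), k ≤ n - 1 → l ≤ n - 1 →
      P.t ^ (2 * k) * P.q ^ a = P.t ^ (2 * l) * P.q ^ b → a = b := by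
    have hlt : ∀ (k l : ℕ) (a b : ℤ), k < l → l ≤ n - 1 →
      P.t ^ (2 * k) * P.q ^ a = P.t ^ (2 * l) * P.q ^ b → False := by
      intro k l a b hk hl h
      refine hP.gen1 (l - k) (by omega) (by omega) (a - b) ?_
      rw [zpow_sub₀ hq, eq_div_iff (zpow_ne_zero _ hq)]
      apply mul_left_cancel₀ (pow_ne_zero (2 * k) ht)
      rw [← mul_assoc, ← pow_add, h]
      congr 2
      omega
    intro k l a b hk hl h
    rcases lt_trichotomy k l with h1 | rfl | h1
    · exact (hlt k l a b h1 hl h).elim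
    · have h2 := mul_left_cancel₀ (pow_ne_zero (2 * k) ht) h
      have h3 := hP.q_pow (a - b) (by rw [zpow_sub₀ hq, h2, div_self (zpow_ne_zero _ hq)])
      omega
    · exact (hlt l k b a h1 hk h.symm).elim
  rcases sgn_eq (lam i) with h1 | h1 <;> rcases sgn_eq (mu i) with h2 | h2 <;> rw [h1, h2] at hi
  · rw [zpow_one, zpow_one, mul_assoc (P.t0 * P.tn), mul_assoc (P.t0 * P.tn)] at hi
    exact hsame k l _ _ hk hl (mul_left_cancel₀ hX hi)
  · exact (hcross k l _ _ hk hl hi).elim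
  · exact (hcross l k _ _ hl hk hi.symm).elim
  · refine (hsame l k _ _ hl hk ?_)
    rw [zpow_neg_one, zpow_neg_one] at hi
    have h3 : P.t0 * P.tn * P.t ^ (2 * l) ≠ 0 := mul_ne_zero hX (pow_ne_zero _ ht)
    have h4 : P.t0 * P.tn * P.t ^ (2 * k) ≠ 0 := mul_ne_zero hX (pow_ne_zero _ ht)
    rw [inv_mul_eq_div, inv_mul_eq_div, div_eq_div_iff h4 h3] at hi
    apply mul_left_cancel₀ hX
    linear_combination hi

end Spectral

section SpectralSteps

variable {m : ℕ}

/-- A simple reflection moves the set of roots positive at `λ` to that of the reflected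
weight. -/
theorem PosAt.refl {j : ℕ} (hj : j ≤ m + 1) {lam β : Wt (m + 1)} (hβ : IsRoot β)
    (hl : 0 < valAt lam (simpleRoot (m + 1) j)) (h : PosAt lam β) :
    PosAt (reflAt (simpleRoot (m + 1) j) lam)
      (β - (β ⬝ᵥ coroot (simpleRoot (m + 1) j).1) • (simpleRoot (m + 1) j).1) := by
  have ha := isRoot_simpleRoot (m := m) hj
  have hval : reflAt (simpleRoot (m + 1) j) lam ⬝ᵥ
      (β - (β ⬝ᵥ coroot (simpleRoot (m + 1) j).1) • (simpleRoot (m + 1) j).1) =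
      lam ⬝ᵥ β - (simpleRoot (m + 1) j).2 / 2 * (β ⬝ᵥ coroot (simpleRoot (m + 1) j).1) := by
    rw [reflAt, valAt]
    simp only [add_dotProduct, dotProduct_sub, smul_dotProduct, dotProduct_smul, smul_eq_mul,
      dotProduct_comm (coroot (simpleRoot (m + 1) j).1), dot_coroot_self ha]
    ring
  unfold PosAt
  rw [hval, simpleRoot_snd hj]
  by_cases hj0 : j = 0
  · subst hj0
    rw [if_pos rfl, coroot_simpleRoot_zero, dotProduct_neg, dot_eps]
    have hl0 : 0 ≤ lam 0 := by
      rw [valAt, simpleRoot_snd hj, if_pos rfl, simpleRoot_zero (by omega)] at hl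
      simp only [smul_neg, dotProduct_neg, dotProduct_smul, dot_eps] at hl
      change 0 < 2 / 2 - -(2 • lam 0) at hl
      rw [two_smul] at hl
      omega
    have ha0 : (simpleRoot (m + 1) 0).1 = -(2 • eps 0) := by
      rw [simpleRoot_zero (by omega)]; simp
    rw [ha0]
    have hnorm : (2 : ℤ) / 2 * -β 0 = -β 0 := by omega
    rw [hnorm]
    rcases hβ with hβ | hβ
    · obtain ⟨i, k, hik, hh⟩ := isMed_iff.1 hβ
      have hb : (0 ≤ β 0) ∨ (β 0 = -1 ∧ ∃ p : Fin (m + 1), 0 < p ∧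
          (β = -eps 0 - eps p ∨ β = -eps 0 + eps p)) := by
        by_cases hi : i = 0
        · subst hi
          have hk : 0 < k := Fin.pos_iff_ne_zero.2 hik.symm
          rcases hh with rfl | rfl | rfl
          · left; simp [eps_apply, hik]
          · left; simp [eps_apply, hik]
          · right; exact ⟨by simp [eps_apply, hik], k, hk, Or.inl (by abel)⟩
        · by_cases hk : k = 0
          · subst hk
            have hi : 0 < i := Fin.pos_iff_ne_zero.2 hi
            rcases hh with rfl | rfl | rfl
            · right; exact ⟨by simp [eps_apply, hik.symm], i, hi, Or.inr (by abel)⟩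
            · left; simp [eps_apply, hik.symm]
            · right; exact ⟨by simp [eps_apply, hik.symm], i, hi, Or.inl (by abel)⟩
          · left
            rcases hh with rfl | rfl | rfl <;> simp [eps_apply, Ne.symm hi, Ne.symm hk]
      rcases hb with hb | ⟨hb, p, hp, hh⟩
      · rcases hb.eq_or_lt with hb | hb
        · rw [← hb] at *
          simpa [PosAt] using h
        · left; rcases h with h | h <;> omega
      · have hl2 : 0 < lam ⬝ᵥ β := by
          rcases h with h | ⟨_, h2⟩
          · exact h
          · have := dot_htVec_pos h2
            have hp' : 0 < p.val := hp
            rcases hh with rfl | rfl <;>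
              simp only [sub_dotProduct, neg_dotProduct, add_dotProduct, eps_dot, htVec,
                Fin.val_zero] at this <;> omega
        rcases lt_or_eq_of_le (show 0 ≤ lam ⬝ᵥ β - -β 0 by omega) with h0 | h0
        · exact Or.inl h0
        · refine Or.inr ⟨h0.symm, mem_posRoots.2 (Or.inl (mem_posMed.2 ⟨0, p, hp, ?_⟩))⟩
          rw [hb]
          rcases hh with rfl | rfl
          · left; module
          · right; module
    · obtain ⟨i, rfl | rfl⟩ := isLong_iff.1 hβ
      · by_cases hi : i = 0
        · subst hi
          have e : (2 • eps (0 : Fin (m + 1))) 0 = 2 := by simp [eps_apply]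
          rw [e]
          left; rcases h with h | h <;> omega
        · have e : (2 • eps i) (0 : Fin (m + 1)) = 0 := by simp [eps_apply, Ne.symm hi]
          rw [e]
          simpa [PosAt] using h
      · by_cases hi : i = 0
        · subst hi
          exfalso
          have e : (-(2 • eps (0 : Fin (m + 1)))) ∉ posRoots (m + 1) := fun h => by
            have := dot_htVec_pos h
            simp only [two_smul, neg_dotProduct, add_dotProduct, eps_dot, htVec] at this
            simp at this; omega
          have e2 : lam ⬝ᵥ (-(2 • eps 0)) = -(2 * lam 0) := by
            rw [dotProduct_neg, dotProduct_smul, dot_eps]; simp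
          rcases h with h | h
          · omega
          · exact e h.2
        · have e : (-(2 • eps i)) (0 : Fin (m + 1)) = 0 := by simp [eps_apply, Ne.symm hi]
          rw [e]
          simpa [PosAt] using h
  · rw [if_neg hj0]
    simp only [Int.zero_ediv, zero_mul, sub_zero]
    refine h.imp_right fun ⟨h1, h2⟩ => ⟨h1, ?_⟩
    have hpos : ((β, 0) : Aff (m + 1)) ∈ affRPos (m + 1) :=
      ⟨⟨hβ, ⟨0, rfl⟩⟩, Or.inl ⟨h2, rfl⟩⟩
    have hne : ((β, 0) : Aff (m + 1)) ≠ simpleRoot (m + 1) j := fun he => by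
      rw [valAt, simpleRoot_snd hj, if_neg hj0, ← he] at hl
      simp [h1] at hl
    have := (refl_simpleRoot_mem hj hpos hne).2
    rcases this with h3 | h3
    · exact h3.1
    · rw [refl_apply, simpleRoot_snd hj, if_neg hj0] at h3
      simp at h3

theorem posAtMed_refl {j : ℕ} (hj : j ≤ m + 1) {lam : Wt (m + 1)}
    (hl : 0 < valAt lam (simpleRoot (m + 1) j)) :
    posAtMed (reflAt (simpleRoot (m + 1) j) lam) = (posAtMed lam).image fun β =>
      β - (β ⬝ᵥ coroot (simpleRoot (m + 1) j).1) • (simpleRoot (m + 1) j).1 := by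
  obtain ⟨w, hw, -⟩ := exists_actWt_eq_refl (isRoot_simpleRoot (m := m) hj)
  symm
  refine Finset.eq_of_subset_of_card_le ?_ ?_
  · intro β hβ
    obtain ⟨γ, hγ, rfl⟩ := Finset.mem_image.1 hβ
    rw [mem_posAtMed] at hγ ⊢
    exact ⟨by rw [hw]; exact hγ.1.actWt w, hγ.2.refl hj (Or.inl hγ.1) hl⟩
  · rw [Finset.card_image_of_injective, card_posAtMed, card_posAtMed]
    intro a b h
    simp only [hw] at h
    rw [← invW_actWt w a, h, invW_actWt]

theorem posAtLong_refl {j : ℕ} (hj : j ≤ m + 1) {lam : Wt (m + 1)}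
    (hl : 0 < valAt lam (simpleRoot (m + 1) j)) :
    posAtLong (reflAt (simpleRoot (m + 1) j) lam) = (posAtLong lam).image fun β =>
      β - (β ⬝ᵥ coroot (simpleRoot (m + 1) j).1) • (simpleRoot (m + 1) j).1 := by
  obtain ⟨w, hw, -⟩ := exists_actWt_eq_refl (isRoot_simpleRoot (m := m) hj)
  symm
  refine Finset.eq_of_subset_of_card_le ?_ ?_
  · intro β hβ
    obtain ⟨γ, hγ, rfl⟩ := Finset.mem_image.1 hβ
    rw [mem_posAtLong] at hγ ⊢
    exact ⟨by rw [hw]; exact hγ.1.actWt w, hγ.2.refl hj (Or.inr hγ.1) hl⟩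
  · rw [Finset.card_image_of_injective, card_posAtLong, card_posAtLong]
    intro a b h
    simp only [hw] at h
    rw [← invW_actWt w a, h, invW_actWt]

theorem refl_injective {j : ℕ} (hj : j ≤ m + 1) : Function.Injective fun β : Wt (m + 1) =>
    β - (β ⬝ᵥ coroot (simpleRoot (m + 1) j).1) • (simpleRoot (m + 1) j).1 := by
  obtain ⟨w, hw, -⟩ := exists_actWt_eq_refl (isRoot_simpleRoot (m := m) hj)
  intro a b h
  simp only [hw] at h
  rw [← invW_actWt w a, h, invW_actWt]

/-- Along an upward step, `ρ_m` and `ρ_l` are moved by the linear part of the affine reflection. -/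
theorem rho_refl {j : ℕ} (hj : j ≤ m + 1) {lam : Wt (m + 1)}
    (hl : 0 < valAt lam (simpleRoot (m + 1) j)) :
    rhoMed (reflAt (simpleRoot (m + 1) j) lam) = rhoMed lam -
      (rhoMed lam ⬝ᵥ (simpleRoot (m + 1) j).1) • coroot (simpleRoot (m + 1) j).1 ∧
    rhoLong (reflAt (simpleRoot (m + 1) j) lam) = rhoLong lam -
      (rhoLong lam ⬝ᵥ (simpleRoot (m + 1) j).1) • coroot (simpleRoot (m + 1) j).1 := by
  have ha := isRoot_simpleRoot (m := m) hj
  constructor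
  · rw [rhoMed_eq, posAtMed_refl hj hl, Finset.sum_image (refl_injective hj).injOn, rhoMed_eq]
    rw [Finset.sum_congr rfl fun β hβ => coroot_refl ha (Or.inl (mem_posAtMed.1 hβ).1)]
    rw [Finset.sum_sub_distrib, ← Finset.sum_smul, sum_dotProduct]
  · rw [rhoLong_eq, posAtLong_refl hj hl, Finset.sum_image (refl_injective hj).injOn, rhoLong_eq]
    rw [Finset.sum_congr rfl fun β hβ => coroot_refl ha (Or.inr (mem_posAtLong.1 hβ).1)]
    rw [Finset.sum_sub_distrib, ← Finset.sum_smul, sum_dotProduct]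

variable {P : Params}

theorem gam_reflAt_mid {j : ℕ} (hj : j + 1 < m + 1) {lam : Wt (m + 1)}
    (hl : 0 < valAt lam (simpleRoot (m + 1) (j + 1))) :
    P.gam (reflAt (simpleRoot (m + 1) (j + 1)) lam) =
      P.gam lam ∘ Equiv.swap ⟨j, by omega⟩ ⟨j + 1, hj⟩ := by
  obtain ⟨h1, h2⟩ := rho_refl (by omega) hl
  have hsw : ∀ (μ : Wt (m + 1)) (i : Fin (m + 1)),
      (μ - (μ ⬝ᵥ (simpleRoot (m + 1) (j + 1)).1) • coroot (simpleRoot (m + 1) (j + 1)).1) i =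
      μ (Equiv.swap ⟨j, by omega⟩ ⟨j + 1, hj⟩ i) := by
    intro μ i
    rw [simpleRoot_mid j hj, coroot_med (isMed_sub (by simp))]
    simp only [dotProduct_sub, dot_eps, Pi.sub_apply, Pi.smul_apply, eps_apply, smul_eq_mul]
    by_cases h1 : i = ⟨j, by omega⟩
    · subst h1; simp
    by_cases h2 : i = ⟨j + 1, hj⟩
    · subst h2; simp
    · rw [if_neg h1, if_neg h2, Equiv.swap_apply_of_ne_of_ne h1 h2]; ring
  have h3 : reflAt (simpleRoot (m + 1) (j + 1)) lam =
      lam - (lam ⬝ᵥ (simpleRoot (m + 1) (j + 1)).1) • coroot (simpleRoot (m + 1) (j + 1)).1 := by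
    rw [reflAt, valAt, simpleRoot_snd (by omega), if_neg (by omega)]; module
  funext i
  simp only [Params.gam, Function.comp_apply]
  rw [h1, h2, hsw, hsw, h3, hsw]

theorem gam_reflAt_last {lam : Wt (m + 1)}
    (hl : 0 < valAt lam (simpleRoot (m + 1) (m + 1))) :
    P.gam (reflAt (simpleRoot (m + 1) (m + 1)) lam) =
      Function.update (P.gam lam) (Fin.last m) (P.gam lam (Fin.last m))⁻¹ := by
  obtain ⟨h1, h2⟩ := rho_refl (by omega) hl
  have hsw : ∀ (μ : Wt (m + 1)) (i : Fin (m + 1)),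
      (μ - (μ ⬝ᵥ (simpleRoot (m + 1) (m + 1)).1) • coroot (simpleRoot (m + 1) (m + 1)).1) i =
      if i = Fin.last m then -μ i else μ i := by
    intro μ i
    rw [simpleRoot_last, coroot_long (isShort_eps _)]
    simp only [dotProduct_smul, dot_eps, Pi.sub_apply, Pi.smul_apply, eps_apply, smul_eq_mul]
    split_ifs with h
    · subst h; simp; ring
    · simp
  have h3 : reflAt (simpleRoot (m + 1) (m + 1)) lam =
      lam - (lam ⬝ᵥ (simpleRoot (m + 1) (m + 1)).1) • coroot (simpleRoot (m + 1) (m + 1)).1 := by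
    rw [reflAt, valAt, simpleRoot_snd (by omega), if_neg (by omega)]; module
  funext i
  by_cases hi : i = Fin.last m
  · subst hi
    rw [Function.update_self]
    simp only [Params.gam]
    rw [h1, h2, hsw, hsw, h3, hsw, if_pos rfl, if_pos rfl, if_pos rfl]
    simp only [zpow_neg, mul_inv]
  · rw [Function.update_of_ne hi]
    simp only [Params.gam]
    rw [h1, h2, hsw, hsw, h3, hsw, if_neg hi, if_neg hi, if_neg hi]

theorem valAt_zero (lam : Wt (m + 1)) : valAt lam (simpleRoot (m + 1) 0) = 1 + 2 * lam 0 := by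
  rw [valAt, simpleRoot_snd (by omega), if_pos rfl, simpleRoot_zero (by omega)]
  simp only [dotProduct_smul, dotProduct_neg, dot_eps]
  change 2 / 2 - 2 • -lam 0 = _
  rw [two_smul]
  omega

theorem gam_reflAt_zero (hq : P.qh ≠ 0) {lam : Wt (m + 1)}
    (hl : 0 < valAt lam (simpleRoot (m + 1) 0)) :
    P.gam (reflAt (simpleRoot (m + 1) 0) lam) =
      Function.update (P.gam lam) 0 (P.qh ^ 2 * P.gam lam 0)⁻¹ := by
  obtain ⟨h1, h2⟩ := rho_refl (by omega) hl
  have hsw : ∀ (μ : Wt (m + 1)) (i : Fin (m + 1)),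
      (μ - (μ ⬝ᵥ (simpleRoot (m + 1) 0).1) • coroot (simpleRoot (m + 1) 0).1) i =
      if i = 0 then -μ i else μ i := by
    intro μ i
    rw [simpleRoot_zero (by omega), coroot_long (isShort_eps _).neg]
    simp only [dotProduct_smul, dotProduct_neg, dot_eps, Pi.sub_apply, Pi.smul_apply, Pi.neg_apply,
      eps_apply, smul_eq_mul]
    change μ i - (2 • -μ 0) * (-if i = 0 then 1 else 0) = _
    split_ifs with h
    · subst h; simp; ring
    · simp
  have h3 : ∀ i, reflAt (simpleRoot (m + 1) 0) lam i = if i = 0 then -1 - lam i else lam i := by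
    intro i
    rw [reflAt, valAt_zero, coroot_simpleRoot_zero]
    simp only [Pi.add_apply, Pi.smul_apply, Pi.neg_apply, eps_apply, smul_eq_mul]
    split_ifs with h
    · subst h; ring
    · ring
  funext i
  by_cases hi : i = 0
  · subst hi
    rw [Function.update_self]
    simp only [Params.gam]
    rw [h1, h2, hsw, hsw, h3, if_pos rfl, if_pos rfl, if_pos rfl]
    have hq' : P.q ≠ 0 := pow_ne_zero 2 hq
    rw [sub_eq_add_neg, zpow_add₀ hq', ← Params.q]
    simp only [zpow_neg, mul_inv, zpow_one]
    ring
  · rw [Function.update_of_ne hi]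
    simp only [Params.gam]
    rw [h1, h2, hsw, hsw, h3, if_neg hi, if_neg hi, if_neg hi]

end SpectralSteps

/-! ### The non-symmetric polynomials -/

section Existence

variable {m : ℕ} {P : Params}

/-- `F` is the monic joint eigenvector of degree `λ`, with its support controlled by the Bruhat
order. -/
structure IsMonicEigen (P : Params) {n : ℕ} (lam : Wt n) (F : Laurent n) : Prop where
  supp : F ∈ suppIn {μ | BLE μ lam}
  coeff : F.coeff lam = 1
  eigen : IsEigen P F (P.gam lam)

theorem T_one (hP : P.Nondeg) {j : ℕ} (hj : j ≤ m + 1) :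
    P.T (m + 1) j (AddMonoidAlgebra.single 0 1) =
      P.mult (simpleRoot (m + 1) j) • (AddMonoidAlgebra.single 0 1 : Laurent (m + 1)) := by
  obtain ⟨c, h, r, h1, h2, h3, h4, h5, h6⟩ := exists_simpleRoot_data hP hj
  rw [T_single P j 0 h1]
  simp [Params.mon]

theorem list_prod_apply {V : Type*} [AddCommGroup V] [Module ℂ V] (A : ℕ → Module.End ℂ V)
    (c : ℕ → ℂ) (v : V) (l : List ℕ) (h : ∀ j ∈ l, A j v = c j • v) :
    (l.map A).prod v = (l.map c).prod • v := by
  induction l with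
  | nil => simp
  | cons j l ih =>
    rw [List.map_cons, List.prod_cons, List.map_cons, List.prod_cons, Module.End.mul_apply,
      ih fun k hk => h k (List.mem_cons_of_mem _ hk), map_smul, h j List.mem_cons_self, smul_smul,
      mul_comm]

theorem prod_map_eq_pow {l : List ℕ} {c : ℕ → ℂ} {t : ℂ} (h : ∀ j ∈ l, c j = t) :
    (l.map c).prod = t ^ l.length := by
  rw [List.map_congr_left h, List.map_const', List.prod_replicate]

theorem isEigen_one (hP : P.Nondeg) :
    IsEigen P (AddMonoidAlgebra.single 0 1 : Laurent (m + 1)) (P.gam 0) := by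
  intro i
  have hi := i.isLt
  have ht := hP.t
  have hinv : ∀ j ∈ List.range' 1 (i.val + 1 - 1), Ring.inverse (P.T (m + 1) j)
      (AddMonoidAlgebra.single 0 1) =
      P.t⁻¹ • (AddMonoidAlgebra.single 0 1 : Laurent (m + 1)) := by
    intro j hj
    rw [List.mem_range'_1] at hj
    have h1 := T_one (m := m) hP (j := j) (by omega)
    obtain ⟨k, rfl⟩ : ∃ k, j = k + 1 := ⟨j - 1, by omega⟩
    rw [mult_simpleRoot_mid P (by omega)] at h1
    rw [← Tu_val hP (m := m) (by omega)] at h1 ⊢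
    rw [Ring.inverse_unit]
    exact units_inv_apply_of_apply _ ht h1
  have hmult : ∀ k, k + 1 < m + 1 → P.mult (simpleRoot (m + 1) (k + 1)) = P.t :=
    fun k hk => mult_simpleRoot_mid P hk
  rw [Params.Y, Module.End.mul_apply, Module.End.mul_apply,
    list_prod_apply _ (fun _ => P.t⁻¹) _ _ hinv, map_smul,
    list_prod_apply _ (fun j => P.mult (simpleRoot (m + 1) j)) _ _ (fun j hj => T_one hP (by
      rw [List.mem_reverse, List.mem_range] at hj; omega)), map_smul, map_smul,
    list_prod_apply _ (fun j => P.mult (simpleRoot (m + 1) j)) _ _ (fun j hj => T_one hP (by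
      rw [List.mem_range'_1] at hj; omega)), smul_smul, smul_smul]
  congr 1
  have e1 : ((List.range' (i.val + 1) (m + 1 + 1 - (i.val + 1))).map
      fun j => P.mult (simpleRoot (m + 1) j)).prod = P.t ^ (m - i.val) * P.tn := by
    rw [show m + 1 + 1 - (i.val + 1) = (m - i.val) + 1 by omega, List.range'_concat,
      List.map_append, List.prod_append, prod_map_eq_pow (t := P.t), List.length_range']
    · simp only [List.map_cons, List.map_nil, List.prod_cons, List.prod_nil, mul_one, one_mul]
      rw [show i.val + 1 + (m - i.val) = m + 1 by omega, mult_simpleRoot_last]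
    · intro j hj
      rw [List.mem_range'_1] at hj
      obtain ⟨k, rfl⟩ : ∃ k, j = k + 1 := ⟨j - 1, by omega⟩
      exact hmult k (by omega)
  have e2 : ((List.range (m + 1)).reverse.map
      fun j => P.mult (simpleRoot (m + 1) j)).prod = P.t ^ m * P.t0 := by
    rw [List.map_reverse, List.prod_reverse, List.range_succ_eq_map, List.map_cons, List.prod_cons,
      mult_simpleRoot_zero, List.map_map, prod_map_eq_pow (t := P.t), List.length_range, mul_comm]
    intro j hj
    rw [List.mem_range] at hj
    exact hmult j (by omega)
  rw [e1, e2, prod_map_eq_pow (t := P.t⁻¹) (fun _ _ => rfl), List.length_range', Params.gam,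
    rhoLong_apply, rhoMed_zero]
  simp only [Pi.zero_apply, sgn, le_refl, if_true, zpow_one, zpow_zero, mul_one]
  have e3 : (2 : ℤ) * (((m + 1 : ℕ) : ℤ) - 1 - (i.val : ℤ)) =
      (m - i.val : ℕ) + (m : ℕ) - (i.val : ℕ) := by omega
  rw [e3, zpow_sub₀ ht, zpow_add₀ ht, zpow_natCast, zpow_natCast, zpow_natCast, inv_pow,
    Nat.add_sub_cancel]
  field_simp

theorem isMonicEigen_zero (hP : P.Nondeg) :
    IsMonicEigen P (0 : Wt (m + 1)) (AddMonoidAlgebra.single 0 1) where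
  supp := single_mem_suppIn (S := {μ | BLE μ 0}) (BLE.refl 0) 1
  coeff := by simp
  eigen := isEigen_one hP

/-- The operator whose intertwining property produces the eigenvector of degree `s_j λ`. -/
noncomputable def stepOp (P : Params) (m j : ℕ) : Module.End ℂ (Laurent (m + 2)) :=
  if j = 0 then Vu P (m + 1) else P.T (m + 2) j

/-- The scalar to be subtracted from `stepOp`, in terms of the spectral point. -/
noncomputable def stepScalar (P : Params) (m j : ℕ) (g : Fin (m + 2) → ℂ) : ℂ :=
  if j = 0 then cLong P.tnv P.t0v (P.qh * g 0)
  else if h : j < m + 2 then cMed P.t (g ⟨j, h⟩) (g ⟨j - 1, by omega⟩)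
  else cLong P.tn P.t0 (g (Fin.last (m + 1)))⁻¹

/-- The coefficient of the leading monomial after one step. -/
noncomputable def stepLead (P : Params) (m j : ℕ) (lam : Wt (m + 2)) : ℂ :=
  if j = 0 then (P.tn * P.t ^ rhoMed lam 0)⁻¹ else P.mult (simpleRoot (m + 2) j)

theorem stepLead_ne (hP : P.Nondeg) {j : ℕ} (hj : j ≤ m + 2) (lam : Wt (m + 2)) :
    stepLead P m j lam ≠ 0 := by
  unfold stepLead
  split_ifs
  · exact inv_ne_zero (mul_ne_zero hP.tn (zpow_ne_zero _ hP.t))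
  · exact mult_simpleRoot_ne hP hj

theorem stepOp_apply (hP : P.Nondeg) {j : ℕ} {lam : Wt (m + 2)}
    {F : Laurent (m + 2)} (hF : IsEigen P F (P.gam lam)) :
    stepOp P m j F = (if j = 0 then (P.gam lam 0)⁻¹ else 1) • raiseOp P (m + 1) j F := by
  unfold stepOp raiseOp
  split_ifs with h
  · have h1 := V_mul_Y (n := m + 2) (T := Tu P (m + 1)) (X := Xu (m + 1)) (by omega)
    have h2 : (Vu P (m + 1) : Module.End ℂ (Laurent (m + 2))) * P.Y (m + 2) 1 =
        mulX (-eps 0) * P.T (m + 2) 0 := by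
      rw [← Yu_val hP le_rfl (by omega), ← Units.val_mul, Vu, Yu, h1, Units.val_mul,
        Tu_val hP (by omega)]
      rfl
    have h3 : P.Y (m + 2) 1 F = P.gam lam 0 • F := hF 0
    rw [← h2, Module.End.mul_apply, h3, map_smul, smul_smul,
      inv_mul_cancel₀ (gam_ne_zero hP lam 0), one_smul]
  · rw [one_smul]

/-- The denominators of the intertwiner do not vanish, since `γ_{s_j λ} ≠ γ_λ`. -/
theorem isEigen_step (hP : P.Generic (m + 2)) {j : ℕ} (hj : j ≤ m + 2) {lam : Wt (m + 2)}
    (hl : 0 < valAt lam (simpleRoot (m + 2) j)) {F : Laurent (m + 2)}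
    (hF : IsEigen P F (P.gam lam)) :
    IsEigen P (stepOp P m j F - stepScalar P m j (P.gam lam) • F)
      (P.gam (reflAt (simpleRoot (m + 2) j) lam)) := by
  have hne : P.gam (reflAt (simpleRoot (m + 2) j) lam) ≠ P.gam lam := fun h => by
    have := gam_injective hP h
    have h2 := (up_reflAt (simpleRoot_mem (m := m + 1) hj) hl).meas_lt
    rw [this] at h2
    exact h2.false
  revert hl hne
  refine simpleRoot_cases (m := m + 1) (p := fun j => 0 < valAt lam (simpleRoot (m + 2) j) →
    P.gam (reflAt (simpleRoot (m + 2) j) lam) ≠ P.gam lam →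
    IsEigen P (stepOp P m j F - stepScalar P m j (P.gam lam) • F)
      (P.gam (reflAt (simpleRoot (m + 2) j) lam))) ?_ ?_ ?_ hj
  · intro hl hne
    rw [gam_reflAt_zero hP.qh hl] at hne ⊢
    rw [stepOp, if_pos rfl, stepScalar, if_pos rfl]
    refine intertwine_zero hP.toNondeg hF (gam_ne_zero hP.toNondeg _ _) fun h => hne ?_
    rw [Function.update_eq_self_iff, inv_eq_iff_eq_inv]
    apply mul_right_cancel₀ (gam_ne_zero hP.toNondeg lam 0)
    rw [inv_mul_cancel₀ (gam_ne_zero hP.toNondeg lam 0), ← h]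
    ring
  · intro j hj hl hne
    rw [gam_reflAt_mid hj hl] at hne ⊢
    rw [stepOp, if_neg (by omega), stepScalar, if_neg (by omega), dif_pos hj]
    refine intertwine_mid hP.toNondeg hj hF fun h => hne ?_
    funext i
    rw [Function.comp_apply]
    by_cases h1 : i = ⟨j, by omega⟩
    · rw [h1, Equiv.swap_apply_left, h]
    by_cases h2 : i = ⟨j + 1, hj⟩
    · rw [h2, Equiv.swap_apply_right, h]
    · rw [Equiv.swap_apply_of_ne_of_ne h1 h2]
  · intro hl hne
    rw [gam_reflAt_last hl] at hne ⊢
    rw [stepOp, if_neg (by omega), stepScalar, if_neg (by omega), dif_neg (by omega)]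
    refine intertwine_last hP.toNondeg hF (gam_ne_zero hP.toNondeg _ _) fun h => hne ?_
    rw [Function.update_eq_self_iff]
    exact inv_eq_of_mul_eq_one_left (by rw [← pow_two]; exact h)

/-- For `j = 0`, the eigenvalue of `Y_1` relates `V` to the raising operator `V Y_1`. -/
theorem coeff_stepOp (hP : P.Nondeg) {j : ℕ} (hj : j ≤ m + 2) {lam : Wt (m + 2)}
    (hl : 0 < valAt lam (simpleRoot (m + 2) j)) {F : Laurent (m + 2)}
    (hF : IsMonicEigen P lam F) :
    (stepOp P m j F).coeff (reflAt (simpleRoot (m + 2) j) lam) = stepLead P m j lam := by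
  rw [stepOp_apply hP hF.eigen, AddMonoidAlgebra.coeff_smul, Finsupp.smul_apply,
    coeff_raiseOp hP hj hl hF.supp, hF.coeff, mul_one, smul_eq_mul, raiseCoeff, stepLead]
  split_ifs with h
  · subst h
    have hl0 : 0 ≤ lam 0 := by rw [valAt_zero] at hl; omega
    have := hP.t0; have := hP.tn; have := hP.t; have := hP.q_ne
    rw [Params.gam, rhoLong_apply, sgn, if_pos hl0, zpow_one, zpow_one]
    field_simp
  · rw [one_mul]

/-- One step in the construction of the monic eigenvectors. -/
theorem isMonicEigen_step (hP : P.Generic (m + 2)) {j : ℕ} (hj : j ≤ m + 2) {lam : Wt (m + 2)}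
    (hl : 0 < valAt lam (simpleRoot (m + 2) j)) {F : Laurent (m + 2)}
    (hF : IsMonicEigen P lam F) :
    IsMonicEigen P (reflAt (simpleRoot (m + 2) j) lam)
      ((stepLead P m j lam)⁻¹ • (stepOp P m j F - stepScalar P m j (P.gam lam) • F)) where
  supp := by
    refine Submodule.smul_mem _ _ (Submodule.sub_mem _ ?_ (Submodule.smul_mem _ _ ?_))
    · rw [stepOp_apply hP.toNondeg hF.eigen]
      exact Submodule.smul_mem _ _ (raiseOp_mem hP.toNondeg hj hl hF.supp)
    · exact suppIn_mono (fun μ hμ => (BLE.lift hj hμ hl).1) hF.supp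
  coeff := by
    have h0 : F.coeff (reflAt (simpleRoot (m + 2) j) lam) = 0 := by
      by_contra h
      have h1 : BLE _ lam := hF.supp _ h
      have h2 : meas lam < meas (reflAt (simpleRoot (m + 2) j) lam) :=
        (up_reflAt (simpleRoot_mem (m := m + 1) hj) hl).meas_lt
      rcases h1.eq_or_meas_lt with h3 | h3
      · rw [h3] at h2; exact h2.false
      · omega
    rw [AddMonoidAlgebra.coeff_smul, Finsupp.smul_apply, AddMonoidAlgebra.coeff_sub,
      Finsupp.sub_apply, coeff_stepOp hP.toNondeg hj hl hF, AddMonoidAlgebra.coeff_smul,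
      Finsupp.smul_apply, h0, smul_zero, sub_zero, smul_eq_mul,
      inv_mul_cancel₀ (stepLead_ne hP.toNondeg hj lam)]
  eigen := by
    intro i
    rw [map_smul, isEigen_step hP hj hl hF.eigen i, smul_comm]

/-- Every weight is reached from `0` by simple reflections that go up in the Bruhat order. -/
theorem weight_induction {p : Wt (m + 1) → Prop} (h0 : p 0)
    (hs : ∀ (j : ℕ) (lam : Wt (m + 1)), j ≤ m + 1 → 0 < valAt lam (simpleRoot (m + 1) j) → p lam →
      p (reflAt (simpleRoot (m + 1) j) lam)) (lam : Wt (m + 1)) : p lam := by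
  have hN : ∀ (N : ℕ) (lam : Wt (m + 1)), (meas lam).toNat = N → p lam := by
    intro N
    induction N using Nat.strong_induction_on with
    | _ N ih =>
      intro lam hN
      by_cases h : ∃ j ≤ m + 1, valAt lam (simpleRoot (m + 1) j) < 0
      · obtain ⟨j, hj, hv⟩ := h
        have ha := simpleRoot_mem (m := m) hj
        have hv' : 0 < valAt (reflAt (simpleRoot (m + 1) j) lam) (simpleRoot (m + 1) j) := by
          rw [valAt_reflAt ha.1]; omega
        have h1 := hs j _ hj hv'
        have h2 := (up_reflAt ha hv').meas_lt
        rw [reflAt_reflAt ha.1] at h1 h2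
        have := meas_nonneg (reflAt (simpleRoot (m + 1) j) lam)
        exact h1 (ih _ (by omega) _ rfl)
      · push Not at h
        -- only the zero weight lies in the closed fundamental alcove
        have hz : lam = 0 := by
          have hlast := h (m + 1) le_rfl
          have hzero := h 0 (by omega)
          rw [valAt_zero] at hzero
          rw [valAt, simpleRoot_snd le_rfl, if_neg (by omega), simpleRoot_last, dotProduct_smul,
            dot_eps, two_smul] at hlast
          have hmono : ∀ k (hk : k < m + 1), lam 0 ≤ lam ⟨k, hk⟩ := by
            intro k
            induction k with
            | zero => intro _; exact le_rfl
            | succ k ih =>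
              intro hk
              have h1 := h (k + 1) (by omega)
              rw [valAt, simpleRoot_snd (by omega), if_neg (by omega), simpleRoot_mid k hk,
                dotProduct_sub, dot_eps, dot_eps] at h1
              have := ih (by omega)
              omega
          have hmono' : ∀ k (hk : k < m + 1), lam ⟨m - k, by omega⟩ ≤ lam (Fin.last m) := by
            intro k
            induction k with
            | zero => intro _; exact le_rfl
            | succ k ih =>
              intro hk
              have h1 := h (m - (k + 1) + 1) (by omega)
              rw [valAt, simpleRoot_snd (by omega), if_neg (by omega),
                simpleRoot_mid (m - (k + 1)) (by omega), dotProduct_sub, dot_eps, dot_eps] at h1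
              have h2 := ih (by omega)
              have e : (⟨m - (k + 1) + 1, by omega⟩ : Fin (m + 1)) = ⟨m - k, by omega⟩ :=
                Fin.ext (by simp; omega)
              rw [e] at h1
              omega
          funext i
          have h1 := hmono i.val i.isLt
          have h2 := hmono' (m - i.val) (by omega)
          have e : (⟨m - (m - i.val), by omega⟩ : Fin (m + 1)) = i := Fin.ext (by simp; omega)
          rw [e] at h2
          change lam 0 ≤ lam i at h1
          change lam i = 0
          omega
        rw [hz]; exact h0
  exact hN _ lam rfl

theorem exists_isMonicEigen (hP : P.Generic (m + 2)) (lam : Wt (m + 2)) :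
    ∃ F, IsMonicEigen P lam F :=
  weight_induction (m := m + 1) (p := fun lam => ∃ F, IsMonicEigen P lam F) ⟨_, isMonicEigen_zero hP.toNondeg⟩
    (fun _ _ hj hl ⟨_, hF⟩ => ⟨_, isMonicEigen_step hP hj hl hF⟩) lam

/-! ### Uniqueness -/

/-- The `Y_i` are triangular on monomials, with the diagonal entries of `γ_μ`: this is deduced from
the existence of triangular eigenvectors, by induction on `meas μ`. -/
theorem Y_single_sub_mem (hP : P.Generic (m + 2)) (i : Fin (m + 2)) (mu : Wt (m + 2)) :
    P.Y (m + 2) (i.val + 1) (AddMonoidAlgebra.single mu 1) -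
      P.gam mu i • (AddMonoidAlgebra.single mu 1 : Laurent (m + 2)) ∈
      suppIn {ν | meas ν < meas mu} := by
  have hN : ∀ (N : ℕ) (mu : Wt (m + 2)), (meas mu).toNat = N →
      P.Y (m + 2) (i.val + 1) (AddMonoidAlgebra.single mu 1) -
        P.gam mu i • (AddMonoidAlgebra.single mu 1 : Laurent (m + 2)) ∈
        suppIn {ν | meas ν < meas mu} := by
    intro N
    induction N using Nat.strong_induction_on with
    | _ N ih =>
      intro mu hN
      obtain ⟨F, hF⟩ := exists_isMonicEigen hP mu
      set G := F - AddMonoidAlgebra.single mu 1 with hG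
      have hGs : G ∈ suppIn {ν | meas ν < meas mu} := by
        intro ν hν
        by_cases h : ν = mu
        · subst h
          simp [hG, hF.coeff] at hν
        · have h1 : F.coeff ν ≠ 0 := by
            rw [hG, AddMonoidAlgebra.coeff_sub, Finsupp.sub_apply, AddMonoidAlgebra.coeff_single,
              Finsupp.single_eq_of_ne h, sub_zero] at hν
            exact hν
          have h2 : BLE ν mu := hF.supp ν h1
          exact h2.eq_or_meas_lt.resolve_left h
      have hYG : P.Y (m + 2) (i.val + 1) G ∈ suppIn {ν | meas ν < meas mu} := by
        refine map_mem_suppIn _ (fun ν hν => ?_) hGs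
        have hν' : meas ν < meas mu := hν
        have h1 := ih _ (by have := meas_nonneg ν; omega) ν rfl
        rw [← sub_add_cancel (P.Y (m + 2) (i.val + 1) (AddMonoidAlgebra.single ν 1))
          (P.gam ν i • (AddMonoidAlgebra.single ν 1 : Laurent (m + 2)))]
        exact Submodule.add_mem _ (suppIn_mono (fun κ hκ => lt_trans hκ hν') h1)
          (Submodule.smul_mem _ _ (single_mem_suppIn hν 1))
      have e : (AddMonoidAlgebra.single mu 1 : Laurent (m + 2)) = F - G := by rw [hG]; abel
      rw [e, map_sub, hF.eigen i, smul_sub, sub_sub_sub_cancel_left]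
      exact Submodule.sub_mem _ (Submodule.smul_mem _ _ hGs) hYG
  exact hN _ mu rfl

/-- The joint spectrum of the operators `Y_i` consists of the points `γ_μ`. -/
theorem exists_gam_eq_of_isEigen (hP : P.Generic (m + 2)) {H : Laurent (m + 2)}
    {g : Fin (m + 2) → ℂ} (hH : IsEigen P H g) (h0 : H ≠ 0) :
    ∃ mu, H.coeff mu ≠ 0 ∧ g = P.gam mu := by
  have hne : H.coeff.support.Nonempty := by
    rw [Finsupp.support_nonempty_iff]
    exact fun h => h0 (AddMonoidAlgebra.coeff_eq_zero.1 h)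
  obtain ⟨mu, hmu, hmax⟩ := Finset.exists_max_image _ meas hne
  have hmu' := Finsupp.mem_support_iff.1 hmu
  refine ⟨mu, hmu', funext fun i => ?_⟩
  have h1 := congrArg (fun F : Laurent (m + 2) => F.coeff mu) (hH i)
  simp only [AddMonoidAlgebra.coeff_smul, Finsupp.smul_apply, smul_eq_mul] at h1
  rw [coeff_apply_eq_sum, Finset.sum_eq_single mu] at h1
  · have h2 : (P.Y (m + 2) (i.val + 1) (AddMonoidAlgebra.single mu 1)).coeff mu = P.gam mu i := by
      have h3 : (P.Y (m + 2) (i.val + 1) (AddMonoidAlgebra.single mu 1) -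
          P.gam mu i • (AddMonoidAlgebra.single mu 1 : Laurent (m + 2))).coeff mu = 0 := by
        by_contra h
        exact lt_irrefl (meas mu) ((Y_single_sub_mem hP i mu : _ ∈ suppIn _) mu h)
      rw [AddMonoidAlgebra.coeff_sub, Finsupp.sub_apply, sub_eq_zero] at h3
      rw [h3]; simp
    rw [h2, mul_comm] at h1
    exact (mul_right_cancel₀ hmu' h1).symm
  · intro ν hν hne
    have h3 : (P.Y (m + 2) (i.val + 1) (AddMonoidAlgebra.single ν 1) -
        P.gam ν i • (AddMonoidAlgebra.single ν 1 : Laurent (m + 2))).coeff mu = 0 := by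
      by_contra h
      exact absurd ((Y_single_sub_mem hP i ν : _ ∈ suppIn _) mu h) (not_lt.2 (hmax ν hν))
    rw [AddMonoidAlgebra.coeff_sub, Finsupp.sub_apply, sub_eq_zero] at h3
    rw [h3]
    simp [Finsupp.single_eq_of_ne hne.symm]
  · intro h; exact absurd hmu h

/-- A joint eigenvector with the eigenvalues `γ_λ` is determined by its coefficient at `x^λ`. -/
theorem eq_of_isEigen (hP : P.Generic (m + 2)) {lam : Wt (m + 2)} {F G : Laurent (m + 2)}
    (hF : IsEigen P F (P.gam lam)) (hG : IsEigen P G (P.gam lam))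
    (h : F.coeff lam = G.coeff lam) : F = G := by
  by_contra hne
  have hH : IsEigen P (F - G) (P.gam lam) := fun i => by
    rw [map_sub, hF i, hG i, smul_sub]
  obtain ⟨mu, hmu, he⟩ := exists_gam_eq_of_isEigen hP hH (sub_ne_zero.2 hne)
  obtain rfl := gam_injective hP he
  apply hmu
  rw [AddMonoidAlgebra.coeff_sub, Finsupp.sub_apply, h, sub_self]

/-! ### Functions of the operators `Y_i` -/

theorem list_prod_eq_of_forall_ne {M ι : Type*} [Monoid M] (f : ι → M) (i : ι) {l : List ι}
    (hl : l.Nodup) (hi : i ∈ l) (h : ∀ j, j ≠ i → f j = 1) : (l.map f).prod = f i := by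
  induction l with
  | nil => exact absurd hi List.not_mem_nil
  | cons a l ih =>
    rw [List.map_cons, List.prod_cons]
    rw [List.nodup_cons] at hl
    by_cases ha : a = i
    · subst ha
      have : (l.map f).prod = 1 := by
        refine List.prod_eq_one fun x hx => ?_
        obtain ⟨j, hj, rfl⟩ := List.mem_map.1 hx
        exact h j fun he => hl.1 (he ▸ hj)
      rw [this, mul_one]
    · rw [h a ha, one_mul, ih hl.2 ((List.mem_cons.1 hi).resolve_left (Ne.symm ha))]

theorem Ypow_eps (i : Fin (m + 2)) : P.Ypow (eps i) = P.Y (m + 2) (i.val + 1) := by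
  rw [Params.Ypow, list_prod_eq_of_forall_ne _ i (List.nodup_finRange _) (List.mem_finRange i)]
  · simp [eps_apply]
  · intro j hj
    simp [eps_apply, hj]

theorem pow_apply_of_apply {V : Type*} [AddCommGroup V] [Module ℂ V] {A : Module.End ℂ V} {c : ℂ}
    {v : V} (h : A v = c • v) (k : ℕ) : (A ^ k) v = c ^ k • v := by
  induction k with
  | zero => simp
  | succ k ih => rw [pow_succ, Module.End.mul_apply, h, map_smul, ih, smul_smul, pow_succ, mul_comm]

theorem Ypow_apply (hP : P.Nondeg) {F : Laurent (m + 2)} {lam : Wt (m + 2)}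
    (hF : IsEigen P F (P.gam lam)) (μ : Wt (m + 2)) :
    P.Ypow μ F = (∏ i, P.gam lam i ^ μ i) • F := by
  have h1 : ∀ i : Fin (m + 2), (P.Y (m + 2) (i.val + 1) ^ (μ i).toNat *
      Ring.inverse (P.Y (m + 2) (i.val + 1)) ^ (-μ i).toNat) F = (P.gam lam i ^ μ i) • F := by
    intro i
    have hinv : Ring.inverse (P.Y (m + 2) (i.val + 1)) F = (P.gam lam i)⁻¹ • F := by
      rw [← Yu_val (m := m + 1) hP (by omega) (by omega), Ring.inverse_unit]
      refine units_inv_apply_of_apply _ (gam_ne_zero hP lam i) ?_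
      rw [Yu_val (m := m + 1) hP (by omega) (by omega)]
      exact hF i
    rw [Module.End.mul_apply, pow_apply_of_apply hinv, map_smul, pow_apply_of_apply (hF i),
      smul_smul]
    congr 1
    rcases le_total 0 (μ i) with h | h
    · obtain ⟨k, hk⟩ := Int.eq_ofNat_of_zero_le h
      rw [hk]; simp
    · obtain ⟨k, hk⟩ := Int.eq_ofNat_of_zero_le (neg_nonneg.2 h)
      have : μ i = -(k : ℤ) := by omega
      rw [this]; simp
  have h2 : ∀ l : List (Fin (m + 2)), ((l.map fun i : Fin (m + 2) =>
      P.Y (m + 2) (i.val + 1) ^ (μ i).toNat *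
      Ring.inverse (P.Y (m + 2) (i.val + 1)) ^ (-μ i).toNat).prod) F =
      ((l.map fun i => P.gam lam i ^ μ i).prod) • F := by
    intro l
    induction l with
    | nil => simp
    | cons i l ih =>
      rw [List.map_cons, List.prod_cons, Module.End.mul_apply, ih, map_smul, h1, smul_smul,
        List.map_cons, List.prod_cons, mul_comm]
  rw [Params.Ypow, h2, Fin.prod_univ_def]

theorem polyY_apply (hP : P.Nondeg) {F : Laurent (m + 2)} {lam : Wt (m + 2)}
    (hF : IsEigen P F (P.gam lam)) (f : Laurent (m + 2)) :
    P.polyY f F = evalAt f (P.gam lam) • F := by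
  rw [Params.polyY, evalAt, Finsupp.sum, Finsupp.sum, LinearMap.sum_apply, Finset.sum_smul]
  refine Finset.sum_congr rfl fun μ _ => ?_
  rw [LinearMap.smul_apply, Ypow_apply hP hF, smul_smul]

theorem isEigen_of_polyY {F : Laurent (m + 2)} {lam : Wt (m + 2)}
    (h : ∀ f : Laurent (m + 2), P.polyY f F = evalAt f (P.gam lam) • F) :
    IsEigen P F (P.gam lam) := by
  intro i
  have h1 := h (AddMonoidAlgebra.single (eps i) 1)
  rw [Params.polyY, AddMonoidAlgebra.coeff_single, Finsupp.sum_single_index (by simp), one_smul,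
    Ypow_eps, evalAt, AddMonoidAlgebra.coeff_single, Finsupp.sum_single_index (by simp), one_mul,
    Finset.prod_eq_single i (fun j _ hj => by simp [eps_apply, hj]) (by simp)] at h1
  simpa [eps_apply] using h1

theorem IsMonicEigen.isKoornwinder (hP : P.Nondeg) {lam : Wt (m + 2)} {F : Laurent (m + 2)}
    (hF : IsMonicEigen P lam F) : P.IsKoornwinder lam F :=
  ⟨hF.coeff, fun μ hμ => BLE.eq_or_precLT (hF.supp μ hμ), polyY_apply hP hF.eigen⟩

theorem IsMonicEigen.eq_of_isKoornwinder (hP : P.Generic (m + 2)) {lam : Wt (m + 2)}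
    {F G : Laurent (m + 2)} (hF : IsMonicEigen P lam F) (hG : P.IsKoornwinder lam G) : G = F :=
  eq_of_isEigen hP (isEigen_of_polyY hG.2.2) hF.eigen (hG.1.trans hF.coeff.symm)

end Existence

/-! ### Values of `v_β` and their transformation under the affine Weyl group -/

section Values

variable {n : ℕ} {P : Params}

theorem monAt_add (hq : P.qh ≠ 0) {y : Fin n → ℂ} (hy : ∀ i, y i ≠ 0) (g h : Aff n) :
    P.monAt y (g + h) = P.monAt y g * P.monAt y h := by
  simp only [Params.monAt, Prod.snd_add, Prod.fst_add, Pi.add_apply, zpow_add₀ hq,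
    zpow_add₀ (hy _), Finset.prod_mul_distrib]
  ring

theorem monAt_ne_zero (hq : P.qh ≠ 0) {y : Fin n → ℂ} (hy : ∀ i, y i ≠ 0) (g : Aff n) :
    P.monAt y g ≠ 0 :=
  mul_ne_zero (zpow_ne_zero _ hq) (Finset.prod_ne_zero_iff.2 fun i _ => zpow_ne_zero _ (hy i))

theorem monAt_zsmul {y : Fin n → ℂ} (k : ℤ) (g : Aff n) :
    P.monAt y (k • g) = P.monAt y g ^ k := by
  simp only [Params.monAt, Prod.smul_snd, Prod.smul_fst, Pi.smul_apply, smul_eq_mul, mul_zpow,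
    ← Finset.prod_zpow, ← zpow_mul]
  congr 1
  · rw [mul_comm]
  · exact Finset.prod_congr rfl fun i _ => by rw [mul_comm]

theorem monAt_neg {y : Fin n → ℂ} (g : Aff n) : P.monAt y (-g) = (P.monAt y g)⁻¹ := by
  rw [← neg_one_zsmul, monAt_zsmul, zpow_neg_one]

theorem prod_zpow_eps' (y : Fin n → ℂ) (i : Fin n) : ∏ k, y k ^ (eps i k) = y i := by
  rw [Finset.prod_eq_single i] <;> simp +contextual [eps_apply]

theorem monAt_eps (y : Fin n → ℂ) (i : Fin n) (m : ℤ) :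
    P.monAt y (eps i, m) = P.qh ^ m * y i := by
  rw [Params.monAt, prod_zpow_eps']

theorem monAt_neg_eps (y : Fin n → ℂ) (i : Fin n) (m : ℤ) :
    P.monAt y (-eps i, m) = P.qh ^ m * (y i)⁻¹ := by
  rw [Params.monAt, ← prod_zpow_eps' y i]
  simp [zpow_neg]

/-- The value of `v_β` for `β/2 = η + (m/2) δ` and `η` short, in terms of the value `u` of
`x^{β/2}`. -/
noncomputable def Params.vLong (P : Params) (m : ℤ) (u : ℂ) : ℂ :=
  if Even m then (1 - P.tn * P.tnv * u) * (1 + P.tn * P.tnv⁻¹ * u) / (1 - u ^ 2)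
  else (1 - P.t0 * P.t0v * u) * (1 + P.t0 * P.t0v⁻¹ * u) / (1 - u ^ 2)

theorem v_long {η : Wt n} (h : IsShort η) (m : ℤ) (y : Fin n → ℂ) :
    P.v (2 • η, 2 * m) y = P.vLong m (P.monAt y (η, m)) := by
  have e : P.monAt y (2 • η, 2 * m) = P.monAt y (η, m) ^ 2 := by
    have : ((2 • η, 2 * m) : Aff n) = (2 : ℤ) • (η, m) := by
      ext <;> simp
    rw [this, monAt_zsmul]
    rfl
  rw [Params.v, vNumOf_long P _ h, e, Params.vLong]
  split_ifs <;> simp [smul_eq_mul]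

theorem v_med {α : Wt n} (h : IsMed α) (m : ℤ) (y : Fin n → ℂ) :
    P.v (α, 2 * m) y = (1 - P.t ^ 2 * P.monAt y (α, 2 * m)) / (1 - P.monAt y (α, 2 * m)) := by
  rw [Params.v, vNumOf_med P _ h, smul_eq_mul]

theorem mem_affR_cases {β : Aff n} (h : β ∈ affR n) :
    (∃ α m, IsMed α ∧ β = (α, 2 * m)) ∨ (∃ η m, IsShort η ∧ β = (2 • η, 2 * m)) := by
  obtain ⟨h1 | h1, k, hk⟩ := h
  · exact Or.inl ⟨β.1, k, h1, Prod.ext rfl (by simp only; omega)⟩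
  · obtain ⟨η, hη, h2⟩ := h1.exists_short
    exact Or.inr ⟨η, k, hη, Prod.ext h2 (by simp only; omega)⟩

/-- `w` acts on gradients by an element of the finite Weyl group and does not change the parity of
the constant term. -/
structure IsAffSymm (w : Module.End ℤ (Aff n)) (u : FinW n) : Prop where
  fst : ∀ g, (w g).1 = actWt u g.1
  snd : ∀ g, Even ((w g).2 - g.2)

theorem IsAffSymm.map_short {w : Module.End ℤ (Aff n)} {u : FinW n} (hw : IsAffSymm w u)
    {η : Wt n} (h : IsShort η) (m : ℤ) : ∃ η' m', IsShort η' ∧ (Even m' ↔ Even m) ∧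
      w (η, m) = (η', m') ∧ w (2 • η, 2 * m) = (2 • η', 2 * m') := by
  refine ⟨actWt u η, (w (η, m)).2, h.actWt u, ?_, Prod.ext (hw.fst _) rfl, ?_⟩
  · exact ((Int.even_sub.1 (hw.snd (η, m))))
  · have : ((2 • η, 2 * m) : Aff n) = (2 : ℕ) • (η, m) := by
      ext <;> simp
    rw [this, map_nsmul]
    refine Prod.ext ?_ ?_
    · rw [Prod.smul_fst, hw.fst]
    · simp

theorem IsAffSymm.map_med {w : Module.End ℤ (Aff n)} {u : FinW n} (hw : IsAffSymm w u)
    {α : Wt n} (h : IsMed α) (m : ℤ) : ∃ α' m', IsMed α' ∧ w (α, 2 * m) = (α', 2 * m') := by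
  obtain ⟨k, hk⟩ := hw.snd (α, 2 * m)
  exact ⟨actWt u α, k + m, h.actWt u, Prod.ext (hw.fst _) (by simp only at hk ⊢; omega)⟩

/-- The functions `v_β` are permuted by affine symmetries, which preserve the multiplicities. -/
theorem IsAffSymm.v_map {w : Module.End ℤ (Aff n)} {u : FinW n} (hw : IsAffSymm w u)
    {y y' : Fin n → ℂ} (hy : ∀ g, P.monAt y' (w g) = P.monAt y g) {β : Aff n} (hβ : β ∈ affR n) :
    P.v (w β) y' = P.v β y := by
  rcases mem_affR_cases hβ with ⟨α, m, h, rfl⟩ | ⟨η, m, h, rfl⟩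
  · obtain ⟨α', m', h', e⟩ := hw.map_med h m
    have := hy (α, 2 * m)
    rw [e] at this ⊢
    rw [v_med h', v_med h, this]
  · obtain ⟨η', m', h', hm, e1, e2⟩ := hw.map_short h m
    have := hy (η, m)
    rw [e1] at this
    rw [e2, v_long h', v_long h, this, Params.vLong, Params.vLong]
    simp only [hm]

theorem IsAffSymm.mult_map {w : Module.End ℤ (Aff n)} {u : FinW n} (hw : IsAffSymm w u)
    {β : Aff n} (hβ : β ∈ affR n) : P.mult (w β) = P.mult β := by
  rcases mem_affR_cases hβ with ⟨α, m, h, rfl⟩ | ⟨η, m, h, rfl⟩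
  · obtain ⟨α', m', h', e⟩ := hw.map_med h m
    rw [e, mult_med P h', mult_med P h]
  · obtain ⟨η', m', h', hm, e1, e2⟩ := hw.map_short h m
    rw [e2, mult_long P h', mult_long P h]
    simp only [hm]

theorem isAffSymm_actW (u : FinW n) : IsAffSymm (actW u) u :=
  ⟨fun _ => rfl, fun g => ⟨0, by simp [actW]⟩⟩

end Values

section Steps

variable {m : ℕ} {P : Params}

theorem exists_isAffSymm_refl {j : ℕ} (hj : j ≤ m + 1) :
    ∃ u, IsAffSymm (refl (simpleRoot (m + 1) j)) u := by
  obtain ⟨u, hu, -⟩ := exists_actWt_eq_refl (isRoot_simpleRoot (m := m) hj)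
  refine ⟨u, fun g => ?_, fun g => ?_⟩
  · rw [← hu]; rfl
  · obtain ⟨k, hk⟩ := even_simpleRoot (m := m) hj
    refine ⟨-((g.1 ⬝ᵥ coroot (simpleRoot (m + 1) j).1) * k), ?_⟩
    rw [refl_apply]
    simp only [hk]
    ring

theorem gamInv_ne_zero (hP : P.Nondeg) (lam : Wt m) (i : Fin m) : P.gamInv lam i ≠ 0 :=
  inv_ne_zero (gam_ne_zero hP lam i)

theorem gamInv_reflAt (hP : P.Nondeg) {j : ℕ} (hj : j ≤ m + 1) {lam : Wt (m + 1)}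
    (hl : 0 < valAt lam (simpleRoot (m + 1) j)) (i : Fin (m + 1)) :
    P.gamInv (reflAt (simpleRoot (m + 1) j) lam) i = P.gamInv lam i *
      P.monAt (P.gamInv lam) (simpleRoot (m + 1) j) ^
        (-coroot (simpleRoot (m + 1) j).1 i) := by
  revert hl
  have hg := gam_ne_zero hP lam
  refine simpleRoot_cases (m := m) (p := fun j => 0 < valAt lam (simpleRoot (m + 1) j) →
    P.gamInv (reflAt (simpleRoot (m + 1) j) lam) i = P.gamInv lam i *
      P.monAt (P.gamInv lam) (simpleRoot (m + 1) j) ^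
        (-coroot (simpleRoot (m + 1) j).1 i)) ?_ ?_ ?_ hj
  · intro hl
    have e : P.monAt (P.gamInv lam) (simpleRoot (m + 1) 0) = P.qh ^ 2 * (P.gam lam 0) ^ 2 := by
      have : simpleRoot (m + 1) 0 = (2 : ℤ) • (-eps 0, 1) := by
        rw [simpleRoot_zero (by omega)]
        ext <;> simp
      rw [this, monAt_zsmul, monAt_neg_eps, Params.gamInv]
      simp only [inv_inv, zpow_one]
      rw [mul_zpow]
      rfl
    rw [e, Params.gamInv, gam_reflAt_zero hP.qh hl, coroot_simpleRoot_zero, Params.gamInv]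
    by_cases hi : i = 0
    · subst hi
      have := hg 0
      simp [eps_apply]
      field_simp
    · simp [eps_apply, hi]
  · intro j hj hl
    have hjj : (⟨j, by omega⟩ : Fin (m + 1)) ≠ ⟨j + 1, hj⟩ := by simp
    have e : P.monAt (P.gamInv lam) (simpleRoot (m + 1) (j + 1)) =
        (P.gam lam ⟨j, by omega⟩)⁻¹ * P.gam lam ⟨j + 1, hj⟩ := by
      have : simpleRoot (m + 1) (j + 1) = ((eps ⟨j, by omega⟩, 0) + (-eps ⟨j + 1, hj⟩, 0) :
          Aff (m + 1)) := by
        rw [simpleRoot_mid j hj, Prod.mk_add_mk, sub_eq_add_neg]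
        rfl
      rw [this, monAt_add hP.qh (gamInv_ne_zero hP lam), monAt_eps, monAt_neg_eps]
      simp [Params.gamInv]
    rw [e, Params.gamInv, gam_reflAt_mid hj hl, simpleRoot_mid j hj, coroot_med (isMed_sub hjj),
      Params.gamInv, Function.comp_apply]
    by_cases h1 : i = ⟨j, by omega⟩
    · subst h1
      have := hg ⟨j, by omega⟩
      have := hg ⟨j + 1, hj⟩
      rw [Equiv.swap_apply_left]
      simp [eps_apply]
      field_simp
    · by_cases h2 : i = ⟨j + 1, hj⟩
      · subst h2
        have := hg ⟨j, by omega⟩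
        have := hg ⟨j + 1, hj⟩
        rw [Equiv.swap_apply_right]
        simp [eps_apply]
        field_simp
      · rw [Equiv.swap_apply_of_ne_of_ne h1 h2]
        simp [eps_apply, h1, h2]
  · intro hl
    have e : P.monAt (P.gamInv lam) (simpleRoot (m + 1) (m + 1)) =
        (P.gam lam (Fin.last m))⁻¹ ^ 2 := by
      have : simpleRoot (m + 1) (m + 1) = (2 : ℤ) • (eps (Fin.last m), 0) := by
        rw [simpleRoot_last]
        ext <;> simp
      rw [this, monAt_zsmul, monAt_eps, Params.gamInv]
      simp only [zpow_zero, one_mul]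
      rfl
    rw [e, Params.gamInv, gam_reflAt_last hl, simpleRoot_last, coroot_long (isShort_eps _),
      Params.gamInv]
    by_cases hi : i = Fin.last m
    · subst hi
      have := hg (Fin.last m)
      simp [eps_apply]
      field_simp
    · simp [eps_apply, hi]

/-- Along an upward step, `γ_{s_j λ}^{-1}` is the image of `γ_λ^{-1}` under `s_j`. -/
theorem monAt_gamInv_refl (hP : P.Nondeg) {j : ℕ} (hj : j ≤ m + 1) {lam : Wt (m + 1)}
    (hl : 0 < valAt lam (simpleRoot (m + 1) j)) (g : Aff (m + 1)) :
    P.monAt (P.gamInv (reflAt (simpleRoot (m + 1) j) lam)) (refl (simpleRoot (m + 1) j) g) =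
      P.monAt (P.gamInv lam) g := by
  set a := simpleRoot (m + 1) j with ha
  have hy := gamInv_ne_zero hP lam
  have hM := monAt_ne_zero hP.qh hy a
  have h1 : ∀ g, P.monAt (P.gamInv (reflAt a lam)) g =
      P.monAt (P.gamInv lam) g * P.monAt (P.gamInv lam) a ^ (-(g.1 ⬝ᵥ coroot a.1)) := by
    intro g
    have h2 : ∀ (s : Finset (Fin (m + 1))) (f : Fin (m + 1) → ℤ),
        ∏ i ∈ s, P.monAt (P.gamInv lam) a ^ f i = P.monAt (P.gamInv lam) a ^ ∑ i ∈ s, f i := by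
      intro s f
      induction s using Finset.induction_on with
      | empty => simp
      | insert i s hi ih =>
        rw [Finset.prod_insert hi, Finset.sum_insert hi, zpow_add₀ hM, ih]
    have h3 : P.monAt (P.gamInv (reflAt a lam)) g = P.qh ^ g.2 *
        ∏ i, (P.gamInv lam i * P.monAt (P.gamInv lam) a ^ (-coroot a.1 i)) ^ g.1 i := by
      rw [Params.monAt]
      congr 1
      exact Finset.prod_congr rfl fun i _ => by rw [gamInv_reflAt hP hj hl i]
    rw [h3]
    simp only [mul_zpow, Finset.prod_mul_distrib, ← zpow_mul]
    rw [h2, ← mul_assoc]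
    congr 2
    rw [dotProduct, ← Finset.sum_neg_distrib]
    exact Finset.sum_congr rfl fun i _ => by ring
  have hr : refl a g = g + (-(g.1 ⬝ᵥ coroot a.1)) • a := by
    rw [refl_apply]
    refine Prod.ext ?_ ?_
    · rw [Prod.fst_add, Prod.smul_fst, neg_smul, sub_eq_add_neg]
    · rw [Prod.snd_add, Prod.smul_snd, neg_smul, smul_eq_mul]
      exact sub_eq_add_neg _ _
  have hd : (refl a g).1 ⬝ᵥ coroot a.1 = -(g.1 ⬝ᵥ coroot a.1) := by
    have hda : a.1 ⬝ᵥ coroot a.1 = 2 := dot_coroot_self (isRoot_simpleRoot (m := m) hj)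
    rw [refl_apply]
    simp only [sub_dotProduct, smul_dotProduct, smul_eq_mul, hda]
    ring
  rw [h1, hd, hr, monAt_add hP.qh hy, monAt_zsmul, mul_assoc, ← zpow_add₀ hM]
  simp

theorem v_gamInv_refl (Q : Params) (hQ : Q.qh = P.qh) (hP : P.Nondeg) {j : ℕ} (hj : j ≤ m + 1)
    {lam : Wt (m + 1)} (hl : 0 < valAt lam (simpleRoot (m + 1) j)) {β : Aff (m + 1)}
    (hβ : β ∈ affR (m + 1)) :
    Q.v (refl (simpleRoot (m + 1) j) β) (P.gamInv (reflAt (simpleRoot (m + 1) j) lam)) =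
      Q.v β (P.gamInv lam) := by
  obtain ⟨u, hu⟩ := exists_isAffSymm_refl (m := m) hj
  refine hu.v_map (fun g => ?_) hβ
  have := monAt_gamInv_refl hP hj hl g
  rw [Params.monAt] at this ⊢
  rw [hQ, this, Params.monAt, Params.monAt, hQ]

theorem gamInv_zero (i : Fin m) :
    P.gamInv (0 : Wt m) i = (P.t0 * P.tn)⁻¹ * (P.t ^ (2 * (m - 1 - i.val)))⁻¹ := by
  have hi := i.isLt
  rw [Params.gamInv, Params.gam, rhoLong_apply, rhoMed_zero]
  have e : (2 : ℤ) * ((m : ℤ) - 1 - (i.val : ℤ)) = (2 * (m - 1 - i.val) : ℕ) := by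
    push_cast [Nat.cast_sub (show i.val ≤ m - 1 by omega), Nat.cast_sub (show 1 ≤ m by omega)]
    ring
  rw [e, zpow_natCast]
  simp [sgn]
  ring

theorem qh_zpow (k : ℤ) : P.qh ^ (2 * k) = P.q ^ k := by
  rw [zpow_mul]; rfl

/-- The affine roots do not vanish at the spectral points. -/
theorem monAt_gamInv_ne_one (hP : P.Generic (m + 1)) (lam : Wt (m + 1)) {β : Aff (m + 1)}
    (hβ : β ∈ affR (m + 1)) : P.monAt (P.gamInv lam) β ≠ 1 := by
  revert β
  refine weight_induction (m := m) (p := fun lam => ∀ {β : Aff (m + 1)}, β ∈ affR (m + 1) →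
    P.monAt (P.gamInv lam) β ≠ 1) ?_ ?_ lam
  · have ht := hP.t
    have h0 := hP.t0
    have hn := hP.tn
    have hq := hP.toNondeg.q_ne
    have hy := gamInv_ne_zero hP.toNondeg (0 : Wt (m + 1))
    -- up to sign, `β` is a positive root plus a constant
    have key : ∀ (α : Wt (m + 1)) (k : ℤ), α ∈ posRoots (m + 1) →
        P.monAt (P.gamInv 0) (α, 2 * k) ≠ 1 := by
      intro α k hα h
      rw [mem_posRoots, mem_posMed, mem_posLong] at hα
      rcases hα with ⟨i, j, hij, rfl | rfl⟩ | ⟨i, rfl⟩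
      · have e : ((eps i - eps j, 2 * k) : Aff (m + 1)) = (eps i, 2 * k) + (-eps j, 0) := by
          rw [Prod.mk_add_mk, add_zero, sub_eq_add_neg]
        have hij' : i.val < j.val := hij
        have hjl := j.isLt
        rw [e, monAt_add hP.qh hy, monAt_eps, monAt_neg_eps, qh_zpow, gamInv_zero, gamInv_zero,
          show 2 * (m + 1 - 1 - i.val) = 2 * (m + 1 - 1 - j.val) + 2 * (j.val - i.val) by omega,
          pow_add] at h
        refine hP.gen1 (j.val - i.val) (by omega) (by omega) k ?_
        field_simp at h
        exact h.symm
      · have e : ((eps i + eps j, 2 * k) : Aff (m + 1)) = (eps i, 2 * k) + (eps j, 0) := by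
          rw [Prod.mk_add_mk, add_zero]
        have hij' : i.val < j.val := hij
        have hjl := j.isLt
        rw [e, monAt_add hP.qh hy, monAt_eps, monAt_eps, qh_zpow, gamInv_zero, gamInv_zero] at h
        refine hP.gen2 ((m + 1 - 1 - i.val) + (m + 1 - 1 - j.val)) (by omega) k ?_
        rw [mul_add, pow_add]
        field_simp at h
        rw [h]; ring
      · have e : ((2 • eps i, 2 * k) : Aff (m + 1)) = (eps i, 2 * k) + (eps i, 0) := by
          rw [Prod.mk_add_mk, add_zero, two_smul]
        rw [e, monAt_add hP.qh hy, monAt_eps, monAt_eps, qh_zpow, gamInv_zero] at h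
        refine hP.gen2 ((m + 1 - 1 - i.val) + (m + 1 - 1 - i.val)) (by omega) k ?_
        rw [mul_add, pow_add]
        field_simp at h
        rw [h]; ring
    intro β hβ
    obtain ⟨α, k, hα, rfl⟩ := mem_affR_iff.1 hβ
    rcases isRoot_iff.1 hα with h | h
    · exact key α k h
    · intro h1
      refine key (-α) (-k) h ?_
      have e : ((-α, 2 * -k) : Aff (m + 1)) = -(α, 2 * k) := by
        rw [Prod.neg_mk, mul_neg]
      rw [e, monAt_neg, h1, inv_one]
  · intro j lam hj hl ih β hβ
    have h1 := monAt_gamInv_refl hP.toNondeg hj hl (refl (simpleRoot (m + 1) j) β)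
    rw [refl_refl (isRoot_simpleRoot hj)] at h1
    rw [h1]
    exact ih (refl_mem_affR (simpleRoot_mem hj).1 hβ)

end Steps

/-! ### Evaluation at `x_0⁻¹` -/

section Evaluation

variable {m : ℕ} {P : Params}

/-- The point `x_0⁻¹ = γ̃_0⁻¹`, with coordinates in the units of `ℂ`. -/
noncomputable def basePt (P : Params) (hP : P.dual.Nondeg) (n : ℕ) : Fin n → ℂˣ :=
  fun i => Units.mk0 (P.dual.gamInv 0 i) (gamInv_ne_zero hP 0 i)

theorem evalAt_eq_ev {n : ℕ} (y : Fin n → ℂˣ) (f : Laurent n) :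
    evalAt f (fun i => (y i : ℂ)) = ev y f := by
  induction f using AddMonoidAlgebra.induction_linear with
  | zero => simp [evalAt]
  | add f g hf hg =>
    rw [map_add, ← hf, ← hg, evalAt, AddMonoidAlgebra.coeff_add, Finsupp.sum_add_index'] <;>
      simp [evalAt, add_mul]
  | single μ c =>
    rw [ev_single, evalAt, AddMonoidAlgebra.coeff_single, Finsupp.sum_single_index (by simp)]
    simp

theorem Params.Nondeg.dual (hP : P.Nondeg) : P.dual.Nondeg :=
  ⟨hP.qh, hP.tnv, hP.t, hP.tn, hP.t0v, hP.t0⟩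

theorem cMed_add_dMed {K : Type} [Field K] {t x w : K} (h : w ≠ x) :
    t - cMed t x w = dMed t x w := by
  have := sub_ne_zero.2 h
  rw [cMed, dMed]; field_simp; ring

theorem cLong_add_dLong {K : Type} [Field K] {t t' u : K} (ht : t ≠ 0) (ht' : t' ≠ 0)
    (h : u ^ 2 ≠ 1) : t - cLong t t' u = dLong t t' u := by
  have := sub_ne_zero.2 h.symm
  rw [cLong, dLong]; field_simp; ring

variable (hP : P.Nondeg)

include hP in
/-- The operators `T_1, …, T_n` act by scalars under evaluation at `x_0⁻¹`: the coefficient of the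
reflected term vanishes there. -/
theorem ev_basePt_T (ht2 : P.t ^ 2 ≠ 1) (htt : (P.tn * P.tnv) ^ 2 ≠ 1) {j : ℕ} (hj : j ≤ m)
    (f : Laurent (m + 1)) :
    ev (basePt P hP.dual (m + 1)) (P.T (m + 1) (j + 1) f) =
      P.mult (simpleRoot (m + 1) (j + 1)) * ev (basePt P hP.dual (m + 1)) f := by
  have htn := hP.tn
  have htnv := hP.tnv
  have ht := hP.t
  rcases hj.lt_or_eq with hj | rfl
  · have e : ((basePt P hP.dual (m + 1) ⟨j + 1, by omega⟩ : ℂˣ) : ℂ) =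
        P.t ^ 2 * (basePt P hP.dual (m + 1) ⟨j, by omega⟩ : ℂˣ) := by
      simp only [basePt, Units.val_mk0, gamInv_zero]
      have : P.dual.t = P.t := rfl
      rw [this, show 2 * (m + 1 - 1 - j) = 2 * (m + 1 - 1 - (j + 1)) + 2 by omega, pow_add]
      field_simp
    have h0 := (basePt P hP.dual (m + 1) ⟨j, by omega⟩).ne_zero
    have h1 := sub_ne_zero.2 ht2
    have hne : ((basePt P hP.dual (m + 1) ⟨j, by omega⟩ : ℂˣ) : ℂ) ≠
        basePt P hP.dual (m + 1) ⟨j + 1, by omega⟩ := by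
      rw [e]
      intro h
      apply ht2
      apply mul_right_cancel₀ h0
      rw [← h, one_mul]
    rw [ev_T_mid P hP (by omega) _ hne, e, mult_simpleRoot_mid P (by omega), cMed, dMed]
    simp only [Algebra.algebraMap_self, RingHom.id_apply]
    generalize ((basePt P hP.dual (m + 1) ⟨j, by omega⟩ : ℂˣ) : ℂ) = x at *
    have h2 : P.t ^ 2 * x - x ≠ 0 := by
      have : P.t ^ 2 * x - x = (P.t ^ 2 - 1) * x := by ring
      rw [this]; exact mul_ne_zero h1 h0
    field_simp
    ring
  · have e : ((basePt P hP.dual (j + 1) (Fin.last j) : ℂˣ) : ℂ) = (P.tn * P.tnv)⁻¹ := by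
      simp only [basePt, Units.val_mk0, gamInv_zero, Fin.val_last]
      have e1 : P.dual.t0 = P.tnv := rfl
      have e2 : P.dual.tn = P.tn := rfl
      rw [e1, e2]
      simp [mul_comm]
    have h1 := sub_ne_zero.2 htt
    rw [ev_T_last P hP _ (by rw [e, inv_pow]; simpa using htt), e, mult_simpleRoot_last, cLong,
      dLong]
    simp only [Algebra.algebraMap_self, RingHom.id_apply]
    have h2 : 1 - ((P.tn * P.tnv)⁻¹) ^ 2 ≠ 0 := by
      rw [inv_pow, sub_ne_zero]
      intro h
      exact htt (inv_eq_one.1 h.symm)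
    have h3 : (1 : ℂ) - P.tn * P.tnv * (P.tn * P.tnv)⁻¹ = 0 := by
      rw [mul_inv_cancel₀ (mul_ne_zero htn htnv), sub_self]
    rw [h3, zero_mul, mul_zero, zero_div, zero_mul, add_zero]
    congr 1
    rw [div_eq_iff h2]
    field_simp
    ring

include hP in
/-- Under evaluation at `x_0⁻¹`, the operator `V` acts by `t_n^∨`. -/
theorem ev_basePt_Vu (ht2 : P.t ^ 2 ≠ 1) (htt : (P.tn * P.tnv) ^ 2 ≠ 1) (f : Laurent (m + 1)) :
    ev (basePt P hP.dual (m + 1)) ((Vu P m : Module.End ℂ (Laurent (m + 1))) f) =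
      P.tnv * ev (basePt P hP.dual (m + 1)) f := by
  have ht := hP.t
  have htn := hP.tn
  have htnv := hP.tnv
  have hT : ∀ k < m, ∀ f, ev (basePt P hP.dual (m + 1))
      ((Tu P m (k + 1) : Module.End ℂ (Laurent (m + 1))) f) =
      P.t * ev (basePt P hP.dual (m + 1)) f := by
    intro k hk f
    rw [Tu_val hP (by omega), ev_basePt_T hP ht2 htt hk.le, mult_simpleRoot_mid P (by omega)]
  have hhook : ∀ k ≤ m, ∀ f, ev (basePt P hP.dual (m + 1))
      ((hookM (m + 1) (Tu P m) k).val f) =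
      P.t ^ (2 * k) * P.tn * ev (basePt P hP.dual (m + 1)) f := by
    intro k
    induction k with
    | zero =>
      intro _ f
      rw [hookM, Tu_val hP le_rfl, ev_basePt_T hP ht2 htt le_rfl, mult_simpleRoot_last]
      simp
    | succ k ih =>
      intro hk f
      obtain ⟨i, hi⟩ : ∃ i, m + 1 - (k + 1) = i + 1 := ⟨m - k - 1, by omega⟩
      rw [hookM, hi, Units.val_mul, Units.val_mul, Module.End.mul_apply, Module.End.mul_apply,
        hT i (by omega), ih (by omega), hT i (by omega)]
      ring
  have hinv : ev (basePt P hP.dual (m + 1))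
      (((hookM (m + 1) (Tu P m) m)⁻¹ : (Module.End ℂ (Laurent (m + 1)))ˣ).val f) =
      (P.t ^ (2 * m) * P.tn)⁻¹ * ev (basePt P hP.dual (m + 1)) f := by
    have h1 := hhook m le_rfl (((hookM (m + 1) (Tu P m) m)⁻¹ :
      (Module.End ℂ (Laurent (m + 1)))ˣ).val f)
    rw [← Module.End.mul_apply, Units.mul_inv, Module.End.one_apply] at h1
    rw [h1, inv_mul_cancel_left₀ (mul_ne_zero (pow_ne_zero _ ht) htn)]
  rw [Vu, grpV, Units.val_mul, Module.End.mul_apply, Nat.add_sub_cancel]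
  have hX : ∀ f, ev (basePt P hP.dual (m + 1))
      (((Xu m 1)⁻¹ : (Module.End ℂ (Laurent (m + 1)))ˣ).val f) =
      P.tn * P.tnv * P.t ^ (2 * m) * ev (basePt P hP.dual (m + 1)) f := by
    intro f
    have h1 : (((Xu m 1)⁻¹ : (Module.End ℂ (Laurent (m + 1)))ˣ) : Module.End ℂ (Laurent (m + 1))) =
        mulX (-eps 0) := rfl
    have e : ((basePt P hP.dual (m + 1) 0 : ℂˣ) : ℂ) = (P.tn * P.tnv * P.t ^ (2 * m))⁻¹ := by
      simp only [basePt, Units.val_mk0, gamInv_zero, Fin.val_zero]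
      have e1 : P.dual.t0 = P.tnv := rfl
      have e2 : P.dual.tn = P.tn := rfl
      have e3 : P.dual.t = P.t := rfl
      rw [e1, e2, e3, ← mul_inv, mul_comm P.tnv]
      rfl
    rw [h1, ev_mulX_neg]
    rw [e, inv_inv]
  rw [hX, hinv]
  field_simp

end Evaluation

/-! ### The recursion for the values at `x_0⁻¹` -/

section Sets

variable {n : ℕ}

/-- The positive affine roots that are not positive at `-λ`. -/
def upSet (lam : Wt n) : Set (Aff n) := {β | β ∈ affRPos n ∧ valAt lam β ≤ 0}

/-- The positive affine roots that are negative at `-λ`. -/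
def invSet (lam : Wt n) : Set (Aff n) := {β | β ∈ affRPos n ∧ valAt lam β < 0}

theorem upSet_zero : upSet (0 : Wt n) = finPos n := by
  ext β
  simp only [upSet, finPos, valAt, Set.mem_ofPred_eq, zero_dotProduct, sub_zero, affRPos]
  constructor
  · rintro ⟨⟨⟨-, h2⟩, h | h⟩, h3⟩
    · exact h
    · obtain ⟨k, hk⟩ := h2; omega
  · rintro ⟨h1, h2⟩
    exact ⟨⟨⟨isRoot_of_mem h1, by rw [h2]; exact ⟨0, rfl⟩⟩, Or.inl ⟨h1, h2⟩⟩, by omega⟩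

theorem invSet_zero : invSet (0 : Wt n) = ∅ := by
  ext β
  simp only [invSet, valAt, Set.mem_ofPred_eq, zero_dotProduct, sub_zero, affRPos,
    Set.mem_empty_iff_false, iff_false]
  rintro ⟨⟨⟨-, h2⟩, h | h⟩, h3⟩ <;> omega

theorem invSet_subset (lam : Wt n) : invSet lam ⊆ upSet lam := fun _ h => ⟨h.1, h.2.le⟩

theorem finPos_eq_image : finPos n = (fun α : Wt n => ((α, 0) : Aff n)) '' (posRoots n : Set (Wt n)) := by
  ext β
  constructor
  · rintro ⟨h1, h2⟩
    exact ⟨β.1, h1, Prod.ext rfl h2.symm⟩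
  · rintro ⟨α, hα, rfl⟩
    exact ⟨hα, rfl⟩

end Sets

section Recursion

variable {m : ℕ} {P : Params}

/-- Along an upward step, the positive affine roots that are negative at `-λ` are permuted by `s_j`,
and `a_j` is added. The predicate `p` covers negative and non-positive values. -/
theorem refl_mem_and_valAt_iff {p : ℤ → Prop} (hp : ∀ k < 0, p k) (hp' : ∀ k > 0, ¬ p k) {j : ℕ}
    (hj : j ≤ m + 1)
    {lam : Wt (m + 1)} (hl : 0 < valAt lam (simpleRoot (m + 1) j)) :
    {β | β ∈ affRPos (m + 1) ∧ p (valAt (reflAt (simpleRoot (m + 1) j) lam) β)} =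
      insert (simpleRoot (m + 1) j) (refl (simpleRoot (m + 1) j) ''
        {β | β ∈ affRPos (m + 1) ∧ p (valAt lam β)}) := by
  have ha := simpleRoot_mem (m := m) hj
  have hr := isRoot_simpleRoot (m := m) hj
  ext β
  simp only [Set.mem_insert_iff, Set.mem_image, Set.mem_ofPred_eq]
  constructor
  · rintro ⟨h1, h2⟩
    by_cases h : β = simpleRoot (m + 1) j
    · exact Or.inl h
    · refine Or.inr ⟨refl (simpleRoot (m + 1) j) β, ⟨refl_simpleRoot_mem hj h1 h, ?_⟩,
        refl_refl hr β⟩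
      rw [← valAt_refl ha.1 (refl_mem_affR ha.1 h1.1), refl_refl hr]
      exact h2
  · rintro (rfl | ⟨γ, ⟨h1, h2⟩, rfl⟩)
    · exact ⟨ha, hp _ (by rw [valAt_reflAt ha.1]; omega)⟩
    · have hne : γ ≠ simpleRoot (m + 1) j := by
        rintro rfl
        exact hp' _ hl h2
      exact ⟨refl_simpleRoot_mem hj h1 hne, by rwa [valAt_refl ha.1 h1.1]⟩

theorem upSet_reflAt {j : ℕ} (hj : j ≤ m + 1) {lam : Wt (m + 1)}
    (hl : 0 < valAt lam (simpleRoot (m + 1) j)) :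
    upSet (reflAt (simpleRoot (m + 1) j) lam) =
      insert (simpleRoot (m + 1) j) (refl (simpleRoot (m + 1) j) '' upSet lam) :=
  refl_mem_and_valAt_iff (p := fun k => k ≤ 0) (fun _ => le_of_lt) (fun _ => not_le_of_gt) hj hl

theorem invSet_reflAt {j : ℕ} (hj : j ≤ m + 1) {lam : Wt (m + 1)}
    (hl : 0 < valAt lam (simpleRoot (m + 1) j)) :
    invSet (reflAt (simpleRoot (m + 1) j) lam) =
      insert (simpleRoot (m + 1) j) (refl (simpleRoot (m + 1) j) '' invSet lam) :=
  refl_mem_and_valAt_iff (p := fun k => k < 0) (fun _ => id) (fun _ h => not_lt_of_gt h) hj hl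

theorem upSet_finite (lam : Wt (m + 1)) : (upSet lam).Finite := by
  refine weight_induction (m := m) (p := fun lam => (upSet lam).Finite) ?_ ?_ lam
  · rw [upSet_zero, finPos_eq_image]
    exact (Finset.finite_toSet _).image _
  · intro j lam hj hl ih
    rw [upSet_reflAt hj hl]
    exact (ih.image _).insert _

theorem invSet_finite (lam : Wt (m + 1)) : (invSet lam).Finite :=
  (upSet_finite lam).subset (invSet_subset lam)

theorem finprod_insert_refl {j : ℕ} (hj : j ≤ m + 1) {S : Set (Aff (m + 1))}
    (hS : S ⊆ affRPos (m + 1)) (hf : S.Finite) (f : Aff (m + 1) → ℂ) :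
    ∏ᶠ β ∈ insert (simpleRoot (m + 1) j) (refl (simpleRoot (m + 1) j) '' S), f β =
      f (simpleRoot (m + 1) j) * ∏ᶠ β ∈ S, f (refl (simpleRoot (m + 1) j) β) := by
  have hr := isRoot_simpleRoot (m := m) hj
  rw [finprod_mem_insert _ _ (hf.image _), finprod_mem_image]
  · intro a _ b _ h
    rw [← refl_refl hr a, h, refl_refl hr]
  · rintro ⟨γ, hγ, h⟩
    have h2 : γ = -simpleRoot (m + 1) j := by
      rw [← refl_self hr]
      conv_lhs => rw [← refl_refl hr γ, h]
    exact not_mem_affRPos_neg (simpleRoot_mem (m := m) hj) (h2 ▸ hS hγ)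

open Classical in
/-- The number of roots in a set that are not positive. -/
noncomputable def negCount {n : ℕ} (S : Finset (Wt n)) : ℤ :=
  ∑ β ∈ S, if β ∈ posRoots n then 0 else 1

/-- The multiplicity `t_{w_λ}`, written with the numbers of negative roots among the roots that are
positive at `λ`; see `signWeight_eq`. -/
noncomputable def signWeight (P : Params) {n : ℕ} (lam : Wt n) : ℂ :=
  P.t ^ negCount (posAtMed lam) * P.tn ^ negCount (posAtLong lam)

theorem mem_posRoots_of_head {β : Wt (m + 1)} (hβ : IsRoot β) (h : 0 < β 0) :
    β ∈ posRoots (m + 1) ∧ coroot β 0 = 1 := by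
  rcases isRoot_iff.1 hβ with hp | hp
  · refine ⟨hp, ?_⟩
    rcases mem_posRoots.1 hp with hp | hp
    · rw [coroot_med (Or.inl hp)]
      obtain ⟨i, k, hik, rfl | rfl⟩ := mem_posMed.1 hp <;>
        simp only [Pi.sub_apply, Pi.add_apply, eps_apply] at h ⊢ <;>
        split_ifs at h ⊢ <;> omega
    · obtain ⟨i, rfl⟩ := mem_posLong.1 hp
      rw [coroot_long (isShort_eps i)]
      simp only [Pi.smul_apply, eps_apply] at h ⊢
      split_ifs at h ⊢ with h1
      · rfl
      · simp at h
  · exfalso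
    have h0 : (-β) 0 < 0 := by rw [Pi.neg_apply]; omega
    rcases mem_posRoots.1 hp with hp | hp
    · obtain ⟨i, k, hik, h'⟩ := mem_posMed.1 hp
      have hk : (0 : Fin (m + 1)) ≠ k := ((Fin.zero_le i).trans_lt hik).ne
      rcases h' with h' | h' <;> rw [h'] at h0 <;>
        simp only [Pi.sub_apply, Pi.add_apply, eps_apply, if_neg hk] at h0 <;>
        split_ifs at h0 <;> omega
    · obtain ⟨i, h'⟩ := mem_posLong.1 hp
      rw [h'] at h0
      simp only [Pi.smul_apply, eps_apply] at h0
      split_ifs at h0 <;> simp at h0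

theorem not_mem_posRoots_neg {n : ℕ} {β : Wt n} (h : β ∈ posRoots n) : -β ∉ posRoots n := fun h' => by
  have h1 := dot_htVec_pos h
  have h2 := dot_htVec_pos h'
  rw [neg_dotProduct] at h2
  omega

open Classical in
theorem negCount_refl_zero {S : Finset (Wt (m + 1))} (hS : ∀ β ∈ S, IsRoot β) :
    negCount (S.image fun β =>
      β - (β ⬝ᵥ coroot (simpleRoot (m + 1) 0).1) • (simpleRoot (m + 1) 0).1) =
      negCount S + (∑ β ∈ S, coroot β) 0 := by
  rw [negCount, Finset.sum_image (refl_injective (by omega)).injOn, negCount, Finset.sum_apply,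
    ← Finset.sum_add_distrib]
  refine Finset.sum_congr rfl fun β hβ => ?_
  have ha0 : (simpleRoot (m + 1) 0).1 = -(2 • eps 0) := by
    rw [simpleRoot_zero (by omega)]; simp
  have hβ := hS β hβ
  obtain ⟨w, hw, -⟩ := exists_actWt_eq_refl (isRoot_simpleRoot (m := m) (j := 0) (by omega))
  have hs := hβ.actWt w
  rw [← hw, coroot_simpleRoot_zero, ha0, dotProduct_neg, dot_eps] at hs
  rw [coroot_simpleRoot_zero, ha0, dotProduct_neg, dot_eps]
  have h0 : (β - -β 0 • -(2 • eps (0 : Fin (m + 1)))) 0 = -β 0 := by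
    simp [eps_apply]; ring
  rcases lt_trichotomy (β 0) 0 with h | h | h
  · have h1 := mem_posRoots_of_head hs (by rw [h0]; omega)
    have h2 := mem_posRoots_of_head hβ.neg (by rw [Pi.neg_apply]; omega)
    have h3 := not_mem_posRoots_neg h2.1
    rw [neg_neg] at h3
    rw [if_pos h1.1, if_neg h3]
    have := h2.2
    rw [coroot_neg hβ, Pi.neg_apply] at this
    omega
  · have : coroot β 0 = 0 := by simp [coroot, h]
    rw [h, this]; simp
  · have h1 := mem_posRoots_of_head hβ h
    have h2 := mem_posRoots_of_head hs.neg (by rw [Pi.neg_apply, h0]; omega)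
    have h3 := not_mem_posRoots_neg h2.1
    rw [neg_neg] at h3
    rw [if_pos h1.1, if_neg h3, h1.2]
    norm_num

theorem refl_mem_posRoots_iff {j : ℕ} (hj : j ≤ m + 1) (hj0 : j ≠ 0) {β : Wt (m + 1)}
    (hβ : IsRoot β) (h1 : β ≠ (simpleRoot (m + 1) j).1) (h2 : β ≠ -(simpleRoot (m + 1) j).1) :
    β - (β ⬝ᵥ coroot (simpleRoot (m + 1) j).1) • (simpleRoot (m + 1) j).1 ∈ posRoots (m + 1) ↔
      β ∈ posRoots (m + 1) := by
  have hr := isRoot_simpleRoot (m := m) hj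
  have key : ∀ γ : Wt (m + 1), γ ∈ posRoots (m + 1) → γ ≠ (simpleRoot (m + 1) j).1 →
      γ - (γ ⬝ᵥ coroot (simpleRoot (m + 1) j).1) • (simpleRoot (m + 1) j).1 ∈
        posRoots (m + 1) := by
    intro γ hγ hne
    have hpos : ((γ, 0) : Aff (m + 1)) ∈ affRPos (m + 1) :=
      ⟨⟨isRoot_of_mem hγ, ⟨0, rfl⟩⟩, Or.inl ⟨hγ, rfl⟩⟩
    have := (refl_simpleRoot_mem hj hpos fun he => hne (by rw [← he])).2
    rw [refl_apply, simpleRoot_snd hj, if_neg hj0] at this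
    rcases this with h3 | h3
    · exact h3.1
    · simp at h3
  refine ⟨fun h => ?_, fun h => key β h h1⟩
  rcases isRoot_iff.1 hβ with h3 | h3
  · exact h3
  · have h4 := key (-β) h3 fun he => h2 (by rw [← he, neg_neg])
    rw [neg_dotProduct, neg_smul, sub_neg_eq_add, neg_add_eq_sub, ← neg_sub] at h4
    exact absurd h4 (not_mem_posRoots_neg h)

open Classical in
theorem negCount_refl_of_ne {j : ℕ} (hj : j ≤ m + 1) (hj0 : j ≠ 0) {S : Finset (Wt (m + 1))}
    (hS : ∀ β ∈ S, IsRoot β) (ha : (simpleRoot (m + 1) j).1 ∉ S) :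
    negCount (S.image fun β =>
      β - (β ⬝ᵥ coroot (simpleRoot (m + 1) j).1) • (simpleRoot (m + 1) j).1) =
      negCount S - if -(simpleRoot (m + 1) j).1 ∈ S then 1 else 0 := by
  have hr := isRoot_simpleRoot (m := m) hj
  have hpos : (simpleRoot (m + 1) j).1 ∈ posRoots (m + 1) := by
    have := (simpleRoot_mem (m := m) hj).2
    rw [simpleRoot_snd hj, if_neg hj0] at this
    rcases this with h | h
    · exact h.1
    · simp at h
  rw [negCount, Finset.sum_image (refl_injective hj).injOn, negCount, eq_sub_iff_add_eq,
    ← Finset.sum_ite_eq' S (-(simpleRoot (m + 1) j).1) fun _ => (1 : ℤ), ← Finset.sum_add_distrib]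
  refine Finset.sum_congr rfl fun β hβ => ?_
  by_cases h : β = -(simpleRoot (m + 1) j).1
  · subst h
    have e : -(simpleRoot (m + 1) j).1 - (-(simpleRoot (m + 1) j).1 ⬝ᵥ
        coroot (simpleRoot (m + 1) j).1) • (simpleRoot (m + 1) j).1 = (simpleRoot (m + 1) j).1 := by
      rw [neg_dotProduct, dot_coroot_self hr]; module
    rw [e, if_pos hpos, if_pos rfl, if_neg (not_mem_posRoots_neg hpos)]
    norm_num
  · rw [if_neg h, add_zero]
    simp only [refl_mem_posRoots_iff hj hj0 (hS β hβ) (fun he => ha (he ▸ hβ)) h]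

end Recursion

section Step

variable {m : ℕ} {P : Params}

/-- Each step divides `signWeight` by the leading coefficient of the intertwiner. -/
theorem signWeight_step (hP : P.Nondeg) {j : ℕ} (hj : j ≤ m + 2) {lam : Wt (m + 2)}
    (hl : 0 < valAt lam (simpleRoot (m + 2) j)) :
    signWeight P (reflAt (simpleRoot (m + 2) j) lam) = signWeight P lam * (stepLead P m j lam)⁻¹ := by
  have hM : ∀ β ∈ posAtMed lam, IsRoot β := fun β h => Or.inl (mem_posAtMed.1 h).1
  have hL : ∀ β ∈ posAtLong lam, IsRoot β := fun β h => Or.inr (mem_posAtLong.1 h).1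
  have ht := hP.t
  have htn := hP.tn
  rw [signWeight, posAtMed_refl (m := m + 1) hj hl, posAtLong_refl (m := m + 1) hj hl, signWeight,
    stepLead]
  by_cases hj0 : j = 0
  · subst hj0
    rw [negCount_refl_zero hM, negCount_refl_zero hL, ← rhoMed_eq, ← rhoLong_eq, rhoLong_apply,
      if_pos rfl, zpow_add₀ ht, zpow_add₀ htn, inv_inv]
    have hl0 : 0 ≤ lam 0 := by rw [valAt_zero] at hl; omega
    rw [sgn, if_pos hl0, zpow_one]
    ring
  · have hneg : lam ⬝ᵥ (simpleRoot (m + 2) j).1 < 0 := by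
      rw [valAt, simpleRoot_snd hj, if_neg hj0] at hl
      omega
    have hna : ¬ PosAt lam (simpleRoot (m + 2) j).1 := by
      rintro (h | h) <;> omega
    have hpa : PosAt lam (-(simpleRoot (m + 2) j).1) := Or.inl (by rw [dotProduct_neg]; omega)
    rw [negCount_refl_of_ne hj hj0 hM (fun h => hna (mem_posAtMed.1 h).2),
      negCount_refl_of_ne hj hj0 hL (fun h => hna (mem_posAtLong.1 h).2), if_neg hj0]
    have i1 : -(simpleRoot (m + 2) j).1 ∈ posAtMed lam ↔ IsMed (-(simpleRoot (m + 2) j).1) :=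
      mem_posAtMed.trans (and_iff_left hpa)
    have i2 : -(simpleRoot (m + 2) j).1 ∈ posAtLong lam ↔ IsLong (-(simpleRoot (m + 2) j).1) :=
      mem_posAtLong.trans (and_iff_left hpa)
    rcases isRoot_simpleRoot (m := m + 1) hj with h | h
    · have h2 : ¬ IsLong (-(simpleRoot (m + 2) j).1) := fun h' => not_isMed_and_isLong h.neg h'
      have h3 : P.mult (simpleRoot (m + 2) j) = P.t := by
        obtain ⟨k, hk⟩ := even_simpleRoot (m := m + 1) hj
        have : simpleRoot (m + 2) j = ((simpleRoot (m + 2) j).1, 2 * k) :=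
          Prod.ext rfl (hk.trans (two_mul k).symm)
        rw [this, mult_med P h]
      rw [if_pos (i1.2 h.neg), if_neg fun h' => h2 (i2.1 h'), h3, zpow_sub₀ ht, sub_zero, zpow_one]
      ring
    · have h2 : ¬ IsMed (-(simpleRoot (m + 2) j).1) := fun h' => not_isMed_and_isLong h' h.neg
      have h3 : P.mult (simpleRoot (m + 2) j) = P.tn := by
        obtain ⟨η, hη, he⟩ := h.exists_short
        have : simpleRoot (m + 2) j = (2 • η, 2 * 0) :=
          Prod.ext he (by rw [simpleRoot_snd hj, if_neg hj0]; rfl)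
        rw [this, mult_long P hη]; simp
      rw [if_neg fun h' => h2 (i1.1 h'), if_pos (i2.2 h.neg), h3, zpow_sub₀ htn, sub_zero, zpow_one]
      ring

/-- The effect of one step on the value at `x_0⁻¹`. -/
theorem ev_basePt_step (hP : P.Generic (m + 2)) (ht2 : P.t ^ 2 ≠ 1)
    (htt : (P.tn * P.tnv) ^ 2 ≠ 1) {j : ℕ} (hj : j ≤ m + 2) {lam : Wt (m + 2)}
    (F : Laurent (m + 2)) :
    ev (basePt P hP.toNondeg.dual (m + 2)) ((stepLead P m j lam)⁻¹ •
      (stepOp P m j F - stepScalar P m j (P.gam lam) • F)) =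
      (stepLead P m j lam)⁻¹ * (P.dual.mult (simpleRoot (m + 2) j))⁻¹ *
        P.dual.v (simpleRoot (m + 2) j) (P.gamInv lam) *
        ev (basePt P hP.toNondeg.dual (m + 2)) F := by
  have hN := hP.toNondeg
  have hne := monAt_gamInv_ne_one hP lam (simpleRoot_mem (m := m + 1) hj).1
  suffices h : ev (basePt P hN.dual (m + 2)) (stepOp P m j F) -
      stepScalar P m j (P.gam lam) * ev (basePt P hN.dual (m + 2)) F =
      (P.dual.mult (simpleRoot (m + 2) j))⁻¹ *
        P.dual.v (simpleRoot (m + 2) j) (P.gamInv lam) * ev (basePt P hN.dual (m + 2)) F by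
    rw [map_smul, map_sub, map_smul, smul_eq_mul, smul_eq_mul, h]
    ring
  revert hne
  have hg := gam_ne_zero hN lam
  refine simpleRoot_cases (m := m + 1) (p := fun j =>
    P.monAt (P.gamInv lam) (simpleRoot (m + 2) j) ≠ 1 →
    ev (basePt P hN.dual (m + 2)) (stepOp P m j F) -
      stepScalar P m j (P.gam lam) * ev (basePt P hN.dual (m + 2)) F =
      (P.dual.mult (simpleRoot (m + 2) j))⁻¹ *
        P.dual.v (simpleRoot (m + 2) j) (P.gamInv lam) * ev (basePt P hN.dual (m + 2)) F)
    ?_ ?_ ?_ hj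
  · intro hne
    have hu : P.dual.monAt (P.gamInv lam) (-eps (0 : Fin (m + 2)), 1) = P.qh * P.gam lam 0 := by
      rw [monAt_neg_eps, Params.gamInv, inv_inv, zpow_one]; rfl
    have hne' : (P.qh * P.gam lam 0) ^ 2 ≠ 1 := by
      have e : simpleRoot (m + 2) 0 = (2 : ℤ) • (-eps 0, 1) := by
        rw [simpleRoot_zero (by omega)]
        ext <;> simp
      rw [e, monAt_zsmul] at hne
      rw [← hu]; exact hne
    have hv : P.dual.v (simpleRoot (m + 2) 0) (P.gamInv lam) =
        (1 - P.tnv * P.t0v * (P.qh * P.gam lam 0)) * (1 + P.tnv * P.t0v⁻¹ * (P.qh * P.gam lam 0)) /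
          (1 - (P.qh * P.gam lam 0) ^ 2) := by
      have e : simpleRoot (m + 2) 0 = (2 • (-eps 0), 2 * 1) := simpleRoot_zero (by omega)
      rw [e, v_long (isShort_eps _).neg, hu]
      simp [Params.vLong, Params.dual]
    rw [stepOp, if_pos rfl, ev_basePt_Vu hN ht2 htt, stepScalar, if_pos rfl, ← sub_mul,
      cLong_add_dLong hN.tnv hN.t0v hne', dLong, hv, mult_simpleRoot_zero]
    simp only [Params.dual]
    ring
  · intro j hj hne
    have hjj : (⟨j, by omega⟩ : Fin (m + 2)) ≠ ⟨j + 1, hj⟩ := by simp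
    have e : simpleRoot (m + 2) (j + 1) = (eps ⟨j, by omega⟩ - eps ⟨j + 1, hj⟩, 2 * 0) :=
      simpleRoot_mid j hj
    have hu : P.dual.monAt (P.gamInv lam) (simpleRoot (m + 2) (j + 1)) =
        (P.gam lam ⟨j, by omega⟩)⁻¹ * P.gam lam ⟨j + 1, hj⟩ := by
      have : simpleRoot (m + 2) (j + 1) = ((eps ⟨j, by omega⟩, 0) + (-eps ⟨j + 1, hj⟩, 0) :
          Aff (m + 2)) := by
        rw [simpleRoot_mid j hj, Prod.mk_add_mk, sub_eq_add_neg]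
        rfl
      rw [this, monAt_add hN.dual.qh (gamInv_ne_zero hN lam), monAt_eps, monAt_neg_eps]
      simp [Params.gamInv]
    have hne' : P.gam lam ⟨j, by omega⟩ ≠ P.gam lam ⟨j + 1, hj⟩ := by
      intro h
      apply hne
      have : P.monAt (P.gamInv lam) (simpleRoot (m + 2) (j + 1)) = _ := hu
      rw [this, h, inv_mul_cancel₀ (hg _)]
    have hv : P.dual.v (simpleRoot (m + 2) (j + 1)) (P.gamInv lam) =
        (1 - P.t ^ 2 * ((P.gam lam ⟨j, by omega⟩)⁻¹ * P.gam lam ⟨j + 1, hj⟩)) /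
          (1 - (P.gam lam ⟨j, by omega⟩)⁻¹ * P.gam lam ⟨j + 1, hj⟩) := by
      rw [e, v_med (isMed_sub hjj), ← e, hu]
      rfl
    have hT := ev_basePt_T hN ht2 htt (j := j) (by omega) F
    rw [stepOp, if_neg (by omega), hT, stepScalar, if_neg (by omega),
      dif_pos hj, ← sub_mul, mult_simpleRoot_mid P hj, mult_simpleRoot_mid P.dual hj]
    simp only [Nat.add_sub_cancel]
    rw [cMed_add_dMed hne', dMed, hv]
    have h1 := hg ⟨j, by omega⟩
    have ht := hN.t
    have h2 := sub_ne_zero.2 hne'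
    simp only [Params.dual]
    congr 1
    field_simp
  · intro hne
    have hu : P.dual.monAt (P.gamInv lam) (eps (Fin.last (m + 1)), 0) =
        (P.gam lam (Fin.last (m + 1)))⁻¹ := by
      rw [monAt_eps, zpow_zero, one_mul]; rfl
    have hne' : ((P.gam lam (Fin.last (m + 1)))⁻¹) ^ 2 ≠ 1 := by
      have e : simpleRoot (m + 2) (m + 2) = (2 : ℤ) • (eps (Fin.last (m + 1)), 0) := by
        rw [simpleRoot_last]
        ext <;> simp
      rw [e, monAt_zsmul] at hne
      rw [← hu]; exact hne
    have hv : P.dual.v (simpleRoot (m + 2) (m + 2)) (P.gamInv lam) =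
        (1 - P.tn * P.t0 * (P.gam lam (Fin.last (m + 1)))⁻¹) *
          (1 + P.tn * P.t0⁻¹ * (P.gam lam (Fin.last (m + 1)))⁻¹) /
          (1 - ((P.gam lam (Fin.last (m + 1)))⁻¹) ^ 2) := by
      rw [simpleRoot_last, v_long (isShort_eps _), hu]
      simp [Params.vLong, Params.dual]
    have hT := ev_basePt_T hN ht2 htt (j := m + 1) le_rfl F
    rw [stepOp, if_neg (by omega), hT, stepScalar, if_neg (by omega),
      dif_neg (by omega), ← sub_mul, mult_simpleRoot_last, mult_simpleRoot_last,
      cLong_add_dLong hN.tn hN.t0 hne', dLong, hv]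
    simp only [Params.dual]
    ring

theorem dual_mult_ne_zero (hP : P.Nondeg) {n : ℕ} (β : Aff n) : P.mult β ≠ 0 := by
  have := hP.t; have := hP.tn; have := hP.tnv; have := hP.t0; have := hP.t0v
  unfold Params.mult
  split_ifs <;> first | assumption | exact one_ne_zero

/-- The values at `x_0⁻¹` as products over affine roots. -/
theorem ev_basePt_eq (hP : P.Generic (m + 2)) (ht2 : P.t ^ 2 ≠ 1)
    (htt : (P.tn * P.tnv) ^ 2 ≠ 1) {lam : Wt (m + 2)} {F : Laurent (m + 2)} (hF : IsMonicEigen P lam F) :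
    ev (basePt P hP.toNondeg.dual (m + 2)) F * P.dual.cFun (P.gamInv (0 : Wt (m + 2))) =
      signWeight P lam * (∏ᶠ β ∈ invSet lam, P.dual.mult β)⁻¹ *
        ∏ᶠ β ∈ upSet lam, P.dual.v (-β) (P.gamInv lam) := by
  have hN := hP.toNondeg
  suffices h : ∃ F, IsMonicEigen P lam F ∧
      ev (basePt P hP.toNondeg.dual (m + 2)) F * P.dual.cFun (P.gamInv (0 : Wt (m + 2))) =
      signWeight P lam * (∏ᶠ β ∈ invSet lam, P.dual.mult β)⁻¹ *
        ∏ᶠ β ∈ upSet lam, P.dual.v (-β) (P.gamInv lam) by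
    obtain ⟨G, hG, h⟩ := h
    rw [eq_of_isEigen hP hF.eigen hG.eigen (hF.coeff.trans hG.coeff.symm)]
    exact h
  clear hF F
  refine weight_induction (m := m + 1) (p := fun lam => ∃ F, IsMonicEigen P lam F ∧
      ev (basePt P hP.toNondeg.dual (m + 2)) F * P.dual.cFun (P.gamInv (0 : Wt (m + 2))) =
      signWeight P lam * (∏ᶠ β ∈ invSet lam, P.dual.mult β)⁻¹ *
        ∏ᶠ β ∈ upSet lam, P.dual.v (-β) (P.gamInv lam)) ?_ ?_ lam
  · refine ⟨_, isMonicEigen_zero hN, ?_⟩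
    have h0 : ∀ S : Finset (Wt (m + 2)), S = posMed (m + 2) ∨ S = posLong (m + 2) →
        negCount S = 0 := by
      intro S hS
      refine Finset.sum_eq_zero fun β hβ => if_pos (mem_posRoots.2 ?_)
      rcases hS with rfl | rfl
      · exact Or.inl hβ
      · exact Or.inr hβ
    have h1 : posAtMed (0 : Wt (m + 2)) = posMed (m + 2) := by simp [posAtMed, sgn]
    have h2 : posAtLong (0 : Wt (m + 2)) = posLong (m + 2) := by simp [posAtLong, sgn]
    rw [signWeight, h1, h2, h0 _ (Or.inl rfl), h0 _ (Or.inr rfl), invSet_zero, upSet_zero,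
      finPos_eq_image, finprod_mem_empty,
      finprod_mem_image (fun a _ b _ h => congrArg Prod.fst h), finprod_mem_coe_finset, ev_single,
      Params.cFun]
    simp
  · rintro j lam hj hl ⟨F, hF, ih⟩
    refine ⟨_, isMonicEigen_step hP hj hl hF, ?_⟩
    have hr := isRoot_simpleRoot (m := m + 1) hj
    have hm := dual_mult_ne_zero hN.dual (simpleRoot (m + 2) j)
    obtain ⟨u, hu⟩ := exists_isAffSymm_refl (m := m + 1) hj
    rw [ev_basePt_step hP ht2 htt hj, signWeight_step hN hj hl,
      invSet_reflAt (m := m + 1) hj hl, upSet_reflAt (m := m + 1) hj hl,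
      finprod_insert_refl (m := m + 1) hj (fun β hβ => hβ.1) (invSet_finite lam),
      finprod_insert_refl (m := m + 1) hj (fun β hβ => hβ.1) (upSet_finite lam)]
    have e1 : ∏ᶠ β ∈ invSet lam, P.dual.mult (refl (simpleRoot (m + 2) j) β) =
        ∏ᶠ β ∈ invSet lam, P.dual.mult β :=
      finprod_mem_congr rfl fun β hβ => hu.mult_map hβ.1.1
    have e2 : ∏ᶠ β ∈ upSet lam, P.dual.v (-refl (simpleRoot (m + 2) j) β)
        (P.gamInv (reflAt (simpleRoot (m + 2) j) lam)) =
        ∏ᶠ β ∈ upSet lam, P.dual.v (-β) (P.gamInv lam) :=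
      finprod_mem_congr rfl fun β hβ => by
        rw [← map_neg]
        exact v_gamInv_refl (P := P) P.dual rfl hN (m := m + 1) hj hl (affR_neg hβ.1.1)
    have e3 : P.dual.v (-simpleRoot (m + 2) j) (P.gamInv (reflAt (simpleRoot (m + 2) j) lam)) =
        P.dual.v (simpleRoot (m + 2) j) (P.gamInv lam) := by
      rw [← refl_self hr]
      exact v_gamInv_refl (P := P) P.dual rfl hN (m := m + 1) hj hl (simpleRoot_mem (m := m + 1) hj).1
    rw [e1, e2, e3, mul_assoc, ih]
    rw [mul_inv]
    ring

end Step

/-! ### Reduced words in the affine Weyl group -/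

section Words

variable {m : ℕ} {P : Params}

/-- `w` preserves the affine root system and its pairing with co-roots. -/
def IsRootMap {n : ℕ} (w : Module.End ℤ (Aff n)) : Prop :=
  ∀ β ∈ affR n, w β ∈ affR n ∧ ∀ g, (w g).1 ⬝ᵥ coroot (w β).1 = g.1 ⬝ᵥ coroot β.1

theorem IsRootMap.mul {n : ℕ} {w w' : Module.End ℤ (Aff n)} (h : IsRootMap w) (h' : IsRootMap w') :
    IsRootMap (w * w') := fun β hβ =>
  ⟨(h _ (h' β hβ).1).1, fun g => ((h _ (h' β hβ).1).2 _).trans ((h' β hβ).2 g)⟩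

theorem isRootMap_refl {β : Aff m} (hβ : β ∈ affR m) : IsRootMap (refl β) := fun γ hγ => by
  refine ⟨refl_mem_affR hβ hγ, fun g => ?_⟩
  obtain ⟨u, hu, -⟩ := exists_actWt_eq_refl hβ.1
  change (g.1 - (g.1 ⬝ᵥ coroot β.1) • β.1) ⬝ᵥ
    coroot (γ.1 - (γ.1 ⬝ᵥ coroot β.1) • β.1) = _
  rw [hu, hu, coroot_actWt hγ.1, actWt_dot]

theorem IsRootMap.refl_mul {n : ℕ} {w : Module.End ℤ (Aff n)} (h : IsRootMap w) {β : Aff n}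
    (hβ : β ∈ affR n) : refl (w β) * w = w * refl β := by
  refine LinearMap.ext fun g => ?_
  change w g - ((w g).1 ⬝ᵥ coroot (w β).1) • w β = w (g - (g.1 ⬝ᵥ coroot β.1) • β)
  rw [(h β hβ).2, map_sub, map_zsmul]

theorem wordProd_cons {n : ℕ} (i : Fin (n + 1)) (l : List (Fin (n + 1))) :
    wordProd (i :: l) = refl (simpleRoot n i.val) * wordProd l := by
  rw [wordProd, List.map_cons, List.prod_cons]; rfl

theorem wordProd_append {n : ℕ} (l l' : List (Fin (n + 1))) :
    wordProd (l ++ l') = wordProd l * wordProd l' := by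
  rw [wordProd, List.map_append, List.prod_append]; rfl

theorem simpleRoot_mem' (i : Fin (m + 1 + 1)) : simpleRoot (m + 1) i.val ∈ affRPos (m + 1) :=
  simpleRoot_mem (by have := i.isLt; omega)

theorem isRootMap_wordProd (l : List (Fin (m + 1 + 1))) : IsRootMap (wordProd l) := by
  induction l with
  | nil => exact fun β hβ => ⟨hβ, fun _ => rfl⟩
  | cons i l ih => rw [wordProd_cons]; exact (isRootMap_refl (simpleRoot_mem' i).1).mul ih

theorem refl_mul_self {β : Aff m} (hβ : β ∈ affR m) : refl β * refl β = 1 :=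
  LinearMap.ext fun g => refl_refl hβ.1 g

/-- The strong exchange condition. -/
theorem exchange (l : List (Fin (m + 1 + 1))) {β : Aff (m + 1)} (hβ : β ∈ affRPos (m + 1))
    (h : -(wordProd l β) ∈ affRPos (m + 1)) :
    ∃ l', l'.length + 1 = l.length ∧ wordProd l' = wordProd l * refl β := by
  induction l with
  | nil => exact absurd h (not_mem_affRPos_neg hβ)
  | cons i l ih =>
    have hl := isRootMap_wordProd l
    rcases mem_affRPos_or_neg (hl β hβ.1).1 with h1 | h1
    · have h2 : wordProd l β = simpleRoot (m + 1) i.val := by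
        by_contra hne
        rw [wordProd_cons] at h
        exact not_mem_affRPos_neg
          (refl_simpleRoot_mem (by have := i.isLt; omega) h1 hne) h
      refine ⟨l, rfl, ?_⟩
      rw [wordProd_cons, ← h2, hl.refl_mul hβ.1, mul_assoc, refl_mul_self hβ.1, mul_one]
    · obtain ⟨l', h2, h3⟩ := ih h1
      exact ⟨i :: l', by simp [h2], by rw [wordProd_cons, wordProd_cons, h3, mul_assoc]⟩

theorem len_le {n : ℕ} (l : List (Fin (n + 1))) : len (wordProd l) ≤ l.length :=
  Nat.sInf_le ⟨l, rfl, rfl⟩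

theorem exists_isReducedExpr {n : ℕ} {w : Module.End ℤ (Aff n)} (h : ∃ l, wordProd l = w) :
    ∃ l, IsReducedExpr l w := by
  obtain ⟨l, hl⟩ := h
  obtain ⟨l', h1, h2⟩ := Nat.sInf_mem (s := {k | ∃ l : List (Fin (n + 1)), l.length = k ∧
    wordProd l = w}) ⟨_, l, rfl, hl⟩
  exact ⟨l', h2, h1⟩

/-- The positive affine roots that `w` makes negative. -/
def inversions {n : ℕ} (w : Module.End ℤ (Aff n)) : Set (Aff n) :=
  {β | β ∈ affRPos n ∧ -(w β) ∈ affRPos n}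

/-- For a reduced word, the product of the multiplicities of the letters is the product over the
inversions. -/
theorem prod_mult_of_reduced (l : List (Fin (m + 1 + 1))) (h : l.length = len (wordProd l)) :
    (inversions (wordProd l)).Finite ∧ (l.map fun j => P.mult (simpleRoot (m + 1) j.val)).prod =
      ∏ᶠ β ∈ inversions (wordProd l), P.mult β := by
  induction l using List.reverseRecOn with
  | nil =>
    have h1 : inversions (wordProd ([] : List (Fin (m + 1 + 1)))) = ∅ :=
      Set.eq_empty_of_forall_notMem fun β hβ => not_mem_affRPos_neg hβ.1 hβ.2
    rw [h1]; simp
  | append_singleton l j ih =>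
    have hj : j.val ≤ m + 1 := by have := j.isLt; omega
    have ha := simpleRoot_mem' j
    have hr := isRoot_simpleRoot hj
    have hw : wordProd (l ++ [j]) = wordProd l * refl (simpleRoot (m + 1) j.val) := by
      rw [wordProd_append]; simp [wordProd]
    -- an initial segment of a reduced word is reduced
    have hred : l.length = len (wordProd l) := by
      refine le_antisymm ?_ (len_le l)
      obtain ⟨l', h1, h2⟩ := exists_isReducedExpr ⟨l, rfl⟩
      have h3 := len_le (l' ++ [j])
      rw [wordProd_append, h1, ← wordProd_append, ← h, List.length_append, List.length_append] at h3
      omega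
    -- otherwise the exchange condition yields a shorter word
    have hpos : wordProd l (simpleRoot (m + 1) j.val) ∈ affRPos (m + 1) := by
      refine (mem_affRPos_or_neg (isRootMap_wordProd l _ ha.1).1).resolve_right fun hn => ?_
      obtain ⟨l', h1, h2⟩ := exchange l ha hn
      have h3 := len_le l'
      rw [h2, ← hw, ← h, List.length_append] at h3
      omega
    obtain ⟨hfin, ih⟩ := ih hred
    have hset : inversions (wordProd (l ++ [j])) = insert (simpleRoot (m + 1) j.val)
        (refl (simpleRoot (m + 1) j.val) '' inversions (wordProd l)) := by
      rw [hw]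
      ext β
      constructor
      · rintro ⟨h1, h2⟩
        by_cases hb : β = simpleRoot (m + 1) j.val
        · exact Or.inl hb
        · exact Or.inr ⟨_, ⟨refl_simpleRoot_mem hj h1 hb, h2⟩, refl_refl hr β⟩
      · rintro (rfl | ⟨γ, ⟨h1, h2⟩, rfl⟩)
        · refine ⟨ha, ?_⟩
          rw [Module.End.mul_apply, refl_self hr, map_neg, neg_neg]
          exact hpos
        · refine ⟨refl_simpleRoot_mem hj h1 ?_, ?_⟩
          · rintro rfl
            exact not_mem_affRPos_neg hpos h2
          · rw [Module.End.mul_apply, refl_refl hr]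
            exact h2
    rw [hset]
    refine ⟨(hfin.image _).insert _, ?_⟩
    obtain ⟨u, hu⟩ := exists_isAffSymm_refl hj
    rw [finprod_insert_refl hj (fun β hβ => hβ.1) hfin, List.map_append, List.prod_append, ih,
      mul_comm]
    congr 1
    · simp
    · exact finprod_mem_congr rfl fun β hβ => (hu.mult_map hβ.1.1).symm

/-- In particular `t_w` does not depend on the choice of the reduced word. -/
theorem tw_eq {w : Module.End ℤ (Aff (m + 1))} (h : ∃ l, wordProd l = w) :
    P.tw w = ∏ᶠ β ∈ inversions w, P.mult β := by
  have h1 := Classical.epsilon_spec (exists_isReducedExpr h)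
  rw [Params.tw]
  set l := Classical.epsilon fun l : List (Fin (m + 1 + 1)) => IsReducedExpr l w
  have h2 := (prod_mult_of_reduced (P := P) l (by rw [h1.1]; exact h1.2)).2
  rw [h2, h1.1]

/-! ### Finite Weyl group elements and translations as words -/

/-- The monoid of products of simple reflections. -/
def wordMonoid (n : ℕ) : Submonoid (Module.End ℤ (Aff n)) where
  carrier := {w | ∃ l, wordProd l = w}
  one_mem' := ⟨[], rfl⟩
  mul_mem' := by
    rintro _ _ ⟨l, rfl⟩ ⟨l', rfl⟩
    exact ⟨l ++ l', wordProd_append l l'⟩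

theorem refl_mem_wordMonoid {n j : ℕ} (hj : j ≤ n) : refl (simpleRoot n j) ∈ wordMonoid n :=
  ⟨[⟨j, by omega⟩], by simp [wordProd]⟩

theorem actW_mul {n : ℕ} (u u' : FinW n) : actW u * actW u' =
    actW (u.1 * u'.1, fun i => u.2 i * u'.2 (u.1.symm i)) := by
  refine LinearMap.ext fun g => Prod.ext (funext fun i => ?_) rfl
  simp [actW, mul_assoc, Equiv.Perm.mul_def]

theorem actW_perm_mem (σ : Equiv.Perm (Fin (m + 1))) : actW (σ, 1) ∈ wordMonoid (m + 1) := by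
  have hσ : σ ∈ Submonoid.closure
      (Set.range fun i : Fin m => Equiv.swap i.castSucc i.succ) := by
    rw [Equiv.Perm.mclosure_swap_castSucc_succ]; trivial
  induction hσ using Submonoid.closure_induction with
  | mem σ h =>
    obtain ⟨i, rfl⟩ := h
    have e : actW (Equiv.swap i.castSucc i.succ, 1) = refl (simpleRoot (m + 1) (i.val + 1)) := by
      have hi := i.isLt
      rw [simpleRoot_mid i.val (by omega)]
      refine LinearMap.ext fun g => Prod.ext (funext fun k => ?_) ?_
      · have h1 : (⟨i.val, by omega⟩ : Fin (m + 1)) = i.castSucc := rfl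
        have h2 : (⟨i.val + 1, by omega⟩ : Fin (m + 1)) = i.succ := rfl
        have h3 : i.castSucc ≠ i.succ := by simp [Fin.ext_iff]
        rw [refl_apply, h1, h2, coroot_med (isMed_sub h3)]
        simp only [actW, LinearMap.coe_mk, AddHom.coe_mk, Pi.one_apply, Units.val_one, one_mul,
          Equiv.symm_swap, Pi.sub_apply, Pi.smul_apply, dotProduct_sub, dot_eps, smul_eq_mul,
          eps_apply]
        by_cases hk : k = i.castSucc
        · subst hk; simp [h3]
        · by_cases hk' : k = i.succ
          · subst hk'; simp [h3.symm]
          · simp [hk, hk', Equiv.swap_apply_of_ne_of_ne]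
      · rw [refl_apply]; simp [actW]
    rw [e]
    exact refl_mem_wordMonoid (by have := i.isLt; omega)
  | one => exact ⟨[], LinearMap.ext fun g => Prod.ext (funext fun i => by
      simp [wordProd, actW, one_symm_apply]) rfl⟩
  | mul σ τ _ _ h1 h2 =>
    have := Submonoid.mul_mem _ h1 h2
    rw [actW_mul] at this
    convert this using 3
    funext i; simp

theorem actW_sign_last_mem :
    actW (1, Pi.mulSingle (Fin.last m) (-1)) ∈ wordMonoid (m + 1) := by
  have e : actW (1, Pi.mulSingle (Fin.last m) (-1)) = refl (simpleRoot (m + 1) (m + 1)) := by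
    rw [simpleRoot_last]
    refine LinearMap.ext fun g => Prod.ext (funext fun k => ?_) ?_
    · rw [refl_apply, coroot_long (isShort_eps _)]
      by_cases hk : k = Fin.last m
      · subst hk; simp [actW, dot_eps, eps_apply, one_symm_apply]; ring
      · simp [actW, dot_eps, eps_apply, one_symm_apply, hk]
    · rw [refl_apply]; simp [actW]
  rw [e]
  exact refl_mem_wordMonoid le_rfl

theorem actW_mem (u : FinW (m + 1)) : actW u ∈ wordMonoid (m + 1) := by
  have h1 : ∀ i : Fin (m + 1), actW (1, Pi.mulSingle i (-1)) ∈ wordMonoid (m + 1) := by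
    intro i
    have h := Submonoid.mul_mem _ (Submonoid.mul_mem _ (actW_perm_mem (Equiv.swap i (Fin.last m)))
      (actW_sign_last_mem (m := m))) (actW_perm_mem (Equiv.swap i (Fin.last m)))
    rw [actW_mul, actW_mul] at h
    convert h using 3
    · simp
    · funext k
      by_cases hk : k = i
      · subst hk; simp
      · have h2 : Equiv.swap i (Fin.last m) k ≠ Fin.last m := fun h2 => hk (by
          rw [← Equiv.swap_apply_self i (Fin.last m) k, h2, Equiv.swap_apply_right])
        simp [Pi.mulSingle_eq_of_ne hk, Pi.mulSingle_eq_of_ne h2]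
  have h2 : ∀ s : Finset (Fin (m + 1)),
      actW (1, ∏ i ∈ s, Pi.mulSingle i (u.2 i)) ∈ wordMonoid (m + 1) := by
    intro s
    induction s using Finset.induction_on with
    | empty => exact actW_perm_mem 1
    | insert i s hi ih =>
      rw [Finset.prod_insert hi]
      have h3 : actW (1, Pi.mulSingle i (u.2 i)) ∈ wordMonoid (m + 1) := by
        rcases Int.units_eq_one_or (u.2 i) with h | h <;> rw [h]
        · rw [Pi.mulSingle_one]; exact actW_perm_mem 1
        · exact h1 i
      have := Submonoid.mul_mem _ h3 ih
      rw [actW_mul] at this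
      convert this using 3
      · simp
      · funext k; simp [one_symm_apply]
  have h3 := Submonoid.mul_mem _ (h2 Finset.univ) (actW_perm_mem u.1)
  rw [Finset.univ_prod_mulSingle, actW_mul] at h3
  convert h3 using 2
  refine Prod.ext (by simp) ?_
  funext i; simp

theorem transl_mem (lam : Wt (m + 1)) : transl lam ∈ wordMonoid (m + 1) := by
  refine weight_induction (m := m) (p := fun lam => transl lam ∈ wordMonoid (m + 1)) ?_ ?_ lam
  · exact ⟨[], LinearMap.ext fun g => Prod.ext rfl (by simp [wordProd, transl])⟩
  · intro j lam hj _ ih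
    have ha := isRoot_simpleRoot (m := m) hj
    obtain ⟨u, hu, -⟩ := exists_actWt_eq_refl ha
    have e : transl (reflAt (simpleRoot (m + 1) j) lam) =
        refl (simpleRoot (m + 1) j) * transl lam * actW u := by
      refine LinearMap.ext fun g => ?_
      have e1 : actW u g = (g.1 - (g.1 ⬝ᵥ coroot (simpleRoot (m + 1) j).1) •
        (simpleRoot (m + 1) j).1, g.2) := Prod.ext (hu g.1).symm rfl
      obtain ⟨c, hc⟩ := even_simpleRoot (m := m) hj
      have hd : 2 * valAt lam (simpleRoot (m + 1) j) =
          (simpleRoot (m + 1) j).2 - 2 * (lam ⬝ᵥ (simpleRoot (m + 1) j).1) := by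
        rw [valAt]; omega
      rw [Module.End.mul_apply, Module.End.mul_apply, e1, refl_apply]
      simp only [transl, LinearMap.coe_mk, AddHom.coe_mk, sub_dotProduct, smul_dotProduct,
        dot_coroot_self ha, smul_eq_mul, dotProduct_sub, dotProduct_smul, reflAt, add_dotProduct]
      refine Prod.ext ?_ ?_
      · module
      · simp only [dotProduct_comm (coroot (simpleRoot (m + 1) j).1)]
        linear_combination (g.1 ⬝ᵥ coroot (simpleRoot (m + 1) j).1) * hd
    rw [e]
    exact Submonoid.mul_mem _ (Submonoid.mul_mem _ (refl_mem_wordMonoid hj) ih) (actW_mem u)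

end Words

/-! ### Passing to the dominant weight -/

section Dominant

variable {m : ℕ} {P : Params}

theorem IsDominant.dot_nonneg {n : ℕ} {μ α : Wt n} (hμ : IsDominant μ) (hα : α ∈ posRoots n) :
    0 ≤ μ ⬝ᵥ α := by
  rcases mem_posRoots.1 hα with h | h
  · obtain ⟨i, j, hij, rfl | rfl⟩ := mem_posMed.1 h
    · rw [dotProduct_sub, dot_eps, dot_eps]
      have := hμ.1 hij.le
      omega
    · rw [dotProduct_add, dot_eps, dot_eps]
      exact add_nonneg (hμ.2 i) (hμ.2 j)
  · obtain ⟨i, rfl⟩ := mem_posLong.1 h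
    rw [two_smul, dotProduct_add, dot_eps]
    exact add_nonneg (hμ.2 i) (hμ.2 i)

theorem actWt_minRep {n : ℕ} (lam : Wt n) : actWt (minRep lam) (domWt lam) = lam :=
  Function.argminOn_mem (fun w : FinW n => len (actW w)) {w | actWt w (domWt lam) = lam}
    (exists_actWt_domWt lam)

theorem len_minRep_le {n : ℕ} {lam : Wt n} {u : FinW n} (h : actWt u (domWt lam) = lam) :
    len (actW (minRep lam)) ≤ len (actW u) :=
  Function.argminOn_le (fun w : FinW n => len (actW w)) {w | actWt w (domWt lam) = lam} h

theorem mem_affRPos_of_posRoots {n : ℕ} {α : Wt n} (h : α ∈ posRoots n) :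
    ((α, 0) : Aff n) ∈ affRPos n :=
  ⟨⟨isRoot_of_mem h, ⟨0, rfl⟩⟩, Or.inl ⟨h, rfl⟩⟩

/-- The minimality of `w_λ`: it keeps the positive roots of the stabilizer of `λ⁺` positive. -/
theorem minRep_mem_posRoots {lam α : Wt (m + 1)} (hα : α ∈ posRoots (m + 1))
    (h0 : domWt lam ⬝ᵥ α = 0) : actWt (minRep lam) α ∈ posRoots (m + 1) := by
  have hr := isRoot_of_mem hα
  refine (isRoot_iff.1 (hr.actWt (minRep lam))).resolve_right fun hn => ?_
  obtain ⟨l, hl⟩ := exists_isReducedExpr (actW_mem (minRep lam))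
  obtain ⟨l', h1, h2⟩ := exchange l (mem_affRPos_of_posRoots hα) (by
    rw [hl.1]
    exact mem_affRPos_of_posRoots hn)
  obtain ⟨u, hu, hu'⟩ := exists_actWt_eq_refl hr
  have h3 : refl ((α, 0) : Aff (m + 1)) = actW u := LinearMap.ext fun g =>
    Prod.ext (hu g.1) (by rw [refl_apply]; simp [actW])
  rw [hl.1, h3, actW_mul] at h2
  -- the reflection in `α` fixes `λ⁺`, so it would lead to a shorter element that maps `λ⁺` to `λ`
  have h4 : actWt ((minRep lam).1 * u.1, fun i => (minRep lam).2 i * u.2 ((minRep lam).1.symm i))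
      (domWt lam) = lam := by
    rw [actWt, ← actW_mul]
    change actWt (minRep lam) (actWt u (domWt lam)) = lam
    rw [← hu', h0, zero_smul, sub_zero, actWt_minRep]
  have h5 := len_minRep_le h4
  have h6 := len_le l'
  rw [h2] at h6
  have h7 := hl.2
  omega

theorem dot_actWt_minRep {n : ℕ} (lam α : Wt n) : lam ⬝ᵥ actWt (minRep lam) α = domWt lam ⬝ᵥ α := by
  have h := actWt_dot (minRep lam) (domWt lam) α
  rwa [actWt_minRep] at h

theorem posAt_actWt_minRep {lam α : Wt (m + 1)} (hα : α ∈ posRoots (m + 1)) :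
    PosAt lam (actWt (minRep lam) α) := by
  rw [PosAt, dot_actWt_minRep]
  rcases ((isDominant_domWt lam).dot_nonneg hα).lt_or_eq with h | h
  · exact Or.inl h
  · exact Or.inr ⟨h.symm, minRep_mem_posRoots hα h.symm⟩

theorem actWt_injective {n : ℕ} (w : FinW n) : Function.Injective (actWt w) := fun a b h => by
  rw [← invW_actWt w a, h, invW_actWt]

theorem posAtMed_eq_image (lam : Wt (m + 1)) :
    posAtMed lam = (posMed (m + 1)).image (actWt (minRep lam)) := by
  symm
  refine Finset.eq_of_subset_of_card_le ?_ ?_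
  · intro β hβ
    obtain ⟨α, hα, rfl⟩ := Finset.mem_image.1 hβ
    exact mem_posAtMed.2 ⟨(isMed_of_mem hα).actWt _, posAt_actWt_minRep (mem_posRoots.2 (Or.inl hα))⟩
  · rw [Finset.card_image_of_injective _ (actWt_injective _), card_posAtMed]

theorem posAtLong_eq_image (lam : Wt (m + 1)) :
    posAtLong lam = (posLong (m + 1)).image (actWt (minRep lam)) := by
  symm
  refine Finset.eq_of_subset_of_card_le ?_ ?_
  · intro β hβ
    obtain ⟨α, hα, rfl⟩ := Finset.mem_image.1 hβ
    exact mem_posAtLong.2 ⟨(isLong_of_mem hα).actWt _,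
      posAt_actWt_minRep (mem_posRoots.2 (Or.inr hα))⟩
  · rw [Finset.card_image_of_injective _ (actWt_injective _), card_posAtLong]

theorem actWt_sum {n : ℕ} {ι : Type*} (w : FinW n) (s : Finset ι) (f : ι → Wt n) :
    actWt w (∑ i ∈ s, f i) = ∑ i ∈ s, actWt w (f i) := by
  funext k
  simp only [actWt_apply, Finset.sum_apply, Finset.mul_sum]

theorem rhoMed_of_dominant {n : ℕ} {μ : Wt n} (hμ : IsDominant μ) :
    rhoMed μ = ∑ α ∈ posMed n, coroot α :=
  Finset.sum_congr rfl fun α hα => by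
    rw [sgn, if_pos (hμ.dot_nonneg (mem_posRoots.2 (Or.inl hα))), one_smul]

theorem rhoLong_of_dominant {n : ℕ} {μ : Wt n} (hμ : IsDominant μ) :
    rhoLong μ = ∑ α ∈ posLong n, coroot α :=
  Finset.sum_congr rfl fun α hα => by
    rw [sgn, if_pos (hμ.dot_nonneg (mem_posRoots.2 (Or.inr hα))), one_smul]

theorem rhoMed_minRep (lam : Wt (m + 1)) :
    rhoMed lam = actWt (minRep lam) (rhoMed (domWt lam)) := by
  rw [rhoMed_of_dominant (isDominant_domWt lam), rhoMed_eq, posAtMed_eq_image,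
    Finset.sum_image (actWt_injective _).injOn, actWt_sum]
  exact Finset.sum_congr rfl fun α hα => coroot_actWt (Or.inl (isMed_of_mem hα)) _

theorem rhoLong_minRep (lam : Wt (m + 1)) :
    rhoLong lam = actWt (minRep lam) (rhoLong (domWt lam)) := by
  rw [rhoLong_of_dominant (isDominant_domWt lam), rhoLong_eq, posAtLong_eq_image,
    Finset.sum_image (actWt_injective _).injOn, actWt_sum]
  exact Finset.sum_congr rfl fun α hα => coroot_actWt (Or.inr (isLong_of_mem hα)) _

theorem zpow_dot {n : ℕ} {a : ℂ} (ha : a ≠ 0) (μ ν : Wt n) :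
    ∏ i, (a ^ μ i) ^ ν i = a ^ (μ ⬝ᵥ ν) := by
  have h : ∀ (s : Finset (Fin n)), ∏ i ∈ s, (a ^ μ i) ^ ν i = a ^ ∑ i ∈ s, μ i * ν i := by
    intro s
    induction s using Finset.induction_on with
    | empty => simp
    | insert i s hi ih => rw [Finset.prod_insert hi, Finset.sum_insert hi, zpow_add₀ ha, ih, zpow_mul]
  exact h _

theorem monAt_gamInv (hP : P.Nondeg) {n : ℕ} (lam : Wt n) (g : Aff n) :
    P.monAt (P.gamInv lam) g = P.qh ^ g.2 * (P.t0 ^ (rhoLong lam ⬝ᵥ g.1) *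
      P.tn ^ (rhoLong lam ⬝ᵥ g.1) * P.t ^ (rhoMed lam ⬝ᵥ g.1) * P.q ^ (lam ⬝ᵥ g.1))⁻¹ := by
  rw [← zpow_dot hP.t0, ← zpow_dot hP.tn, ← zpow_dot hP.t, ← zpow_dot hP.q_ne,
    ← Finset.prod_mul_distrib, ← Finset.prod_mul_distrib, ← Finset.prod_mul_distrib,
    ← Finset.prod_inv_distrib, Params.monAt]
  congr 1
  refine Finset.prod_congr rfl fun i _ => ?_
  simp only [Params.gamInv, Params.gam, inv_zpow, mul_zpow]

theorem monAt_gamInv_minRep (hP : P.Nondeg) (lam : Wt (m + 1)) (g : Aff (m + 1)) :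
    P.monAt (P.gamInv lam) (actW (minRep lam) g) = P.monAt (P.gamInv (domWt lam)) g := by
  have h1 : (actW (minRep lam) g).1 = actWt (minRep lam) g.1 := rfl
  have h2 : (actW (minRep lam) g).2 = g.2 := rfl
  rw [monAt_gamInv hP, monAt_gamInv hP, h1, h2, rhoMed_minRep, rhoLong_minRep, actWt_dot, actWt_dot,
    dot_actWt_minRep]

theorem v_minRep (Q : Params) (hQ : Q.qh = P.qh) (hP : P.Nondeg) (lam : Wt (m + 1))
    {β : Aff (m + 1)} (hβ : β ∈ affR (m + 1)) :
    Q.v (actW (minRep lam) β) (P.gamInv lam) = Q.v β (P.gamInv (domWt lam)) := by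
  refine (isAffSymm_actW _).v_map (fun g => ?_) hβ
  have := monAt_gamInv_minRep hP lam g
  rw [Params.monAt] at this ⊢
  rw [hQ, this, Params.monAt, Params.monAt, hQ]

/-! ### The index sets of the products -/

/-- The elements of `upSet λ` with a positive constant term. -/
def upPos {n : ℕ} (lam : Wt n) : Set (Aff n) := {β | β ∈ upSet lam ∧ 0 < β.2}

/-- The positive roots that `w_λ` makes negative. -/
def flipped {n : ℕ} (lam : Wt n) : Set (Aff n) :=
  {β | β ∈ finPos n ∧ actWt (minRep lam) β.1 ∉ posRoots n}

/-- The positive roots that `w_λ` keeps positive. -/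
def kept {n : ℕ} (lam : Wt n) : Set (Aff n) :=
  {β | β ∈ finPos n ∧ actWt (minRep lam) β.1 ∈ posRoots n}

theorem finPos_finite (n : ℕ) : (finPos n).Finite := by
  rw [finPos_eq_image]; exact (Finset.finite_toSet _).image _

theorem actW_injective {n : ℕ} (w : FinW n) : Function.Injective (actW w) := fun a b h => by
  have h1 := congrArg Prod.fst h
  have h2 := congrArg Prod.snd h
  exact Prod.ext (actWt_injective w h1) h2

theorem exists_actW_eq {n : ℕ} (w : FinW n) {β : Aff n} (hβ : β ∈ affR n) :
    ∃ γ ∈ affR n, actW w γ = β :=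
  ⟨(actWt (invW w) β.1, β.2), ⟨IsRoot.actWt hβ.1 _, hβ.2⟩, Prod.ext (actWt_invW w _) rfl⟩

theorem valAt_actW_minRep {n : ℕ} (lam : Wt n) (β : Aff n) :
    valAt lam (actW (minRep lam) β) = valAt (domWt lam) β := by
  change β.2 / 2 - lam ⬝ᵥ actWt (minRep lam) β.1 = _
  rw [dot_actWt_minRep]; rfl

theorem mem_affRPos_of_pos {n : ℕ} {β : Aff n} (hβ : β ∈ affR n) (h : 0 < β.2) : β ∈ affRPos n :=
  ⟨hβ, Or.inr h⟩

theorem invSet_image (lam : Wt (m + 1)) :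
    actW (minRep lam) '' (invSet (domWt lam) \ flipped lam) = invSet lam := by
  ext β
  constructor
  · rintro ⟨γ, ⟨⟨h1, h2⟩, h3⟩, rfl⟩
    refine ⟨⟨⟨IsRoot.actWt h1.1.1 _, h1.1.2⟩, ?_⟩, by rwa [valAt_actW_minRep]⟩
    rcases h1.2 with h | h
    · refine Or.inl ⟨?_, h.2⟩
      by_contra h4
      exact h3 ⟨h, h4⟩
    · exact Or.inr h
  · rintro ⟨h1, h2⟩
    obtain ⟨γ, hγ, rfl⟩ := exists_actW_eq (minRep lam) h1.1
    rw [valAt_actW_minRep] at h2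
    refine ⟨γ, ⟨⟨⟨hγ, ?_⟩, h2⟩, ?_⟩, rfl⟩
    · rcases h1.2 with h | h
      · refine Or.inl ⟨?_, h.2⟩
        have h3 : γ.2 = 0 := h.2
        refine (isRoot_iff.1 hγ.1).resolve_right fun h4 => ?_
        have h5 := (isDominant_domWt lam).dot_nonneg h4
        rw [valAt, h3] at h2
        rw [dotProduct_neg] at h5
        omega
      · exact Or.inr h
    · rintro ⟨h3, h4⟩
      rcases h1.2 with h | h
      · exact h4 h.1
      · have h5 : γ.2 = 0 := h3.2
        have h6 : 0 < γ.2 := h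
        omega

theorem flipped_subset (lam : Wt (m + 1)) : flipped lam ⊆ invSet (domWt lam) := by
  rintro β ⟨⟨h1, h2⟩, h3⟩
  refine ⟨⟨⟨isRoot_of_mem h1, by rw [h2]; exact ⟨0, rfl⟩⟩, Or.inl ⟨h1, h2⟩⟩, ?_⟩
  have h4 := (isDominant_domWt lam).dot_nonneg h1
  have h5 : domWt lam ⬝ᵥ β.1 ≠ 0 := fun h => h3 (minRep_mem_posRoots h1 h)
  rw [valAt, h2]
  omega

theorem flipped_finite {n : ℕ} (lam : Wt n) : (flipped lam).Finite :=
  (finPos_finite n).subset fun _ h => h.1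

theorem kept_finite {n : ℕ} (lam : Wt n) : (kept lam).Finite :=
  (finPos_finite n).subset fun _ h => h.1

theorem upPos_image {n : ℕ} (lam : Wt n) : actW (minRep lam) '' upPos (domWt lam) = upPos lam := by
  ext β
  constructor
  · rintro ⟨γ, ⟨⟨h1, h2⟩, h3⟩, rfl⟩
    exact ⟨⟨mem_affRPos_of_pos ⟨IsRoot.actWt h1.1.1 _, h1.1.2⟩ h3, by rwa [valAt_actW_minRep]⟩, h3⟩
  · rintro ⟨⟨h1, h2⟩, h3⟩
    obtain ⟨γ, hγ, rfl⟩ := exists_actW_eq (minRep lam) h1.1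
    rw [valAt_actW_minRep] at h2
    exact ⟨γ, ⟨⟨mem_affRPos_of_pos hγ h3, h2⟩, h3⟩, rfl⟩

theorem upSet_eq_union (lam : Wt (m + 1)) :
    upSet lam = upPos lam ∪ actW (minRep lam) '' kept lam := by
  ext β
  constructor
  · rintro ⟨h1, h2⟩
    rcases h1.2 with h | h
    · right
      obtain ⟨γ, hγ, rfl⟩ := exists_actW_eq (minRep lam) h1.1
      have h3 : γ.2 = 0 := h.2
      refine ⟨γ, ⟨⟨?_, h3⟩, h.1⟩, rfl⟩
      refine (isRoot_iff.1 hγ.1).resolve_right fun h4 => ?_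
      have h5 := (isDominant_domWt lam).dot_nonneg h4
      rw [valAt_actW_minRep, valAt, h3] at h2
      rw [dotProduct_neg] at h5
      have h6 := minRep_mem_posRoots (lam := lam) h4 (by rw [dotProduct_neg]; omega)
      rw [actWt_neg] at h6
      exact not_mem_posRoots_neg h.1 h6
    · exact Or.inl ⟨⟨h1, h2⟩, h⟩
  · rintro (h | ⟨γ, ⟨⟨h1, h2⟩, h3⟩, rfl⟩)
    · exact h.1
    · have h4 : actW (minRep lam) γ = (actWt (minRep lam) γ.1, 0) := Prod.ext rfl h2
      refine ⟨by rw [h4]; exact mem_affRPos_of_posRoots h3, ?_⟩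
      rw [valAt_actW_minRep, valAt, h2]
      have := (isDominant_domWt lam).dot_nonneg h1
      omega

/-- The inversions of `τ(-λ⁺)`. -/
theorem inversions_transl (lam : Wt (m + 1)) :
    inversions (transl (-domWt lam)) = invSet (domWt lam) := by
  ext β
  rw [inversions, Set.mem_ofPred_eq, invSet, Set.mem_ofPred_eq]
  refine and_congr_right fun hβ => ?_
  obtain ⟨α, c, hα, rfl⟩ := mem_affR_iff.1 hβ.1
  rw [valAt_mk]
  have e : -(transl (-domWt lam) (α, 2 * c)) = (-α, -(2 * c) + 2 * (domWt lam ⬝ᵥ α)) :=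
    Prod.ext rfl (by simp [transl]; ring)
  rw [e]
  have hR : ((-α, -(2 * c) + 2 * (domWt lam ⬝ᵥ α)) : Aff (m + 1)) ∈ affR (m + 1) :=
    ⟨hα.neg, ⟨-c + domWt lam ⬝ᵥ α, by simp only; ring⟩⟩
  constructor
  · rintro ⟨-, h | h⟩
    · exfalso
      have h3 := (isDominant_domWt lam).dot_nonneg h.1
      rw [dotProduct_neg] at h3
      have h4 := h.2
      simp only at h4 h
      rcases hβ.2 with h5 | h5
      · exact not_mem_posRoots_neg h5.1 h.1
      · simp only at h5; omega
    · simp only at h; omega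
  · intro h
    exact ⟨hR, Or.inr (by simp only; omega)⟩

theorem evalRoots_eq (lam : Wt (m + 1)) : evalRoots lam = invSet (domWt lam) \ flipped lam := by
  have h2 : affRPos (m + 1) ∩ transl (domWt lam) '' affRNeg (m + 1) = invSet (domWt lam) := by
    rw [← inversions_transl]
    ext β
    refine and_congr_right fun _ => ?_
    constructor
    · rintro ⟨γ, hγ, rfl⟩
      have : transl (-domWt lam) (transl (domWt lam) γ) = γ := Prod.ext rfl (by simp [transl])
      rw [this]; exact hγ
    · intro h
      exact ⟨_, h, Prod.ext rfl (by simp [transl])⟩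
  rw [evalRoots, h2]
  ext β
  refine and_congr_right fun hβ => not_congr ?_
  rw [flipped, Set.mem_inter_iff, Set.mem_ofPred_eq]
  refine and_congr_right fun hf => ?_
  have hr := (isRoot_of_mem hf.1).actWt (minRep lam)
  have e : -(actW (minRep lam) β) = (-actWt (minRep lam) β.1, -β.2) := rfl
  rw [Set.mem_preimage, finNeg, Set.mem_ofPred_eq, e, hf.2, finPos, Set.mem_ofPred_eq]
  constructor
  · rintro ⟨h, -⟩ h'
    exact not_mem_posRoots_neg h' h
  · intro h
    exact ⟨(isRoot_iff.1 hr).resolve_left h, rfl⟩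

theorem inversions_minRep (lam : Wt (m + 1)) : inversions (actW (minRep lam)) = flipped lam := by
  ext β
  have e : -(actW (minRep lam) β) = (-actWt (minRep lam) β.1, -β.2) := rfl
  constructor
  · rintro ⟨h1, h2⟩
    rw [e] at h2
    have h3 : β.1 ∈ posRoots (m + 1) ∧ β.2 = 0 := by
      rcases h1.2 with h | h
      · exact h
      · rcases h2.2 with h4 | h4 <;> simp only at h4 <;> omega
    refine ⟨h3, fun h => ?_⟩
    rcases h2.2 with h4 | h4
    · exact not_mem_posRoots_neg h h4.1
    · simp only at h4; omega
  · rintro ⟨h1, h2⟩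
    have hp := mem_affRPos_of_posRoots h1.1
    have hb : β = (β.1, 0) := Prod.ext rfl h1.2
    refine ⟨by rw [hb]; exact hp, ?_⟩
    rw [e, h1.2]
    exact mem_affRPos_of_posRoots
      ((isRoot_iff.1 ((isRoot_of_mem h1.1).actWt (minRep lam))).resolve_left h2)

/-! ### The products over the index sets -/

theorem finprod_invSet_minRep (lam : Wt (m + 1)) (f : Aff (m + 1) → ℂ) :
    ∏ᶠ β ∈ invSet (domWt lam), f (actW (minRep lam) β) =
      (∏ᶠ β ∈ invSet lam, f β) * ∏ᶠ β ∈ flipped lam, f (actW (minRep lam) β) := by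
  rw [← invSet_image lam, finprod_mem_image (actW_injective _).injOn, mul_comm,
    finprod_mem_mul_sdiff (flipped_subset lam) (invSet_finite _)]

theorem signWeight_eq (P : Params) (lam : Wt (m + 1)) :
    signWeight P lam = ∏ᶠ β ∈ flipped lam, P.mult β := by
  classical
  have hz : ∀ (a : ℂ) (s : Finset (Wt (m + 1))), a ^ negCount (s.image (actWt (minRep lam))) =
      ∏ α ∈ s, if actWt (minRep lam) α ∈ posRoots (m + 1) then 1 else a := by
    intro a s
    have : negCount (s.image (actWt (minRep lam))) =
        ((s.filter fun α => actWt (minRep lam) α ∉ posRoots (m + 1)).card : ℕ) := by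
      rw [negCount, Finset.sum_image (actWt_injective _).injOn, Finset.card_filter]
      push_cast
      refine Finset.sum_congr rfl fun α _ => ?_
      split_ifs <;> rfl
    rw [this, zpow_natCast, ← Finset.prod_const, Finset.prod_filter]
    refine Finset.prod_congr rfl fun α _ => ?_
    split_ifs <;> rfl
  have hd : Disjoint (posMed (m + 1)) (posLong (m + 1)) :=
    Finset.disjoint_left.2 fun α h h' => not_isMed_and_isLong (isMed_of_mem h) (isLong_of_mem h')
  have hf : flipped lam = (fun α : Wt (m + 1) => ((α, 0) : Aff (m + 1))) ''
      ((posRoots (m + 1)).filter fun α => actWt (minRep lam) α ∉ posRoots (m + 1) : Finset _) := by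
    ext β
    simp only [flipped, finPos, Set.mem_ofPred_eq, Set.mem_image, Finset.coe_filter]
    constructor
    · rintro ⟨⟨h1, h2⟩, h3⟩
      exact ⟨β.1, ⟨h1, h3⟩, Prod.ext rfl h2.symm⟩
    · rintro ⟨α, ⟨h1, h2⟩, rfl⟩
      exact ⟨⟨h1, rfl⟩, h2⟩
  rw [hf, finprod_mem_image (fun a _ b _ h => congrArg Prod.fst h), finprod_mem_coe_finset,
    Finset.prod_filter, posRoots, Finset.prod_union hd, signWeight, posAtMed_eq_image,
    posAtLong_eq_image, hz, hz]
  congr 1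
  · refine Finset.prod_congr rfl fun α hα => ?_
    have : P.mult ((α, 0) : Aff (m + 1)) = P.t := mult_med P (isMed_of_mem hα) 0
    rw [this, posRoots]
    split_ifs <;> rfl
  · refine Finset.prod_congr rfl fun α hα => ?_
    have : P.mult ((α, 0) : Aff (m + 1)) = P.tn := by
      obtain ⟨η, hη, rfl⟩ := (isLong_of_mem hα).exists_short
      have := mult_long P hη 0
      simpa using this
    rw [this, posRoots]
    split_ifs <;> rfl

theorem mult_dual_finPos {n : ℕ} {β : Aff n} (h : β ∈ finPos n) : P.dual.mult β = P.mult β := by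
  obtain ⟨h1, h2⟩ := h
  have hb : β = (β.1, 2 * 0) := Prod.ext rfl h2
  rw [hb]
  rcases isRoot_of_mem h1 with h | h
  · rw [mult_med _ h, mult_med _ h]; rfl
  · obtain ⟨η, hη, he⟩ := h.exists_short
    rw [he, mult_long _ hη, mult_long _ hη]; simp [Params.dual]

/-- The multiplicities on both sides of the evaluation formula. -/
theorem tw_minRep_sq (hP : P.Nondeg) (lam : Wt (m + 1)) :
    P.dual.tw (actW (minRep lam)) ^ 2 * (P.dual.tw (transl (-domWt lam)))⁻¹ =
      signWeight P lam * (∏ᶠ β ∈ invSet lam, P.dual.mult β)⁻¹ := by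
  have h1 : P.dual.tw (actW (minRep lam)) = signWeight P lam := by
    rw [tw_eq (actW_mem _), inversions_minRep, signWeight_eq]
    exact finprod_mem_congr rfl fun β hβ => mult_dual_finPos hβ.1
  have h2 : P.dual.tw (transl (-domWt lam)) =
      (∏ᶠ β ∈ invSet lam, P.dual.mult β) * signWeight P lam := by
    have h3 := finprod_invSet_minRep lam P.dual.mult
    rw [finprod_mem_congr rfl fun β (hβ : β ∈ invSet (domWt lam)) =>
      (isAffSymm_actW (minRep lam)).mult_map (P := P.dual) hβ.1.1] at h3
    rw [tw_eq (transl_mem _), inversions_transl, h3, signWeight_eq]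
    congr 1
    refine finprod_mem_congr rfl fun β hβ => ?_
    rw [(isAffSymm_actW (minRep lam)).mult_map (flipped_subset lam hβ).1.1, mult_dual_finPos hβ.1]
  have h3 : signWeight P lam ≠ 0 := mul_ne_zero (zpow_ne_zero _ hP.t) (zpow_ne_zero _ hP.tn)
  rw [h1, h2, mul_inv]
  field_simp

/-- The discrete weight on the orbit of a dominant weight. -/
theorem cFun_mul_finprod (hP : P.Nondeg) (lam : Wt (m + 1)) {E : ℂ}
    (hE : E * ∏ᶠ β ∈ invSet (domWt lam), P.dual.v β (P.gamInv (domWt lam)) =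
      ∏ᶠ β ∈ upPos (domWt lam), P.dual.v (-β) (P.gamInv (domWt lam))) :
    P.dual.cFun (P.gamInv lam) * E *
        ∏ᶠ β ∈ evalRoots lam, P.dual.v β (P.gamInv (domWt lam)) =
      ∏ᶠ β ∈ upSet lam, P.dual.v (-β) (P.gamInv lam) := by
  classical
  set w := minRep lam with hw
  have hv : ∀ β ∈ affR (m + 1), P.dual.v β (P.gamInv (domWt lam)) =
      P.dual.v (actW w β) (P.gamInv lam) := fun β hβ => (v_minRep (P := P) P.dual rfl hP lam hβ).symm
  have hfin : ∀ β ∈ finPos (m + 1), β ∈ affR (m + 1) := fun β hβ =>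
    ⟨isRoot_of_mem hβ.1, by rw [hβ.2]; exact ⟨0, rfl⟩⟩
  have hev : ∏ᶠ β ∈ evalRoots lam, P.dual.v β (P.gamInv (domWt lam)) =
      ∏ᶠ β ∈ evalRoots lam, P.dual.v (actW w β) (P.gamInv lam) :=
    finprod_mem_congr rfl fun β hβ => hv β hβ.1.1.1
  have hinv : ∏ᶠ β ∈ invSet (domWt lam), P.dual.v β (P.gamInv (domWt lam)) =
      (∏ᶠ β ∈ flipped lam, P.dual.v (actW w β) (P.gamInv lam)) *
        ∏ᶠ β ∈ evalRoots lam, P.dual.v (actW w β) (P.gamInv lam) := by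
    rw [finprod_mem_congr rfl fun β (hβ : β ∈ invSet (domWt lam)) => hv β hβ.1.1, evalRoots_eq,
      finprod_mem_mul_sdiff (flipped_subset lam) (invSet_finite _)]
  have hup : ∏ᶠ β ∈ upPos (domWt lam), P.dual.v (-β) (P.gamInv (domWt lam)) =
      ∏ᶠ β ∈ upPos lam, P.dual.v (-β) (P.gamInv lam) := by
    rw [← upPos_image lam, finprod_mem_image (actW_injective _).injOn]
    exact finprod_mem_congr rfl fun β hβ => by rw [hv _ (affR_neg hβ.1.1.1), map_neg]
  have hupSet : ∏ᶠ β ∈ upSet lam, P.dual.v (-β) (P.gamInv lam) =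
      (∏ᶠ β ∈ upPos lam, P.dual.v (-β) (P.gamInv lam)) *
        ∏ᶠ β ∈ kept lam, P.dual.v (-actW w β) (P.gamInv lam) := by
    rw [upSet_eq_union, finprod_mem_union, finprod_mem_image (actW_injective _).injOn]
    · refine Set.disjoint_left.2 ?_
      rintro β h ⟨γ, ⟨hγ, -⟩, rfl⟩
      have h2 : 0 < γ.2 := h.2
      rw [hγ.2] at h2
      exact h2.false
    · exact (upSet_finite lam).subset fun β h => h.1
    · exact (kept_finite lam).image _
  have hC : P.dual.cFun (P.gamInv lam) =
      (∏ᶠ β ∈ kept lam, P.dual.v (-actW w β) (P.gamInv lam)) *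
        ∏ᶠ β ∈ flipped lam, P.dual.v (actW w β) (P.gamInv lam) := by
    -- `w_λ` maps `Σ⁺` onto `Σ⁺`, up to the signs of the roots in `flipped`
    have hset : finPos (m + 1) = actW w '' kept lam ∪ (fun β => -actW w β) '' flipped lam := by
      ext β
      constructor
      · intro hβ
        obtain ⟨γ, hγ, rfl⟩ := exists_actW_eq w (hfin β hβ)
        have h2 : γ.2 = 0 := hβ.2
        rcases isRoot_iff.1 hγ.1 with h | h
        · exact Or.inl ⟨γ, ⟨⟨h, h2⟩, hβ.1⟩, rfl⟩
        · refine Or.inr ⟨-γ, ⟨⟨h, by rw [Prod.snd_neg, h2]; rfl⟩, ?_⟩, by simp⟩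
          rw [Prod.fst_neg, actWt_neg]
          exact not_mem_posRoots_neg hβ.1
      · rintro (⟨γ, ⟨⟨h1, h2⟩, h3⟩, rfl⟩ | ⟨γ, ⟨⟨h1, h2⟩, h3⟩, rfl⟩)
        · exact ⟨h3, h2⟩
        · refine ⟨(isRoot_iff.1 ((isRoot_of_mem h1).actWt w)).resolve_left h3, ?_⟩
          change -γ.2 = 0
          rw [h2]; rfl
    have hc : P.dual.cFun (P.gamInv lam) = ∏ᶠ β ∈ finPos (m + 1), P.dual.v (-β) (P.gamInv lam) := by
      rw [finPos_eq_image, finprod_mem_image (fun a _ b _ h => congrArg Prod.fst h),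
        finprod_mem_coe_finset, Params.cFun]
      simp
    rw [hc, hset, finprod_mem_union, finprod_mem_image (actW_injective _).injOn, finprod_mem_image]
    · simp only [neg_neg]
    · exact fun a _ b _ h => actW_injective _ (neg_injective h)
    · refine Set.disjoint_left.2 ?_
      rintro _ ⟨γ, hγ, rfl⟩ ⟨κ, hκ, h⟩
      have h1 : γ = -κ := actW_injective w (by rw [map_neg]; exact h.symm)
      exact not_mem_posRoots_neg hκ.1.1 (by rw [h1] at hγ; exact hγ.1.1)
    · exact (kept_finite lam).image _
    · exact (flipped_finite lam).image _
  rw [hev, hupSet, hC, ← hup, ← hE, hinv]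
  ring

end Dominant
open Filter Topology

/-! ### Iterated residues at simple poles -/

section Residue

/-- The residue at a simple pole; of the numerator only continuity is needed. -/
theorem residue_eq {f g : ℂ → ℂ} {c : ℂ} (hg : ∀ᶠ z in 𝓝 c, ContinuousAt g z)
    (hf : ∀ᶠ z in 𝓝 c, z ≠ c → f z = g z / (z - c)) : residue f c = g c := by
  refine Tendsto.limUnder_eq ?_
  obtain ⟨R, hR, hball⟩ := Metric.eventually_nhds_iff_ball.1 (hg.and hf)
  rw [Metric.tendsto_nhdsWithin_nhds]
  intro ε hε
  obtain ⟨d, hd, hdist⟩ := Metric.continuousAt_iff.1 hg.self_of_nhds (ε / 2) (by positivity)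
  refine ⟨min R d, lt_min hR hd, fun {r} hr hr' => ?_⟩
  have hr : 0 < r := hr
  rw [Real.dist_eq, sub_zero, abs_of_pos hr, lt_min_iff] at hr'
  have hsph : ∀ z ∈ Metric.sphere c r, z ∈ Metric.ball c R ∧ z ≠ c ∧ dist z c < d := by
    intro z hz
    rw [Metric.mem_sphere] at hz
    refine ⟨by rw [Metric.mem_ball, hz]; exact hr'.1, fun h => ?_, by rw [hz]; exact hr'.2⟩
    rw [h, dist_self] at hz
    exact hr.ne hz
  have e1 : ∮ z in C(c, r), f z = ∮ z in C(c, r), ((z - c)⁻¹ * g c + (z - c)⁻¹ * (g z - g c)) := by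
    refine circleIntegral.integral_congr hr.le fun z hz => ?_
    obtain ⟨h1, h2, -⟩ := hsph z hz
    rw [(hball z h1).2 h2]
    ring
  have hinv : ContinuousOn (fun z : ℂ => (z - c)⁻¹) (Metric.sphere c r) := by
    refine ContinuousOn.inv₀ (by fun_prop) fun z hz => sub_ne_zero.2 (hsph z hz).2.1
  have hgc : ContinuousOn g (Metric.sphere c r) := fun z hz =>
    (hball z (hsph z hz).1).1.continuousWithinAt
  have e2 : ∮ z in C(c, r), f z = 2 * Real.pi * Complex.I * g c +
      ∮ z in C(c, r), (z - c)⁻¹ * (g z - g c) := by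
    rw [e1, circleIntegral.integral_add]
    · congr 1
      have := circleIntegral.integral_sub_center_inv c hr.ne'
      rw [← this, ← smul_eq_mul, ← circleIntegral.integral_smul_const]
      rfl
    · exact (hinv.mul continuousOn_const).circleIntegrable hr.le
    · exact (hinv.mul (hgc.sub continuousOn_const)).circleIntegrable hr.le
  have h2pi : (2 * Real.pi * Complex.I : ℂ) ≠ 0 := Complex.two_pi_I_ne_zero
  rw [e2, mul_add, inv_mul_cancel_left₀ h2pi, dist_eq_norm, add_sub_cancel_left, norm_mul]
  have hb := circleIntegral.norm_integral_le_of_norm_le_const (f := fun z => (z - c)⁻¹ * (g z - g c))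
    (c := c) (R := r) (C := r⁻¹ * (ε / 2)) hr.le (by
      intro z hz
      obtain ⟨h1, h2, h3⟩ := hsph z hz
      rw [Metric.mem_sphere, dist_eq_norm] at hz
      rw [norm_mul, norm_inv, hz]
      have := (hdist h3).le
      rw [dist_eq_norm] at this
      gcongr)
  have hn : ‖(2 * Real.pi * Complex.I : ℂ)⁻¹‖ = (2 * Real.pi)⁻¹ := by
    simp [abs_of_pos Real.pi_pos]
  rw [hn]
  calc (2 * Real.pi)⁻¹ * ‖∮ z in C(c, r), (z - c)⁻¹ * (g z - g c)‖
      ≤ (2 * Real.pi)⁻¹ * (2 * Real.pi * r * (r⁻¹ * (ε / 2))) := by gcongr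
    _ = ε / 2 := by
      have := Real.pi_pos
      field_simp
    _ < ε := by linarith

/-- The first coordinate, or `1` if there is none. -/
def headOr : (n : ℕ) → (Fin n → ℂ) → ℂ
  | 0, _ => 1
  | _ + 1, r => r 0

/-- The product of `1 - r_i / r_{i+1}`, with `1` in place of the missing last coordinate. -/
noncomputable def chainProd : (n : ℕ) → (Fin n → ℂ) → ℂ
  | 0, _ => 1
  | n + 1, r => (1 - r 0 / headOr n (Fin.tail r)) * chainProd n (Fin.tail r)

theorem continuous_headOr (n : ℕ) : Continuous (headOr n) := by
  cases n with
  | zero => exact continuous_const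
  | succ n => exact continuous_apply 0

theorem headOr_div_self {n : ℕ} {c : Fin n → ℂ} (hc : ∀ i, c i ≠ 0) :
    headOr n (fun i => c i / c i) = 1 := by
  cases n with
  | zero => rfl
  | succ n => exact div_self (hc 0)

/-- The iterated residue of a function with simple poles along the hypersurfaces
`x_i / c_i = x_{i+1} / c_{i+1}` and `x_n = c_n`. -/
theorem iterResidue_eq : ∀ (n : ℕ) (c : Fin n → ℂ) (_ : ∀ i, c i ≠ 0) (H F : (Fin n → ℂ) → ℂ)
    (_ : ∀ᶠ x in 𝓝 c, ContinuousAt H x)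
    (_ : ∀ᶠ x in 𝓝 c, chainProd n (fun i => x i / c i) ≠ 0 →
      F x = H x / ((∏ i, x i) * chainProd n fun i => x i / c i)),
    iterResidue n F c = (-1) ^ n * H c := by
  intro n
  induction n with
  | zero =>
    intro c _ H F _ hF
    have := hF.self_of_nhds one_ne_zero
    rw [iterResidue, this]
    simp [chainProd]
  | succ n ih =>
    intro c hc H F hH hF
    have hc' : ∀ i, Fin.tail c i ≠ 0 := fun i => hc i.succ
    have hcons : Tendsto (fun p : ℂ × (Fin n → ℂ) => (Fin.cons p.1 p.2 : Fin (n + 1) → ℂ))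
        (𝓝 (c 0) ×ˢ 𝓝 (Fin.tail c)) (𝓝 c) := by
      rw [← nhds_prod_eq]
      have h : Continuous fun p : ℂ × (Fin n → ℂ) => (Fin.cons p.1 p.2 : Fin (n + 1) → ℂ) := by
        fun_prop
      have h2 := h.tendsto (c 0, Fin.tail c)
      simpa using h2
    have hF2 := (hcons.eventually hF).curry
    have hH2 := (hcons.eventually hH).curry
    have hz0 : ∀ᶠ z in 𝓝 (c 0), z ≠ 0 := isOpen_ne.mem_nhds (hc 0)
    -- the coordinate ratios of the remaining variables are close to `1`
    have hhead : Tendsto (fun x : Fin n → ℂ => headOr n fun i => x i / Fin.tail c i)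
        (𝓝 (Fin.tail c)) (𝓝 1) := by
      have h : Continuous fun x : Fin n → ℂ => headOr n fun i => x i / Fin.tail c i :=
        (continuous_headOr n).comp (continuous_pi fun i => (continuous_apply i).div_const _)
      have h2 := h.tendsto (Fin.tail c)
      rwa [headOr_div_self hc'] at h2
    have key : ∀ᶠ z in 𝓝 (c 0), z ≠ c 0 →
        iterResidue n (fun x => F (Fin.cons z x)) (Fin.tail c) =
          ((-1) ^ n * -(H (Fin.cons z (Fin.tail c)) * (c 0 / z))) / (z - c 0) := by
      filter_upwards [hF2, hH2, hz0] with z hFz hHz hz hne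
      have hr : z / c 0 ≠ 1 := fun h => hne (by rwa [div_eq_one_iff_eq (hc 0)] at h)
      have hne1 : ∀ᶠ x in 𝓝 (Fin.tail c),
          headOr n (fun i => x i / Fin.tail c i) ≠ 0 ∧
          1 - z / c 0 / headOr n (fun i => x i / Fin.tail c i) ≠ 0 := by
        have h1 : ∀ᶠ y in 𝓝 (1 : ℂ), y ≠ 0 := isOpen_ne.mem_nhds one_ne_zero
        have h2 : ∀ᶠ y in 𝓝 (1 : ℂ), y ≠ z / c 0 := isOpen_ne.mem_nhds hr.symm
        filter_upwards [hhead.eventually h1, hhead.eventually h2] with x h1 h2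
        refine ⟨h1, fun h => h2 ?_⟩
        rw [sub_eq_zero, eq_div_iff h1, one_mul] at h
        exact h
      rw [ih (Fin.tail c) hc' (fun x => H (Fin.cons z x) /
        (z * (1 - z / c 0 / headOr n fun i => x i / Fin.tail c i)))]
      · rw [headOr_div_self hc']
        have h1 := hc 0
        have h2 := sub_ne_zero.2 hne
        have h3 : c 0 - z ≠ 0 := sub_ne_zero.2 hne.symm
        have h4 : 1 - z / c 0 / 1 ≠ 0 := by rw [div_one]; exact sub_ne_zero.2 hr.symm
        have h5 : (1 - z / c 0 / 1) = -((z - c 0) / c 0) := by field_simp; ring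
        rw [h5]
        field_simp
      · filter_upwards [hHz, hne1] with x h1 h2
        refine ContinuousAt.div ?_ ?_ (mul_ne_zero hz h2.2)
        · exact ContinuousAt.comp (f := fun x => (Fin.cons z x : Fin (n + 1) → ℂ)) h1
            (Continuous.continuousAt (by fun_prop))
        · refine continuousAt_const.mul (continuousAt_const.sub (continuousAt_const.div ?_ h2.1))
          exact ((continuous_headOr n).comp
            (continuous_pi fun i => (continuous_apply i).div_const _)).continuousAt
      · filter_upwards [hFz, hne1] with x h1 h2 h3
        have e : chainProd (n + 1) (fun i => (Fin.cons z x : Fin (n + 1) → ℂ) i / c i) =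
            (1 - z / c 0 / headOr n fun i => x i / Fin.tail c i) *
              chainProd n fun i => x i / Fin.tail c i := by
          have h4 : Fin.tail (fun i => (Fin.cons z x : Fin (n + 1) → ℂ) i / c i) =
              fun i => x i / Fin.tail c i := by
            funext i
            simp [Fin.tail]
          rw [chainProd, h4]
          rfl
        rw [e] at h1
        rw [h1 (mul_ne_zero h2.2 h3), Fin.prod_univ_succ]
        simp only [Fin.cons_zero, Fin.cons_succ]
        rw [mul_mul_mul_comm]
        exact (div_div _ _ _).symm
    -- the outermost residue; the inner ones have turned the pole into one at `x_1 = c_1`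
    rw [iterResidue, residue_eq (g := fun z => (-1) ^ n * -(H (Fin.cons z (Fin.tail c)) * (c 0 / z)))
      ?_ key]
    · rw [Fin.cons_self_tail, div_self (hc 0)]
      ring
    · have hcz : Tendsto (fun z : ℂ => (Fin.cons z (Fin.tail c) : Fin (n + 1) → ℂ)) (𝓝 (c 0)) (𝓝 c) := by
        have h : Continuous fun z : ℂ => (Fin.cons z (Fin.tail c) : Fin (n + 1) → ℂ) := by fun_prop
        have h2 := h.tendsto (c 0)
        rwa [Fin.cons_self_tail] at h2
      filter_upwards [hcz.eventually hH, hz0] with z h1 h2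
      have h3 : ContinuousAt (fun z : ℂ => H (Fin.cons z (Fin.tail c))) z :=
        ContinuousAt.comp (f := fun z => (Fin.cons z (Fin.tail c) : Fin (n + 1) → ℂ)) h1
          (Continuous.continuousAt (by fun_prop))
      exact continuousAt_const.mul (h3.mul (continuousAt_const.div continuousAt_id h2)).neg

end Residue

/-! ### Infinite products over the affine roots with a given gradient -/

section Pochhammer

variable {q : ℂ}

/-- The infinite shifted factorial `(u; q)_∞ = ∏_{k ≥ 0} (1 - u q^k)`. -/
noncomputable def poch (q u : ℂ) : ℂ := ∏' k : ℕ, (1 - u * q ^ k)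

theorem summable_norm_pow (hq : ‖q‖ < 1) (u : ℂ) : Summable fun k : ℕ => ‖-(u * q ^ k)‖ := by
  simp only [norm_neg, norm_mul, norm_pow]
  exact (summable_geometric_of_lt_one (norm_nonneg q) hq).mul_left _

theorem hasProd_poch (hq : ‖q‖ < 1) (u : ℂ) : HasProd (fun k : ℕ => 1 - u * q ^ k) (poch q u) := by
  have h := multipliable_one_add_of_summable (summable_norm_pow hq u)
  simp only [← sub_eq_add_neg] at h
  exact h.hasProd

theorem poch_ne_zero (hq : ‖q‖ < 1) {u : ℂ} (h : ∀ k : ℕ, u * q ^ k ≠ 1) : poch q u ≠ 0 := by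
  have h1 := tprod_one_add_ne_zero_of_summable (f := fun k : ℕ => -(u * q ^ k))
    (fun k hk => h k (by linear_combination -hk)) (summable_norm_pow hq u)
  simp only [← sub_eq_add_neg] at h1
  exact h1

theorem poch_eq (hq : ‖q‖ < 1) (u : ℂ) : poch q u = (1 - u) * poch q (q * u) := by
  have h : HasProd (fun k : ℕ => 1 - u * q ^ (k + 1)) (poch q (q * u)) := by
    convert hasProd_poch hq (q * u) using 3 with k
    ring
  have h2 := HasProd.zero_mul (f := fun k : ℕ => 1 - u * q ^ k) h
  rw [pow_zero, mul_one] at h2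
  exact (hasProd_poch hq u).unique h2

theorem poch_zero (q : ℂ) : poch q 0 = 1 := by simp [poch]

theorem differentiable_poch (hq : ‖q‖ < 1) : Differentiable ℂ (poch q) := by
  rw [← differentiableOn_univ]
  have h : HasProdLocallyUniformlyOn (fun (k : ℕ) (x : ℂ) => 1 + -(x * q ^ k))
      (fun x => ∏' k : ℕ, (1 + -(x * q ^ k))) Set.univ := by
    refine hasProdLocallyUniformlyOn_of_forall_compact isOpen_univ fun K _ hK => ?_
    obtain ⟨R, hR⟩ := hK.isBounded.exists_norm_le
    refine Summable.hasProdUniformlyOn_one_add (u := fun k => R * ‖q‖ ^ k) hK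
      ((summable_geometric_of_lt_one (norm_nonneg q) hq).mul_left _)
      (.of_forall fun k x hx => ?_) (fun k => by fun_prop)
    rw [norm_neg, norm_mul, norm_pow]
    gcongr
    exact hR x hx
  simp only [← sub_eq_add_neg] at h
  refine h.tendstoLocallyUniformlyOn_finsetRange.differentiableOn (.of_forall fun s => ?_) isOpen_univ
  fun_prop

/-- The tail of an infinite product of which finitely many factors are removed. -/
theorem hasProd_tail {f : ℕ → ℂ} {a : ℂ} (hf : HasProd f a) (k : ℕ) (h0 : ∀ m < k, f m ≠ 0) :
    HasProd (fun m => f (m + k)) (a * ∏ m ∈ Finset.range k, (f m)⁻¹) := by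
  have h1 : HasProd (fun m => if m < k then (f m)⁻¹ else 1) (∏ m ∈ Finset.range k, (f m)⁻¹) := by
    have h2 := hasProd_prod_of_ne_finset_one (L := .unconditional ℕ) (s := Finset.range k)
      (f := fun m => if m < k then (f m)⁻¹ else 1) (fun m hm => if_neg (by simpa using hm))
    rwa [Finset.prod_congr rfl fun m hm => if_pos (Finset.mem_range.1 hm)] at h2
  have h3 := hf.mul h1
  rw [← (add_left_injective k).hasProd_iff] at h3
  · convert h3 using 2 with m
    simp
  · intro m hm
    have hmk : m < k := by
      by_contra h
      exact hm ⟨m - k, by simp only; omega⟩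
    simp [hmk, h0 m hmk]

theorem ne_zero_of_hasProd {f : ℕ → ℂ} {a : ℂ} (hf : HasProd f a) (ha : a ≠ 0) (m : ℕ) : f m ≠ 0 := by
  intro h
  refine ha (hf.unique ?_)
  refine tendsto_const_nhds.congr' ?_
  filter_upwards [eventually_ge_atTop ({m} : Finset ℕ)] with s hs
  exact (Finset.prod_eq_zero (Finset.singleton_subset_iff.1 hs) h).symm

end Pochhammer

section Fibre

variable {n : ℕ} {P : Params}

theorem monAt_mk (y : Fin n → ℂ) (α : Wt n) (k : ℤ) :
    P.monAt y (α, k) = P.qh ^ k * P.monAt y (α, 0) := by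
  simp [Params.monAt]

open Classical in
/-- The numbers `s` such that `∏_{m ≥ 0} v_{α + mδ}(z) = ∏_s (s; q)_∞ / (z^α; q)_∞`: there are four
if `α` is long; if `α` is of medium length there is one, and the vector is filled up by zeros. -/
noncomputable def Params.legs (P : Params) (α : Wt n) (z : Fin n → ℂ) : Fin 4 → ℂ :=
  if IsMed α then ![P.t ^ 2 * P.monAt z (α, 0), 0, 0, 0]
  else ![P.tn * P.tnv * P.monAt z (half (α, 0)), -(P.tn * P.tnv⁻¹ * P.monAt z (half (α, 0))),
    P.t0 * P.t0v * P.qh * P.monAt z (half (α, 0)),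
    -(P.t0 * P.t0v⁻¹ * P.qh * P.monAt z (half (α, 0)))]

theorem legs_med {α : Wt n} (h : IsMed α) (z : Fin n → ℂ) :
    P.legs α z = ![P.t ^ 2 * P.monAt z (α, 0), 0, 0, 0] := if_pos h

theorem legs_long {η : Wt n} (h : IsShort η) (z : Fin n → ℂ) :
    P.legs (2 • η) z = ![P.tn * P.tnv * P.monAt z (η, 0), -(P.tn * P.tnv⁻¹ * P.monAt z (η, 0)),
      P.t0 * P.t0v * P.qh * P.monAt z (η, 0), -(P.t0 * P.t0v⁻¹ * P.qh * P.monAt z (η, 0))] := by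
  have e : half ((2 • η, 0) : Aff n) = (η, 0) := by
    ext <;> simp [half]
  rw [Params.legs, if_neg (fun h' => not_isMed_and_isLong h' h), e]

theorem vNum_med {α : Wt n} (h : IsMed α) (m : ℤ) (z : Fin n → ℂ) :
    P.vNumOf (P.monAt z) (α, 2 * m) = 1 - P.legs α z 0 * P.q ^ m := by
  rw [vNumOf_med P _ h, monAt_mk, qh_zpow, legs_med h]
  simp only [Matrix.cons_val_zero, smul_eq_mul]
  ring

theorem vNum_long_even {η : Wt n} (h : IsShort η) (m : ℤ) (z : Fin n → ℂ) :
    P.vNumOf (P.monAt z) (2 • η, 2 * (2 * m)) =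
      (1 - P.legs (2 • η) z 0 * P.q ^ m) * (1 - P.legs (2 • η) z 1 * P.q ^ m) := by
  rw [vNumOf_long P _ h, if_pos ⟨m, by ring⟩, if_pos ⟨m, by ring⟩, legs_long h, monAt_mk, qh_zpow]
  simp only [Matrix.cons_val_zero, Matrix.cons_val_one, smul_eq_mul]
  ring

theorem vNum_long_odd (hq : P.qh ≠ 0) {η : Wt n} (h : IsShort η) (m : ℤ) (z : Fin n → ℂ) :
    P.vNumOf (P.monAt z) (2 • η, 2 * (2 * m + 1)) =
      (1 - P.legs (2 • η) z 2 * P.q ^ m) * (1 - P.legs (2 • η) z 3 * P.q ^ m) := by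
  have hm : ¬ Even (2 * m + 1) := by simp [parity_simps]
  rw [vNumOf_long P _ h, if_neg hm, if_neg hm, legs_long h, monAt_mk, zpow_add₀ hq, qh_zpow, zpow_one]
  simp only [Matrix.cons_val, smul_eq_mul]
  ring

/-- The product of `v_{α + mδ}^{-1}` over `m ≥ 0` is a quotient of shifted factorials. -/
theorem hasProd_fibre (hq0 : P.qh ≠ 0) (hq : ‖P.q‖ < 1) {α : Wt n} (hα : IsRoot α) {z : Fin n → ℂ}
    (hD : ∏ k, poch P.q (P.legs α z k) ≠ 0) :
    HasProd (fun m : ℕ => (P.v (α, 2 * (m : ℤ)) z)⁻¹)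
      (poch P.q (P.monAt z (α, 0)) * (∏ k, poch P.q (P.legs α z k))⁻¹) := by
  have hnum : HasProd (fun m : ℕ => P.vNumOf (P.monAt z) (α, 2 * (m : ℤ)))
      (∏ k, poch P.q (P.legs α z k)) := by
    rcases hα with h | h
    · have e : ∏ k, poch P.q (P.legs α z k) = poch P.q (P.legs α z 0) := by
        simp [Fin.prod_univ_four, legs_med h, poch_zero]
      rw [e]
      convert hasProd_poch hq (P.legs α z 0) using 2 with m
      rw [vNum_med h, zpow_natCast]
    · obtain ⟨η, hη, rfl⟩ := h.exists_short
      rw [Fin.prod_univ_four, mul_assoc (_ * _)]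
      refine HasProd.even_mul_odd ?_ ?_
      · convert (hasProd_poch hq _).mul (hasProd_poch hq _) using 2 with m
        rw [Nat.cast_mul, Nat.cast_two, vNum_long_even hη, zpow_natCast]
      · convert (hasProd_poch hq _).mul (hasProd_poch hq _) using 2 with m
        rw [Nat.cast_add, Nat.cast_mul, Nat.cast_two, Nat.cast_one, vNum_long_odd hq0 hη, zpow_natCast]
  convert (hasProd_poch hq (P.monAt z (α, 0))).mul (hnum.inv₀ hD) using 2 with m
  rw [Params.v, inv_div, monAt_mk, qh_zpow, zpow_natCast, div_eq_mul_inv, mul_comm (P.q ^ m)]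

/-- The numerator of `v_{α + mδ}` with `m < 0` does not vanish, if `s q^j ≠ 1` for `j < 0`. -/
theorem vNum_ne_zero (hq0 : P.qh ≠ 0) {α : Wt n} (hα : IsRoot α) {z : Fin n → ℂ}
    (h : ∀ k, ∀ j : ℤ, j < 0 → P.legs α z k * P.q ^ j ≠ 1) {m : ℤ} (hm : m < 0) :
    P.vNumOf (P.monAt z) (α, 2 * m) ≠ 0 := by
  have h' : ∀ k, ∀ j : ℤ, j < 0 → 1 - P.legs α z k * P.q ^ j ≠ 0 := fun k j hj h0 =>
    h k j hj (sub_eq_zero.1 h0).symm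
  rcases hα with h1 | h1
  · rw [vNum_med h1]
    exact h' 0 m hm
  · obtain ⟨η, hη, rfl⟩ := h1.exists_short
    obtain ⟨j, rfl | rfl⟩ := Int.even_or_odd' m
    · rw [vNum_long_even hη]
      exact mul_ne_zero (h' _ _ (by omega)) (h' _ _ (by omega))
    · rw [vNum_long_odd hq0 hη]
      exact mul_ne_zero (h' _ _ (by omega)) (h' _ _ (by omega))

/-- `Δ_+` as a finite product over gradients. -/
theorem deltaPlus_eq {z : Fin n → ℂ} {a b : Wt n → ℂ}
    (ha : ∀ α ∈ posRoots n, HasProd (fun m : ℕ => (P.v (α, 2 * (m : ℤ)) z)⁻¹) (a α))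
    (hb : ∀ α ∈ posRoots n, HasProd (fun m : ℕ => (P.v (-α, 2 * (m : ℤ)) z)⁻¹) (b α)) :
    P.deltaPlus z = ∏ α ∈ posRoots n, (a α * b α) := by
  classical
  let f : Aff n → ℂ := fun β => (P.v β z)⁻¹
  let ray : Wt n → ℕ → Aff n := fun α m => (α, 2 * (m : ℤ))
  have hray : ∀ α, Function.Injective (ray α) := fun α x y h => by
    have := congrArg Prod.snd h
    simp only [ray] at this
    omega
  set s := posRoots n ∪ (posRoots n).image Neg.neg with hs
  have hmem : ∀ α, α ∈ s ↔ IsRoot α := fun α => by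
    rw [hs, isRoot_iff, Finset.mem_union, Finset.mem_image]
    refine or_congr Iff.rfl ⟨?_, fun h => ⟨_, h, neg_neg α⟩⟩
    rintro ⟨γ, h, rfl⟩
    rwa [neg_neg]
  have h := hasProd_prod_disjoint (f := f) s (t := fun α => Set.range (ray α))
    (a := fun α => if α ∈ posRoots n then a α else b (-α)) ?_ ?_
  · have e : (⋃ α ∈ s, Set.range (ray α)) = {β : Aff n | β ∈ affR n ∧ 0 ≤ β.2} := by
      ext β
      simp only [Set.mem_iUnion, Set.mem_range, exists_prop, hmem, mem_affR_iff, Set.mem_ofPred_eq]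
      constructor
      · rintro ⟨α, hα, m, rfl⟩
        exact ⟨⟨α, m, hα, rfl⟩, by simp only [ray]; omega⟩
      · rintro ⟨⟨α, m, hα, rfl⟩, h0⟩
        refine ⟨α, hα, m.toNat, ?_⟩
        simp only at h0
        simp only [ray, Prod.mk.injEq, true_and]
        omega
    rw [e] at h
    rw [Params.deltaPlus]
    refine h.tprod_eq.trans ?_
    rw [hs, Finset.prod_union, Finset.prod_image neg_injective.injOn, Finset.prod_mul_distrib]
    · congr 1
      · exact Finset.prod_congr rfl fun α hα => if_pos hα
      · refine Finset.prod_congr rfl fun α hα => ?_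
        rw [if_neg (not_mem_posRoots_neg hα), neg_neg]
    · rw [Finset.disjoint_left]
      intro α hα h'
      obtain ⟨γ, hγ, rfl⟩ := Finset.mem_image.1 h'
      exact not_mem_posRoots_neg hγ hα
  · intro α _ γ _ hne
    rw [Function.onFun, Set.disjoint_left]
    rintro β ⟨x, rfl⟩ ⟨y, h⟩
    exact hne (congrArg Prod.fst h).symm
  · intro α hα
    refine ((hray α).hasProd_range_iff (f := f)).2 ?_
    split_ifs with hp
    · exact ha α hp
    · have := hb (-α) ((isRoot_iff.1 ((hmem α).1 hα)).resolve_left hp)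
      rwa [neg_neg] at this

end Fibre

/-! ### The factors of `Δ̃_+` at the point `γ_0^{-1}` -/

section BasePoint

/-- Parameters that are generic, and for which the weight function converges. -/
structure Params.Admissible (P : Params) (n : ℕ) : Prop extends P.Generic n where
  norm_q : ‖P.q‖ < 1
  norm_t : ‖P.t‖ < 1
  norm_a : ‖P.t0 * P.t0v * P.qh‖ < 1
  norm_b : ‖P.t0 * P.t0v⁻¹ * P.qh‖ < 1
  norm_c : ‖P.tn * P.tnv‖ < 1
  norm_d : ‖P.tn * P.tnv⁻¹‖ < 1
  gen3 : ∀ k : ℕ, k < n → ∀ m : ℤ,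
    P.tnv * P.t0v * P.qh ≠ P.t0 * P.tn * P.t ^ (2 * k) * P.q ^ m ∧
    -(P.tnv * P.t0v⁻¹ * P.qh) ≠ P.t0 * P.tn * P.t ^ (2 * k) * P.q ^ m ∧
    -(P.tn * P.t0⁻¹) ≠ P.t0 * P.tn * P.t ^ (2 * k) * P.q ^ m

variable {m : ℕ} {P : Params}

theorem ne_one_of_norm_lt {a : ℂ} (h : ‖a‖ < 1) : a ≠ 1 := by
  rintro rfl
  simp at h

theorem norm_mul_pow_lt_one {a b : ℂ} (ha : ‖a‖ < 1) (hb : ‖b‖ < 1) (k : ℕ) : ‖a * b ^ k‖ < 1 := by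
  rw [norm_mul, norm_pow]
  exact mul_lt_one_of_nonneg_of_lt_one_left (norm_nonneg _) ha (pow_le_one₀ (norm_nonneg _) hb.le)

theorem norm_mul_lt_one' {a b : ℂ} (ha : ‖a‖ < 1) (hb : ‖b‖ < 1) : ‖a * b‖ < 1 := by
  simpa using norm_mul_pow_lt_one ha hb 1

/-- The simple root with number `i + 1` of the finite root system. -/
def simpleFin (i : Fin (m + 1)) : Wt (m + 1) := (simpleRoot (m + 1) (i.val + 1)).1

theorem simpleFin_last : simpleFin (Fin.last m) = 2 • eps (Fin.last m) := by
  rw [simpleFin, Fin.val_last, simpleRoot_last]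

theorem simpleFin_of_lt {i : ℕ} (h : i + 1 < m + 1) :
    simpleFin (⟨i, by omega⟩ : Fin (m + 1)) = eps ⟨i, by omega⟩ - eps ⟨i + 1, h⟩ := by
  rw [simpleFin, simpleRoot_mid i h]

theorem inv_gamInv_zero (i : Fin (m + 1)) :
    (P.gamInv (0 : Wt (m + 1)) i)⁻¹ = P.t0 * P.tn * P.t ^ (2 * (m - i.val)) := by
  rw [gamInv_zero, mul_inv, inv_inv, inv_inv, Nat.add_sub_cancel]

theorem gamInv_zero' (i : Fin (m + 1)) :
    P.gamInv (0 : Wt (m + 1)) i = (P.t0 * P.tn)⁻¹ * (P.t ^ (2 * (m - i.val)))⁻¹ := by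
  rw [gamInv_zero, Nat.add_sub_cancel]

/-- On a positive root, the only factor of the denominator of `Δ̃_+` that vanishes at `γ_0^{-1}` is
the first one, for a simple root. -/
theorem legs_pos (hP : P.Admissible (m + 1)) {α : Wt (m + 1)} (hα : α ∈ posRoots (m + 1)) (k : Fin 4)
    (j : ℤ) (h : P.dual.legs α (P.gamInv (0 : Wt (m + 1))) k * P.q ^ j = 1) :
    (∃ i, α = simpleFin i) ∧ k = 0 ∧ j = 0 := by
  have hN := hP.toNondeg
  have ht := hP.t
  have h0 := hP.t0
  have hn := hP.tn
  have hq := hN.q_ne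
  have hqj := zpow_ne_zero j hq
  have hy := gamInv_ne_zero hN (0 : Wt (m + 1))
  rcases mem_posRoots.1 hα with hm | hl
  · rw [legs_med (isMed_of_mem hm)] at h
    have hk : k = 0 := by
      fin_cases k
      · rfl
      all_goals simp at h
    subst hk
    change P.t ^ 2 * P.monAt (P.gamInv (0 : Wt (m + 1))) (α, 0) * P.q ^ j = 1 at h
    obtain ⟨i, l, hil, rfl | rfl⟩ := mem_posMed.1 hm
    · have hil' : i.val < l.val := hil
      have hll := l.isLt
      have e : ((eps i - eps l, 0) : Aff (m + 1)) = (eps i, 0) + (-eps l, 0) := by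
        rw [Prod.mk_add_mk, add_zero, sub_eq_add_neg]
      have h1 : P.t ^ (2 * (l.val - i.val - 1)) = P.q ^ j := by
        rw [e, monAt_add hN.qh hy, monAt_eps, monAt_neg_eps, zpow_zero, one_mul, one_mul,
          inv_gamInv_zero, gamInv_zero', show 2 * (m - i.val) =
            2 * (m - l.val) + 2 * (l.val - i.val - 1) + 2 by omega, pow_add, pow_add] at h
        field_simp at h
        exact h.symm
      by_cases hd : l.val - i.val - 1 = 0
      · rw [hd, mul_zero, pow_zero] at h1
        refine ⟨⟨i, ?_⟩, rfl, hP.q_pow j h1.symm⟩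
        have := simpleFin_of_lt (m := m) (i := i.val) (by omega)
        have hl : l = ⟨i.val + 1, by omega⟩ := Fin.ext (by simp only; omega)
        rw [hl]
        exact this.symm
      · exact absurd h1 (hP.gen1 _ (by omega) (by omega) j)
    · have hil' : i.val < l.val := hil
      have hll := l.isLt
      have e : ((eps i + eps l, 0) : Aff (m + 1)) = (eps i, 0) + (eps l, 0) := by
        rw [Prod.mk_add_mk, add_zero]
      -- `t^2 γ_0^{-α} q^j = 1` would mean `(t_0 t_n)^2 t^{2k} = q^j` with `k = 2n - i - l - 1`,
      -- if the coordinates are numbered from `1`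
      refine absurd ?_ (hP.gen2 ((m - i.val) + (m - l.val) - 1) (by omega) j)
      rw [e, monAt_add hN.qh hy, monAt_eps, monAt_eps, zpow_zero, one_mul, one_mul,
        gamInv_zero', gamInv_zero', show 2 * (m - i.val) = 2 * (m - i.val - 1) + 2 by omega,
        pow_add] at h
      rw [show 2 * ((m - i.val) + (m - l.val) - 1) = 2 * (m - i.val - 1) + 2 * (m - l.val) by omega,
        pow_add]
      field_simp at h
      linear_combination -h
  · obtain ⟨i, rfl⟩ := mem_posLong.1 hl
    have hil := i.isLt
    rw [legs_long (isShort_eps i)] at h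
    have e : P.dual.monAt (P.gamInv (0 : Wt (m + 1))) (eps i, 0) =
        (P.t0 * P.tn)⁻¹ * (P.t ^ (2 * (m - i.val)))⁻¹ := by
      rw [monAt_eps, zpow_zero, one_mul, gamInv_zero']
    rw [e] at h
    simp only [Params.dual] at h
    have hg := hP.gen3 (m - i.val) (by omega) (-j)
    rw [zpow_neg] at hg
    set A := P.t0 * P.tn * P.t ^ (2 * (m - i.val)) with hA
    have hA0 : A ≠ 0 := by positivity
    have key : ∀ s : ℂ, s * ((P.t0 * P.tn)⁻¹ * (P.t ^ (2 * (m - i.val)))⁻¹) * P.q ^ j = 1 →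
        s = A * (P.q ^ j)⁻¹ := fun s hs => by
      rw [← mul_inv] at hs
      change s * A⁻¹ * _ = 1 at hs
      field_simp at hs ⊢
      exact hs
    -- the first factor is compared by `gen1`, the other three are excluded by `gen3`
    fin_cases k
    · have h1 := key (P.tn * P.t0) h
      have h2 : P.t ^ (2 * (m - i.val)) = P.q ^ j := by
        rw [hA] at h1
        field_simp at h1
        exact h1.symm
      by_cases hd : m - i.val = 0
      · rw [hd, mul_zero, pow_zero] at h2
        refine ⟨⟨i, ?_⟩, rfl, hP.q_pow j h2.symm⟩
        have : i = Fin.last m := Fin.ext (by rw [Fin.val_last]; omega)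
        rw [this, simpleFin_last]
      · exact absurd h2 (hP.gen1 _ (by omega) (by omega) j)
    · exact absurd (key (-(P.tn * P.t0⁻¹)) (by rw [neg_mul]; exact h)) hg.2.2
    · exact absurd (key (P.tnv * P.t0v * P.qh) h) hg.1
    · exact absurd (key (-(P.tnv * P.t0v⁻¹ * P.qh)) (by rw [neg_mul]; exact h)) hg.2.1

/-- On a negative root no factor of the denominator of `Δ̃_+` vanishes at `γ_0^{-1}`: most are
excluded by their absolute value, the others by `gen2`. -/
theorem legs_neg (hP : P.Admissible (m + 1)) {α : Wt (m + 1)} (hα : α ∈ posRoots (m + 1)) (k : Fin 4)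
    (j : ℕ) : P.dual.legs (-α) (P.gamInv (0 : Wt (m + 1))) k * P.q ^ j ≠ 1 := by
  have hN := hP.toNondeg
  have ht := hP.t
  have h0 := hP.t0
  have hn := hP.tn
  have hq := hN.q_ne
  have hy := gamInv_ne_zero hN (0 : Wt (m + 1))
  rcases mem_posRoots.1 hα with hm | hl
  · rw [legs_med (isMed_of_mem hm).neg]
    have hk : k ≠ 0 → ![P.dual.t ^ 2 * P.dual.monAt (P.gamInv (0 : Wt (m + 1))) (-α, 0), 0, 0, 0] k *
        P.q ^ j ≠ 1 := by
      fin_cases k <;> simp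
    by_cases hk0 : k = 0
    swap
    · exact hk hk0
    subst hk0
    change P.t ^ 2 * P.monAt (P.gamInv (0 : Wt (m + 1))) (-α, 0) * P.q ^ j ≠ 1
    obtain ⟨i, l, hil, rfl | rfl⟩ := mem_posMed.1 hm
    · have hil' : i.val < l.val := hil
      have hll := l.isLt
      have e : ((-(eps i - eps l), 0) : Aff (m + 1)) = (eps l, 0) + (-eps i, 0) := by
        rw [Prod.mk_add_mk, add_zero, neg_sub, sub_eq_add_neg]
      rw [e, monAt_add hN.qh hy, monAt_eps, monAt_neg_eps, zpow_zero, one_mul, one_mul,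
        inv_gamInv_zero, gamInv_zero']
      have h1 : P.t ^ 2 * ((P.t0 * P.tn)⁻¹ * (P.t ^ (2 * (m - l.val)))⁻¹ *
          (P.t0 * P.tn * P.t ^ (2 * (m - i.val)))) * P.q ^ j =
          P.t * P.t ^ (2 * (l.val - i.val) + 1) * P.q ^ j := by
        rw [show 2 * (m - i.val) = 2 * (m - l.val) + 2 * (l.val - i.val) by omega, pow_add, pow_succ]
        field_simp
        ring
      rw [h1]
      exact ne_one_of_norm_lt (norm_mul_pow_lt_one (norm_mul_pow_lt_one hP.norm_t hP.norm_t _)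
        hP.norm_q _)
    · have hil' : i.val < l.val := hil
      have hll := l.isLt
      have e : ((-(eps i + eps l), 0) : Aff (m + 1)) = (-eps i, 0) + (-eps l, 0) := by
        rw [Prod.mk_add_mk, add_zero, neg_add]
      intro h
      refine hP.gen2 ((m - i.val) + (m - l.val) + 1) (by omega) (-(j : ℤ)) ?_
      rw [e, monAt_add hN.qh hy, monAt_neg_eps, monAt_neg_eps, zpow_zero, one_mul, one_mul,
        inv_gamInv_zero, inv_gamInv_zero] at h
      rw [zpow_neg, zpow_natCast, show 2 * ((m - i.val) + (m - l.val) + 1) = 2 * (m - i.val) + 2 * (m - l.val) + 2 by ring,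
        pow_add, pow_add]
      refine eq_inv_of_mul_eq_one_left ?_
      linear_combination h
  · obtain ⟨i, rfl⟩ := mem_posLong.1 hl
    have hil := i.isLt
    rw [← smul_neg, legs_long (isShort_eps i).neg]
    have e : P.dual.monAt (P.gamInv (0 : Wt (m + 1))) (-eps i, 0) =
        P.t0 * P.tn * P.t ^ (2 * (m - i.val)) := by
      rw [monAt_neg_eps, zpow_zero, one_mul, inv_gamInv_zero]
    rw [e]
    simp only [Params.dual]
    have key : ∀ s a b : ℂ, ‖a‖ < 1 → ‖b‖ < 1 → s * (P.t0 * P.tn) = a * b →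
        s * (P.t0 * P.tn * P.t ^ (2 * (m - i.val))) * P.q ^ j ≠ 1 := by
      intro s a b ha hb hs
      rw [← mul_assoc, hs]
      exact ne_one_of_norm_lt (norm_mul_pow_lt_one (norm_mul_pow_lt_one (norm_mul_lt_one' ha hb)
        hP.norm_t _) hP.norm_q _)
    -- the first factor is excluded by `gen2`; the others have modulus below `1`
    fin_cases k
    · intro h
      change P.tn * P.t0 * (P.t0 * P.tn * P.t ^ (2 * (m - i.val))) * P.q ^ j = 1 at h
      refine hP.gen2 (m - i.val) (by omega) (-(j : ℤ)) ?_
      rw [zpow_neg, zpow_natCast]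
      refine eq_inv_of_mul_eq_one_left ?_
      linear_combination h
    · have := key (-(P.tn * P.t0⁻¹)) (-(P.tn * P.tnv)) (P.tn * P.tnv⁻¹) (by rw [norm_neg]; exact hP.norm_c)
        hP.norm_d (by have := hP.tnv; field_simp)
      rw [neg_mul] at this
      exact this
    · exact key (P.tnv * P.t0v * P.qh) (P.t0 * P.t0v * P.qh) (P.tn * P.tnv) hP.norm_a hP.norm_c (by ring)
    · have := key (-(P.tnv * P.t0v⁻¹ * P.qh)) (-(P.t0 * P.t0v⁻¹ * P.qh)) (P.tn * P.tnv)
        (by rw [norm_neg]; exact hP.norm_b) hP.norm_c (by ring)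
      rw [neg_mul] at this
      exact this

end BasePoint

/-! ### The iterated residues of `Δ̃_+` -/

section Analytic

variable {n : ℕ} {P : Params}

theorem analyticAt_monAt {c : Fin n → ℂ} (hc : ∀ i, c i ≠ 0) (β : Aff n) :
    AnalyticAt ℂ (fun x => P.monAt x β) c := by
  refine analyticAt_const.mul (Finset.analyticAt_fun_prod _ fun i _ => ?_)
  exact ((ContinuousLinearMap.proj (R := ℂ) (φ := fun _ : Fin n => ℂ) i).analyticAt c).zpow (hc i)

theorem analyticAt_v {c : Fin n → ℂ} (hc : ∀ i, c i ≠ 0) {β : Aff n} (hβ : P.monAt c β ≠ 1) :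
    AnalyticAt ℂ (P.v β) c := by
  have h : ∀ γ, AnalyticAt ℂ (fun x => P.monAt x γ) c := analyticAt_monAt hc
  have hnum : AnalyticAt ℂ (fun x => P.vNumOf (P.monAt x) β) c := by
    unfold Params.vNumOf
    split_ifs
    · simp only [smul_eq_mul]
      exact (analyticAt_const.sub (analyticAt_const.mul (h _))).mul
        (analyticAt_const.add (analyticAt_const.mul (h _)))
    · simp only [smul_eq_mul]
      exact analyticAt_const.sub (analyticAt_const.mul (h _))
  exact hnum.div (analyticAt_const.sub (h β)) (sub_ne_zero.2 hβ.symm)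

theorem analyticAt_legs {c : Fin n → ℂ} (hc : ∀ i, c i ≠ 0) (α : Wt n) (k : Fin 4) :
    AnalyticAt ℂ (fun x => P.legs α x k) c := by
  have h : ∀ γ, AnalyticAt ℂ (fun x => P.monAt x γ) c := analyticAt_monAt hc
  unfold Params.legs
  split_ifs
  · fin_cases k
    · exact analyticAt_const.mul (h _)
    all_goals exact analyticAt_const
  · fin_cases k
    · exact analyticAt_const.mul (h _)
    · exact (analyticAt_const.mul (h _)).neg
    · exact analyticAt_const.mul (h _)
    · exact (analyticAt_const.mul (h _)).neg

theorem analyticAt_poch {q : ℂ} (hq : ‖q‖ < 1) {f : (Fin n → ℂ) → ℂ} {c : Fin n → ℂ}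
    (hf : AnalyticAt ℂ f c) : AnalyticAt ℂ (fun x => poch q (f x)) c :=
  ((differentiable_poch hq).analyticAt (f c)).comp hf

end Analytic

section Residues

variable {m : ℕ} {P : Params}

open Classical in
/-- The factor of the denominator of `Δ_+` that vanishes at the base point. -/
noncomputable def Params.lead (P : Params) (α : Wt (m + 1)) (z : Fin (m + 1) → ℂ) : ℂ :=
  if ∃ i, α = simpleFin i then 1 - P.legs α z 0 else 1

open Classical in
/-- The remaining factors of the denominator of `Δ_+`. -/
noncomputable def Params.regDen (P : Params) (α : Wt (m + 1)) (z : Fin (m + 1) → ℂ) : ℂ :=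
  poch P.q (if ∃ i, α = simpleFin i then P.q * P.legs α z 0 else P.legs α z 0) *
    ∏ k : Fin 3, poch P.q (P.legs α z k.succ)

/-- The regular part of `∏_{m ≥ 0} v_{α + mδ}(z)^{-1}`. -/
noncomputable def Params.regFib (P : Params) (α : Wt (m + 1)) (z : Fin (m + 1) → ℂ) : ℂ :=
  poch P.q (P.monAt z (α, 0)) * (P.regDen α z)⁻¹

theorem lead_mul_regDen (hq : ‖P.q‖ < 1) (α : Wt (m + 1)) (z : Fin (m + 1) → ℂ) :
    P.lead α z * P.regDen α z = ∏ k, poch P.q (P.legs α z k) := by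
  rw [Fin.prod_univ_succ, Params.lead, Params.regDen]
  split_ifs
  · rw [poch_eq hq (P.legs α z 0), mul_assoc]
  · rw [one_mul]

theorem analyticAt_regDen (hq : ‖P.q‖ < 1) {c : Fin (m + 1) → ℂ} (hc : ∀ i, c i ≠ 0)
    (α : Wt (m + 1)) : AnalyticAt ℂ (P.regDen α) c := by
  unfold Params.regDen
  refine AnalyticAt.mul (analyticAt_poch hq ?_)
    (Finset.analyticAt_fun_prod _ fun k _ => analyticAt_poch hq (analyticAt_legs hc α _))
  split_ifs
  · exact analyticAt_const.mul (analyticAt_legs hc α 0)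
  · exact analyticAt_legs hc α 0

theorem analyticAt_regFib (hq : ‖P.q‖ < 1) {c : Fin (m + 1) → ℂ} (hc : ∀ i, c i ≠ 0)
    {α : Wt (m + 1)} (h : P.regDen α c ≠ 0) : AnalyticAt ℂ (P.regFib α) c :=
  (analyticAt_poch hq (analyticAt_monAt hc _)).mul ((analyticAt_regDen hq hc α).inv h)

/-- The product over a gradient, with the factor that may vanish split off. -/
theorem hasProd_fibre' (hq0 : P.qh ≠ 0) (hq : ‖P.q‖ < 1) {α : Wt (m + 1)} (hα : IsRoot α)
    {z : Fin (m + 1) → ℂ} (hL : P.lead α z ≠ 0) (hD : P.regDen α z ≠ 0) :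
    HasProd (fun m : ℕ => (P.v (α, 2 * (m : ℤ)) z)⁻¹) ((P.lead α z)⁻¹ * P.regFib α z) := by
  have h := hasProd_fibre hq0 hq hα (z := z) (by rw [← lead_mul_regDen hq]; exact mul_ne_zero hL hD)
  rw [← lead_mul_regDen hq, mul_inv, mul_left_comm] at h
  exact h

theorem simpleFin_mem (i : Fin (m + 1)) : simpleFin i ∈ posRoots (m + 1) := by
  have hi := i.isLt
  by_cases h : i.val + 1 < m + 1
  · have e := simpleFin_of_lt h
    change simpleFin i = _ at e
    rw [e]
    exact mem_posRoots.2 (Or.inl (mem_posMed.2 ⟨_, _, by simp [Fin.lt_def], Or.inl rfl⟩))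
  · have : i = Fin.last m := Fin.ext (by rw [Fin.val_last]; omega)
    rw [this, simpleFin_last]
    exact mem_posRoots.2 (Or.inr (mem_posLong.2 ⟨_, rfl⟩))

theorem simpleFin_injective : Function.Injective (simpleFin (m := m)) := by
  have key : ∀ i j : Fin (m + 1), i < j → simpleFin i ≠ simpleFin j := by
    intro i j hij h
    have hij' : i.val < j.val := hij
    have hj := j.isLt
    have e := congrFun h i
    simp only [simpleFin, simpleRoot] at e
    rw [if_neg (by omega), if_neg (by omega), if_neg (by omega)] at e
    split_ifs at e <;> simp only at e <;> split_ifs at e <;> omega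
  intro i j h
  by_contra hne
  rcases lt_or_gt_of_ne hne with h1 | h1
  · exact key i j h1 h
  · exact key j i h1 h.symm

theorem chainProd_succ : ∀ (m : ℕ) (r : Fin (m + 1) → ℂ), chainProd (m + 1) r =
    (∏ i : Fin m, (1 - r i.castSucc / r i.succ)) * (1 - r (Fin.last m))
  | 0, r => by simp [chainProd, headOr]
  | m + 1, r => by
    rw [chainProd, chainProd_succ m, Fin.prod_univ_succ, mul_assoc]
    rfl

/-- The vanishing factors are those of the simple roots. -/
theorem prod_lead (hN : P.Nondeg) {z : Fin (m + 1) → ℂ} (hz : ∀ i, z i ≠ 0) :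
    ∏ α ∈ posRoots (m + 1), P.dual.lead α z =
      chainProd (m + 1) fun i => z i / P.gamInv (0 : Wt (m + 1)) i := by
  classical
  have ht := hN.t
  have h0 := hN.t0
  have hn := hN.tn
  have h1 : ∏ α ∈ posRoots (m + 1), P.dual.lead α z =
      ∏ i : Fin (m + 1), (1 - P.dual.legs (simpleFin i) z 0) := by
    rw [← Finset.prod_image (f := fun α => 1 - P.dual.legs α z 0) simpleFin_injective.injOn]
    symm
    rw [← Finset.prod_subset (s₁ := Finset.univ.image simpleFin) (f := fun α => P.dual.lead α z)]
    · refine Finset.prod_congr rfl fun α hα => ?_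
      obtain ⟨i, -, rfl⟩ := Finset.mem_image.1 hα
      rw [Params.lead, if_pos ⟨i, rfl⟩]
    · intro α hα
      obtain ⟨i, -, rfl⟩ := Finset.mem_image.1 hα
      exact simpleFin_mem i
    · intro α _ hα
      exact if_neg fun ⟨i, hi⟩ => hα (Finset.mem_image.2 ⟨i, Finset.mem_univ _, hi.symm⟩)
  rw [h1, chainProd_succ, Fin.prod_univ_castSucc]
  congr 1
  · refine Finset.prod_congr rfl fun i _ => ?_
    have hi := i.isLt
    have e := simpleFin_of_lt (m := m) (i := i.val) (by omega)
    change simpleFin i.castSucc = eps i.castSucc - eps i.succ at e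
    have hne : i.castSucc ≠ i.succ := (Fin.castSucc_lt_succ (i := i)).ne
    have e2 : ((eps i.castSucc - eps i.succ, 0) : Aff (m + 1)) =
        (eps i.castSucc, 0) + (-eps i.succ, 0) := by
      rw [Prod.mk_add_mk, add_zero, sub_eq_add_neg]
    have hz1 := hz i.succ
    rw [e, legs_med (isMed_sub hne), gamInv_zero', gamInv_zero', e2,
      monAt_add (P := P.dual) hN.qh hz,
      monAt_eps, monAt_neg_eps, Fin.val_succ, Fin.val_castSucc,
      show 2 * (m - i.val) = 2 * (m - (i.val + 1)) + 2 by omega, pow_add]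
    simp only [Matrix.cons_val_zero, zpow_zero, one_mul, Params.dual]
    field_simp
  · rw [simpleFin_last, legs_long (isShort_eps _), gamInv_zero', monAt_eps]
    simp [Params.dual]
    field_simp

theorem regDen_ne_zero (hP : P.Admissible (m + 1)) {α : Wt (m + 1)} (hα : α ∈ posRoots (m + 1)) :
    P.dual.regDen α (P.gamInv 0) ≠ 0 := by
  refine mul_ne_zero (poch_ne_zero hP.norm_q fun k hk => ?_)
    (Finset.prod_ne_zero_iff.2 fun i _ => poch_ne_zero hP.norm_q fun k hk => ?_)
  · split_ifs at hk with h
    · have h1 := (legs_pos hP hα 0 ((k : ℤ) + 1) (by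
        rw [zpow_add_one₀ hP.toNondeg.q_ne, zpow_natCast, ← hk]
        change _ = P.q * _ * P.q ^ k
        ring)).2.2
      omega
    · exact h (legs_pos hP hα 0 k (by rw [zpow_natCast]; exact hk)).1
  · exact Fin.succ_ne_zero i (legs_pos hP hα i.succ k (by rw [zpow_natCast]; exact hk)).2.1

theorem not_simpleFin_neg {α : Wt (m + 1)} (hα : α ∈ posRoots (m + 1)) :
    ¬ ∃ i, -α = simpleFin i := by
  rintro ⟨i, hi⟩
  exact not_mem_posRoots_neg hα (hi ▸ simpleFin_mem i)

theorem regDen_neg_ne_zero (hP : P.Admissible (m + 1)) {α : Wt (m + 1)}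
    (hα : α ∈ posRoots (m + 1)) : P.dual.regDen (-α) (P.gamInv 0) ≠ 0 := by
  rw [Params.regDen, if_neg (not_simpleFin_neg hα)]
  exact mul_ne_zero (poch_ne_zero hP.norm_q fun k => legs_neg hP hα 0 k)
    (Finset.prod_ne_zero_iff.2 fun i _ => poch_ne_zero hP.norm_q fun k => legs_neg hP hα i.succ k)

theorem regFib_ne_zero (hP : P.Admissible (m + 1)) {α : Wt (m + 1)} (hα : IsRoot α)
    (h : P.dual.regDen α (P.gamInv 0) ≠ 0) : P.dual.regFib α (P.gamInv 0) ≠ 0 := by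
  refine mul_ne_zero (poch_ne_zero hP.norm_q fun k hk => ?_) (inv_ne_zero h)
  refine monAt_gamInv_ne_one hP.toGeneric 0 (β := (α, 2 * (k : ℤ))) (mem_affR_iff.2 ⟨α, k, hα, rfl⟩) ?_
  rw [monAt_mk, qh_zpow, zpow_natCast, mul_comm]
  exact hk

/-- The point with coordinates `q^{μ_i} x_i`. -/
noncomputable def Params.shift (P : Params) {n : ℕ} (μ : Wt n) (x : Fin n → ℂ) : Fin n → ℂ :=
  fun i => P.q ^ μ i * x i

theorem monAt_transl (hq : P.qh ≠ 0) {n : ℕ} (μ : Wt n) (x : Fin n → ℂ) (g : Aff n) :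
    P.monAt x (transl μ g) = P.monAt (P.shift μ x) g := by
  change P.qh ^ (g.2 + 2 * (μ ⬝ᵥ g.1)) * ∏ i, x i ^ g.1 i = _
  have hq' : P.q ≠ 0 := pow_ne_zero 2 hq
  rw [zpow_add₀ hq, qh_zpow, ← zpow_dot hq', Params.monAt, mul_assoc,
    ← Finset.prod_mul_distrib]
  simp only [Params.shift, mul_zpow]

/-- A translation of the affine root amounts to a shift of the argument by powers of `q`. -/
theorem v_transl (hq : P.qh ≠ 0) {n : ℕ} (μ : Wt n) (x : Fin n → ℂ) {α : Wt n} (hα : IsRoot α)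
    (k : ℤ) : P.v (α, 2 * (k + μ ⬝ᵥ α)) x = P.v (α, 2 * k) (P.shift μ x) := by
  have h : IsAffSymm (transl μ) (1 : FinW n) :=
    ⟨fun g => funext fun i => (one_mul (g.1 i)).symm, fun g => ⟨μ ⬝ᵥ g.1, by simp [transl]; ring⟩⟩
  rw [← h.v_map (P := P) (monAt_transl hq μ x) (mem_affR_iff.2 ⟨α, k, hα, rfl⟩)]
  congr 1
  exact Prod.ext rfl (by simp [transl]; ring)

theorem shift_gamInv (hP : P.Nondeg) {n : ℕ} {μ : Wt n} (hμ : IsDominant μ) :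
    P.shift μ (P.gamInv μ) = P.gamInv 0 := by
  have h0 : IsDominant (0 : Wt n) := ⟨fun _ _ _ => le_rfl, fun _ => le_rfl⟩
  funext i
  have := zpow_ne_zero (μ i) hP.q_ne
  simp only [Params.shift, Params.gamInv, Params.gam, rhoMed_of_dominant hμ, rhoLong_of_dominant hμ,
    rhoMed_of_dominant h0, rhoLong_of_dominant h0, Pi.zero_apply, zpow_zero, mul_one, mul_inv]
  field_simp

/-- The ratio of the factors of `Δ̃_+` that are changed by the translation by `μ`. -/
noncomputable def Params.shiftFac (P : Params) {n : ℕ} (μ : Wt n) (x : Fin n → ℂ) : ℂ :=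
  ∏ α ∈ posRoots n, ∏ j ∈ Finset.range (μ ⬝ᵥ α).toNat,
    ((P.v (α, 2 * (j : ℤ)) x)⁻¹ * P.v (-α, 2 * (j : ℤ)) (P.shift μ x))

/-- The regular part of `Δ_+`. -/
noncomputable def Params.regPart (P : Params) (z : Fin (m + 1) → ℂ) : ℂ :=
  ∏ α ∈ posRoots (m + 1), (P.regFib α z * P.regFib (-α) z)

/-- `Δ_+` at `x`, in terms of its singular and regular parts at the point shifted by `q^μ`. -/
theorem deltaPlus_eq_shiftFac (hq0 : P.qh ≠ 0) (hq : ‖P.q‖ < 1) {μ : Wt (m + 1)} (hμ : IsDominant μ)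
    {x : Fin (m + 1) → ℂ}
    (hL : ∀ α ∈ posRoots (m + 1), P.lead α (P.shift μ x) ≠ 0)
    (hD : ∀ α ∈ posRoots (m + 1), P.regDen α (P.shift μ x) ≠ 0)
    (hD' : ∀ α ∈ posRoots (m + 1), P.regDen (-α) (P.shift μ x) ≠ 0)
    (hF : ∀ α ∈ posRoots (m + 1), P.regFib (-α) (P.shift μ x) ≠ 0) :
    P.deltaPlus x = P.shiftFac μ x * P.regPart (P.shift μ x) /
      ∏ α ∈ posRoots (m + 1), P.lead α (P.shift μ x) := by
  have hk : ∀ α ∈ posRoots (m + 1), (((μ ⬝ᵥ α).toNat : ℕ) : ℤ) = μ ⬝ᵥ α := fun α hα =>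
    Int.toNat_of_nonneg (hμ.dot_nonneg hα)
  rw [deltaPlus_eq (a := fun α => (∏ j ∈ Finset.range (μ ⬝ᵥ α).toNat, (P.v (α, 2 * (j : ℤ)) x)⁻¹) *
      ((P.lead α (P.shift μ x))⁻¹ * P.regFib α (P.shift μ x)))
    (b := fun α => P.regFib (-α) (P.shift μ x) * ∏ j ∈ Finset.range (μ ⬝ᵥ α).toNat,
      ((P.v (-α, 2 * (j : ℤ)) (P.shift μ x))⁻¹)⁻¹)]
  · rw [Params.shiftFac, Params.regPart, div_eq_mul_inv, ← Finset.prod_inv_distrib,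
      ← Finset.prod_mul_distrib, ← Finset.prod_mul_distrib]
    refine Finset.prod_congr rfl fun α _ => ?_
    simp only [inv_inv, Finset.prod_mul_distrib]
    ring
  · intro α hα
    have hr := isRoot_of_mem hα
    refine HasProd.prod_range_mul (f := fun j : ℕ => (P.v (α, 2 * (j : ℤ)) x)⁻¹) ?_
    convert hasProd_fibre' hq0 hq hr (hL α hα) (hD α hα) using 2 with j
    rw [Nat.cast_add, hk α hα, v_transl hq0 μ x hr]
  · intro α hα
    have hr := isRoot_of_mem hα
    have hr' : IsRoot (-α) := isRoot_iff.2 (Or.inr (by rwa [neg_neg]))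
    have hL1 : P.lead (-α) (P.shift μ x) = 1 := if_neg (not_simpleFin_neg hα)
    have h := hasProd_fibre' hq0 hq hr' (hL1 ▸ one_ne_zero) (hD' α hα)
    rw [hL1, inv_one, one_mul] at h
    convert hasProd_tail h (μ ⬝ᵥ α).toNat (fun j _ => ne_zero_of_hasProd h (hF α hα) j) using 2 with j
    rw [Nat.cast_add, hk α hα, ← v_transl hq0 μ x hr', dotProduct_neg, add_neg_cancel_right]

theorem v_gamInv_zero_ne_zero (hP : P.Admissible (m + 1)) {α : Wt (m + 1)} (hα : α ∈ posRoots (m + 1))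
    {k : ℤ} (hk : k < 0) : P.dual.v (α, 2 * k) (P.gamInv 0) ≠ 0 := by
  refine div_ne_zero (vNum_ne_zero (P := P.dual) hP.qh (isRoot_of_mem hα) (fun i j hj h => ?_) hk)
    (sub_ne_zero.2 (monAt_gamInv_ne_one hP.toGeneric 0
      (mem_affR_iff.2 ⟨α, k, isRoot_of_mem hα, rfl⟩)).symm)
  have := (legs_pos hP hα i j h).2.2
  omega

theorem v_gamInv_ne_zero (hP : P.Admissible (m + 1)) {μ : Wt (m + 1)} (hμ : IsDominant μ)
    {α : Wt (m + 1)} (hα : α ∈ posRoots (m + 1)) {j : ℕ} (hj : j ∈ Finset.range (μ ⬝ᵥ α).toNat) :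
    P.dual.v (α, 2 * (j : ℤ)) (P.gamInv μ) ≠ 0 := by
  rw [Finset.mem_range] at hj
  have h := v_transl (P := P.dual) hP.qh μ (P.gamInv μ) (isRoot_of_mem hα) (j - μ ⬝ᵥ α)
  rw [sub_add_cancel] at h
  have e : P.dual.shift μ (P.gamInv μ) = P.gamInv 0 := shift_gamInv hP.toNondeg hμ
  rw [h, e]
  exact v_gamInv_zero_ne_zero hP hα (by omega)

/-- The value of the iterated residue. -/
theorem wPlusDual_eq (hP : P.Admissible (m + 1)) {μ : Wt (m + 1)} (hμ : IsDominant μ) :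
    P.wPlusDual μ = (-1) ^ (m + 1) *
      (P.dual.shiftFac μ (P.gamInv μ) * P.dual.regPart (P.gamInv (0 : Wt (m + 1)))) := by
  have hN := hP.toNondeg
  have hq1 : ‖P.dual.q‖ < 1 := hP.norm_q
  have hqh : P.dual.qh ≠ 0 := hP.qh
  set c := P.gamInv μ with hcdef
  set c0 := P.gamInv (0 : Wt (m + 1)) with hc0def
  have hc : ∀ i, c i ≠ 0 := gamInv_ne_zero hN μ
  have hc0 : ∀ i, c0 i ≠ 0 := gamInv_ne_zero hN 0
  have hs : P.dual.shift μ c = c0 := shift_gamInv hN hμ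
  have hsA : AnalyticAt ℂ (P.dual.shift μ) c := by
    refine analyticAt_pi_iff.2 fun i => ?_
    exact analyticAt_const.mul
      ((ContinuousLinearMap.proj (R := ℂ) (φ := fun _ : Fin (m + 1) => ℂ) i).analyticAt c)
  have hcomp : ∀ {f : (Fin (m + 1) → ℂ) → ℂ}, AnalyticAt ℂ f c0 →
      AnalyticAt ℂ (fun x => f (P.dual.shift μ x)) c := fun {f} hf =>
    AnalyticAt.comp (g := f) (f := P.dual.shift μ) (hs.symm ▸ hf) hsA
  have hone : ∀ (α : Wt (m + 1)) (k : ℤ) (ν : Wt (m + 1)), IsRoot α →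
      P.dual.monAt (P.gamInv ν) (α, 2 * k) ≠ 1 := fun α k ν hα =>
    monAt_gamInv_ne_one hP.toGeneric ν (mem_affR_iff.2 ⟨α, k, hα, rfl⟩)
  have hneg : ∀ {α : Wt (m + 1)}, α ∈ posRoots (m + 1) → IsRoot (-α) := fun {α} hα =>
    isRoot_iff.2 (Or.inr (by rwa [neg_neg]))
  have hH : AnalyticAt ℂ (fun x => P.dual.shiftFac μ x * P.dual.regPart (P.dual.shift μ x)) c := by
    refine AnalyticAt.mul ?_ (hcomp ?_)
    · refine Finset.analyticAt_fun_prod _ fun α hα => Finset.analyticAt_fun_prod _ fun j hj => ?_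
      exact ((analyticAt_v (P := P.dual) hc (hone α j μ (isRoot_of_mem hα))).inv
        (v_gamInv_ne_zero hP hμ hα hj)).mul (hcomp (analyticAt_v (P := P.dual) hc0 (hone (-α) j 0 (hneg hα))))
    · exact Finset.analyticAt_fun_prod _ fun α hα =>
        (analyticAt_regFib hq1 hc0 (regDen_ne_zero hP hα)).mul
          (analyticAt_regFib hq1 hc0 (regDen_neg_ne_zero hP hα))
  have hev : ∀ {f : Wt (m + 1) → (Fin (m + 1) → ℂ) → ℂ},
      (∀ α ∈ posRoots (m + 1), AnalyticAt ℂ (f α) c0) → (∀ α ∈ posRoots (m + 1), f α c0 ≠ 0) →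
      ∀ᶠ x in 𝓝 c, ∀ α ∈ posRoots (m + 1), f α (P.dual.shift μ x) ≠ 0 := fun {f} h1 h2 =>
    (Filter.eventually_all_finset _).2 fun α hα =>
      (hcomp (h1 α hα)).continuousAt.eventually_ne (by rw [hs]; exact h2 α hα)
  rw [Params.wPlusDual, ← hcdef, iterResidue_eq (m + 1) c hc
    (fun x => P.dual.shiftFac μ x * P.dual.regPart (P.dual.shift μ x)), hs]
  · exact hH.eventually_analyticAt.mono fun x hx => hx.continuousAt
  · have hx0 : ∀ᶠ x in 𝓝 c, ∀ i, x i ≠ 0 := eventually_all.2 fun i =>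
      (continuous_apply i).continuousAt.eventually_ne (hc i)
    filter_upwards [hx0,
      hev (f := fun α => P.dual.regDen α) (fun α _ => analyticAt_regDen hq1 hc0 α)
        (fun α hα => regDen_ne_zero hP hα),
      hev (f := fun α => P.dual.regDen (-α)) (fun α _ => analyticAt_regDen hq1 hc0 (-α))
        (fun α hα => regDen_neg_ne_zero hP hα),
      hev (f := fun α => P.dual.regFib (-α))
        (fun α hα => analyticAt_regFib hq1 hc0 (regDen_neg_ne_zero hP hα))
        (fun α hα => regFib_ne_zero hP (hneg hα) (regDen_neg_ne_zero hP hα))] with x h0 h1 h2 h3 hch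
    have hz : ∀ i, P.dual.shift μ x i ≠ 0 := fun i => mul_ne_zero (zpow_ne_zero _ hN.q_ne) (h0 i)
    -- the coordinate ratios with respect to `γ_μ^{-1}` and, after the shift, to `γ_0^{-1}` agree
    have hratio : (fun i => x i / c i) = fun i => P.dual.shift μ x i / c0 i := by
      funext i
      rw [← hs]
      exact (mul_div_mul_left _ _ (zpow_ne_zero _ hN.q_ne)).symm
    have hl := prod_lead hN hz
    rw [hratio] at hch ⊢
    rw [← hl] at hch ⊢
    rw [deltaPlus_eq_shiftFac hqh hq1 hμ (Finset.prod_ne_zero_iff.1 hch) h1 h2 h3, div_div,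
      mul_comm (∏ i, x i)]

end Residues

/-! ### The evaluation formula -/

section Translate

variable {m : ℕ} {P : Params}

/-- For dominant `μ`, the roots in `invSet μ` are the `α + jδ` with `α ∈ Σ⁺` and `0 ≤ j < ⟨μ, α⟩`.
-/
theorem mem_invSet_of_dominant {n : ℕ} {μ : Wt n} (hμ : IsDominant μ) {β : Aff n} :
    β ∈ invSet μ ↔ ∃ α ∈ posRoots n, ∃ j ∈ Finset.range (μ ⬝ᵥ α).toNat, (α, 2 * (j : ℤ)) = β := by
  constructor
  · rintro ⟨⟨hR, hp⟩, hv⟩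
    obtain ⟨α, c, hα, rfl⟩ := mem_affR_iff.1 hR
    rw [valAt_mk] at hv
    simp only at hp
    have hc : 0 ≤ c := by rcases hp with h | h <;> omega
    have hαp : α ∈ posRoots n := by
      refine (isRoot_iff.1 hα).resolve_right fun h => ?_
      have := hμ.dot_nonneg h
      rw [dotProduct_neg] at this
      omega
    refine ⟨α, hαp, c.toNat, Finset.mem_range.2 (by omega), ?_⟩
    rw [Int.toNat_of_nonneg hc]
  · rintro ⟨α, hα, j, hj, rfl⟩
    rw [Finset.mem_range] at hj
    refine ⟨⟨mem_affR_iff.2 ⟨α, j, isRoot_of_mem hα, rfl⟩, ?_⟩, ?_⟩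
    · rcases Nat.eq_zero_or_pos j with h | h
      · exact Or.inl ⟨hα, by simp [h]⟩
      · exact Or.inr (by simp only; omega)
    · rw [valAt_mk]
      omega

/-- For dominant `μ`, the roots in `upPos μ` are the `α + jδ` with `α ∈ Σ⁺` and `0 < j ≤ ⟨μ, α⟩`. -/
theorem mem_upPos_of_dominant {n : ℕ} {μ : Wt n} (hμ : IsDominant μ) {β : Aff n} :
    β ∈ upPos μ ↔
      ∃ α ∈ posRoots n, ∃ j ∈ Finset.range (μ ⬝ᵥ α).toNat, (α, 2 * ((j : ℤ) + 1)) = β := by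
  constructor
  · rintro ⟨⟨⟨hR, -⟩, hv⟩, h0⟩
    obtain ⟨α, c, hα, rfl⟩ := mem_affR_iff.1 hR
    rw [valAt_mk] at hv
    simp only at h0
    have hαp : α ∈ posRoots n := by
      refine (isRoot_iff.1 hα).resolve_right fun h => ?_
      have := hμ.dot_nonneg h
      rw [dotProduct_neg] at this
      omega
    refine ⟨α, hαp, (c - 1).toNat, Finset.mem_range.2 (by omega), ?_⟩
    rw [Int.toNat_of_nonneg (by omega), sub_add_cancel]
  · rintro ⟨α, hα, j, hj, rfl⟩
    rw [Finset.mem_range] at hj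
    refine ⟨⟨⟨mem_affR_iff.2 ⟨α, _, isRoot_of_mem hα, rfl⟩, Or.inr (by simp only; omega)⟩, ?_⟩,
      by simp only; omega⟩
    rw [valAt_mk]
    omega

theorem finprod_mem_ray {n : ℕ} {μ : Wt n} {S : Set (Aff n)} (f : Aff n → ℂ) (e : ℤ)
    (hS : ∀ β, β ∈ S ↔
      ∃ α ∈ posRoots n, ∃ j ∈ Finset.range (μ ⬝ᵥ α).toNat, (α, 2 * ((j : ℤ) + e)) = β) :
    ∏ᶠ β ∈ S, f β =
      ∏ α ∈ posRoots n, ∏ j ∈ Finset.range (μ ⬝ᵥ α).toNat, f (α, 2 * ((j : ℤ) + e)) := by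
  classical
  have hS' : S = ↑(((posRoots n).sigma fun α => Finset.range (μ ⬝ᵥ α).toNat).image
      fun p : (_ : Wt n) × ℕ => ((p.1, 2 * ((p.2 : ℤ) + e)) : Aff n)) := by
    ext β
    rw [hS, Finset.coe_image]
    simp only [Set.mem_image, Finset.mem_coe, Finset.mem_sigma, Sigma.exists]
    grind
  rw [hS', finprod_mem_coe_finset, Finset.prod_image, Finset.prod_sigma]
  · rintro ⟨a, x⟩ _ ⟨b, y⟩ _ h
    simp only [Prod.mk.injEq] at h
    obtain ⟨rfl, h⟩ := h
    have : x = y := by omega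
    rw [this]

/-- The translation by `μ` exchanges factors `v_β` of the weight function by factors `v_{-β}`. -/
theorem shiftFac_mul_finprod (hP : P.Admissible (m + 1)) {μ : Wt (m + 1)} (hμ : IsDominant μ) :
    P.dual.shiftFac μ (P.gamInv μ) * ∏ᶠ β ∈ invSet μ, P.dual.v β (P.gamInv μ) =
      ∏ᶠ β ∈ upPos μ, P.dual.v (-β) (P.gamInv μ) := by
  rw [finprod_mem_ray (μ := μ) _ 0 (fun β => by simpa using mem_invSet_of_dominant hμ),
    finprod_mem_ray (μ := μ) (fun β => P.dual.v (-β) (P.gamInv μ)) 1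
      (fun β => mem_upPos_of_dominant hμ), Params.shiftFac, ← Finset.prod_mul_distrib]
  refine Finset.prod_congr rfl fun α hα => ?_
  have hn : IsRoot (-α) := isRoot_iff.2 (Or.inr (by rwa [neg_neg]))
  -- the translation by `μ` maps `-α + jδ` to `-(α + (⟨μ, α⟩ - j) δ)`
  rw [← Finset.prod_range_reflect (fun j : ℕ => P.dual.v (-(α, 2 * ((j : ℤ) + 1))) (P.gamInv μ)),
    ← Finset.prod_mul_distrib]
  refine Finset.prod_congr rfl fun j hj => ?_
  have h0 := v_gamInv_ne_zero hP hμ hα hj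
  rw [Finset.mem_range] at hj
  have e : ((-(α, 2 * (((μ ⬝ᵥ α).toNat - 1 - j : ℕ) + 1 : ℤ)) : Aff (m + 1))) =
      (-α, 2 * (j + μ ⬝ᵥ (-α))) := by
    refine Prod.ext rfl ?_
    simp only [Prod.snd_neg, dotProduct_neg]
    omega
  rw [e, v_transl (P := P.dual) hP.qh μ _ hn, add_zero]
  field_simp

theorem cFun_ne_zero (hP : P.Admissible (m + 1)) :
    P.dual.cFun (P.gamInv (0 : Wt (m + 1))) ≠ 0 := by
  have hq1 : ‖P.dual.q‖ < 1 := hP.norm_q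
  refine Finset.prod_ne_zero_iff.2 fun α hα => ?_
  have hr : IsRoot (-α) := isRoot_iff.2 (Or.inr (by rwa [neg_neg]))
  have hD := regDen_neg_ne_zero hP hα
  have hL : P.dual.lead (-α) (P.gamInv 0) = 1 := if_neg (not_simpleFin_neg hα)
  have h := hasProd_fibre' (P := P.dual) hP.qh hq1 hr (hL ▸ one_ne_zero) hD
  rw [hL, inv_one, one_mul] at h
  have h2 := ne_zero_of_hasProd h (regFib_ne_zero hP hr hD) 0
  simpa using h2

theorem regPart_ne_zero (hP : P.Admissible (m + 1)) :
    P.dual.regPart (P.gamInv (0 : Wt (m + 1))) ≠ 0 := by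
  refine Finset.prod_ne_zero_iff.2 fun α hα => mul_ne_zero
    (regFib_ne_zero hP (isRoot_of_mem hα) (regDen_ne_zero hP hα))
    (regFib_ne_zero hP (isRoot_iff.2 (Or.inr (by rwa [neg_neg]))) (regDen_neg_ne_zero hP hα))

theorem isDominant_zero {n : ℕ} : IsDominant (0 : Wt n) := ⟨fun _ _ _ => le_rfl, fun _ => le_rfl⟩

theorem domWt_zero {n : ℕ} : domWt (0 : Wt n) = 0 := by
  funext i
  simp [domWt]

theorem shiftFac_zero {n : ℕ} (x : Fin n → ℂ) : P.shiftFac 0 x = 1 := by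
  simp [Params.shiftFac]

theorem wDual_zero_ne_zero (hP : P.Admissible (m + 1)) : P.wDual (0 : Wt (m + 1)) ≠ 0 := by
  rw [Params.wDual, domWt_zero, wPlusDual_eq hP isDominant_zero, shiftFac_zero, one_mul]
  exact mul_ne_zero (cFun_ne_zero hP) (mul_ne_zero (pow_ne_zero _ (by norm_num)) (regPart_ne_zero hP))

/-- The factors that do not depend on `λ` cancel in the ratio of weights. -/
theorem wDual_div (hP : P.Admissible (m + 1)) (lam : Wt (m + 1)) :
    P.wDual lam / P.wDual (0 : Wt (m + 1)) = P.dual.cFun (P.gamInv lam) *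
      P.dual.shiftFac (domWt lam) (P.gamInv (domWt lam)) / P.dual.cFun (P.gamInv (0 : Wt (m + 1))) := by
  have h1 := cFun_ne_zero hP
  have h2 := regPart_ne_zero hP
  have h3 : ((-1 : ℂ) ^ (m + 1)) ≠ 0 := pow_ne_zero _ (by norm_num)
  rw [Params.wDual, Params.wDual, domWt_zero, wPlusDual_eq hP isDominant_zero,
    wPlusDual_eq hP (isDominant_domWt lam), shiftFac_zero]
  field_simp

/-- The evaluation formula for the monic eigenvectors. -/
theorem evalAt_of_isMonicEigen (hP : P.Admissible (m + 2)) (ht2 : P.t ^ 2 ≠ 1) (htt : (P.tn * P.tnv) ^ 2 ≠ 1)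
    {lam : Wt (m + 2)} {F : Laurent (m + 2)} (hF : IsMonicEigen P lam F) :
    evalAt F (P.dual.gamInv (0 : Wt (m + 2))) =
      P.wDual lam / P.wDual (0 : Wt (m + 2)) * P.dual.tw (actW (minRep lam)) ^ 2 *
        (P.dual.tw (transl (-domWt lam)))⁻¹ *
        ∏ᶠ β ∈ evalRoots lam, P.dual.v β (P.gamInv (domWt lam)) := by
  have hC := cFun_ne_zero hP
  have h1 := ev_basePt_eq hP.toGeneric ht2 htt hF
  have h2 := cFun_mul_finprod hP.toNondeg lam (shiftFac_mul_finprod hP (isDominant_domWt lam))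
  have h3 := tw_minRep_sq hP.toNondeg lam
  have h4 : evalAt F (P.dual.gamInv (0 : Wt (m + 2))) = ev (basePt P hP.toNondeg.dual (m + 2)) F := by
    rw [← evalAt_eq_ev]
    rfl
  rw [h4, eq_div_of_mul_eq hC h1, wDual_div hP, mul_assoc (_ / _), h3, ← h2]
  ring

end Translate
end Koornwinder

theorem mainTheorem2 (n : ℕ) (hn : 2 ≤ n) (P : Params) (q t : ℝ)
    (hq : P.q = (q : ℂ)) (hq0 : 0 < q) (hq1 : q < 1)
    (ht : P.t = (t : ℂ)) (ht0 : 0 < t) (ht1 : t < 1)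
    (h_t0 : P.t0 ≠ 0) (h_tn : P.tn ≠ 0) (h_t0v : P.t0v ≠ 0) (h_tnv : P.tnv ≠ 0)
    (ha : ‖P.t0 * P.t0v * P.qh‖ < 1) (hb : ‖-(P.t0 * P.t0v⁻¹ * P.qh)‖ < 1)
    (hc : ‖P.tn * P.tnv‖ < 1) (hd : ‖-(P.tn * P.tnv⁻¹)‖ < 1)
    (gen1 : ∀ k : ℕ, 1 ≤ k → k < n → ∀ m : ℤ, P.t ^ (2 * k) ≠ P.q ^ m)
    (gen2 : ∀ k : ℕ, k ≤ 2 * n - 2 → ∀ m : ℤ, (P.t0 * P.tn) ^ 2 * P.t ^ (2 * k) ≠ P.q ^ m)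
    (gen3 : ∀ k : ℕ, k < n → ∀ m : ℤ,
      P.tnv * P.t0v * P.qh ≠ P.t0 * P.tn * P.t ^ (2 * k) * P.q ^ m ∧
      -(P.tnv * P.t0v⁻¹ * P.qh) ≠ P.t0 * P.tn * P.t ^ (2 * k) * P.q ^ m ∧
      -(P.tn * P.t0⁻¹) ≠ P.t0 * P.tn * P.t ^ (2 * k) * P.q ^ m)
    (lam : Wt n) :
    P.wDual (0 : Wt n) ≠ 0 ∧
    ∃ F : Laurent n, P.IsKoornwinder lam F ∧ (∀ G : Laurent n, P.IsKoornwinder lam G → G = F) ∧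
      evalAt F (P.dual.gamInv (0 : Wt n)) =
        P.wDual lam / P.wDual (0 : Wt n) * P.dual.tw (actW (minRep lam)) ^ 2 *
          (P.dual.tw (transl (-domWt lam)))⁻¹ *
          ∏ᶠ β ∈ evalRoots lam, P.dual.v β (P.gamInv (domWt lam)) := by
  obtain ⟨m, rfl⟩ : ∃ m, n = m + 2 := ⟨n - 2, by omega⟩
  have hq_ne : P.q ≠ 0 := by
    rw [hq]
    exact_mod_cast hq0.ne'
  have hP : P.Admissible (m + 2) :=
    { qh := fun h => hq_ne (by rw [Params.q, h]; simp)
      t0 := h_t0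
      t := by
        rw [ht]
        exact_mod_cast ht0.ne'
      tn := h_tn
      t0v := h_t0v
      tnv := h_tnv
      q_pow := fun k hk => by
        rw [hq] at hk
        exact (zpow_eq_one_iff_right₀ hq0.le hq1.ne).1 (by exact_mod_cast hk)
      gen1 := gen1
      gen2 := gen2
      norm_q := by
        rw [hq, Complex.norm_real, Real.norm_of_nonneg hq0.le]
        exact hq1
      norm_t := by
        rw [ht, Complex.norm_real, Real.norm_of_nonneg ht0.le]
        exact ht1
      norm_a := ha
      norm_b := by rwa [norm_neg] at hb
      norm_c := hc
      norm_d := by rwa [norm_neg] at hd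
      gen3 := gen3 }
  -- the next two facts keep the coefficients of `T_j` finite at `x_0⁻¹`
  have ht2 : P.t ^ 2 ≠ 1 := by
    have := gen1 1 le_rfl (by omega) 0
    rwa [mul_one, zpow_zero] at this
  have htt : (P.tn * P.tnv) ^ 2 ≠ 1 :=
    ne_one_of_norm_lt (by rw [norm_pow]; exact pow_lt_one₀ (norm_nonneg _) hc two_ne_zero)
  obtain ⟨F, hF⟩ := exists_isMonicEigen hP.toGeneric lam
  exact ⟨wDual_zero_ne_zero hP, F, hF.isKoornwinder hP.toNondeg,
    fun G hG => hF.eq_of_isKoornwinder hP.toGeneric hG, evalAt_of_isMonicEigen hP ht2 htt hF⟩
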